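/- Let $L_{1,1}$ be the set of real measurable $q$ on $(0,\infty)$ with $\int_0^\infty(1+x)|q(x)|\,dx<\infty$, and let $\mathbb C_+=\{\operatorname{Im}k>0\}$. For $q\in L_{1,1}$ and $\operatorname{Im}k\ge 0$ the Jost solution $f(x,k)$ is the solution of $-f''+qf=k^2f$ on $[0,\infty)$ with $e^{-ikx}f(x,k)\to1$ as $x\to\infty$; put $f(k)=f(0,k)$, $\dot f=df/dk$ (at $k=0$: the derivative within $\overline{\mathbb C_+}$), and $$I(k)=\frac{f'(0,k)}{f(k)},\qquad S(k)=\frac{f(-k)}{f(k)}\quad(k\in\mathbb R\setminus\{0\}).$$ Let $k_1,\dots,k_J>0$ be the numbers for which $-k_j^2$ is an eigenvalue of $-d^2/dx^2+q$ in $L^2(0,\infty)$ with the Dirichlet condition at $0$, let $s_j=\|f(\cdot,ik_j)\|_{L^2(0,\infty)}^{-2}$, and let $\mathcal S=\{S(k),k_j,s_j\}$. Let $w(z)=\prod_{j=1}^J\frac{z-ik_j}{z+ik_j}$, $w_1(z)=\frac{z}{z+i}w(z)$, $g(k)=k/\operatorname{Im}I(k)$ for real $k\neq 0$, and $I_j=f'(0,ik_j)/\dot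 f(ik_j)$; if $f(0)=0$, put also $k_0=0$, $I_0=f'(0,0)/\dot f(0)$. Sums $\sum_{j=0}^J$ contain the term $j=0$ only if $f(0)=0$. **One-to-one correspondence.** For $p,q\in L_{1,1}$, the $I$-functions of $p$ and $q$ coincide for all $k>0$ if and only if the scattering triples of $p$ and $q$ coincide. Moreover, for every $q\in L_{1,1}$ the following holds. **Well-posedness.** The Jost solution exists and is unique for all $\operatorname{Im}k\ge0$; $J<\infty$; $f(\cdot,ik_j)\in L^2(0,\infty)$ and $s_j>0$. Let $\mathcal F$ be the class of functions $F$ continuous on $\overline{\mathbb C_+}$ and analytic in $\mathbb C_+$ with $F(z)\to1$ as $|z|\to\infty$, $\operatorname{Im}z\ge0$, whose zeros in $\overline{\mathbb C_+}\setminus\{0\}$ are exactly the $ik_j$, all simple, and which either do not vanish at $0$ or have there a nonzero derivative within $\overline{\mathbb C_+}$. Then $f\in\mathcal F$. The function $I$ is continuous on $\overline{\mathbb C_+}$ at every real $k\ne0$, and $I(-k)=\overline{I(k)}$ for these $k$. **From $I$ to $\mathcal S$.** (a) $I$ is meromorphic in $\mathbb C_+$ and is, up to isolated points, the only meromorphic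 function in $\mathbb C_+$ with the boundary values $I(k)$ for $k>0$; its poles in $\mathbb C_+$ are exactly the points $ik_j$, all simple, and $\operatorname{Res}_{k=ik_j}I=I_j$. (b) $g(k)>0$ for real $k\ne0$, and $f$ is the unique solution in $\mathcal F$ of the Riemann problem $f(k)=g(k)/f(-k)$, $k\in\mathbb R\setminus\{0\}$. For $\operatorname{Im}z>0$, $$f(z)=\exp\Big(\frac1{2\pi i}\int_{-\infty}^\infty\frac{\ln g(s)}{s-z}ds\Big)w(z)=\exp\Big(\frac1{i\pi}\int_0^\infty\frac{z\ln g(s)}{s^2-z^2}ds\Big)w(z),$$ with absolutely convergent integrals; for $k>0$, $f(k)=\exp\big(\frac1{2\pi i}\,\mathrm{v.p.}\!\int_{-\infty}^\infty\frac{\ln g(s)}{s-k}ds+\frac12\ln g(k)\big)w(k)$. If $f(0)=0$, the first formula also holds with $g(s)$ replaced by $\frac{s^2+1}{s\operatorname{Im}I(s)}$ and $w$ by $w_1$. (c) $s_j=-\dfrac{2ik_j}{\dot f(ik_j)^2I_j}$ for $1\le j\le J$. **From $\mathcal S$ to $I$.** (d) $f$ is the unique solution in $\mathcal F$ of the Riemann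 problem $f(k)=S(-k)f(-k)$, $k\in\mathbb R\setminus\{0\}$. For $\operatorname{Im}z>0$, $$f(z)=\exp\Big(\frac1{2\pi i}\int_{-\infty}^\infty\frac{1}{t-z}\ln\frac{S(-t)}{w^2(t)}\,dt\Big)w(z)$$ with an absolutely convergent integral, where $\ln$ is the branch (which exists) that is continuous on $\mathbb R\setminus\{0\}$ and tends to $0$ at $\pm\infty$; if $f(0)\ne0$, it extends continuously to $\mathbb R$. If $f(0)=0$, the same formula holds with $S(k)$ replaced by $S_1(k)=S(k)\frac{k-i}{k+i}$ and the factor $w(z)$ by $w_1(z)$, and the branch of $\ln\frac{S_1(-t)}{w^2(t)}$ then extends continuously to $\mathbb R$. (e) $I_j=-\dfrac{2ik_j}{\dot f(ik_j)^2s_j}$ for $1\le j\le J$; if $f(0)=0$, then $\dot f(0)$ exists, $\dot f(0)\neq0$, $f'(0,0)=-i/\dot f(0)$ and $I_0=-i/\dot f(0)^2$. (f) $I(k)-I(-k)=2ik/|f(k)|^2$ for real $k\ne0$. The function $$\mathcal J(z)=I(z)-iz-\sum_{j=0}^J\frac{I_j}{z-ik_j}$$ (with its removable singularities at the $ik_j$,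 $j\geq 1$, removed) is the unique function that is analytic in $\mathbb C_+$, continuous on $\overline{\mathbb C_+}\setminus\{0\}$, tends to $0$ as $|z|\to\infty$, is $o(1/|z|)$ as $z\to0$, and satisfies $$\mathcal J(k)=\mathcal J(-k)+\frac{2ik}{|f(k)|^2}-2ik-\sum_{j=0}^JI_j\Big(\frac1{k-ik_j}+\frac1{k+ik_j}\Big),\qquad k\in\mathbb R\setminus\{0\}.$$ For $\operatorname{Im}z>0$ it is given by $$\mathcal J(z)=\frac1\pi\,\mathrm{v.p.}\!\int_{-\infty}^\infty\frac{dt}{t-z}\Big[t\big(|f(t)|^{-2}-1\big)+i\sum_{j=0}^J\frac{I_jt}{t^2+k_j^2}\Big],$$ where v.p. means the limit of the integral over $\varepsilon<|t|<N$ as $\varepsilon\to0^+$, $N\to\infty$. -/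

import Mathlib

open MeasureTheory Set Filter Topology

noncomputable section

namespace IFunction

/-- The class `L_{1,1}` of real potentials: `q` is measurable on `(0,∞)` and
`∫₀^∞ (1 + x) |q x| dx < ∞`. -/
def MemL11 (q : ℝ → ℝ) : Prop :=
  AEStronglyMeasurable q (volume.restrict (Ioi 0)) ∧
    IntegrableOn (fun x => (1 + x) * |q x|) (Ioi 0)

/-- The open upper half-plane. -/
def openUpperHP : Set ℂ := {z | 0 < z.im}

/-- The closed upper half-plane. -/
def closedUpperHP : Set ℂ := {z | 0 ≤ z.im}

/-- `u` solves `-u'' + q u = z u` on `[0,∞)` in the usual sense for an integrable potential: `u` is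
differentiable, `u'` is absolutely continuous, and `u'' = (q - z) u` a.e. (integrated form). -/
def IsSolution (q : ℝ → ℝ) (z : ℂ) (u : ℝ → ℂ) : Prop :=
  DifferentiableOn ℝ u (Ici 0) ∧
    ∀ x, 0 ≤ x → derivWithin u (Ici 0) x =
      derivWithin u (Ici 0) 0 + ∫ t in (0 : ℝ)..x, ((q t : ℂ) - z) * u t

/-- `u` is the Jost solution at `k`: it solves `-u'' + q u = k² u` and
`u(x) = e^{ikx} (1 + o(1))` as `x → ∞`. -/
def IsJost (q : ℝ → ℝ) (k : ℂ) (u : ℝ → ℂ) : Prop :=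
  IsSolution q (k ^ 2) u ∧
    Tendsto (fun x : ℝ => Complex.exp (-(Complex.I * k * x)) * u x) atTop (𝓝 1)

open Classical in
/-- The Jost solution `f(x,k)`, as a function of `x ≥ 0`. Its existence and uniqueness for
`Im k ≥ 0` is part of the theorem. -/
def jost (q : ℝ → ℝ) (k : ℂ) : ℝ → ℂ :=
  if h : ∃ u, IsJost q k u then h.choose else 0

/-- The Jost function `f(k) = f(0,k)`. -/
def jostFn (q : ℝ → ℝ) (k : ℂ) : ℂ := jost q k 0

/-- `f'(0,k)`, the (right) derivative in `x` at `x = 0`. -/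
def jostDeriv (q : ℝ → ℝ) (k : ℂ) : ℂ := derivWithin (jost q k) (Ici 0) 0

/-- The derivative of `f(k)` in `k`, taken within the closed upper half-plane (at interior
points this is the complex derivative; it is also used at `k = 0`). -/
def jostDot (q : ℝ → ℝ) (k : ℂ) : ℂ := derivWithin (jostFn q) closedUpperHP k

/-- The `I`-function `I(k) = f'(0,k) / f(k)`. -/
def iFun (q : ℝ → ℝ) (k : ℂ) : ℂ := jostDeriv q k / jostFn q k

/-- `S(k) = f(-k) / f(k)` for real `k`. It is only used for `k ≠ 0`. -/
def scatS (q : ℝ → ℝ) (k : ℝ) : ℂ := jostFn q (-(k : ℂ)) / jostFn q k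

/-- `μ` is an eigenvalue of `-d²/dx² + q` in `L²(0,∞)` with the Dirichlet condition at `0`. -/
def IsDirichletEigenvalue (q : ℝ → ℝ) (μ : ℝ) : Prop :=
  ∃ u : ℝ → ℂ, IsSolution q μ u ∧ u 0 = 0 ∧ MemLp u 2 (volume.restrict (Ioi 0)) ∧
    ∃ x, 0 ≤ x ∧ u x ≠ 0

/-- The set `{k_j}`: the `κ > 0` such that `-κ²` is a Dirichlet eigenvalue. -/
def boundStates (q : ℝ → ℝ) : Set ℝ := {κ | 0 < κ ∧ IsDirichletEigenvalue q (-κ ^ 2)}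

/-- The norming constant `s_j = ‖f(·, i k_j)‖⁻²` (norm of `L²(0,∞)`). -/
def normingConst (q : ℝ → ℝ) (κ : ℝ) : ℝ :=
  (∫ x in Ioi (0 : ℝ), ‖jost q (Complex.I * κ) x‖ ^ 2)⁻¹

/-- The type of scattering triples: `S(k)` for real `k ≠ 0`, and the set of pairs `(k_j, s_j)`. -/
@[ext]
structure ScatteringData where
  S : {k : ℝ // k ≠ 0} → ℂ
  bound : Set (ℝ × ℝ)

/-- The scattering triple of `q`. -/
def scatteringData (q : ℝ → ℝ) : ScatteringData where
  S := fun k => scatS q k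
  bound := (fun κ => (κ, normingConst q κ)) '' boundStates q

/-- The `I`-function of `q`, restricted to `k > 0`. -/
def iData (q : ℝ → ℝ) : {k : ℝ // 0 < k} → ℂ := fun k => iFun q ((k : ℝ) : ℂ)

/-- `w(z) = ∏ (z - i k_j) / (z + i k_j)`. -/
def blaschke (K : Set ℝ) (z : ℂ) : ℂ :=
  ∏ᶠ κ ∈ K, (z - Complex.I * κ) / (z + Complex.I * κ)

/-- `w₁(z) = z / (z + i) · w(z)`. -/
def blaschke₁ (K : Set ℝ) (z : ℂ) : ℂ := z / (z + Complex.I) * blaschke K z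

/-- The residue `f'(0, iκ) / ḟ(iκ)` of `I` at `iκ`, `κ ≥ 0`. -/
def iRes (q : ℝ → ℝ) (κ : ℝ) : ℂ :=
  jostDeriv q (Complex.I * κ) / jostDot q (Complex.I * κ)

/-- The index set of the principal parts of `I`: the `k_j`, and `0` if `f(0) = 0`. -/
def poleSet (q : ℝ → ℝ) : Set ℝ := boundStates q ∪ {κ | κ = 0 ∧ jostFn q 0 = 0}

/-- The class in which the two Riemann problems for `f` are posed: continuous on the closed upper
half-plane, analytic inside, equal to `1` at infinity, with simple zeros at exactly the points
`iκ`, `κ ∈ K`, and possibly a simple zero at `0`. -/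
structure IsJostClass (K : Set ℝ) (F : ℂ → ℂ) : Prop where
  continuousOn : ContinuousOn F closedUpperHP
  differentiableOn : DifferentiableOn ℂ F openUpperHP
  tendsto_one : Tendsto F (Bornology.cobounded ℂ ⊓ 𝓟 closedUpperHP) (𝓝 1)
  zero_iff : ∀ z ∈ closedUpperHP, z ≠ 0 → (F z = 0 ↔ ∃ κ ∈ K, z = Complex.I * κ)
  simple : ∀ κ ∈ K, deriv F (Complex.I * κ) ≠ 0
  simple_at_zero : F 0 = 0 → ∃ c, c ≠ 0 ∧ HasDerivWithinAt F c closedUpperHP 0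

/-- `G` solves the jump problem `G(k) = G(-k) + h(k)`, `k ∈ ℝ \ {0}`: it is analytic in the
upper half-plane, continuous up to `ℝ \ {0}`, zero at infinity, and `o(1/|z|)` at `0`. -/
structure IsJumpSolution (h : ℝ → ℂ) (G : ℂ → ℂ) : Prop where
  differentiableOn : DifferentiableOn ℂ G openUpperHP
  continuousOn : ContinuousOn G (closedUpperHP \ {0})
  tendsto_zero : Tendsto G (Bornology.cobounded ℂ ⊓ 𝓟 closedUpperHP) (𝓝 0)
  isLittleO_at_zero : Tendsto (fun z => z * G z) (𝓝[closedUpperHP \ {0}] 0) (𝓝 0)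
  jump : ∀ k : ℝ, k ≠ 0 → G k = G (-(k : ℂ)) + h k

/-- `L` is the branch of `ln h` on `ℝ \ {0}` that is continuous there and vanishes at `±∞`
(such a branch is unique on `ℝ \ {0}`). -/
structure IsLogBranch (h : ℝ → ℂ) (L : ℝ → ℂ) : Prop where
  continuousOn : ContinuousOn L {0}ᶜ
  exp_eq : ∀ t, t ≠ 0 → Complex.exp (L t) = h t
  tendsto_atTop : Tendsto L atTop (𝓝 0)
  tendsto_atBot : Tendsto L atBot (𝓝 0)

/-- `g(s) = s / Im I(s)` for real `s`. -/
def gFun (q : ℝ → ℝ) (s : ℝ) : ℝ := s / (iFun q s).im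

/-- The right-hand side of the jump problem for `𝒥`. -/
def jumpRHS (q : ℝ → ℝ) (k : ℝ) : ℂ :=
  2 * Complex.I * k / (‖jostFn q k‖ : ℂ) ^ 2 - 2 * Complex.I * k -
    ∑ᶠ κ ∈ poleSet q, iRes q κ * (1 / (k - Complex.I * κ) + 1 / (k + Complex.I * κ))

/-- The density `t (|f(t)|⁻² - 1) + i ∑ I_j t / (t² + k_j²)`. -/
def jumpDensity (q : ℝ → ℝ) (t : ℝ) : ℂ :=
  t * (((‖jostFn q t‖ : ℂ) ^ 2)⁻¹ - 1) +
    Complex.I * ∑ᶠ κ ∈ poleSet q, iRes q κ * t / ((t : ℂ) ^ 2 + (κ : ℂ) ^ 2)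

end IFunction

end

open MeasureTheory Set Filter Topology

noncomputable section

namespace IFunction

/-! Both sets of data determine the Jost function, and each direction of the correspondence recovers
f first.

Direct theory. Write f(x,k) = e^{ikx} m(x,k). The Volterra kernel for m is bounded by (t-x)^+
uniformly in Im k ≥ 0, so the weight 1+x makes the Neumann series converge like an exponential
series, uniformly in x and k (`norm_picard_le`). This gives existence, analyticity in k, continuity
up to the real axis including k = 0, and f(k) = 1 + O(1/k). Wronskians give the rest: W(f(·,k),
f(·,-k)) = -2ik excludes real zeros other than 0 and yields Im I = k/|f|^2. Green's identity puts
all zeros in the upper half-plane on the imaginary axis (`jostFn_eq_zero_iff`) and evaluates the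
derivative of f there in terms of the norming constant, so they are simple. If f(0) = 0, integration
by parts against the zero-energy solution shows that this zero is simple as well, using only the
first moment of q (`jostFn_mul_jostDeriv_zero`).

Riemann problems. The relations f(k)f(-k) = g(k) and f(k)/f(-k) = S(-k) are multiplicative. After
division by the Blaschke product, and by z/(z+i) when f(0) = 0, f has a logarithm l analytic in the
half-plane, and the data become l(t) + σ l(-t) with σ = 1 or σ = -1. The reflected term G(-t)/(t-z)
corresponds to a kernel with its pole at -z, in the lower half-plane, and contributes nothing. Hence
(G(t) + σ G(-t))/(t-z) integrates to 2πi G(z) for every σ (`tendsto_cauchy`). This one formula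
yields both representations of f, both uniqueness statements and, with σ = -1, the solution of the
additive jump problem for I.

Correspondence. From I on k > 0: boundary uniqueness fixes I in the half-plane
(`eventuallyEq_zero_of_tendsto_zero`), its poles are the bound states, g gives f, and the residues
give the s_j. From the triple: S and the k_j give f, the s_j give the residues, and the jump problem
gives I. The latter is uniquely solvable because I(z) - iz tends to 0 at infinity by the
Riemann–Lebesgue lemma, and because subtracting I_0/z leaves o(1/|z|) at the origin. -/

/-! ### Absolute continuity, product rule and Gronwall-type iteration -/

theorem absolutelyContinuousOnInterval_of_dist_le {X Y : Type*} [PseudoMetricSpace X]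
    [PseudoMetricSpace Y] {f : ℝ → X} {g : ℝ → Y} {a b : ℝ}
    (hg : AbsolutelyContinuousOnInterval g a b)
    (h : ∀ x ∈ uIcc a b, ∀ y ∈ uIcc a b, dist (f x) (f y) ≤ dist (g x) (g y)) :
    AbsolutelyContinuousOnInterval f a b := by
  rw [absolutelyContinuousOnInterval_iff] at hg ⊢
  intro ε hε
  obtain ⟨δ, hδ, H⟩ := hg ε hε
  refine ⟨δ, hδ, fun E hE hlt => lt_of_le_of_lt (Finset.sum_le_sum fun i hi => ?_) (H E hE hlt)⟩
  exact h _ (hE.1 i hi).1 _ (hE.1 i hi).2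

/-- Increments of the primitive are bounded by those of the primitive of the norm, which reduces the
claim to real integrands. -/
theorem absolutelyContinuousOnInterval_integral {f : ℝ → ℂ} {a b : ℝ}
    (hf : IntervalIntegrable f volume a b) :
    AbsolutelyContinuousOnInterval (fun x => ∫ t in a..x, f t) a b := by
  refine absolutelyContinuousOnInterval_of_dist_le
    (hf.norm.absolutelyContinuousOnInterval_intervalIntegral (c := a) left_mem_uIcc) ?_
  intro x hx y hy
  have hi : ∀ z ∈ uIcc a b, IntervalIntegrable f volume a z := fun z hz =>
    hf.mono_set (uIcc_subset_uIcc left_mem_uIcc hz)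
  rw [dist_eq_norm, dist_eq_norm,
    intervalIntegral.integral_interval_sub_left (hi x hx) (hi y hy),
    intervalIntegral.integral_interval_sub_left (hi x hx).norm (hi y hy).norm]
  exact (intervalIntegral.norm_integral_le_abs_integral_norm).trans_eq (Real.norm_eq_abs _).symm

/-- The product rule for indefinite integrals. -/
theorem mul_sub_mul_eq_integral {u v u' v' : ℝ → ℂ} {a b : ℝ} (hab : a ≤ b)
    (hu' : IntervalIntegrable u' volume a b) (hv' : IntervalIntegrable v' volume a b)
    (hu : ∀ x ∈ Icc a b, u x = u a + ∫ t in a..x, u' t)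
    (hv : ∀ x ∈ Icc a b, v x = v a + ∫ t in a..x, v' t) :
    u b * v b - u a * v a = ∫ t in a..b, (u' t * v t + u t * v' t) := by
  have hI : uIcc a b = Icc a b := uIcc_of_le hab
  -- The functions u and v are controlled only on [a,b], whereas the primitives live on the whole
  -- line and have two-sided derivatives almost everywhere. The difference below is absolutely
  -- continuous with derivative zero a.e., hence constant.
  set U : ℝ → ℂ := fun x => u a + ∫ t in a..x, u' t with hU
  set V : ℝ → ℂ := fun x => v a + ∫ t in a..x, v' t with hV
  have hUac : AbsolutelyContinuousOnInterval U a b := by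
    refine absolutelyContinuousOnInterval_of_dist_le
      (absolutelyContinuousOnInterval_integral hu') fun x _ y _ => ?_
    simp [hU]
  have hVac : AbsolutelyContinuousOnInterval V a b := by
    refine absolutelyContinuousOnInterval_of_dist_le
      (absolutelyContinuousOnInterval_integral hv') fun x _ y _ => ?_
    simp [hV]
  have hint : IntervalIntegrable (fun t => u' t * V t + U t * v' t) volume a b :=
    (hu'.mul_continuousOn hVac.continuousOn).add (hv'.continuousOn_mul hUac.continuousOn)
  have hW : AbsolutelyContinuousOnInterval
      (fun x => U x * V x - ∫ t in a..x, (u' t * V t + U t * v' t)) a b :=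
    AbsolutelyContinuousOnInterval.fun_sub (hUac.fun_smul hVac)
      (absolutelyContinuousOnInterval_integral hint)
  obtain ⟨C, hC⟩ := hW.const_of_ae_hasDerivAt_zero (by
    filter_upwards [hu'.ae_hasDerivAt_integral, hv'.ae_hasDerivAt_integral,
      hint.ae_hasDerivAt_integral] with x h1 h2 h3 hx
    have e1 := (h1 hx a left_mem_uIcc).const_add (u a)
    have e2 := (h2 hx a left_mem_uIcc).const_add (v a)
    have e3 := (e1.mul e2).sub (h3 hx a left_mem_uIcc)
    convert! e3 using 1
    simp [hU, hV])
  have ha := hC a left_mem_uIcc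
  have hb := hC b right_mem_uIcc
  have hUu : ∀ x ∈ Icc a b, U x = u x := fun x hx => (hu x hx).symm
  have hVv : ∀ x ∈ Icc a b, V x = v x := fun x hx => (hv x hx).symm
  have hc : ∫ t in a..b, (u' t * v t + u t * v' t) = ∫ t in a..b, (u' t * V t + U t * v' t) := by
    refine intervalIntegral.integral_congr fun t ht => ?_
    rw [hI] at ht
    simp only [hUu t ht, hVv t ht]
  rw [hc]
  simp only [intervalIntegral.integral_same, sub_zero] at ha
  rw [hUu a (left_mem_Icc.2 hab), hVv a (left_mem_Icc.2 hab)] at ha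
  rw [hUu b (right_mem_Icc.2 hab), hVv b (right_mem_Icc.2 hab)] at hb
  linear_combination hb - ha

theorem absolutelyContinuousOnInterval_pow {f : ℝ → ℝ} {a b : ℝ}
    (hf : AbsolutelyContinuousOnInterval f a b) (n : ℕ) :
    AbsolutelyContinuousOnInterval (fun x => f x ^ n) a b := by
  induction n with
  | zero =>
    simp only [pow_zero]
    exact absolutelyContinuousOnInterval_of_dist_le hf fun x _ y _ => by simp
  | succ n ih => simpa only [pow_succ] using! ih.fun_mul hf

/-- The integrand is, almost everywhere, -1/(n+1) times the derivative of the absolutely continuous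
function (c - ∫h)^(n+1). Taking c to be a full tail integral serves iterations from infinity; c = 0
serves iterations from a finite endpoint. -/
theorem integral_mul_tail_pow {h : ℝ → ℝ} {a b : ℝ} (hh : IntervalIntegrable h volume a b)
    (c : ℝ) (n : ℕ) :
    ∫ t in a..b, h t * (c - ∫ s in a..t, h s) ^ n =
      (c ^ (n + 1) - (c - ∫ s in a..b, h s) ^ (n + 1)) / (n + 1) := by
  set H : ℝ → ℝ := fun t => c - ∫ s in a..t, h s with hH
  have hHac : AbsolutelyContinuousOnInterval H a b := by
    refine absolutelyContinuousOnInterval_of_dist_le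
      (hh.absolutelyContinuousOnInterval_intervalIntegral (c := a) left_mem_uIcc)
      fun x _ y _ => ?_
    rw [Real.dist_eq, Real.dist_eq, abs_sub_comm]
    simp only [hH, sub_sub_sub_cancel_left]
    exact le_rfl
  have key := (absolutelyContinuousOnInterval_pow hHac (n + 1)).integral_deriv_eq_sub
  have hcongr : ∫ t in a..b, deriv (fun x => H x ^ (n + 1)) t =
      ∫ t in a..b, -(n + 1) * (h t * H t ^ n) := by
    refine intervalIntegral.integral_congr_ae ?_
    filter_upwards [hh.ae_hasDerivAt_integral] with x hx hx'
    have e := (((hx (uIoc_subset_uIcc hx') a left_mem_uIcc).const_sub c).pow (n + 1)).deriv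
    refine Eq.trans e ?_
    simp only [hH]
    push_cast
    ring_nf
  rw [hcongr, intervalIntegral.integral_const_mul] at key
  have hn : ((n : ℝ) + 1) ≠ 0 := by positivity
  have ha : H a = c := by simp [hH]
  rw [eq_div_iff hn]
  simp only [ha] at key
  linear_combination -key

/-- If `h ≥ 0` is integrable and `H` is its tail integral, then `∫ₓ^∞ h Hⁿ ≤ Hⁿ⁺¹ / (n + 1)`. -/
theorem integral_Ioi_mul_tail_pow_le {h : ℝ → ℝ} (hh : Integrable h) (h0 : ∀ t, 0 ≤ h t)
    (x : ℝ) (n : ℕ) :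
    IntegrableOn (fun t => h t * (∫ s in Ioi t, h s) ^ n) (Ioi x) ∧
    ∫ t in Ioi x, h t * (∫ s in Ioi t, h s) ^ n ≤ (∫ s in Ioi x, h s) ^ (n + 1) / (n + 1) := by
  have hH : ∀ t, x ≤ t → ∫ s in Ioi t, h s = (∫ s in Ioi x, h s) - ∫ s in x..t, h s := by
    intro t ht
    rw [← intervalIntegral.integral_Ioi_sub_Ioi hh.integrableOn ht]
    ring
  have hHnn : ∀ t, 0 ≤ ∫ s in Ioi t, h s := fun t => integral_nonneg h0
  have hHc : Continuous fun t : ℝ => ∫ s in Ioi t, h s := by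
    have : (fun t : ℝ => ∫ s in Ioi t, h s) =
        fun t => (∫ s in Ioi x, h s) - ∫ s in x..t, h s := by
      funext t
      have h1 := intervalIntegral.integral_Ioi_sub_Ioi' (μ := volume) (a := x) (b := t)
        hh.integrableOn hh.integrableOn
      rw [← h1]; ring
    rw [this]
    exact continuous_const.sub (intervalIntegral.continuous_primitive
      (fun a b => hh.intervalIntegrable) x)
  have hint : IntegrableOn (fun t => h t * (∫ s in Ioi t, h s) ^ n) (Ioi x) := by
    refine (hh.mul_bdd (c := (∫ s, h s) ^ n)
      (hHc.pow n).aestronglyMeasurable (ae_of_all _ fun t => ?_)).integrableOn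
    simp only [Pi.pow_apply]
    rw [norm_pow, Real.norm_of_nonneg (hHnn t)]
    exact pow_le_pow_left₀ (hHnn t) (setIntegral_le_integral hh (ae_of_all _ h0)) n
  refine ⟨hint, ?_⟩
  have ht := intervalIntegral_tendsto_integral_Ioi x hint tendsto_id
  refine le_of_tendsto ht ?_
  filter_upwards [eventually_ge_atTop x] with b hb
  have e : ∫ t in x..b, h t * (∫ s in Ioi t, h s) ^ n =
      ∫ t in x..b, h t * ((∫ s in Ioi x, h s) - ∫ s in x..t, h s) ^ n := by
    refine intervalIntegral.integral_congr fun t ht => ?_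
    rw [uIcc_of_le hb] at ht
    simp only [hH t ht.1]
  simp only [id]
  rw [e, integral_mul_tail_pow hh.intervalIntegrable, ← hH b hb]
  have := pow_nonneg (hHnn b) (n + 1)
  gcongr
  linarith

/-- A nonnegative function dominated by its weighted tail integral vanishes. -/
theorem eq_zero_of_le_integral_right {Y h : ℝ → ℝ} {a b : ℝ} (hab : a ≤ b)
    (hh : IntervalIntegrable h volume a b) (h0 : ∀ t, 0 ≤ h t)
    (hYc : ContinuousOn Y (Icc a b)) (hY0 : ∀ x ∈ Icc a b, 0 ≤ Y x)
    (hY : ∀ x ∈ Icc a b, Y x ≤ ∫ t in a..x, h t * Y t) : ∀ x ∈ Icc a b, Y x = 0 := by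
  obtain ⟨M, hM⟩ := isCompact_Icc.exists_bound_of_continuousOn hYc
  have hM' : ∀ x ∈ Icc a b, Y x ≤ M := fun x hx => (le_abs_self _).trans (hM x hx)
  have hsub : ∀ x ∈ Icc a b, IntervalIntegrable h volume a x := fun x hx =>
    hh.mono_set (by rw [uIcc_of_le hx.1, uIcc_of_le hab]; exact Icc_subset_Icc_right hx.2)
  have hprim : ∀ x ∈ Icc a b, ContinuousOn (fun t => ∫ s in a..t, h s) (Icc a x) := by
    intro x hx
    have := (hsub x hx).absolutelyContinuousOnInterval_intervalIntegral
      (c := a) left_mem_uIcc |>.continuousOn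
    rwa [uIcc_of_le hx.1] at this
  -- Feeding the hypothesis into itself n times produces the general term of an exponential series,
  -- which tends to 0.
  have hbound : ∀ n : ℕ, ∀ x ∈ Icc a b,
      Y x ≤ M * ((∫ s in a..x, h s) ^ n / (n.factorial : ℝ)) := by
    intro n
    induction n with
    | zero => intro x hx; simpa using hM' x hx
    | succ n ih =>
      intro x hx
      have hYx : ContinuousOn Y (uIcc a x) := by
        rw [uIcc_of_le hx.1]; exact hYc.mono (Icc_subset_Icc_right hx.2)
      have hpc : ContinuousOn (fun t => (∫ s in a..t, h s) ^ n) (uIcc a x) := by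
        rw [uIcc_of_le hx.1]; exact (hprim x hx).pow n
      have h1 : ∫ t in a..x, h t * Y t ≤
          ∫ t in a..x, M / (n.factorial : ℝ) * (h t * (∫ s in a..t, h s) ^ n) := by
        refine intervalIntegral.integral_mono_on hx.1 ((hsub x hx).mul_continuousOn hYx)
          (((hsub x hx).mul_continuousOn hpc).const_mul _) fun t ht => ?_
        have := mul_le_mul_of_nonneg_left (ih t ⟨ht.1, ht.2.trans hx.2⟩) (h0 t)
        refine this.trans_eq ?_
        ring
      -- With c = 0 the closed form involves powers of minus the primitive, so signs (-1)^n have to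
      -- be moved across.
      have h2 := integral_mul_tail_pow (hsub x hx) 0 n
      have h3 : ∫ t in a..x, h t * (0 - ∫ s in a..t, h s) ^ n =
          (-1) ^ n * ∫ t in a..x, h t * (∫ s in a..t, h s) ^ n := by
        rw [← intervalIntegral.integral_const_mul]
        refine intervalIntegral.integral_congr fun t _ => ?_
        simp only [zero_sub]
        rw [neg_pow]; ring
      have h4 : ∫ t in a..x, h t * (∫ s in a..t, h s) ^ n =
          (∫ s in a..x, h s) ^ (n + 1) / (n + 1) := by
        have hs : ((-1 : ℝ) ^ n) * (-1) ^ n = 1 := by rw [← mul_pow]; simp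
        have : ∫ t in a..x, h t * (∫ s in a..t, h s) ^ n =
          (-1) ^ n * ∫ t in a..x, h t * (0 - ∫ s in a..t, h s) ^ n := by
          rw [h3, ← mul_assoc, hs, one_mul]
        rw [this, h2, zero_sub, neg_pow (∫ s in a..x, h s), zero_pow (Nat.succ_ne_zero n),
          pow_succ (-1 : ℝ) n]
        linear_combination (∫ s in a..x, h s) ^ (n + 1) / (n + 1) * hs
      refine (hY x hx).trans (h1.trans_eq ?_)
      rw [intervalIntegral.integral_const_mul, h4, Nat.factorial_succ]
      push_cast
      have : (n.factorial : ℝ) ≠ 0 := by positivity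
      field_simp
  intro x hx
  refine le_antisymm ?_ (hY0 x hx)
  have ht := (FloorSemiring.tendsto_pow_div_factorial_atTop (∫ s in a..x, h s)).const_mul M
  rw [mul_zero] at ht
  exact ge_of_tendsto' ht fun n => hbound n x hx

/-- The reflection x ↦ a + b - x exchanges the two endpoints. -/
theorem eq_zero_of_le_integral_left {Y h : ℝ → ℝ} {a b : ℝ} (hab : a ≤ b)
    (hh : IntervalIntegrable h volume a b) (h0 : ∀ t, 0 ≤ h t)
    (hYc : ContinuousOn Y (Icc a b)) (hY0 : ∀ x ∈ Icc a b, 0 ≤ Y x)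
    (hY : ∀ x ∈ Icc a b, Y x ≤ ∫ t in x..b, h t * Y t) : ∀ x ∈ Icc a b, Y x = 0 := by
  have hm : ∀ x ∈ Icc a b, a + b - x ∈ Icc a b := fun x hx => ⟨by linarith [hx.2], by linarith [hx.1]⟩
  have key := eq_zero_of_le_integral_right (Y := fun x => Y (a + b - x))
    (h := fun x => h (a + b - x)) hab ?_ (fun t => h0 _)
    (hYc.comp (by fun_prop) hm) (fun x hx => hY0 _ (hm x hx)) ?_
  · intro x hx
    simpa using key _ (hm x hx)
  · have := (hh.comp_sub_left (a + b)).symm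
    simpa using this
  · intro x hx
    refine (hY _ (hm x hx)).trans_eq ?_
    have := intervalIntegral.integral_comp_sub_left (a := a) (b := x) (fun t => h t * Y t) (a + b)
    simp only [add_sub_cancel_left] at this
    exact this.symm

/-! ### Holomorphic dependence on a parameter -/

/-- Integrals of dominated families of holomorphic functions are holomorphic. -/
theorem differentiableOn_integral_of_dominated {α : Type*} [MeasurableSpace α] {μ : Measure α}
    {U : Set ℂ} (hU : IsOpen U) {F : ℂ → α → ℂ} {bound : α → ℝ}
    (hm : ∀ k ∈ U, AEStronglyMeasurable (F k) μ) (hb : Integrable bound μ)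
    (hle : ∀ᵐ t ∂μ, ∀ k ∈ U, ‖F k t‖ ≤ bound t)
    (hd : ∀ᵐ t ∂μ, DifferentiableOn ℂ (fun k => F k t) U) :
    DifferentiableOn ℂ (fun k => ∫ t, F k t ∂μ) U := by
  intro k₀ hk₀
  obtain ⟨r, hr, hrU⟩ := Metric.isOpen_iff.1 hU k₀ hk₀
  have hr2 : 0 < r / 2 := by positivity
  -- Cauchy's estimate on circles of radius r/4 about points of the ball of radius r/2 turns the
  -- bound on F into a bound on its derivative. No separate domination of the derivative is
  -- therefore required.
  have hder : ∀ᵐ t ∂μ, ∀ k ∈ Metric.ball k₀ (r / 2), ‖deriv (fun k => F k t) k‖ ≤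
      bound t / (r / 4) := by
    filter_upwards [hle, hd] with t h1 h2 k hk
    have hsub : Metric.closedBall k (r / 4) ⊆ U := by
      intro w hw
      refine hrU ?_
      have h3 := dist_triangle w k k₀
      simp only [Metric.mem_closedBall, Metric.mem_ball] at *
      linarith
    refine Complex.norm_deriv_le_of_forall_mem_sphere_norm_le (by positivity) ?_ fun z hz =>
      h1 z (hsub (Metric.sphere_subset_closedBall hz))
    exact DifferentiableOn.diffContOnCl (h2.mono (by
      rw [closure_ball _ (by positivity)]; exact hsub))
  -- The derivative at k₀ is measurable in t as the limit of difference quotients along the sequence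
  -- k₀ + (r/2)/(n+1).
  have hA : AEStronglyMeasurable (fun t => deriv (fun k => F k t) k₀) μ := by
    have hseq : Tendsto (fun n : ℕ => k₀ + ((r / 2 / (n + 1) : ℝ) : ℂ)) atTop (𝓝[≠] k₀) := by
      refine tendsto_nhdsWithin_iff.2 ⟨?_, Eventually.of_forall fun n => ?_⟩
      · have : Tendsto (fun n : ℕ => r / 2 / ((n : ℝ) + 1)) atTop (𝓝 0) :=
          tendsto_const_nhds.div_atTop
            (tendsto_atTop_add_const_right _ _ tendsto_natCast_atTop_atTop)
        have h2 := (Complex.continuous_ofReal.tendsto 0).comp this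
        simpa using h2.const_add k₀
      · have : (0 : ℝ) < r / 2 / ((n : ℝ) + 1) := by positivity
        simp only [mem_compl_iff, mem_singleton_iff, add_eq_left]
        exact_mod_cast this.ne'
    have hin : ∀ n : ℕ, k₀ + ((r / 2 / (n + 1) : ℝ) : ℂ) ∈ U := fun n => hrU (by
      rw [Metric.mem_ball, dist_eq_norm, add_sub_cancel_left, Complex.norm_real,
        Real.norm_of_nonneg (by positivity)]
      have : r / 2 / ((n : ℝ) + 1) ≤ r / 2 := div_le_self (by positivity) (by linarith [n.cast_nonneg (α := ℝ)])
      linarith)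
    refine aestronglyMeasurable_of_tendsto_ae (u := atTop)
      (f := fun (n : ℕ) t => slope (fun k => F k t) k₀ (k₀ + ((r / 2 / (n + 1) : ℝ) : ℂ))) (fun n => ?_) ?_
    · simp only [slope, vsub_eq_sub, smul_eq_mul]
      exact ((hm _ (hin n)).sub (hm _ hk₀)).const_mul _
    · filter_upwards [hd] with t ht
      exact ((ht.differentiableAt (hU.mem_nhds hk₀)).hasDerivAt.tendsto_slope).comp hseq
  have hB : ∀ᵐ t ∂μ, LipschitzOnWith (Real.nnabs (bound t / (r / 4))) (fun k => F k t)
      (Metric.ball k₀ (r / 2)) := by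
    filter_upwards [hder, hd] with t h1 h2
    refine (convex_ball k₀ (r / 2)).lipschitzOnWith_of_nnnorm_deriv_le (𝕜 := ℂ) (fun k hk => ?_) fun k hk => ?_
    · exact h2.differentiableAt (hU.mem_nhds (hrU (Metric.ball_subset_ball (by linarith) hk)))
    · rw [← NNReal.coe_le_coe]
      simp only [coe_nnnorm, Real.coe_nnabs]
      exact (h1 k hk).trans (le_abs_self _)
  obtain ⟨-, h⟩ := hasDerivAt_integral_of_dominated_loc_of_lip (μ := μ) (F := F) (x₀ := k₀)
    (s := Metric.ball k₀ (r / 2)) (bound := fun t => bound t / (r / 4))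
    (F' := fun t => deriv (fun k => F k t) k₀) (Metric.ball_mem_nhds _ hr2)
    (by filter_upwards [hU.mem_nhds hk₀] with k hk using hm k hk)
    (hb.mono' (hm k₀ hk₀) (hle.mono fun t ht => ht k₀ hk₀))
    hA hB (hb.div_const _)
    (hd.mono fun t ht => (ht.differentiableAt (hU.mem_nhds hk₀)).hasDerivAt)
  exact h.differentiableAt.differentiableWithinAt

/-! ### The Volterra equation for e^{-ikx} f(x,k) -/

/-- The potential, extended by zero to the left half-line. -/
def zeroExt (q : ℝ → ℝ) : ℝ → ℝ := (Ioi (0 : ℝ)).indicator q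

theorem zeroExt_of_pos (q : ℝ → ℝ) {t : ℝ} (ht : 0 < t) : zeroExt q t = q t :=
  indicator_of_mem (s := Ioi (0 : ℝ)) ht q

theorem zeroExt_of_nonpos (q : ℝ → ℝ) {t : ℝ} (ht : t ≤ 0) : zeroExt q t = 0 :=
  indicator_of_notMem (s := Ioi (0 : ℝ)) (by simpa using ht) q

/-- The weight `(1 + t) |q t|`, extended by zero. -/
def weight (q : ℝ → ℝ) (t : ℝ) : ℝ := (1 + t) * |zeroExt q t|

theorem weight_nonneg (q : ℝ → ℝ) (t : ℝ) : 0 ≤ weight q t := by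
  rcases le_or_gt t 0 with ht | ht
  · simp [weight, zeroExt_of_nonpos q ht]
  · unfold weight; positivity

theorem abs_zeroExt_le_weight (q : ℝ → ℝ) (t : ℝ) : |zeroExt q t| ≤ weight q t := by
  rcases le_or_gt t 0 with ht | ht
  · simp [weight, zeroExt_of_nonpos q ht]
  · unfold weight; nlinarith [abs_nonneg (zeroExt q t)]

theorem MemL11.integrable_weight {q : ℝ → ℝ} (hq : MemL11 q) : Integrable (weight q) := by
  have h := hq.2
  rw [← integrable_indicator_iff measurableSet_Ioi] at h
  refine h.congr (ae_of_all _ fun t => ?_)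
  rcases le_or_gt t 0 with ht | ht
  · simp [weight, zeroExt_of_nonpos q ht, indicator, not_lt.2 ht]
  · simp [weight, zeroExt_of_pos q ht, indicator, ht]

theorem MemL11.aestronglyMeasurable_zeroExt {q : ℝ → ℝ} (hq : MemL11 q) :
    AEStronglyMeasurable (zeroExt q) :=
  (aestronglyMeasurable_indicator_iff measurableSet_Ioi).2 hq.1

theorem MemL11.integrable_zeroExt {q : ℝ → ℝ} (hq : MemL11 q) : Integrable (zeroExt q) :=
  hq.integrable_weight.mono' hq.aestronglyMeasurable_zeroExt
    (ae_of_all _ (abs_zeroExt_le_weight q))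

/-- The tail integral of the weight. -/
def tail (q : ℝ → ℝ) (x : ℝ) : ℝ := ∫ t in Ioi x, weight q t

theorem tail_nonneg (q : ℝ → ℝ) (x : ℝ) : 0 ≤ tail q x := integral_nonneg (weight_nonneg q)

theorem MemL11.tail_le {q : ℝ → ℝ} (hq : MemL11 q) (x : ℝ) : tail q x ≤ ∫ t, weight q t :=
  setIntegral_le_integral hq.integrable_weight (ae_of_all _ (weight_nonneg q))

theorem MemL11.tendsto_tail {q : ℝ → ℝ} (hq : MemL11 q) : Tendsto (tail q) atTop (𝓝 0) := by
  have h := (intervalIntegral_tendsto_integral_Ioi 0 hq.integrable_weight.integrableOn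
    tendsto_id).const_sub (∫ t in Ioi 0, weight q t)
  rw [sub_self] at h
  refine h.congr' ?_
  filter_upwards [eventually_ge_atTop 0] with x hx
  rw [id, ← intervalIntegral.integral_Ioi_sub_Ioi hq.integrable_weight.integrableOn hx, tail]
  ring

theorem norm_exp_two_mul_le {k : ℂ} (hk : k ∈ closedUpperHP) {s : ℝ} (hs : 0 ≤ s) :
    ‖Complex.exp (2 * Complex.I * k * s)‖ ≤ 1 := by
  rw [Complex.norm_exp, Real.exp_le_one_iff]
  have : (2 * Complex.I * k * s).re = -(2 * k.im * s) := by simp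
  rw [this]
  have := mul_nonneg hk hs
  linarith

/-- The kernel `(exp (2 i k y) - 1) / (2 i k)` for `y ≥ 0`, extended by zero. -/
def kernel (k : ℂ) (y : ℝ) : ℂ := ∫ s in (0 : ℝ)..max y 0, Complex.exp (2 * Complex.I * k * s)

theorem kernel_of_nonpos (k : ℂ) {y : ℝ} (hy : y ≤ 0) : kernel k y = 0 := by
  simp [kernel, max_eq_right hy]

theorem continuous_kernel : Continuous fun p : ℂ × ℝ => kernel p.1 p.2 := by
  unfold kernel
  refine intervalIntegral.continuous_parametric_intervalIntegral_of_continuous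
    (f := fun (p : ℂ × ℝ) (s : ℝ) => Complex.exp (2 * Complex.I * p.1 * s)) ?_ ?_
  · fun_prop
  · fun_prop

/-- The kernel is defined as an integral rather than a quotient, so k = 0 is not exceptional. The
integrand has modulus at most 1 when Im k ≥ 0, which makes the Lipschitz constant independent of k.
-/
theorem norm_kernel_sub_le {k : ℂ} (hk : k ∈ closedUpperHP) (y z : ℝ) :
    ‖kernel k y - kernel k z‖ ≤ |y - z| := by
  have hi : ∀ a b : ℝ, IntervalIntegrable (fun s : ℝ => Complex.exp (2 * Complex.I * k * s))
      volume a b := fun a b => Continuous.intervalIntegrable (by fun_prop) a b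
  rw [kernel, kernel, intervalIntegral.integral_interval_sub_left (hi _ _) (hi _ _)]
  have := intervalIntegral.norm_integral_le_of_norm_le_const
    (f := fun s : ℝ => Complex.exp (2 * Complex.I * k * s)) (a := max z 0) (b := max y 0) (C := 1)
    (fun s hs => norm_exp_two_mul_le hk (by
      rw [mem_uIoc] at hs
      rcases hs with hs | hs
      · exact (le_max_right z 0).trans hs.1.le
      · exact (le_max_right y 0).trans hs.1.le))
  rw [one_mul] at this
  exact this.trans (abs_max_sub_max_le_abs y z 0)

theorem norm_kernel_le {k : ℂ} (hk : k ∈ closedUpperHP) (y : ℝ) : ‖kernel k y‖ ≤ max y 0 := by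
  rcases le_or_gt y 0 with hy | hy
  · simp [kernel_of_nonpos k hy]
  · have := norm_kernel_sub_le hk y 0
    rw [kernel_of_nonpos k le_rfl, sub_zero, sub_zero, abs_of_pos hy] at this
    exact this.trans (le_max_left _ _)

/-- In (e^{2iky} - 1)/(2ik) the numerator is at most 2. This bound supplies decay for large k, while
`norm_kernel_le` is the one that stays uniform near k = 0. -/
theorem norm_mul_norm_kernel_le {k : ℂ} (hk : k ∈ closedUpperHP) (y : ℝ) :
    ‖k‖ * ‖kernel k y‖ ≤ 1 := by
  rcases eq_or_ne k 0 with rfl | h0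
  · simp
  have hc : 2 * Complex.I * k ≠ 0 := by simp [h0]
  have h1 : kernel k y = (Complex.exp (2 * Complex.I * k * (max y 0 : ℝ)) - 1) /
      (2 * Complex.I * k) := by
    rw [kernel, integral_exp_mul_complex hc]
    simp
  have h2 : ‖Complex.exp (2 * Complex.I * k * (max y 0 : ℝ)) - 1‖ ≤ 2 :=
    (norm_sub_le _ _).trans (by
      have := norm_exp_two_mul_le hk (le_max_right y 0)
      rw [norm_one]; linarith)
  have hk0 : 0 < ‖k‖ := norm_pos_iff.2 h0
  rw [h1, norm_div, norm_mul, norm_mul]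
  simp only [Complex.norm_ofNat, Complex.norm_I, mul_one]
  rw [mul_div_assoc', div_le_one (by positivity)]
  nlinarith

theorem differentiableOn_kernel (y : ℝ) :
    DifferentiableOn ℂ (fun k => kernel k y) openUpperHP := by
  simp only [kernel, intervalIntegral.integral_of_le (le_max_right y 0)]
  refine differentiableOn_integral_of_dominated
    (isOpen_lt continuous_const Complex.continuous_im) (bound := fun _ => 1) (fun k _ => ?_)
    (integrable_const _) ?_ ?_
  · exact Continuous.aestronglyMeasurable (by fun_prop)
  · refine (ae_restrict_iff' measurableSet_Ioc).2 (ae_of_all _ fun t ht k hk => ?_)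
    exact norm_exp_two_mul_le (le_of_lt (show 0 < k.im from hk)) ht.1.le
  · exact ae_of_all _ fun t => (by fun_prop)

theorem hasDerivAt_kernel (k : ℂ) {y : ℝ} (hy : y ≠ 0) :
    HasDerivAt (kernel k) (if 0 < y then Complex.exp (2 * Complex.I * k * y) else 0) y := by
  rcases lt_or_gt_of_ne hy with h | h
  · rw [if_neg (not_lt.2 h.le)]
    refine (hasDerivAt_const y (0 : ℂ)).congr_of_eventuallyEq ?_
    filter_upwards [eventually_lt_nhds h] with z hz using kernel_of_nonpos k hz.le
  · rw [if_pos h]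
    have hc : Continuous fun s : ℝ => Complex.exp (2 * Complex.I * k * s) := by fun_prop
    refine (intervalIntegral.integral_hasDerivAt_right (hc.intervalIntegrable 0 y)
      (hc.stronglyMeasurableAtFilter _ _) hc.continuousAt).congr_of_eventuallyEq ?_
    filter_upwards [eventually_gt_nhds h] with z hz
    simp [kernel, max_eq_left hz.le]

/-- The Picard iterates of the Volterra equation for `e^{-ikx} f(x, k)`. -/
def picard (q : ℝ → ℝ) : ℕ → ℝ → ℂ → ℂ
  | 0 => fun _ _ => 1
  | n + 1 => fun x k => ∫ t, kernel k (t - x) * ((zeroExt q t : ℂ) * picard q n t k)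

/-- `e^{-ikx} f(x, k)`. -/
def modJost (q : ℝ → ℝ) (x : ℝ) (k : ℂ) : ℂ := ∑' n, picard q n x k

/-- For t > 0 and x ≥ -1 the kernel is at most t - x ≤ 1 + t, which is exactly the weight. Admitting
x down to -1 makes x = 0 an interior point, so that derivatives in x may be taken two-sidedly there.
-/
theorem norm_kernel_mul_zeroExt_le {k : ℂ} (hk : k ∈ closedUpperHP) {x : ℝ} (hx : -1 ≤ x)
    (q : ℝ → ℝ) (t : ℝ) : ‖kernel k (t - x)‖ * |zeroExt q t| ≤ (Ioi x).indicator (weight q) t := by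
  rcases le_or_gt t x with h | h
  · simp [kernel_of_nonpos k (sub_nonpos.2 h), h.not_gt]
  · rw [indicator_of_mem (by exact h)]
    rcases le_or_gt t 0 with ht | ht
    · simp [weight, zeroExt_of_nonpos q ht]
    · unfold weight
      gcongr
      refine (norm_kernel_le hk _).trans (max_le ?_ ?_) <;> linarith

theorem closedUpperHP_def (k : ℂ) : k ∈ closedUpperHP ↔ 0 ≤ k.im := Iff.rfl

theorem openUpperHP_subset : openUpperHP ⊆ closedUpperHP := fun k (hk : 0 < k.im) => hk.le

theorem isOpen_openUpperHP : IsOpen openUpperHP :=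
  isOpen_lt continuous_const Complex.continuous_im

section
variable {q : ℝ → ℝ} (hq : MemL11 q)
include hq

/-- Nothing is assumed about u to the left of -1; the extended potential vanishes on t ≤ 0, so only
the values of u on t > 0 enter. -/
theorem aestronglyMeasurable_volterra {k : ℂ} (x : ℝ) {u : ℝ → ℂ}
    (hu : ContinuousOn u (Ici (-1))) :
    AEStronglyMeasurable (fun t => kernel k (t - x) * ((zeroExt q t : ℂ) * u t)) := by
  have h1 : Continuous fun t : ℝ => kernel k (t - x) :=
    continuous_kernel.comp (by fun_prop : Continuous fun t : ℝ => (k, t - x))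
  refine h1.aestronglyMeasurable.mul ?_
  have h2 : AEStronglyMeasurable ((Ioi (0 : ℝ)).indicator u) := by
    rw [aestronglyMeasurable_indicator_iff measurableSet_Ioi]
    exact (hu.mono (Ioi_subset_Ici (by norm_num))).aestronglyMeasurable measurableSet_Ioi
  refine ((Complex.continuous_ofReal.comp_aestronglyMeasurable
    hq.aestronglyMeasurable_zeroExt).mul h2).congr (ae_of_all _ fun t => ?_)
  rcases le_or_gt t 0 with ht | ht
  · simp [zeroExt_of_nonpos q ht]
  · simp [indicator, ht]

theorem continuousOn_volterra {m : ℝ → ℂ → ℂ} {B : ℝ}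
    (hm : ContinuousOn (fun p : ℝ × ℂ => m p.1 p.2) (Ici (-1) ×ˢ closedUpperHP))
    (hB : ∀ x, -1 ≤ x → ∀ k ∈ closedUpperHP, ‖m x k‖ ≤ B) :
    ContinuousOn (fun p : ℝ × ℂ => ∫ t, kernel p.2 (t - p.1) * ((zeroExt q t : ℂ) * m t p.2))
      (Ici (-1) ×ˢ closedUpperHP) := by
  have hs : ∀ k ∈ closedUpperHP, ContinuousOn (fun t => m t k) (Ici (-1)) := fun k hk =>
    hm.comp (f := fun t : ℝ => (t, k)) (by fun_prop) fun t ht => ⟨ht, hk⟩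
  refine continuousOn_of_dominated (bound := fun t => B * weight q t) ?_ ?_
    (hq.integrable_weight.const_mul B) ?_
  · rintro ⟨x, k⟩ ⟨hx, hk⟩
    exact aestronglyMeasurable_volterra hq x (hs k hk)
  · rintro ⟨x, k⟩ ⟨hx, hk⟩
    refine ae_of_all _ fun t => ?_
    rcases le_or_gt t 0 with ht | ht
    · simp [zeroExt_of_nonpos q ht, weight]
    have h1 := norm_kernel_mul_zeroExt_le hk hx q t
    have h2 := hB t (by linarith) k hk
    have h3 : (Ioi x).indicator (weight q) t ≤ weight q t :=
      indicator_le_self' (fun _ _ => weight_nonneg q t) t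
    rw [norm_mul, norm_mul, Complex.norm_real, Real.norm_eq_abs, ← mul_assoc, mul_comm B]
    exact mul_le_mul (h1.trans h3) h2 (norm_nonneg _) (weight_nonneg q t)
  · refine ae_of_all _ fun t => ?_
    rcases le_or_gt t 0 with ht | ht
    · simp only [zeroExt_of_nonpos q ht, Complex.ofReal_zero, zero_mul, mul_zero]
      exact continuousOn_const
    refine ContinuousOn.mul ?_ (continuousOn_const.mul ?_)
    · exact (continuous_kernel.comp
        (by fun_prop : Continuous fun p : ℝ × ℂ => (p.2, t - p.1))).continuousOn
    · exact hm.comp (f := fun p : ℝ × ℂ => (t, p.2)) (by fun_prop)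
        fun p hp => ⟨by rw [mem_Ici]; linarith, hp.2⟩

theorem differentiableOn_volterra {m : ℝ → ℂ → ℂ} {B x : ℝ} (hx : -1 ≤ x)
    (hm : ContinuousOn (fun p : ℝ × ℂ => m p.1 p.2) (Ici (-1) ×ˢ closedUpperHP))
    (hB : ∀ x, -1 ≤ x → ∀ k ∈ closedUpperHP, ‖m x k‖ ≤ B)
    (hd : ∀ x, -1 ≤ x → DifferentiableOn ℂ (m x) openUpperHP) :
    DifferentiableOn ℂ (fun k => ∫ t, kernel k (t - x) * ((zeroExt q t : ℂ) * m t k))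
      openUpperHP := by
  have hs : ∀ k ∈ closedUpperHP, ContinuousOn (fun t => m t k) (Ici (-1)) := fun k hk =>
    hm.comp (f := fun t : ℝ => (t, k)) (by fun_prop) fun t ht => ⟨ht, hk⟩
  refine differentiableOn_integral_of_dominated isOpen_openUpperHP
    (bound := fun t => B * weight q t) ?_ (hq.integrable_weight.const_mul B) ?_ ?_
  · exact fun k hk => aestronglyMeasurable_volterra hq x (hs k (openUpperHP_subset hk))
  · refine ae_of_all _ fun t k hk => ?_
    rcases le_or_gt t 0 with ht | ht
    · simp [zeroExt_of_nonpos q ht, weight]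
    have h1 := norm_kernel_mul_zeroExt_le (openUpperHP_subset hk) hx q t
    have h2 := hB t (by linarith) k (openUpperHP_subset hk)
    have h3 : (Ioi x).indicator (weight q) t ≤ weight q t :=
      indicator_le_self' (fun _ _ => weight_nonneg q t) t
    rw [norm_mul, norm_mul, Complex.norm_real, Real.norm_eq_abs, ← mul_assoc, mul_comm B]
    exact mul_le_mul (h1.trans h3) h2 (norm_nonneg _) (weight_nonneg q t)
  · refine ae_of_all _ fun t => ?_
    rcases le_or_gt t 0 with ht | ht
    · simp only [zeroExt_of_nonpos q ht, Complex.ofReal_zero, zero_mul, mul_zero]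
      exact differentiableOn_const _
    exact (differentiableOn_kernel (t - x)).mul
      ((differentiableOn_const _).mul (hd t (by linarith)))

/-- The bound `Hⁿ / n!` for the Picard iterates. -/
theorem norm_picard_le (n : ℕ) :
    ∀ x, -1 ≤ x → ∀ k ∈ closedUpperHP, ‖picard q n x k‖ ≤ tail q x ^ n / n.factorial := by
  induction n with
  | zero => intro x _ k _; simp [picard]
  | succ n ih =>
    intro x hx k hk
    obtain ⟨hi, hle⟩ := integral_Ioi_mul_tail_pow_le hq.integrable_weight (weight_nonneg q) x n
    have h1 : ‖picard q (n + 1) x k‖ ≤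
        ∫ t, (Ioi x).indicator (fun t => weight q t * tail q t ^ n / n.factorial) t := by
      refine norm_integral_le_of_norm_le ?_ (ae_of_all _ fun t => ?_)
      · rw [integrable_indicator_iff measurableSet_Ioi]
        exact hi.div_const _
      · rw [norm_mul, norm_mul, Complex.norm_real, Real.norm_eq_abs, ← mul_assoc]
        have h2 := norm_kernel_mul_zeroExt_le hk hx q t
        rcases le_or_gt t x with h | h
        · simp [kernel_of_nonpos k (sub_nonpos.2 h), h.not_gt]
        · rw [indicator_of_mem (by exact h)] at h2 ⊢
          rw [mul_div_assoc]
          exact mul_le_mul h2 (ih t (by linarith) k hk) (norm_nonneg _) (weight_nonneg q t)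
    refine h1.trans ?_
    rw [integral_indicator measurableSet_Ioi, integral_div, Nat.factorial_succ]
    push_cast
    rw [← div_div]
    gcongr
    exact hle

/-- A majorant independent of x and k, so the Weierstrass test passes continuity and analyticity
from the iterates to the sum. -/
theorem norm_picard_le' (n : ℕ) {x : ℝ} (hx : -1 ≤ x) {k : ℂ} (hk : k ∈ closedUpperHP) :
    ‖picard q n x k‖ ≤ (∫ t, weight q t) ^ n / n.factorial := by
  refine (norm_picard_le hq n x hx k hk).trans ?_
  gcongr
  · exact tail_nonneg q x
  · exact hq.tail_le x

theorem continuousOn_picard (n : ℕ) :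
    ContinuousOn (fun p : ℝ × ℂ => picard q n p.1 p.2) (Ici (-1) ×ˢ closedUpperHP) := by
  induction n with
  | zero => exact continuousOn_const
  | succ n ih => exact continuousOn_volterra hq ih fun x hx k hk => norm_picard_le' hq n hx hk

theorem differentiableOn_picard (n : ℕ) :
    ∀ x, -1 ≤ x → DifferentiableOn ℂ (picard q n x) openUpperHP := by
  induction n with
  | zero => intro x _; exact differentiableOn_const _
  | succ n ih =>
    exact fun x hx => differentiableOn_volterra hq hx (continuousOn_picard hq n)
      (fun x hx k hk => norm_picard_le' hq n hx hk) ih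

theorem summable_picard {x : ℝ} (hx : -1 ≤ x) {k : ℂ} (hk : k ∈ closedUpperHP) :
    Summable fun n => picard q n x k :=
  Summable.of_norm_bounded (Real.summable_pow_div_factorial _)
    fun n => norm_picard_le' hq n hx hk

theorem continuousOn_modJost :
    ContinuousOn (fun p : ℝ × ℂ => modJost q p.1 p.2) (Ici (-1) ×ˢ closedUpperHP) :=
  continuousOn_tsum (continuousOn_picard hq) (Real.summable_pow_div_factorial _)
    fun n _ hp => norm_picard_le' hq n hp.1 hp.2

theorem differentiableOn_modJost {x : ℝ} (hx : -1 ≤ x) :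
    DifferentiableOn ℂ (modJost q x) openUpperHP :=
  Complex.differentiableOn_tsum_of_summable_norm (Real.summable_pow_div_factorial _)
    (fun n => differentiableOn_picard hq n x hx) isOpen_openUpperHP
    fun n _ hk => norm_picard_le' hq n hx (openUpperHP_subset hk)

/-- The bound for `e^{-ikx} f(x, k)`. -/
theorem norm_modJost_le {x : ℝ} (hx : -1 ≤ x) {k : ℂ} (hk : k ∈ closedUpperHP) :
    ‖modJost q x k‖ ≤ Real.exp (∫ t, weight q t) := by
  rw [Real.exp_eq_exp_ℝ, NormedSpace.exp_eq_tsum_div]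
  exact tsum_of_norm_bounded (Real.summable_pow_div_factorial _).hasSum
    fun n => norm_picard_le' hq n hx hk

/-- The Volterra equation. -/
theorem modJost_eq {x : ℝ} (hx : -1 ≤ x) {k : ℂ} (hk : k ∈ closedUpperHP) :
    modJost q x k = 1 + ∫ t, kernel k (t - x) * ((zeroExt q t : ℂ) * modJost q t k) := by
  rw [modJost, (summable_picard hq hx hk).tsum_eq_zero_add]
  congr 1
  simp only [picard]
  have hs : ∀ n, ContinuousOn (fun t => picard q n t k) (Ici (-1)) := fun n =>
    (continuousOn_picard hq n).comp (f := fun t : ℝ => (t, k)) (by fun_prop) fun t ht => ⟨ht, hk⟩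
  -- The zeroth iterate supplies the summand 1 and every later iterate is the integral operator
  -- applied to its predecessor. What remains is to exchange sum and integral, with the exponential
  -- series times the weight as majorant.
  refine (hasSum_integral_of_dominated_convergence
    (fun n t => weight q t * ((∫ t, weight q t) ^ n / n.factorial)) (fun n => ?_) (fun n => ?_)
    (ae_of_all _ fun t => ?_) ?_ (ae_of_all _ fun t => ?_)).tsum_eq
  · exact aestronglyMeasurable_volterra hq x (hs n)
  · refine ae_of_all _ fun t => ?_
    rcases le_or_gt t 0 with ht | ht
    · simp [zeroExt_of_nonpos q ht, weight]
    have h1 := norm_kernel_mul_zeroExt_le hk hx q t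
    have h2 := norm_picard_le' hq n (by linarith : -1 ≤ t) hk
    have h3 : (Ioi x).indicator (weight q) t ≤ weight q t :=
      indicator_le_self' (fun _ _ => weight_nonneg q t) t
    rw [norm_mul, norm_mul, Complex.norm_real, Real.norm_eq_abs, ← mul_assoc]
    exact mul_le_mul (h1.trans h3) h2 (norm_nonneg _) (weight_nonneg q t)
  · exact (Real.summable_pow_div_factorial _).mul_left _
  · simp only [tsum_mul_left]
    exact hq.integrable_weight.mul_const _
  · rcases le_or_gt t 0 with ht | ht
    · simp [zeroExt_of_nonpos q ht, hasSum_zero]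
    · exact ((summable_picard hq (by linarith : -1 ≤ t) hk).hasSum.mul_left _).mul_left _

theorem continuousOn_modJost_left {k : ℂ} (hk : k ∈ closedUpperHP) :
    ContinuousOn (fun t => modJost q t k) (Ici (-1)) :=
  (continuousOn_modJost hq).comp (f := fun t : ℝ => (t, k)) (by fun_prop) fun _ ht => ⟨ht, hk⟩

theorem norm_modJost_sub_one_le_tail {x : ℝ} (hx : -1 ≤ x) {k : ℂ} (hk : k ∈ closedUpperHP) :
    ‖modJost q x k - 1‖ ≤ Real.exp (∫ t, weight q t) * tail q x := by
  rw [modJost_eq hq hx hk, add_sub_cancel_left, tail, ← integral_const_mul,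
    ← integral_indicator measurableSet_Ioi]
  refine norm_integral_le_of_norm_le ?_ (ae_of_all _ fun t => ?_)
  · rw [integrable_indicator_iff measurableSet_Ioi]
    exact (hq.integrable_weight.const_mul _).integrableOn
  · rw [norm_mul, norm_mul, Complex.norm_real, Real.norm_eq_abs, ← mul_assoc]
    have h2 := norm_kernel_mul_zeroExt_le hk hx q t
    rcases le_or_gt t x with h | h
    · simp [kernel_of_nonpos k (sub_nonpos.2 h), h.not_gt]
    · rw [indicator_of_mem (by exact h)] at h2 ⊢
      rw [mul_comm (Real.exp _)]
      exact mul_le_mul h2 (norm_modJost_le hq (by linarith) hk) (norm_nonneg _) (weight_nonneg q t)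

/-- The kernel bound 1/|k| is inserted into the Volterra equation. Only the integral of |q| appears,
without the weight. -/
theorem norm_mul_norm_modJost_sub_one_le {x : ℝ} (hx : -1 ≤ x) {k : ℂ} (hk : k ∈ closedUpperHP) :
    ‖k‖ * ‖modJost q x k - 1‖ ≤ Real.exp (∫ t, weight q t) * ∫ t, |zeroExt q t| := by
  rw [modJost_eq hq hx hk, add_sub_cancel_left, ← norm_mul, ← integral_const_mul,
    ← integral_const_mul]
  refine norm_integral_le_of_norm_le (hq.integrable_zeroExt.abs.const_mul _)
    (ae_of_all _ fun t => ?_)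
  rcases le_or_gt t 0 with ht | ht
  · simp [zeroExt_of_nonpos q ht]
  rw [← mul_assoc, norm_mul, norm_mul, norm_mul, Complex.norm_real, Real.norm_eq_abs]
  have h1 := norm_mul_norm_kernel_le hk (t - x)
  have h2 := norm_modJost_le hq (by linarith : -1 ≤ t) hk
  calc _ ≤ 1 * (|zeroExt q t| * Real.exp (∫ t, weight q t)) := by gcongr
    _ = _ := by ring

end

/-- The derivative in `x` of `e^{-ikx} f(x, k)`. -/
def modJostDeriv (q : ℝ → ℝ) (x : ℝ) (k : ℂ) : ℂ :=
  -∫ t in Ioi x, Complex.exp (2 * Complex.I * k * (t - x : ℝ)) *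
    ((zeroExt q t : ℂ) * modJost q t k)

section
variable {q : ℝ → ℝ} (hq : MemL11 q)
include hq

theorem integrable_zeroExt_mul_modJost {k : ℂ} (hk : k ∈ closedUpperHP) :
    Integrable fun t => (zeroExt q t : ℂ) * modJost q t k := by
  refine (hq.integrable_zeroExt.abs.mul_const (Real.exp (∫ t, weight q t))).mono' ?_
    (ae_of_all _ fun t => ?_)
  · have h2 : AEStronglyMeasurable ((Ioi (0 : ℝ)).indicator fun t => modJost q t k) := by
      rw [aestronglyMeasurable_indicator_iff measurableSet_Ioi]
      exact ((continuousOn_modJost_left hq hk).mono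
        (Ioi_subset_Ici (by norm_num))).aestronglyMeasurable measurableSet_Ioi
    refine ((Complex.continuous_ofReal.comp_aestronglyMeasurable
      hq.aestronglyMeasurable_zeroExt).mul h2).congr (ae_of_all _ fun t => ?_)
    rcases le_or_gt t 0 with ht | ht
    · simp [zeroExt_of_nonpos q ht]
    · simp [indicator, ht]
  · rcases le_or_gt t 0 with ht | ht
    · simp [zeroExt_of_nonpos q ht]
    rw [norm_mul, Complex.norm_real, Real.norm_eq_abs]
    gcongr
    exact norm_modJost_le hq (by linarith) hk

/-- The kernel is Lipschitz in x with constant 1, and its corner at t = x is a null set in t, so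
differentiation under the integral is legitimate. -/
theorem hasDerivAt_modJost {x : ℝ} (hx : -1 < x) {k : ℂ} (hk : k ∈ closedUpperHP) :
    HasDerivAt (fun x => modJost q x k) (modJostDeriv q x k) x := by
  have hcm := continuousOn_modJost_left hq hk
  have hint := integrable_zeroExt_mul_modJost hq hk
  have key := hasDerivAt_integral_of_dominated_loc_of_lip (μ := volume) (x₀ := x)
    (s := Ioi (-1)) (bound := fun t => ‖(zeroExt q t : ℂ) * modJost q t k‖)
    (F := fun x t => kernel k (t - x) * ((zeroExt q t : ℂ) * modJost q t k))
    (F' := fun t => -((Ioi x).indicator (fun t => Complex.exp (2 * Complex.I * k * (t - x : ℝ)) *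
      ((zeroExt q t : ℂ) * modJost q t k)) t)) (Ioi_mem_nhds hx)
    (Eventually.of_forall fun y => aestronglyMeasurable_volterra hq y hcm)
    ?_ ?_ ?_ hint.norm ?_
  · have h2 := key.2.const_add 1
    rw [integral_neg, integral_indicator measurableSet_Ioi] at h2
    refine h2.congr_of_eventuallyEq ?_
    filter_upwards [Ioi_mem_nhds hx] with y hy using modJost_eq hq (le_of_lt hy) hk
  · refine (hq.integrable_weight.const_mul (Real.exp (∫ t, weight q t))).mono'
      (aestronglyMeasurable_volterra hq x hcm) (ae_of_all _ fun t => ?_)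
    rcases le_or_gt t 0 with ht | ht
    · simp [zeroExt_of_nonpos q ht, weight]
    have h1 := norm_kernel_mul_zeroExt_le hk hx.le q t
    have h2 := norm_modJost_le hq (by linarith : -1 ≤ t) hk
    have h3 : (Ioi x).indicator (weight q) t ≤ weight q t :=
      indicator_le_self' (fun _ _ => weight_nonneg q t) t
    rw [norm_mul, norm_mul, Complex.norm_real, Real.norm_eq_abs, ← mul_assoc,
      mul_comm (Real.exp _)]
    exact mul_le_mul (h1.trans h3) h2 (norm_nonneg _) (weight_nonneg q t)
  · refine AEStronglyMeasurable.neg ?_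
    refine AEStronglyMeasurable.indicator ?_ measurableSet_Ioi
    exact (Continuous.aestronglyMeasurable (by fun_prop)).mul hint.aestronglyMeasurable
  · refine ae_of_all _ fun t => LipschitzOnWith.of_dist_le_mul fun y _ z _ => ?_
    rw [dist_eq_norm, ← sub_mul, norm_mul, Real.coe_nnabs, abs_of_nonneg (norm_nonneg _), mul_comm]
    gcongr
    refine (norm_kernel_sub_le hk _ _).trans_eq ?_
    rw [Real.dist_eq, abs_sub_comm y z]
    congr 1; ring
  · have hne : ∀ᵐ t : ℝ, t ≠ x := by simp [ae_iff, measure_singleton]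
    filter_upwards [hne] with t ht
    have h1 := (hasDerivAt_kernel k (sub_ne_zero.2 ht)).scomp x ((hasDerivAt_id x).const_sub t)
    have h2 := h1.mul_const ((zeroExt q t : ℂ) * modJost q t k)
    refine h2.congr_deriv ?_
    by_cases hxt : x < t
    · simp [indicator, hxt]
    · simp [indicator, hxt]

/-- The tail of |q| is kept here, rather than the tail of the weight, because it is integrable in x;
this is needed at k = 0. -/
theorem norm_modJostDeriv_le (x : ℝ) {k : ℂ} (hk : k ∈ closedUpperHP) :
    ‖modJostDeriv q x k‖ ≤ Real.exp (∫ t, weight q t) * ∫ t in Ioi x, |zeroExt q t| := by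
  rw [modJostDeriv, norm_neg, ← integral_const_mul]
  refine norm_integral_le_of_norm_le (hq.integrable_zeroExt.abs.const_mul _).integrableOn
    ((ae_restrict_iff' measurableSet_Ioi).2 (ae_of_all _ fun t ht => ?_))
  rcases le_or_gt t 0 with h0 | h0
  · simp [zeroExt_of_nonpos q h0]
  rw [norm_mul, norm_mul, Complex.norm_real, Real.norm_eq_abs]
  have h1 := norm_exp_two_mul_le hk (sub_nonneg.2 (le_of_lt ht))
  have h2 := norm_modJost_le hq (by linarith : -1 ≤ t) hk
  calc _ ≤ 1 * (|zeroExt q t| * Real.exp (∫ t, weight q t)) := by gcongr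
    _ = _ := by ring

end

/-! ### Solutions of the differential equation and their Wronskians -/

theorem MemL11.intervalIntegrable {q : ℝ → ℝ} (hq : MemL11 q) {a b : ℝ} (ha : 0 ≤ a)
    (hb : 0 ≤ b) : IntervalIntegrable q volume a b := by
  refine (hq.integrable_zeroExt.intervalIntegrable (a := a) (b := b)).congr fun t ht => ?_
  refine zeroExt_of_pos q ?_
  rw [mem_uIoc] at ht
  rcases ht with ht | ht
  · exact ha.trans_lt ht.1
  · exact hb.trans_lt ht.1

namespace IsSolution

variable {q : ℝ → ℝ} {z : ℂ} {u : ℝ → ℂ}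

theorem continuousOn (hu : IsSolution q z u) : ContinuousOn u (Ici 0) := hu.1.continuousOn

theorem hasDerivAt (hu : IsSolution q z u) {x : ℝ} (hx : 0 < x) :
    HasDerivAt u (derivWithin u (Ici 0) x) x :=
  (hu.1 x hx.le).hasDerivWithinAt.hasDerivAt (Ici_mem_nhds hx)

theorem intervalIntegrable (hq : MemL11 q) (hu : IsSolution q z u) {a b : ℝ} (ha : 0 ≤ a)
    (hb : 0 ≤ b) : IntervalIntegrable (fun t => ((q t : ℂ) - z) * u t) volume a b := by
  refine IntervalIntegrable.mul_continuousOn ?_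
    (hu.continuousOn.mono fun t ht => (le_min ha hb).trans ht.1)
  have h := hq.intervalIntegrable ha hb
  exact (IntervalIntegrable.sub (⟨h.1.ofReal, h.2.ofReal⟩ :
    IntervalIntegrable (fun t => (q t : ℂ)) volume a b) intervalIntegrable_const)

theorem deriv_eq (hq : MemL11 q) (hu : IsSolution q z u) {a b : ℝ} (ha : 0 ≤ a) (hb : 0 ≤ b) :
    derivWithin u (Ici 0) b =
      derivWithin u (Ici 0) a + ∫ t in a..b, ((q t : ℂ) - z) * u t := by
  rw [hu.2 a ha, hu.2 b hb, add_assoc, intervalIntegral.integral_add_adjacent_intervals]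
  · exact hu.intervalIntegrable hq le_rfl ha
  · exact hu.intervalIntegrable hq ha hb

theorem continuousOn_deriv (hq : MemL11 q) (hu : IsSolution q z u) :
    ContinuousOn (derivWithin u (Ici 0)) (Ici 0) := by
  intro x hx
  have hx0 : (0 : ℝ) ≤ x := hx
  have h1 : ContinuousOn (fun y => derivWithin u (Ici 0) 0 +
      ∫ t in (0 : ℝ)..y, ((q t : ℂ) - z) * u t) (Icc 0 (x + 1)) := by
    have := (absolutelyContinuousOnInterval_integral
      (hu.intervalIntegrable hq le_rfl (by linarith : (0 : ℝ) ≤ x + 1))).continuousOn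
    rw [uIcc_of_le (by linarith)] at this
    exact continuousOn_const.add this
  have h2 : ContinuousWithinAt (derivWithin u (Ici 0)) (Icc 0 (x + 1)) x :=
    (h1 x ⟨hx, by linarith⟩).congr (fun y hy => hu.2 y hy.1) (hu.2 x hx)
  refine h2.mono_of_mem_nhdsWithin ?_
  rw [← Ici_inter_Iic]
  exact inter_mem self_mem_nhdsWithin (mem_nhdsWithin_of_mem_nhds (Iic_mem_nhds (by linarith)))

theorem intervalIntegrable_deriv (hq : MemL11 q) (hu : IsSolution q z u) {a b : ℝ} (ha : 0 ≤ a)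
    (hb : 0 ≤ b) : IntervalIntegrable (derivWithin u (Ici 0)) volume a b :=
  ((hu.continuousOn_deriv hq).mono fun _ ht => (le_min ha hb).trans ht.1).intervalIntegrable

theorem eq_integral (hq : MemL11 q) (hu : IsSolution q z u) {a b : ℝ} (ha : 0 ≤ a) (hb : 0 ≤ b) :
    u b = u a + ∫ t in a..b, derivWithin u (Ici 0) t := by
  rw [intervalIntegral.integral_eq_sub_of_hasDeriv_right
    (hu.continuousOn.mono fun t ht => (le_min ha hb).trans ht.1) (fun x hx =>
      (hu.hasDerivAt (lt_of_le_of_lt (le_min ha hb) hx.1)).hasDerivWithinAt)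
    (hu.intervalIntegrable_deriv hq ha hb)]
  ring

theorem sub {v : ℝ → ℂ} (hq : MemL11 q) (hu : IsSolution q z u) (hv : IsSolution q z v) :
    IsSolution q z (u - v) := by
  have hd : ∀ x : ℝ, 0 ≤ x → derivWithin (u - v) (Ici 0) x =
      derivWithin u (Ici 0) x - derivWithin v (Ici 0) x := fun x hx =>
    derivWithin_sub (hu.1 x hx) (hv.1 x hx)
  refine ⟨hu.1.sub hv.1, fun x hx => ?_⟩
  rw [hd x hx, hd 0 le_rfl, hu.2 x hx, hv.2 x hx]
  simp only [Pi.sub_apply, mul_sub]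
  rw [intervalIntegral.integral_sub]
  · ring
  · exact hu.intervalIntegrable hq le_rfl hx
  · exact hv.intervalIntegrable hq le_rfl hx

theorem const_mul (hu : IsSolution q z u) (c : ℂ) : IsSolution q z (fun x => c * u x) := by
  have hd : ∀ x : ℝ, 0 ≤ x → derivWithin (fun x => c * u x) (Ici 0) x =
      c * derivWithin u (Ici 0) x := fun x hx => derivWithin_const_mul c (hu.1 x hx)
  refine ⟨hu.1.const_mul c, fun x hx => ?_⟩
  rw [hd x hx, hd 0 le_rfl, hu.2 x hx, mul_add, ← intervalIntegral.integral_const_mul]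
  congr 1
  refine intervalIntegral.integral_congr fun t _ => ?_
  ring

theorem conj (hu : IsSolution q z u) :
    IsSolution q (starRingEnd ℂ z) (fun x => starRingEnd ℂ (u x)) := by
  have hd : ∀ x : ℝ, 0 ≤ x → HasDerivWithinAt (fun x => starRingEnd ℂ (u x))
      (starRingEnd ℂ (derivWithin u (Ici 0) x)) (Ici 0) x := fun x hx =>
    (Complex.conjCLE.toContinuousLinearMap.hasFDerivAt).comp_hasDerivWithinAt x
      (hu.1 x hx).hasDerivWithinAt
  have hd' : ∀ x : ℝ, 0 ≤ x → derivWithin (fun x => starRingEnd ℂ (u x)) (Ici 0) x =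
      starRingEnd ℂ (derivWithin u (Ici 0) x) := fun x hx =>
    (hd x hx).derivWithin (uniqueDiffOn_Ici 0 x hx)
  refine ⟨fun x hx => (hd x hx).differentiableWithinAt, fun x hx => ?_⟩
  rw [hd' x hx, hd' 0 le_rfl, hu.2 x hx, map_add]
  congr 1
  rw [intervalIntegral.integral_of_le hx, intervalIntegral.integral_of_le hx, ← integral_conj]
  simp

end IsSolution

/-- The Wronskian `u v' - u' v`. -/
def wronskian (u v : ℝ → ℂ) (x : ℝ) : ℂ :=
  u x * derivWithin v (Ici 0) x - derivWithin u (Ici 0) x * v x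

/-- The product rule is applied to u v' and to u' v. The terms u'v' cancel, and so do the terms
containing q, which leaves the difference of the spectral parameters. -/
theorem wronskian_sub {q : ℝ → ℝ} {z₁ z₂ : ℂ} {u v : ℝ → ℂ} (hq : MemL11 q)
    (hu : IsSolution q z₁ u) (hv : IsSolution q z₂ v) {a b : ℝ} (ha : 0 ≤ a) (hab : a ≤ b) :
    wronskian u v b - wronskian u v a = (z₁ - z₂) * ∫ t in a..b, u t * v t := by
  have hb := ha.trans hab
  have h0 : ∀ x ∈ Icc a b, 0 ≤ x := fun x hx => ha.trans hx.1
  have h1 := mul_sub_mul_eq_integral hab (hu.intervalIntegrable_deriv hq ha hb)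
    (hv.intervalIntegrable hq ha hb) (fun x hx => hu.eq_integral hq ha (h0 x hx))
    (fun x hx => hv.deriv_eq hq ha (h0 x hx))
  have h2 := mul_sub_mul_eq_integral hab (hu.intervalIntegrable hq ha hb)
    (hv.intervalIntegrable_deriv hq ha hb) (fun x hx => hu.deriv_eq hq ha (h0 x hx))
    (fun x hx => hv.eq_integral hq ha (h0 x hx))
  have hI : uIcc a b = Icc a b := uIcc_of_le hab
  have cu : ContinuousOn u (uIcc a b) := hu.continuousOn.mono (by rw [hI]; exact h0)
  have cv : ContinuousOn v (uIcc a b) := hv.continuousOn.mono (by rw [hI]; exact h0)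
  have cud : ContinuousOn (derivWithin u (Ici 0)) (uIcc a b) :=
    (hu.continuousOn_deriv hq).mono (by rw [hI]; exact h0)
  have cv' : ContinuousOn (derivWithin v (Ici 0)) (uIcc a b) :=
    (hv.continuousOn_deriv hq).mono (by rw [hI]; exact h0)
  have e : wronskian u v b - wronskian u v a =
      (u b * derivWithin v (Ici 0) b - u a * derivWithin v (Ici 0) a) -
      (derivWithin u (Ici 0) b * v b - derivWithin u (Ici 0) a * v a) := by
    unfold wronskian; ring
  rw [e, h1, h2, ← intervalIntegral.integral_sub, ← intervalIntegral.integral_const_mul]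
  · refine intervalIntegral.integral_congr fun t _ => ?_
    ring
  · exact ((hu.intervalIntegrable_deriv hq ha hb).mul_continuousOn cv').add
      ((hv.intervalIntegrable hq ha hb).continuousOn_mul cu)
  · exact ((hu.intervalIntegrable hq ha hb).mul_continuousOn cv).add
      ((hv.intervalIntegrable_deriv hq ha hb).continuousOn_mul cud)

/-- Uniqueness for the initial value problem at any point. -/
theorem IsSolution.eq_zero {q : ℝ → ℝ} {z : ℂ} {u : ℝ → ℂ} (hq : MemL11 q)
    (hu : IsSolution q z u) {x₀ : ℝ} (hx₀ : 0 ≤ x₀) (h0 : u x₀ = 0)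
    (h0' : derivWithin u (Ici 0) x₀ = 0) : ∀ x, 0 ≤ x → u x = 0 := by
  set u' := derivWithin u (Ici 0) with hu'
  -- The first-order system for (u, u') gives Y ≤ ∫ (1 + |q - z|) Y from x₀ to either side, so the
  -- iteration lemmas apply to the right and to the left of x₀.
  set Y : ℝ → ℝ := fun x => ‖u x‖ + ‖u' x‖ with hY
  set h : ℝ → ℝ := fun t => 1 + ‖(q t : ℂ) - z‖ with hh
  have hYc : ContinuousOn Y (Ici 0) := hu.continuousOn.norm.add (hu.continuousOn_deriv hq).norm
  have hY0 : ∀ x, 0 ≤ Y x := fun x => by positivity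
  have hh0 : ∀ x, 0 ≤ h x := fun x => by positivity
  have hhi : ∀ a b : ℝ, 0 ≤ a → 0 ≤ b → IntervalIntegrable h volume a b := by
    intro a b ha hb
    have h := hq.intervalIntegrable ha hb
    exact intervalIntegrable_const.add (IntervalIntegrable.sub (⟨h.1.ofReal, h.2.ofReal⟩ :
      IntervalIntegrable (fun t => (q t : ℂ)) volume a b) intervalIntegrable_const).norm
  have hle : ∀ a b : ℝ, 0 ≤ a → a ≤ b → ‖∫ t in a..b, u' t‖ +
      ‖∫ t in a..b, ((q t : ℂ) - z) * u t‖ ≤ ∫ t in a..b, h t * Y t := by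
    intro a b ha hab
    have hb := ha.trans hab
    have i1 := (hu.intervalIntegrable_deriv hq ha hb).norm
    have i2 := (hu.intervalIntegrable hq ha hb).norm
    refine (add_le_add (intervalIntegral.norm_integral_le_integral_norm hab)
      (intervalIntegral.norm_integral_le_integral_norm hab)).trans ?_
    rw [← intervalIntegral.integral_add i1 i2]
    refine intervalIntegral.integral_mono_on hab (i1.add i2)
      ((hhi a b ha hb).mul_continuousOn (hYc.mono fun t ht => (le_min ha hb).trans ht.1))
      fun t _ => ?_
    simp only [hh, hY, norm_mul]
    have := norm_nonneg (u t)
    have := norm_nonneg (u' t)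
    have := norm_nonneg ((q t : ℂ) - z)
    nlinarith
  have hbd : ∀ x, 0 ≤ x → Y x = ‖∫ t in x₀..x, u' t‖ + ‖∫ t in x₀..x, ((q t : ℂ) - z) * u t‖ := by
    intro x hx
    simp only [hY]
    rw [hu.eq_integral hq hx₀ hx, h0, zero_add, hu', hu.deriv_eq hq hx₀ hx, ← hu', h0', zero_add]
  intro x hx
  have : Y x = 0 := by
    rcases le_total x₀ x with hxx | hxx
    · refine eq_zero_of_le_integral_right hxx (hhi x₀ x hx₀ hx) hh0
        (hYc.mono fun t ht => hx₀.trans ht.1) (fun y _ => hY0 y) (fun y hy => ?_) x ⟨hxx, le_rfl⟩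
      rw [hbd y (hx₀.trans hy.1)]
      exact hle x₀ y hx₀ hy.1
    · refine eq_zero_of_le_integral_left hxx (hhi x x₀ hx hx₀) hh0
        (hYc.mono fun t ht => hx.trans ht.1) (fun y _ => hY0 y) (fun y hy => ?_) x ⟨le_rfl, hxx⟩
      rw [hbd y (hx.trans hy.1), intervalIntegral.integral_symm, intervalIntegral.integral_symm y,
        norm_neg, norm_neg]
      exact hle y x₀ (hx.trans hy.1) hy.2
  have h2 := norm_nonneg (u' x)
  have h3 := norm_nonneg (u x)
  exact norm_eq_zero.1 (by simp only [hY] at this; linarith)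

/-! ### Construction and uniqueness of the Jost solution -/

/-- The Jost solution built from the Volterra equation. -/
def jostSol (q : ℝ → ℝ) (k : ℂ) (x : ℝ) : ℂ := Complex.exp (Complex.I * k * x) * modJost q x k

/-- The derivative in `x` of `jostSol`. -/
def jostSolDeriv (q : ℝ → ℝ) (k : ℂ) (x : ℝ) : ℂ :=
  Complex.exp (Complex.I * k * x) * (Complex.I * k * modJost q x k + modJostDeriv q x k)

theorem hasDerivAt_exp_mul (c : ℂ) (x : ℝ) :
    HasDerivAt (fun x : ℝ => Complex.exp (c * x)) (c * Complex.exp (c * x)) x := by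
  have h : HasDerivAt (fun x : ℝ => c * (x : ℂ)) c x := by
    simpa using (Complex.ofRealCLM.hasDerivAt (x := x)).const_mul c
  exact h.cexp.congr_deriv (mul_comm _ _)

section
variable {q : ℝ → ℝ} (hq : MemL11 q) {k : ℂ} (hk : k ∈ closedUpperHP)
include hq hk

theorem hasDerivAt_jostSol {x : ℝ} (hx : -1 < x) :
    HasDerivAt (jostSol q k) (jostSolDeriv q k x) x := by
  refine ((hasDerivAt_exp_mul (Complex.I * k) x).mul (hasDerivAt_modJost hq hx hk)).congr_deriv ?_
  unfold jostSolDeriv; ring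

theorem derivWithin_jostSol {x : ℝ} (hx : 0 ≤ x) :
    derivWithin (jostSol q k) (Ici 0) x = jostSolDeriv q k x :=
  (hasDerivAt_jostSol hq hk (by linarith)).hasDerivWithinAt.derivWithin (uniqueDiffOn_Ici 0 x hx)

theorem integrableOn_exp_mul_zeroExt_mul_modJost :
    IntegrableOn (fun t : ℝ => Complex.exp (2 * Complex.I * k * t) *
      ((zeroExt q t : ℂ) * modJost q t k)) (Ioi 0) := by
  refine (integrable_zeroExt_mul_modJost hq hk).integrableOn.bdd_mul (c := 1)
    (Continuous.aestronglyMeasurable (by fun_prop)) ?_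
  exact (ae_restrict_iff' measurableSet_Ioi).2
    (ae_of_all _ fun t ht => norm_exp_two_mul_le hk (le_of_lt ht))

/-- The dependence on x is separated into a smooth exponential and a primitive. The product rule can
then be applied to the derivative although q is merely integrable. -/
theorem modJostDeriv_eq {x : ℝ} (hx : 0 ≤ x) :
    modJostDeriv q x k = -(Complex.exp (-(2 * Complex.I * k) * x) *
      ((∫ t in Ioi (0 : ℝ), Complex.exp (2 * Complex.I * k * t) *
        ((zeroExt q t : ℂ) * modJost q t k)) -
      ∫ t in (0 : ℝ)..x, Complex.exp (2 * Complex.I * k * t) *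
        ((zeroExt q t : ℂ) * modJost q t k))) := by
  rw [← intervalIntegral.integral_Ioi_sub_Ioi (integrableOn_exp_mul_zeroExt_mul_modJost hq hk) hx,
    sub_sub_cancel, modJostDeriv, ← integral_const_mul]
  congr 1
  refine integral_congr_ae (ae_of_all _ fun t => ?_)
  simp only
  rw [← mul_assoc (Complex.exp (-(2 * Complex.I * k) * x)), ← Complex.exp_add]
  congr 2
  push_cast; ring

/-- With E(x) = e^{-ikx} and A(x) the tail integral of e^{2ikt} q m, the derivative is ik f - E A.
Differentiating E A gives -ik E A - q f, so differentiating ik f - E A leaves (q - k^2) f. -/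
theorem jostSolDeriv_eq_integral {x : ℝ} (hx : 0 ≤ x) :
    jostSolDeriv q k x = jostSolDeriv q k 0 +
      ∫ t in (0 : ℝ)..x, ((zeroExt q t : ℂ) - k ^ 2) * jostSol q k t := by
  set G : ℝ → ℂ := fun t => Complex.exp (2 * Complex.I * k * t) *
    ((zeroExt q t : ℂ) * modJost q t k) with hG
  set A : ℝ → ℂ := fun x => (∫ t in Ioi (0 : ℝ), G t) - ∫ t in (0 : ℝ)..x, G t with hA
  set E : ℝ → ℂ := fun x => Complex.exp (-(Complex.I * k) * x) with hE
  have hGi : IntervalIntegrable G volume 0 x := by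
    rw [intervalIntegrable_iff_integrableOn_Ioc_of_le hx]
    exact (integrableOn_exp_mul_zeroExt_mul_modJost hq hk).mono_set Ioc_subset_Ioi_self
  have hAc : ContinuousOn A (uIcc 0 x) :=
    continuousOn_const.sub (absolutelyContinuousOnInterval_integral hGi).continuousOn
  have hEd : ∀ x : ℝ, HasDerivAt E (-(Complex.I * k) * E x) x := fun x =>
    hasDerivAt_exp_mul (-(Complex.I * k)) x
  have hEc : Continuous E := by fun_prop
  have hprod := mul_sub_mul_eq_integral (u := E) (v := A) (u' := fun t => -(Complex.I * k) * E t)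
    (v' := fun t => -G t) hx (Continuous.intervalIntegrable (by fun_prop) 0 x) hGi.neg
    (fun y _ => by
      rw [intervalIntegral.integral_eq_sub_of_hasDerivAt (fun t _ => hEd t)
        (Continuous.intervalIntegrable (by fun_prop) 0 y)]
      ring)
    (fun y _ => by simp only [hA, intervalIntegral.integral_neg, intervalIntegral.integral_same]; ring)
  have hder : ∀ y, 0 ≤ y → jostSolDeriv q k y = Complex.I * k * jostSol q k y - E y * A y := by
    intro y hy
    rw [jostSolDeriv, modJostDeriv_eq hq hk hy, jostSol]
    have : Complex.exp (Complex.I * k * y) * Complex.exp (-(2 * Complex.I * k) * y) = E y := by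
      rw [hE, ← Complex.exp_add]; congr 1; ring
    rw [← this]; ring
  have hfc : ContinuousOn (jostSol q k) (uIcc 0 x) := fun y hy =>
    (hasDerivAt_jostSol hq hk (by
      rw [uIcc_of_le hx] at hy; linarith [hy.1])).continuousAt.continuousWithinAt
  have hdc : ContinuousOn (jostSolDeriv q k) (uIcc 0 x) := by
    refine ((hfc.const_mul (Complex.I * k)).sub (hEc.continuousOn.mul hAc)).congr fun y hy => ?_
    rw [uIcc_of_le hx] at hy
    simpa [mul_assoc] using hder y hy.1
  have hf : jostSol q k x - jostSol q k 0 = ∫ t in (0 : ℝ)..x, jostSolDeriv q k t := by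
    rw [intervalIntegral.integral_eq_sub_of_hasDerivAt (fun t ht => hasDerivAt_jostSol hq hk ?_)
      hdc.intervalIntegrable]
    rw [uIcc_of_le hx] at ht; linarith [ht.1]
  have hfin : jostSolDeriv q k x - jostSolDeriv q k 0 =
      ∫ t in (0 : ℝ)..x, ((zeroExt q t : ℂ) - k ^ 2) * jostSol q k t := by
    have : jostSolDeriv q k x - jostSolDeriv q k 0 =
        Complex.I * k * (jostSol q k x - jostSol q k 0) - (E x * A x - E 0 * A 0) := by
      rw [hder x hx, hder 0 le_rfl]; ring
    rw [this, hf, hprod, ← intervalIntegral.integral_const_mul, ← intervalIntegral.integral_sub]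
    · refine intervalIntegral.integral_congr fun t ht => ?_
      rw [uIcc_of_le hx] at ht
      rw [hder t ht.1]
      have e : E t * G t = zeroExt q t * jostSol q k t := by
        simp only [hE, hG, jostSol]
        rw [← mul_assoc, ← Complex.exp_add]
        have : -(Complex.I * k) * t + 2 * Complex.I * k * t = Complex.I * k * t := by ring
        rw [this]; ring
      linear_combination e + (k ^ 2 * jostSol q k t) * Complex.I_sq
    · exact (hdc.const_mul (Complex.I * k)).intervalIntegrable
    · exact ((Continuous.continuousOn (by fun_prop)).mul hAc).intervalIntegrable.add
        (hGi.neg.continuousOn_mul hEc.continuousOn)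
  rw [← hfin]; ring

theorem isSolution_jostSol : IsSolution q (k ^ 2) (jostSol q k) := by
  refine ⟨fun x hx => ?_, fun x hx => ?_⟩
  · have hx0 : (0 : ℝ) ≤ x := hx
    exact (hasDerivAt_jostSol hq hk (by linarith)).differentiableAt.differentiableWithinAt
  · rw [derivWithin_jostSol hq hk hx, derivWithin_jostSol hq hk le_rfl,
      jostSolDeriv_eq_integral hq hk hx]
    congr 1
    refine intervalIntegral.integral_congr_ae (ae_of_all _ fun t ht => ?_)
    rw [uIoc_of_le hx] at ht
    rw [zeroExt_of_pos q ht.1]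

theorem tendsto_modJost : Tendsto (fun x => modJost q x k) atTop (𝓝 1) := by
  rw [tendsto_iff_norm_sub_tendsto_zero]
  have h := hq.tendsto_tail.const_mul (Real.exp (∫ t, weight q t))
  rw [mul_zero] at h
  refine squeeze_zero' (Eventually.of_forall fun _ => norm_nonneg _) ?_ h
  filter_upwards [eventually_ge_atTop (-1)] with x hx
    using norm_modJost_sub_one_le_tail hq hx hk

theorem isJost_jostSol : IsJost q k (jostSol q k) := by
  refine ⟨isSolution_jostSol hq hk, (tendsto_modJost hq hk).congr fun x => ?_⟩
  rw [jostSol, ← mul_assoc, ← Complex.exp_add, neg_add_cancel, Complex.exp_zero, one_mul]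

theorem exists_jostSol_ne_zero : ∃ N : ℝ, 0 < N ∧ ∀ x, N ≤ x → 1 / 2 < ‖modJost q x k‖ := by
  have h := (tendsto_modJost hq hk).norm
  rw [norm_one] at h
  obtain ⟨N, hN⟩ := eventually_atTop.1 (h.eventually_const_lt (by norm_num : (1 : ℝ) / 2 < 1))
  exact ⟨max N 1, by positivity, fun x hx => hN x ((le_max_left _ _).trans hx)⟩

/-- A solution that is `o(e^{-ikx})`, along suitable sequences, has zero Wronskian with the Jost
solution. -/
theorem wronskian_jostSol_eq_zero {u : ℝ → ℂ} (hu : IsSolution q (k ^ 2) u)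
    (h : ∀ s : ℝ, 0 < s → ∀ ε : ℝ, 0 < ε → ∃ᶠ x : ℝ in atTop,
      ‖Complex.exp (Complex.I * k * x) * u x‖ < ε ∧
      ‖Complex.exp (Complex.I * k * (x + s : ℝ)) * u (x + s)‖ < ε) :
    ∀ x, 0 ≤ x → wronskian u (jostSol q k) x = 0 := by
  have hf := isSolution_jostSol hq hk
  -- The Wronskian is constant and u/f has derivative -W/f^2. Integrating over [x, x+s] and
  -- multiplying by e^{2ikx} expresses W times an integral through the values of u at x and x+s
  -- only. The derivative of u is never estimated.
  set W := wronskian u (jostSol q k) 0 with hW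
  have hWc : ∀ x, 0 ≤ x → wronskian u (jostSol q k) x = W := by
    intro x hx
    have := wronskian_sub hq hu hf le_rfl hx
    rw [sub_self, zero_mul] at this
    exact sub_eq_zero.1 this
  obtain ⟨N, hN0, hN⟩ := exists_jostSol_ne_zero hq hk
  have hm0 : ∀ x, N ≤ x → modJost q x k ≠ 0 := fun x hx h0 => by
    have := hN x hx; rw [h0, norm_zero] at this; linarith
  have hf0 : ∀ x, N ≤ x → jostSol q k x ≠ 0 := fun x hx =>
    mul_ne_zero (Complex.exp_ne_zero _) (hm0 x hx)
  have hmc : ContinuousOn (fun x => modJost q x k) (Ici N) :=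
    (continuousOn_modJost_left hq hk).mono (Ici_subset_Ici.2 (by linarith))
  have hfc : ContinuousOn (jostSol q k) (Ici N) :=
    hf.continuousOn.mono (Ici_subset_Ici.2 hN0.le)
  -- the increments of `u / f`
  have hinc : ∀ x s : ℝ, N ≤ x → 0 ≤ s → u (x + s) / jostSol q k (x + s) - u x / jostSol q k x =
      ∫ t in (0 : ℝ)..s, -W / jostSol q k (x + t) ^ 2 := by
    intro x s hx hs
    have hge : ∀ t ∈ uIcc x (x + s), N ≤ t := fun t ht => by
      rw [uIcc_of_le (by linarith)] at ht; exact hx.trans ht.1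
    have h1 := intervalIntegral.integral_eq_sub_of_hasDerivAt (a := x) (b := x + s)
      (f := fun t => u t / jostSol q k t) (f' := fun t => -W / jostSol q k t ^ 2)
      (fun t ht => by
        have htN := hge t ht
        have h0 : 0 < t := by linarith
        refine ((hu.hasDerivAt h0).div (hf.hasDerivAt h0) (hf0 t htN)).congr_deriv ?_
        rw [← hWc t h0.le, wronskian]
        congr 1; ring)
      (ContinuousOn.intervalIntegrable (continuousOn_const.div
        ((hfc.mono hge).pow 2) fun t ht => pow_ne_zero 2 (hf0 t (hge t ht))))
    rw [← h1]
    have h2 := intervalIntegral.integral_comp_add_left (a := 0) (b := s)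
      (fun t => -W / jostSol q k t ^ 2) x
    rw [h2, add_zero]
  set e : ℝ → ℂ := fun t => Complex.exp (-(2 * Complex.I * k) * t) with he
  have hec : Continuous e := by fun_prop
  have hlim : ∀ s : ℝ, 0 ≤ s → Tendsto (fun x : ℝ => ∫ t in (0 : ℝ)..s,
      e t / modJost q (x + t) k ^ 2) atTop (𝓝 (∫ t in (0 : ℝ)..s, e t)) := by
    intro s hs
    refine intervalIntegral.tendsto_integral_filter_of_dominated_convergence
      -- The 4 comes from |m| > 1/2 beyond N.
      (fun t => ‖e t‖ * 4) ?_ ?_ ?_ ?_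
    · filter_upwards [eventually_ge_atTop N] with x hx
      refine ContinuousOn.aestronglyMeasurable ?_ measurableSet_uIoc
      refine hec.continuousOn.div (ContinuousOn.pow (hmc.comp
        (f := fun t : ℝ => x + t) (by fun_prop) ?_) 2) fun t ht => pow_ne_zero 2 (hm0 _ ?_)
      · intro t ht
        rw [uIoc_of_le hs] at ht
        have := ht.1
        simp only [mem_Ici]; linarith
      · rw [uIoc_of_le hs] at ht
        linarith [ht.1]
    · filter_upwards [eventually_ge_atTop N] with x hx
      refine ae_of_all _ fun t ht => ?_
      rw [uIoc_of_le hs] at ht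
      have h1 := hN (x + t) (by linarith [ht.1])
      rw [norm_div, norm_pow, div_eq_mul_inv]
      gcongr
      rw [inv_le_comm₀ (by positivity) (by norm_num)]
      nlinarith
    · exact Continuous.intervalIntegrable (by fun_prop) _ _
    · refine ae_of_all _ fun t _ => ?_
      have h1 : Tendsto (fun x : ℝ => modJost q (x + t) k) atTop (𝓝 1) :=
        (tendsto_modJost hq hk).comp (tendsto_atTop_add_const_right _ t tendsto_id)
      simpa using! (tendsto_const_nhds (x := e t)).div (h1.pow 2) (by simp)
  have hid : ∀ x s : ℝ, N ≤ x → 0 ≤ s → -W * (∫ t in (0 : ℝ)..s, e t / modJost q (x + t) k ^ 2) =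
      Complex.exp (-(2 * Complex.I * k) * s) *
        (Complex.exp (Complex.I * k * (x + s : ℝ)) * u (x + s)) / modJost q (x + s) k -
      Complex.exp (Complex.I * k * x) * u x / modJost q x k := by
    intro x s hx hs
    have h1 : -W * (∫ t in (0 : ℝ)..s, e t / modJost q (x + t) k ^ 2) =
        Complex.exp (2 * Complex.I * k * x) *
          ∫ t in (0 : ℝ)..s, -W / jostSol q k (x + t) ^ 2 := by
      rw [← intervalIntegral.integral_const_mul, ← intervalIntegral.integral_const_mul]
      refine intervalIntegral.integral_congr fun t _ => ?_
      simp only [jostSol, he, mul_pow]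
      have h2 : Complex.exp (-(2 * Complex.I * k) * t) *
          Complex.exp (Complex.I * k * (x + t : ℝ)) ^ 2 = Complex.exp (2 * Complex.I * k * x) := by
        rw [← Complex.exp_nat_mul, ← Complex.exp_add]; congr 1; push_cast; ring
      rw [← h2]
      have := Complex.exp_ne_zero (Complex.I * k * (x + t : ℝ))
      field_simp
    rw [h1, ← hinc x s hx hs, mul_sub, jostSol, jostSol]
    have h3 : ∀ y : ℝ, Complex.exp (2 * Complex.I * k * y) = Complex.exp (Complex.I * k * y) ^ 2 := by
      intro y; rw [← Complex.exp_nat_mul]; congr 1; push_cast; ring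
    have h4 : Complex.exp (2 * Complex.I * k * x) = Complex.exp (-(2 * Complex.I * k) * s) *
        Complex.exp (Complex.I * k * (x + s : ℝ)) ^ 2 := by
      rw [← h3, ← Complex.exp_add]; congr 1; push_cast; ring
    have n1 := Complex.exp_ne_zero (Complex.I * k * (x + s : ℝ))
    have n2 := Complex.exp_ne_zero (Complex.I * k * x)
    have n3 := hm0 x hx
    have n4 := hm0 (x + s) (by linarith)
    congr 1
    · rw [h4]; field_simp
    · rw [h3]; field_simp
  -- As x → ∞ the left side of `hid` converges, because m → 1; the right side is arbitrarily small
  -- for arbitrarily large x by hypothesis.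
  have hzero : ∀ s : ℝ, 0 < s → W * ∫ t in (0 : ℝ)..s, e t = 0 := by
    intro s hs
    have ht := ((hlim s hs.le).const_mul (-W)).norm
    by_contra hne
    have hpos : 0 < ‖-W * ∫ t in (0 : ℝ)..s, e t‖ := by
      rw [neg_mul, norm_neg]; exact norm_pos_iff.2 hne
    set δ := ‖-W * ∫ t in (0 : ℝ)..s, e t‖ with hδ
    set M := ‖Complex.exp (-(2 * Complex.I * k) * s)‖ with hM
    have hM0 : 0 ≤ M := norm_nonneg _
    have hev := (ht.eventually_const_lt (half_lt_self hpos)).and (eventually_ge_atTop N)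
    obtain ⟨x, ⟨hx1, hx2⟩, hx3, hxN⟩ :=
      -- Since 1/|m| ≤ 2, the two quotients in `hid` then add up to at most δ/2, below the limit δ.
      ((h s hs (δ / (4 * (M + 1))) (by positivity)).and_eventually hev).exists
    rw [hid x s hxN hs.le] at hx3
    have b1 : ‖modJost q (x + s) k‖⁻¹ ≤ 2 := by
      rw [inv_le_comm₀ (by linarith [hN (x + s) (by linarith)]) (by norm_num)]
      linarith [hN (x + s) (by linarith)]
    have b2 : ‖modJost q x k‖⁻¹ ≤ 2 := by
      rw [inv_le_comm₀ (by linarith [hN x hxN]) (by norm_num)]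
      linarith [hN x hxN]
    have h5 : ‖Complex.exp (-(2 * Complex.I * k) * s) *
        (Complex.exp (Complex.I * k * (x + s : ℝ)) * u (x + s)) / modJost q (x + s) k‖ ≤
        M * (δ / (4 * (M + 1))) * 2 := by
      rw [norm_div, norm_mul, div_eq_mul_inv]
      gcongr
    have h6 : ‖Complex.exp (Complex.I * k * x) * u x / modJost q x k‖ ≤
        (δ / (4 * (M + 1))) * 2 := by
      rw [norm_div, div_eq_mul_inv]
      gcongr
    have h7 : M * (δ / (4 * (M + 1))) * 2 + (δ / (4 * (M + 1))) * 2 = δ / 2 := by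
      field_simp; ring
    have := (norm_sub_le _ _).trans (add_le_add h5 h6)
    linarith
  -- For k ≠ 0 a single s could make the integral vanish. The identity holds for all s > 0, however,
  -- and the integral has derivative 1 at s = 0.
  have hW0 : W = 0 := by
    by_contra hne
    have hd : HasDerivAt (fun s : ℝ => ∫ t in (0 : ℝ)..s, e t) (e 0) 0 :=
      intervalIntegral.integral_hasDerivAt_right (hec.intervalIntegrable 0 0)
        (hec.stronglyMeasurableAtFilter _ _) hec.continuousAt
    have h1 : HasDerivWithinAt (fun s : ℝ => ∫ t in (0 : ℝ)..s, e t) 0 (Ici 0) 0 := by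
      refine (hasDerivWithinAt_const 0 (Ici 0) (0 : ℂ)).congr (fun s hs => ?_) (by simp)
      rcases eq_or_lt_of_le (show (0 : ℝ) ≤ s from hs) with rfl | hs'
      · simp
      · exact (mul_eq_zero.1 (hzero s hs')).resolve_left hne
    have h2 := (uniqueDiffOn_Ici (0 : ℝ) 0 (mem_Ici.2 le_rfl)).eq_deriv _
      hd.hasDerivWithinAt h1
    simp [he] at h2
  intro x hx
  rw [hWc x hx, hW0]

/-- A solution with zero Wronskian with the Jost solution is a multiple of it. -/
theorem eq_const_mul_jostSol {u : ℝ → ℂ} (hu : IsSolution q (k ^ 2) u)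
    (h : ∀ x, 0 ≤ x → wronskian u (jostSol q k) x = 0) :
    ∃ c : ℂ, ∀ x, 0 ≤ x → u x = c * jostSol q k x := by
  obtain ⟨N, hN0, hN⟩ := exists_jostSol_ne_zero hq hk
  have hf := isSolution_jostSol hq hk
  have hfN : jostSol q k N ≠ 0 := mul_ne_zero (Complex.exp_ne_zero _) fun h0 => by
    have := hN N le_rfl; rw [h0, norm_zero] at this; linarith
  -- At N, where f does not vanish, this c makes u - c f zero; the vanishing Wronskian then makes
  -- its derivative zero too, and the initial value problem has a unique solution.
  set c := u N / jostSol q k N with hc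
  have hd := hu.sub hq (hf.const_mul c)
  refine ⟨c, fun x hx => ?_⟩
  have := hd.eq_zero hq hN0.le ?_ ?_ x hx
  · simpa [sub_eq_zero] using this
  · simp [hc, div_mul_cancel₀ _ hfN]
  · have hw := h N hN0.le
    rw [wronskian] at hw
    rw [derivWithin_sub (hu.1 N hN0.le) ((hf.const_mul c).1 N hN0.le),
      derivWithin_const_mul c (hf.1 N hN0.le), hc]
    field_simp
    linear_combination -hw

/-- The difference of two Jost solutions is o(e^{ikx}), and hence o(e^{-ikx}) because Im k ≥ 0. It
is therefore a multiple c f, and dividing by e^{ikx} and letting x → ∞ gives c = 0. -/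
theorem IsJost.eqOn_jostSol {u : ℝ → ℂ} (hu : IsJost q k u) : EqOn u (jostSol q k) (Ici 0) := by
  have hj := isJost_jostSol hq hk
  have hd := hu.1.sub hq hj.1
  have ht : Tendsto (fun x : ℝ => Complex.exp (-(Complex.I * k * x)) * (u - jostSol q k) x)
      atTop (𝓝 0) := by
    have := hu.2.sub hj.2
    rw [sub_self] at this
    refine this.congr fun x => ?_
    simp [mul_sub]
  have ht2 : Tendsto (fun x : ℝ => Complex.exp (Complex.I * k * x) * (u - jostSol q k) x)
      atTop (𝓝 0) := by
    refine squeeze_zero_norm' ?_ (tendsto_zero_iff_norm_tendsto_zero.1 ht)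
    filter_upwards [eventually_ge_atTop 0] with x hx
    rw [norm_mul, norm_mul]
    refine mul_le_mul_of_nonneg_right ?_ (norm_nonneg _)
    rw [Complex.norm_exp, Complex.norm_exp, Real.exp_le_exp]
    have := mul_nonneg ((closedUpperHP_def k).1 hk) hx
    simp
    linarith
  obtain ⟨c, hc⟩ := eq_const_mul_jostSol hq hk hd
    (wronskian_jostSol_eq_zero hq hk hd fun s hs ε hε => by
      have h1 : ∀ᶠ x : ℝ in atTop, ‖Complex.exp (Complex.I * k * x) * (u - jostSol q k) x‖ < ε := by
        have := (tendsto_zero_iff_norm_tendsto_zero.1 ht2).eventually_lt_const hε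
        exact this
      have h2 := (tendsto_atTop_add_const_right atTop s tendsto_id).eventually h1
      exact (h1.and h2).frequently)
  have hc0 : c = 0 := by
    refine tendsto_nhds_unique (((tendsto_modJost hq hk).const_mul c).congr' ?_)
      (ht.trans (by simp)) |>.symm.trans ?_ |>.symm
    · filter_upwards [eventually_ge_atTop 0] with x hx
      rw [hc x hx, jostSol, Complex.exp_neg]
      have := Complex.exp_ne_zero (Complex.I * k * x)
      field_simp
    · simp
  intro x hx
  have := hc x hx
  rw [hc0, zero_mul, Pi.sub_apply, sub_eq_zero] at this
  exact this

theorem isJost_jost : IsJost q k (jost q k) := by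
  have h : ∃ u, IsJost q k u := ⟨_, isJost_jostSol hq hk⟩
  rw [jost, dif_pos h]
  exact h.choose_spec

theorem eqOn_jost : EqOn (jost q k) (jostSol q k) (Ici 0) :=
  IsJost.eqOn_jostSol hq hk (isJost_jost hq hk)

theorem jostFn_eq : jostFn q k = modJost q 0 k := by
  rw [jostFn, eqOn_jost hq hk (mem_Ici.2 le_rfl), jostSol]
  simp

theorem derivWithin_jost {x : ℝ} (hx : 0 ≤ x) :
    derivWithin (jost q k) (Ici 0) x = jostSolDeriv q k x := by
  rw [← derivWithin_jostSol hq hk hx]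
  exact derivWithin_congr (eqOn_jost hq hk) (eqOn_jost hq hk hx)

theorem jostDeriv_eq : jostDeriv q k = Complex.I * k * modJost q 0 k + modJostDeriv q 0 k := by
  rw [jostDeriv, derivWithin_jost hq hk le_rfl, jostSolDeriv]
  simp

end

/-! ### Symmetry, dependence on k and Green's identity -/

theorem neg_conj_mem {k : ℂ} (hk : k ∈ closedUpperHP) : -(starRingEnd ℂ k) ∈ closedUpperHP := by
  rw [closedUpperHP_def] at *; simpa using hk

/-- The symmetry `f(x, -k̄) = conj f(x, k)`. -/
theorem jost_neg_conj {q : ℝ → ℝ} (hq : MemL11 q) {k : ℂ} (hk : k ∈ closedUpperHP) :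
    EqOn (fun x => starRingEnd ℂ (jost q k x)) (jost q (-(starRingEnd ℂ k))) (Ici 0) := by
  have hk' := neg_conj_mem hk
  have h := isJost_jost hq hk
  have : IsJost q (-(starRingEnd ℂ k)) (fun x => starRingEnd ℂ (jost q k x)) := by
    refine ⟨?_, ?_⟩
    · have h2 := h.1.conj
      rw [map_pow] at h2
      rwa [neg_sq]
    · have h2 := (Complex.continuous_conj.tendsto 1).comp h.2
      rw [map_one] at h2
      refine h2.congr fun x => ?_
      simp [← Complex.exp_conj]
  intro x hx
  rw [IsJost.eqOn_jostSol hq hk' this hx, eqOn_jost hq hk' hx]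

theorem jostFn_neg_conj {q : ℝ → ℝ} (hq : MemL11 q) {k : ℂ} (hk : k ∈ closedUpperHP) :
    jostFn q (-(starRingEnd ℂ k)) = starRingEnd ℂ (jostFn q k) :=
  (jost_neg_conj hq hk (mem_Ici.2 le_rfl)).symm

theorem jostDeriv_neg_conj {q : ℝ → ℝ} (hq : MemL11 q) {k : ℂ} (hk : k ∈ closedUpperHP) :
    jostDeriv q (-(starRingEnd ℂ k)) = starRingEnd ℂ (jostDeriv q k) := by
  rw [jostDeriv, jostDeriv, ← derivWithin_congr (jost_neg_conj hq hk)
    (jost_neg_conj hq hk (mem_Ici.2 le_rfl))]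
  have h := ((isJost_jost hq hk).1.1 0 (mem_Ici.2 le_rfl)).hasDerivWithinAt
  exact ((Complex.conjCLE.toContinuousLinearMap.hasFDerivAt).comp_hasDerivWithinAt 0 h).derivWithin
    (uniqueDiffOn_Ici 0 0 (mem_Ici.2 le_rfl))

theorem ofReal_mem_closedUpperHP (k : ℝ) : (k : ℂ) ∈ closedUpperHP := by
  simp [closedUpperHP_def]

theorem neg_ofReal_mem_closedUpperHP (k : ℝ) : -(k : ℂ) ∈ closedUpperHP := by
  simp [closedUpperHP_def]

theorem I_mul_mem_openUpperHP {κ : ℝ} (hκ : 0 < κ) : Complex.I * κ ∈ openUpperHP := by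
  simpa [openUpperHP] using hκ

theorem closure_openUpperHP : closure openUpperHP = closedUpperHP :=
  Complex.closure_setOfPred_lt_im 0

section
variable {q : ℝ → ℝ} (hq : MemL11 q)
include hq

theorem aestronglyMeasurable_modJostDeriv_integrand (x : ℝ) {k : ℂ} (hk : k ∈ closedUpperHP) :
    AEStronglyMeasurable (fun t : ℝ => Complex.exp (2 * Complex.I * k * (t - x : ℝ)) *
      ((zeroExt q t : ℂ) * modJost q t k)) (volume.restrict (Ioi x)) :=
  ((Continuous.aestronglyMeasurable (by fun_prop)).mul
    (integrable_zeroExt_mul_modJost hq hk).aestronglyMeasurable).restrict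

theorem norm_modJostDeriv_integrand_le {x t : ℝ} (ht : x < t) {k : ℂ} (hk : k ∈ closedUpperHP) :
    ‖Complex.exp (2 * Complex.I * k * (t - x : ℝ)) * ((zeroExt q t : ℂ) * modJost q t k)‖ ≤
      Real.exp (∫ t, weight q t) * |zeroExt q t| := by
  rcases le_or_gt t 0 with h0 | h0
  · simp [zeroExt_of_nonpos q h0]
  rw [norm_mul, norm_mul, Complex.norm_real, Real.norm_eq_abs]
  have h1 := norm_exp_two_mul_le hk (sub_nonneg.2 ht.le)
  have h2 := norm_modJost_le hq (by linarith : -1 ≤ t) hk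
  calc _ ≤ 1 * (|zeroExt q t| * Real.exp (∫ t, weight q t)) := by gcongr
    _ = _ := by ring

theorem continuousOn_modJostDeriv (x : ℝ) : ContinuousOn (modJostDeriv q x) closedUpperHP := by
  refine ContinuousOn.neg (continuousOn_of_dominated
    (bound := fun t => Real.exp (∫ t, weight q t) * |zeroExt q t|)
    (fun k hk => aestronglyMeasurable_modJostDeriv_integrand hq x hk)
    (fun k hk => (ae_restrict_iff' measurableSet_Ioi).2 (ae_of_all _ fun t ht =>
      norm_modJostDeriv_integrand_le hq ht hk))
    (hq.integrable_zeroExt.abs.const_mul _).integrableOn (ae_of_all _ fun t => ?_))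
  rcases le_or_gt t 0 with h0 | h0
  · simp only [zeroExt_of_nonpos q h0, Complex.ofReal_zero, zero_mul, mul_zero]
    exact continuousOn_const
  refine (Continuous.continuousOn (by fun_prop)).mul (continuousOn_const.mul ?_)
  exact (continuousOn_modJost hq).comp (f := fun k : ℂ => (t, k)) (by fun_prop)
    fun k hk => ⟨by rw [mem_Ici]; linarith, hk⟩

theorem differentiableOn_modJostDeriv (x : ℝ) :
    DifferentiableOn ℂ (modJostDeriv q x) openUpperHP := by
  refine DifferentiableOn.neg (differentiableOn_integral_of_dominated isOpen_openUpperHP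
    (bound := fun t => Real.exp (∫ t, weight q t) * |zeroExt q t|)
    (fun k hk => aestronglyMeasurable_modJostDeriv_integrand hq x (openUpperHP_subset hk))
    (hq.integrable_zeroExt.abs.const_mul _).integrableOn
    ((ae_restrict_iff' measurableSet_Ioi).2 (ae_of_all _ fun t ht k hk =>
      norm_modJostDeriv_integrand_le hq ht (openUpperHP_subset hk)))
    (ae_of_all _ fun t => ?_))
  rcases le_or_gt t 0 with h0 | h0
  · simp only [zeroExt_of_nonpos q h0, Complex.ofReal_zero, zero_mul, mul_zero]
    exact differentiableOn_const _
  exact (Differentiable.differentiableOn (by fun_prop)).mul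
    ((differentiableOn_const _).mul (differentiableOn_modJost hq (by linarith)))

theorem continuousOn_modJost_right {x : ℝ} (hx : -1 ≤ x) :
    ContinuousOn (modJost q x) closedUpperHP :=
  (continuousOn_modJost hq).comp (f := fun k : ℂ => (x, k)) (by fun_prop) fun _ hk => ⟨hx, hk⟩

theorem continuousOn_jostFn : ContinuousOn (jostFn q) closedUpperHP :=
  (continuousOn_modJost_right hq (by norm_num)).congr fun _ hk => jostFn_eq hq hk

theorem differentiableOn_jostFn : DifferentiableOn ℂ (jostFn q) openUpperHP :=
  (differentiableOn_modJost hq (by norm_num)).congr fun _ hk => jostFn_eq hq (openUpperHP_subset hk)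

theorem continuousOn_jostDeriv : ContinuousOn (jostDeriv q) closedUpperHP := by
  refine ContinuousOn.congr (f := fun k => Complex.I * k * modJost q 0 k + modJostDeriv q 0 k) ?_
    fun _ hk => jostDeriv_eq hq hk
  exact ((Continuous.continuousOn (by fun_prop)).mul
    (continuousOn_modJost_right hq (by norm_num))).add (continuousOn_modJostDeriv hq 0)

theorem differentiableOn_jostDeriv : DifferentiableOn ℂ (jostDeriv q) openUpperHP := by
  refine DifferentiableOn.congr
    (f := fun k => Complex.I * k * modJost q 0 k + modJostDeriv q 0 k) ?_
    fun _ hk => jostDeriv_eq hq (openUpperHP_subset hk)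
  exact ((Differentiable.differentiableOn (by fun_prop)).mul
    (differentiableOn_modJost hq (by norm_num))).add (differentiableOn_modJostDeriv hq 0)

theorem exists_norm_mul_norm_jostFn_sub_one_le :
    ∃ C : ℝ, ∀ k ∈ closedUpperHP, ‖k‖ * ‖jostFn q k - 1‖ ≤ C :=
  ⟨_, fun k hk => by
    rw [jostFn_eq hq hk]; exact norm_mul_norm_modJost_sub_one_le hq (by norm_num) hk⟩

end

theorem tendsto_cobounded_of_norm_mul_le {F : ℂ → ℂ} {a : ℂ} {C : ℝ}
    (h : ∀ k ∈ closedUpperHP, ‖k‖ * ‖F k - a‖ ≤ C) :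
    Tendsto F (Bornology.cobounded ℂ ⊓ 𝓟 closedUpperHP) (𝓝 a) := by
  rw [tendsto_iff_norm_sub_tendsto_zero]
  have h1 : Tendsto (fun k : ℂ => C / ‖k‖) (Bornology.cobounded ℂ ⊓ 𝓟 closedUpperHP) (𝓝 0) :=
    (tendsto_const_nhds.div_atTop tendsto_norm_cobounded_atTop).mono_left inf_le_left
  refine squeeze_zero' (Eventually.of_forall fun _ => norm_nonneg _) ?_ h1
  have h2 : ∀ᶠ k : ℂ in Bornology.cobounded ℂ ⊓ 𝓟 closedUpperHP, 0 < ‖k‖ :=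
    (tendsto_norm_cobounded_atTop.mono_left inf_le_left).eventually_gt_atTop 0
  filter_upwards [h2, (mem_inf_of_right (mem_principal_self _) :
    closedUpperHP ∈ Bornology.cobounded ℂ ⊓ 𝓟 closedUpperHP)] with k hk hk'
  rw [le_div_iff₀ hk, mul_comm]
  exact h k hk'

section
variable {q : ℝ → ℝ} (hq : MemL11 q)
include hq

theorem tendsto_jostFn : Tendsto (jostFn q) (Bornology.cobounded ℂ ⊓ 𝓟 closedUpperHP) (𝓝 1) := by
  obtain ⟨C, hC⟩ := exists_norm_mul_norm_jostFn_sub_one_le hq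
  exact tendsto_cobounded_of_norm_mul_le hC

theorem norm_modJostDeriv_le_tail (x : ℝ) {k : ℂ} (hk : k ∈ closedUpperHP) :
    ‖modJostDeriv q x k‖ ≤ Real.exp (∫ t, weight q t) * tail q x := by
  refine (norm_modJostDeriv_le hq x hk).trans ?_
  gcongr
  exact setIntegral_mono hq.integrable_zeroExt.abs.integrableOn hq.integrable_weight.integrableOn
    (abs_zeroExt_le_weight q)

theorem tendsto_modJostDeriv {k : ℂ} (hk : k ∈ closedUpperHP) :
    Tendsto (fun x => modJostDeriv q x k) atTop (𝓝 0) := by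
  have h := hq.tendsto_tail.const_mul (Real.exp (∫ t, weight q t))
  rw [mul_zero] at h
  exact squeeze_zero_norm (fun x => norm_modJostDeriv_le_tail hq x hk) h

variable {k l : ℂ} (hk : k ∈ closedUpperHP) (hl : l ∈ closedUpperHP)
include hk

theorem norm_jostSol_le {x : ℝ} (hx : 0 ≤ x) :
    ‖jostSol q k x‖ ≤ Real.exp (∫ t, weight q t) * Real.exp (-k.im * x) := by
  rw [jostSol, norm_mul, Complex.norm_exp, mul_comm]
  have : (Complex.I * k * x).re = -k.im * x := by simp
  rw [this]
  gcongr
  exact norm_modJost_le hq (by linarith) hk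

theorem norm_jostSol_le' {x : ℝ} (hx : 0 ≤ x) :
    ‖jostSol q k x‖ ≤ Real.exp (∫ t, weight q t) := by
  refine (norm_jostSol_le hq hk hx).trans ?_
  have : Real.exp (-k.im * x) ≤ 1 := by
    rw [Real.exp_le_one_iff]
    have := mul_nonneg ((closedUpperHP_def k).1 hk) hx
    linarith
  nlinarith [Real.exp_pos (∫ t, weight q t)]

include hl

/-- All growth is collected in e^{i(k+l)x}, while the bracket converges. The two cases used are
Im(k+l) > 0, where the exponential decays, and l = -k, where it is identically 1. -/
theorem wronskian_jostSol {x : ℝ} (hx : 0 ≤ x) :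
    wronskian (jostSol q k) (jostSol q l) x = Complex.exp (Complex.I * (k + l) * x) *
      (Complex.I * (l - k) * (modJost q x k * modJost q x l) +
        (modJost q x k * modJostDeriv q x l - modJostDeriv q x k * modJost q x l)) := by
  rw [wronskian, derivWithin_jostSol hq hk hx, derivWithin_jostSol hq hl hx, jostSolDeriv,
    jostSolDeriv, jostSol, jostSol]
  have : Complex.exp (Complex.I * (k + l) * x) =
      Complex.exp (Complex.I * k * x) * Complex.exp (Complex.I * l * x) := by
    rw [← Complex.exp_add]; congr 1; ring
  rw [this]; ring

theorem tendsto_modJost_bracket : Tendsto (fun x =>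
    Complex.I * (l - k) * (modJost q x k * modJost q x l) +
      (modJost q x k * modJostDeriv q x l - modJostDeriv q x k * modJost q x l)) atTop
    (𝓝 (Complex.I * (l - k))) := by
  have h1 := tendsto_modJost hq hk
  have h2 := tendsto_modJost hq hl
  have h3 := tendsto_modJostDeriv hq hk
  have h4 := tendsto_modJostDeriv hq hl
  have := ((h1.mul h2).const_mul (Complex.I * (l - k))).add ((h1.mul h4).sub (h3.mul h2))
  simpa using this

theorem wronskian_jostSol_zero : wronskian (jostSol q k) (jostSol q l) 0 =
    jostFn q k * jostDeriv q l - jostDeriv q k * jostFn q l := by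
  rw [wronskian_jostSol hq hk hl le_rfl, jostFn_eq hq hk, jostFn_eq hq hl, jostDeriv_eq hq hk,
    jostDeriv_eq hq hl]
  simp
  ring

theorem integrableOn_jostSol_mul (h : 0 < (k + l).im) :
    IntegrableOn (fun x => jostSol q k x * jostSol q l x) (Ioi 0) := by
  have hc : ContinuousOn (fun x => jostSol q k x * jostSol q l x) (Ioi 0) :=
    ((isSolution_jostSol hq hk).continuousOn.mul (isSolution_jostSol hq hl).continuousOn).mono
      Ioi_subset_Ici_self
  refine Integrable.mono' (((exp_neg_integrableOn_Ioi 0 h).const_mul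
    (Real.exp (∫ t, weight q t) ^ 2))) (hc.aestronglyMeasurable measurableSet_Ioi)
    ((ae_restrict_iff' measurableSet_Ioi).2 (ae_of_all _ fun x hx => ?_))
  rw [norm_mul]
  refine (mul_le_mul (norm_jostSol_le hq hk (le_of_lt hx)) (norm_jostSol_le hq hl (le_of_lt hx))
    (norm_nonneg _) (by positivity)).trans_eq ?_
  have : -(k + l).im * x = -k.im * x + -l.im * x := by simp; ring
  rw [this, Real.exp_add]; ring

/-- Green's identity for two Jost solutions. -/
theorem jost_green (h : 0 < (k + l).im) :
    jostFn q k * jostDeriv q l - jostDeriv q k * jostFn q l =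
      -((k ^ 2 - l ^ 2) * ∫ x in Ioi (0 : ℝ), jostSol q k x * jostSol q l x) := by
  have h1 : Tendsto (fun x => wronskian (jostSol q k) (jostSol q l) x) atTop (𝓝 0) := by
    have h2 : Tendsto (fun x : ℝ => Complex.exp (Complex.I * (k + l) * x)) atTop (𝓝 0) := by
      rw [tendsto_zero_iff_norm_tendsto_zero]
      have h3 : Tendsto (fun x : ℝ => Real.exp (-((k + l).im * x))) atTop (𝓝 0) :=
        Real.tendsto_exp_neg_atTop_nhds_zero.comp (tendsto_id.const_mul_atTop h)
      refine h3.congr fun x => ?_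
      rw [Complex.norm_exp]
      congr 1
      simp
      ring
    have h4 := h2.mul (tendsto_modJost_bracket hq hk hl)
    rw [zero_mul] at h4
    refine h4.congr' ?_
    filter_upwards [eventually_ge_atTop 0] with x hx using (wronskian_jostSol hq hk hl hx).symm
  have h5 := (intervalIntegral_tendsto_integral_Ioi 0 (integrableOn_jostSol_mul hq hk hl h)
    tendsto_id).const_mul (k ^ 2 - l ^ 2)
  have h6 := tendsto_nhds_unique h5 ((h1.sub_const
    (wronskian (jostSol q k) (jostSol q l) 0)).congr' (by
      filter_upwards [eventually_ge_atTop 0] with x hx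
      exact wronskian_sub hq (isSolution_jostSol hq hk) (isSolution_jostSol hq hl) le_rfl hx))
  rw [h6, wronskian_jostSol_zero hq hk hl]
  ring

end

/-! ### Zeros of the Jost function and bound states -/

section
variable {q : ℝ → ℝ} (hq : MemL11 q)
include hq

theorem jostFn_neg_ofReal (k : ℝ) : jostFn q (-(k : ℂ)) = starRingEnd ℂ (jostFn q k) := by
  rw [← jostFn_neg_conj hq (ofReal_mem_closedUpperHP k), Complex.conj_ofReal]

theorem jostDeriv_neg_ofReal (k : ℝ) :
    jostDeriv q (-(k : ℂ)) = starRingEnd ℂ (jostDeriv q k) := by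
  rw [← jostDeriv_neg_conj hq (ofReal_mem_closedUpperHP k), Complex.conj_ofReal]

/-- The Wronskian of `f(x, k)` and `f(x, -k)`. -/
theorem jost_wronskian_real (k : ℝ) :
    jostFn q k * jostDeriv q (-(k : ℂ)) - jostDeriv q k * jostFn q (-(k : ℂ)) =
      -(2 * Complex.I * k) := by
  have hk := ofReal_mem_closedUpperHP k
  have hl := neg_ofReal_mem_closedUpperHP k
  have h1 : Tendsto (fun x => wronskian (jostSol q k) (jostSol q (-(k : ℂ))) x) atTop
      (𝓝 (Complex.I * (-(k : ℂ) - k))) := by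
    refine (tendsto_modJost_bracket hq hk hl).congr' ?_
    filter_upwards [eventually_ge_atTop 0] with x hx
    rw [wronskian_jostSol hq hk hl hx]
    simp
  have h2 : Tendsto (fun x => wronskian (jostSol q k) (jostSol q (-(k : ℂ))) x) atTop
      (𝓝 (wronskian (jostSol q k) (jostSol q (-(k : ℂ))) 0)) := by
    refine tendsto_const_nhds.congr' ?_
    filter_upwards [eventually_ge_atTop 0] with x hx
    have := wronskian_sub hq (isSolution_jostSol hq hk) (isSolution_jostSol hq hl) le_rfl hx
    rw [neg_sq, sub_self, zero_mul] at this
    exact (sub_eq_zero.1 this).symm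
  rw [← wronskian_jostSol_zero hq hk hl, tendsto_nhds_unique h2 h1]
  ring

/-- Since f(-k) is the conjugate of f(k), both would vanish together, contradicting the nonzero
Wronskian -2ik. -/
theorem jostFn_ofReal_ne_zero {k : ℝ} (hk : k ≠ 0) : jostFn q k ≠ 0 := by
  intro h
  have h1 := jost_wronskian_real hq k
  rw [jostFn_neg_ofReal hq, h, map_zero, zero_mul, mul_zero, sub_self] at h1
  simp [hk] at h1

/-- The Jost solution and its derivative do not vanish simultaneously. -/
theorem jostDeriv_ne_zero {k : ℂ} (hk : k ∈ closedUpperHP) (h : jostFn q k = 0) :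
    jostDeriv q k ≠ 0 := by
  intro h'
  have hs := isSolution_jostSol hq hk
  have h1 := hs.eq_zero hq le_rfl (by rw [← h, jostFn, eqOn_jost hq hk (mem_Ici.2 le_rfl)])
    (by rw [derivWithin_jostSol hq hk le_rfl, ← derivWithin_jost hq hk le_rfl]; exact h')
  obtain ⟨N, hN0, hN⟩ := exists_jostSol_ne_zero hq hk
  have h2 := h1 N hN0.le
  have h3 := hN N le_rfl
  rw [(mul_eq_zero.1 h2).resolve_left (Complex.exp_ne_zero _), norm_zero] at h3
  linarith

theorem memLp_jostSol {k : ℂ} (hk : k ∈ openUpperHP) :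
    MemLp (jostSol q k) 2 (volume.restrict (Ioi 0)) := by
  have hk' := openUpperHP_subset hk
  have hc : ContinuousOn (jostSol q k) (Ioi 0) :=
    (isSolution_jostSol hq hk').continuousOn.mono Ioi_subset_Ici_self
  rw [memLp_two_iff_integrable_sq_norm (hc.aestronglyMeasurable measurableSet_Ioi)]
  have h1 := integrableOn_jostSol_mul hq hk' hk' (by
    have h : 0 < k.im := hk
    simpa using h)
  refine h1.norm.congr (ae_of_all _ fun x => ?_)
  simp [sq]

theorem integral_sq_norm_jostSol_pos {k : ℂ} (hk : k ∈ openUpperHP) :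
    0 < ∫ x in Ioi (0 : ℝ), ‖jostSol q k x‖ ^ 2 := by
  have hk' := openUpperHP_subset hk
  have hi := (memLp_two_iff_integrable_sq_norm (memLp_jostSol hq hk).1).1 (memLp_jostSol hq hk)
  rw [setIntegral_pos_iff_support_of_nonneg_ae (ae_of_all _ fun x => by positivity) hi]
  obtain ⟨N, hN0, hN⟩ := exists_jostSol_ne_zero hq hk'
  refine lt_of_lt_of_le (b := volume (Ioi N)) (by simp) (measure_mono fun x hx => ?_)
  have hxN : N < x := hx
  refine ⟨?_, hN0.trans hxN⟩
  have h2 : jostSol q k x ≠ 0 := mul_ne_zero (Complex.exp_ne_zero _) fun h0 => by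
    have := hN x hxN.le; rw [h0, norm_zero] at this; linarith
  simpa using h2

theorem conj_jostSol {k : ℂ} (hk : k ∈ closedUpperHP) {x : ℝ} (hx : 0 ≤ x) :
    jostSol q (-(starRingEnd ℂ k)) x = starRingEnd ℂ (jostSol q k x) := by
  rw [← eqOn_jost hq hk hx, ← eqOn_jost hq (neg_conj_mem hk) hx]
  exact (jost_neg_conj hq hk hx).symm

theorem integral_jostSol_mul_conj {k : ℂ} (hk : k ∈ closedUpperHP) :
    ∫ x in Ioi (0 : ℝ), jostSol q k x * jostSol q (-(starRingEnd ℂ k)) x =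
      ((∫ x in Ioi (0 : ℝ), ‖jostSol q k x‖ ^ 2 : ℝ) : ℂ) := by
  rw [← integral_complex_ofReal]
  refine setIntegral_congr_fun measurableSet_Ioi fun x hx => ?_
  rw [conj_jostSol hq hk (le_of_lt hx), Complex.mul_conj, Complex.normSq_eq_norm_sq]

omit hq in
theorem neg_conj_I_mul (κ : ℝ) : -(starRingEnd ℂ (Complex.I * κ)) = Complex.I * κ := by
  simp

omit hq in
-- Otherwise |u(x)|^2 + |u(x+s)|^2 ≥ ε^2 for all large x, although this sum is integrable on the
-- half-line.
theorem frequently_small_of_memLp {u : ℝ → ℂ} (hu : MemLp u 2 (volume.restrict (Ioi 0)))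
    {s ε : ℝ} (hs : 0 < s) (hε : 0 < ε) : ∃ᶠ x : ℝ in atTop, ‖u x‖ < ε ∧ ‖u (x + s)‖ < ε := by
  intro hev
  obtain ⟨N, hN⟩ := eventually_atTop.1 hev
  have hi : IntegrableOn (fun x => ‖u x‖ ^ 2) (Ioi 0) :=
    (memLp_two_iff_integrable_sq_norm hu.1).1 hu
  have hi2 : IntegrableOn (fun x => ‖u (x + s)‖ ^ 2) (Ioi 0) := by
    have := (measurePreserving_add_right (volume : Measure ℝ) s).integrableOn_comp_preimage
      (measurableEmbedding_addRight s) (f := fun x => ‖u x‖ ^ 2) (s := Ioi s)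
    simp only [Function.comp_def, preimage_add_const_Ioi, sub_self] at this
    exact this.2 (hi.mono_set (Ioi_subset_Ioi hs.le))
  have hi3 : IntegrableOn (fun _ : ℝ => ε ^ 2) (Ioi (max N 0)) := by
    refine Integrable.mono' ((hi.add hi2).mono_set (Ioi_subset_Ioi (le_max_right N 0)))
      aestronglyMeasurable_const
      ((ae_restrict_iff' measurableSet_Ioi).2 (ae_of_all _ fun x hx => ?_))
    have hx1 : N < x := (le_max_left _ _).trans_lt hx
    have h1 := hN x hx1.le
    rw [Real.norm_of_nonneg (by positivity)]
    simp only [Pi.add_apply]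
    by_cases h2 : ‖u x‖ < ε
    · have h3 : ε ≤ ‖u (x + s)‖ := not_lt.1 fun h => h1 ⟨h2, h⟩
      nlinarith [norm_nonneg (u x)]
    · nlinarith [norm_nonneg (u (x + s))]
  rw [integrableOn_const_iff] at hi3
  simp [hε.ne'] at hi3

/-- An eigenfunction is small at x and x+s for arbitrarily large x, and |e^{ikx}| ≤ 1 at k = iκ, so
its Wronskian with the Jost solution vanishes and it is a nonzero multiple of the latter. Conversely
the Jost solution at iκ is square integrable by exponential decay. -/
theorem mem_boundStates_iff {κ : ℝ} (hκ : 0 < κ) :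
    κ ∈ boundStates q ↔ jostFn q (Complex.I * κ) = 0 := by
  have hk := I_mul_mem_openUpperHP hκ
  have hk' := openUpperHP_subset hk
  have hsq : (Complex.I * κ) ^ 2 = ((-κ ^ 2 : ℝ) : ℂ) := by
    rw [mul_pow, Complex.I_sq]; push_cast; ring
  have h0 : jostFn q (Complex.I * κ) = jostSol q (Complex.I * κ) 0 := by
    rw [jostFn, eqOn_jost hq hk' (mem_Ici.2 le_rfl)]
  constructor
  · rintro ⟨-, u, hu, hu0, hL, x, hx, hux⟩
    rw [← hsq] at hu
    obtain ⟨c, hc⟩ := eq_const_mul_jostSol hq hk' hu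
      (wronskian_jostSol_eq_zero hq hk' hu fun s hs ε hε => by
        refine ((frequently_small_of_memLp hL hs hε).and_eventually
          (eventually_ge_atTop 0)).mono fun x hx => ?_
        have hb : ∀ y : ℝ, 0 ≤ y → ‖Complex.exp (Complex.I * (Complex.I * κ) * y) * u y‖ ≤
            ‖u y‖ := by
          intro y hy
          rw [norm_mul, Complex.norm_exp]
          refine mul_le_of_le_one_left (norm_nonneg _) ?_
          rw [Real.exp_le_one_iff]
          have := mul_nonneg hκ.le hy
          simp
          linarith
        exact ⟨(hb x hx.2).trans_lt hx.1.1, (hb (x + s) (by linarith [hx.2])).trans_lt hx.1.2⟩)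
    have hc0 : c ≠ 0 := by
      rintro rfl
      exact hux (by rw [hc x hx, zero_mul])
    rw [h0]
    have := hc 0 le_rfl
    rw [hu0] at this
    exact (mul_eq_zero.1 this.symm).resolve_left hc0
  · intro h
    refine ⟨hκ, jostSol q (Complex.I * κ), ?_, h0 ▸ h, memLp_jostSol hq hk, ?_⟩
    · rw [← hsq]; exact isSolution_jostSol hq hk'
    · obtain ⟨N, hN0, hN⟩ := exists_jostSol_ne_zero hq hk'
      refine ⟨N, hN0.le, mul_ne_zero (Complex.exp_ne_zero _) fun h0 => ?_⟩
      have := hN N le_rfl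
      rw [h0, norm_zero] at this
      linarith

/-- This is self-adjointness: Green's identity for the pair z and -z̄ gives (z^2 - z̄^2)‖f(·,z)‖^2 =
0 at a zero. Hence Re z · Im z = 0, and real nonzero z are already excluded. -/
theorem jostFn_eq_zero_iff {z : ℂ} (hz : z ∈ closedUpperHP) (hz0 : z ≠ 0) :
    jostFn q z = 0 ↔ ∃ κ ∈ boundStates q, z = Complex.I * κ := by
  constructor
  · intro h
    rcases eq_or_lt_of_le ((closedUpperHP_def z).1 hz) with him | him
    · have hzr : z = (z.re : ℂ) := Complex.ext (by simp) (by simp [← him])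
      rw [hzr] at h hz0
      exact absurd h (jostFn_ofReal_ne_zero hq (by exact_mod_cast hz0))
    · have hg := jost_green hq hz (neg_conj_mem hz) (by simpa using by linarith)
      rw [jostFn_neg_conj hq hz, h, map_zero, zero_mul, mul_zero, sub_zero,
        integral_jostSol_mul_conj hq hz] at hg
      have h1 : z ^ 2 - (-(starRingEnd ℂ z)) ^ 2 = 0 := by
        refine (mul_eq_zero.1 (neg_eq_zero.1 hg.symm)).resolve_right ?_
        exact_mod_cast (integral_sq_norm_jostSol_pos hq him).ne'
      have h2 : z.re * z.im = 0 := by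
        have := congrArg Complex.im h1
        simp [sq] at this
        linarith
      have h3 : z.re = 0 := (mul_eq_zero.1 h2).resolve_right him.ne'
      have hzi : z = Complex.I * (z.im : ℝ) := Complex.ext (by simp [h3]) (by simp)
      refine ⟨z.im, (mem_boundStates_iff hq him).2 ?_, hzi⟩
      rwa [← hzi]
  · rintro ⟨κ, hκ, rfl⟩
    exact (mem_boundStates_iff hq hκ.1).1 hκ

/-- The derivative of the Jost function at a zero on the imaginary axis. -/
theorem deriv_jostFn_mul_jostDeriv {κ : ℝ} (hκ : κ ∈ boundStates q) :
    deriv (jostFn q) (Complex.I * κ) * jostDeriv q (Complex.I * κ) =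
      -(2 * Complex.I * κ * ((∫ x in Ioi (0 : ℝ), ‖jostSol q (Complex.I * κ) x‖ ^ 2 : ℝ) : ℂ)) := by
  have hκ0 := hκ.1
  set l := Complex.I * (κ : ℂ) with hl
  have hlo : l ∈ openUpperHP := I_mul_mem_openUpperHP hκ0
  have hlc := openUpperHP_subset hlo
  have hf0 : jostFn q l = 0 := (mem_boundStates_iff hq hκ0).1 hκ
  have hlim : l.im = κ := by simp [hl]
  -- Because f(l) = 0, Green's identity has one term on the left. Dividing by k - l and letting k →
  -- l produces the derivative of f on the left and -2l ∫ f(x,l)^2 on the right.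
  have hgreen : ∀ k ∈ openUpperHP, jostFn q k * jostDeriv q l =
      -((k ^ 2 - l ^ 2) * ∫ x in Ioi (0 : ℝ), jostSol q k x * jostSol q l x) := by
    intro k hk
    rw [← jost_green hq (openUpperHP_subset hk) hlc (by
      have h1 : 0 < k.im := hk
      rw [Complex.add_im, hlim]; linarith), hf0, mul_zero, sub_zero]
  have hJ : ContinuousOn (fun k => ∫ x in Ioi (0 : ℝ), jostSol q k x * jostSol q l x)
      openUpperHP := by
    have hcl : ContinuousOn (jostSol q l) (Ioi 0) :=
      (isSolution_jostSol hq hlc).continuousOn.mono Ioi_subset_Ici_self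
    refine continuousOn_of_dominated (bound := fun x => Real.exp (∫ t, weight q t) *
      (Real.exp (∫ t, weight q t) * Real.exp (-κ * x))) (fun k hk => ?_) (fun k hk => ?_) ?_ ?_
    · exact (((isSolution_jostSol hq (openUpperHP_subset hk)).continuousOn.mono
        Ioi_subset_Ici_self).mul hcl).aestronglyMeasurable measurableSet_Ioi
    · refine (ae_restrict_iff' measurableSet_Ioi).2 (ae_of_all _ fun x hx => ?_)
      have h2 := norm_jostSol_le hq hlc (le_of_lt hx)
      rw [hlim] at h2
      rw [norm_mul]
      exact mul_le_mul (norm_jostSol_le' hq (openUpperHP_subset hk) (le_of_lt hx)) h2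
        (norm_nonneg _) (by positivity)
    · exact ((exp_neg_integrableOn_Ioi 0 hκ0).const_mul _).const_mul _
    · refine (ae_restrict_iff' measurableSet_Ioi).2 (ae_of_all _ fun x hx => ?_)
      have hx0 : 0 < x := hx
      refine ContinuousOn.mul ?_ continuousOn_const
      exact (Continuous.continuousOn (by fun_prop)).mul
        ((continuousOn_modJost_right hq (by linarith)).mono openUpperHP_subset)
  have hd : HasDerivAt (jostFn q) (deriv (jostFn q) l) l :=
    ((differentiableOn_jostFn hq).differentiableAt (isOpen_openUpperHP.mem_nhds hlo)).hasDerivAt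
  have ht1 := (hd.tendsto_slope).mul_const (jostDeriv q l)
  have ht2 : Tendsto (fun k => -((k + l) * ∫ x in Ioi (0 : ℝ), jostSol q k x * jostSol q l x))
      (𝓝[≠] l) (𝓝 (-((l + l) * ∫ x in Ioi (0 : ℝ), jostSol q l x * jostSol q l x))) := by
    refine Tendsto.neg (Tendsto.mul ?_ ?_)
    · exact tendsto_nhdsWithin_of_tendsto_nhds (Continuous.tendsto (by fun_prop) l)
    · exact tendsto_nhdsWithin_of_tendsto_nhds
        (hJ.continuousAt (isOpen_openUpperHP.mem_nhds hlo))
  have hev : ∀ᶠ k in 𝓝[≠] l, slope (jostFn q) l k * jostDeriv q l =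
      -((k + l) * ∫ x in Ioi (0 : ℝ), jostSol q k x * jostSol q l x) := by
    filter_upwards [self_mem_nhdsWithin,
      nhdsWithin_le_nhds (isOpen_openUpperHP.mem_nhds hlo)] with k hk hko
    have hkl : k - l ≠ 0 := sub_ne_zero.2 hk
    rw [slope_def_field, hf0, sub_zero, div_mul_eq_mul_div, hgreen k hko]
    field_simp
    ring
  have heq := tendsto_nhds_unique (ht1.congr' hev) ht2
  rw [heq]
  -- On the imaginary axis -l̄ = l, so f(·,l) is real and ∫ f^2 is the squared norm.
  have h3 := integral_jostSol_mul_conj hq hlc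
  rw [hl, neg_conj_I_mul, ← hl] at h3
  rw [h3, hl]; ring

theorem normingConst_eq {κ : ℝ} (hκ : κ ∈ boundStates q) :
    normingConst q κ = (∫ x in Ioi (0 : ℝ), ‖jostSol q (Complex.I * κ) x‖ ^ 2)⁻¹ := by
  rw [normingConst]
  congr 1
  refine setIntegral_congr_fun measurableSet_Ioi fun x hx => ?_
  rw [eqOn_jost hq (openUpperHP_subset (I_mul_mem_openUpperHP hκ.1)) (Ioi_subset_Ici_self hx)]

theorem normingConst_pos {κ : ℝ} (hκ : κ ∈ boundStates q) : 0 < normingConst q κ := by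
  rw [normingConst_eq hq hκ]
  exact inv_pos.2 (integral_sq_norm_jostSol_pos hq (I_mul_mem_openUpperHP hκ.1))

omit hq in
theorem jostDot_eq_deriv {z : ℂ} (hz : z ∈ openUpperHP) : jostDot q z = deriv (jostFn q) z :=
  derivWithin_of_mem_nhds (mem_of_superset (isOpen_openUpperHP.mem_nhds hz) openUpperHP_subset)

theorem jostDot_mul_jostDeriv {κ : ℝ} (hκ : κ ∈ boundStates q) :
    jostDot q (Complex.I * κ) * jostDeriv q (Complex.I * κ) =
      -(2 * Complex.I * κ) / normingConst q κ := by
  rw [jostDot_eq_deriv (I_mul_mem_openUpperHP hκ.1), deriv_jostFn_mul_jostDeriv hq hκ,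
    normingConst_eq hq hκ]
  push_cast
  rw [div_inv_eq_mul]
  ring

theorem jostDot_ne_zero {κ : ℝ} (hκ : κ ∈ boundStates q) : jostDot q (Complex.I * κ) ≠ 0 := by
  intro h
  have h1 := jostDot_mul_jostDeriv hq hκ
  rw [h, zero_mul] at h1
  have h2 : (normingConst q κ : ℂ) ≠ 0 := by exact_mod_cast (normingConst_pos hq hκ).ne'
  have h3 : (κ : ℂ) ≠ 0 := by exact_mod_cast hκ.1.ne'
  exact (div_ne_zero (neg_ne_zero.2 (by simp [h3])) h2) h1.symm

end

/-! ### The zero at k = 0 and finiteness of the bound states -/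

section
variable {q : ℝ → ℝ} (hq : MemL11 q)
include hq

theorem continuous_tail_abs : Continuous fun x : ℝ => ∫ t in Ioi x, |zeroExt q t| := by
  have : (fun x : ℝ => ∫ t in Ioi x, |zeroExt q t|) =
      fun x => (∫ s in Ioi 0, |zeroExt q s|) - ∫ s in (0 : ℝ)..x, |zeroExt q s| := by
    funext t
    have h1 := intervalIntegral.integral_Ioi_sub_Ioi' (μ := volume) (a := 0) (b := t)
      hq.integrable_zeroExt.abs.integrableOn hq.integrable_zeroExt.abs.integrableOn
    rw [← h1]; ring
  rw [this]
  exact continuous_const.sub (intervalIntegral.continuous_primitive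
    (fun a b => hq.integrable_zeroExt.abs.intervalIntegrable) 0)

/-- By integration by parts the double integral equals that of t|q(t)|, up to a boundary term; the
first moment of q is what makes it finite. -/
theorem integrableOn_tail_abs : IntegrableOn (fun x => ∫ t in Ioi x, |zeroExt q t|) (Ioi 0) := by
  set R : ℝ → ℝ := fun x => ∫ t in Ioi x, |zeroExt q t| with hR
  have hRc : Continuous R := continuous_tail_abs hq
  have hR0 : ∀ x, 0 ≤ R x := fun x => integral_nonneg fun _ => abs_nonneg _
  have hi := hq.integrable_zeroExt.abs
  refine integrableOn_Ioi_of_intervalIntegral_norm_bounded (2 * ∫ t, weight q t) 0 (l := atTop)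
    (b := id) (fun x => (hRc.integrableOn_Icc).mono_set Ioc_subset_Icc_self) tendsto_id ?_
  filter_upwards [eventually_ge_atTop 0] with x hx
  have hsub : ∀ y, 0 ≤ y → R y = R 0 - ∫ t in (0 : ℝ)..y, |zeroExt q t| := by
    intro y hy
    simp only [hR]
    rw [← intervalIntegral.integral_Ioi_sub_Ioi hi.integrableOn hy]
    ring
  have hp := mul_sub_mul_eq_integral (u := fun t : ℝ => (t : ℂ)) (v := fun t => (R t : ℂ))
    (u' := fun _ => 1) (v' := fun t => -((|zeroExt q t| : ℝ) : ℂ)) hx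
    intervalIntegrable_const
    (⟨(hi.intervalIntegrable (a := 0) (b := x)).1.ofReal.neg,
      (hi.intervalIntegrable (a := 0) (b := x)).2.ofReal.neg⟩) (by simp)
    (fun y hy => by
      rw [hsub y hy.1, intervalIntegral.integral_neg, intervalIntegral.integral_ofReal]
      push_cast; ring)
  -- Both the boundary term x R(x) and the integral of t|q| are at most the total weight, which
  -- accounts for the factor 2 in the bound.
  have hp' : ∫ t in (0 : ℝ)..x, R t = x * R x + ∫ t in (0 : ℝ)..x, t * |zeroExt q t| := by
    have h1 : ∫ t in (0 : ℝ)..x, ((R t - t * |zeroExt q t| : ℝ) : ℂ) = ((x * R x : ℝ) : ℂ) := by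
      push_cast
      rw [show (x : ℂ) * R x = (x : ℂ) * R x - ((0 : ℝ) : ℂ) * R 0 by simp, hp]
      refine intervalIntegral.integral_congr fun t _ => ?_
      ring
    rw [intervalIntegral.integral_ofReal] at h1
    have h2 := Complex.ofReal_injective h1
    rw [intervalIntegral.integral_sub (g := fun t => t * |zeroExt q t|) (hRc.intervalIntegrable _ _)
      (hi.intervalIntegrable.continuousOn_mul continuousOn_id)] at h2
    linarith
  have h3 : x * R x ≤ ∫ t, weight q t := by
    refine le_trans ?_ (hq.tail_le x)
    simp only [hR]
    rw [← integral_const_mul]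
    refine setIntegral_mono_on (hi.const_mul x).integrableOn hq.integrable_weight.integrableOn
      measurableSet_Ioi fun t ht => ?_
    have : x < t := ht
    unfold weight
    gcongr
    linarith
  have h4 : ∫ t in (0 : ℝ)..x, t * |zeroExt q t| ≤ ∫ t, weight q t := by
    rw [intervalIntegral.integral_of_le hx]
    refine le_trans (setIntegral_mono_on ?_ hq.integrable_weight.integrableOn measurableSet_Ioc
      fun t ht => ?_) (setIntegral_le_integral hq.integrable_weight (ae_of_all _ (weight_nonneg q)))
    · have := (hi.intervalIntegrable (a := 0) (b := x)).continuousOn_mul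
        (continuousOn_id (s := uIcc (0 : ℝ) x))
      exact this.1
    · unfold weight
      gcongr
      linarith
  simp only [id, Real.norm_of_nonneg (hR0 _)]
  linarith

/-- The derivative of `e^{-ikx} f(x, k) f(x, 0)`. -/
theorem integrableOn_modJost_prod_deriv {k : ℂ} (hk : k ∈ closedUpperHP) {x : ℝ} (hx : 0 < x) :
    ‖modJostDeriv q x k * modJost q x 0 + modJost q x k * modJostDeriv q x 0‖ ≤
      2 * Real.exp (∫ t, weight q t) ^ 2 * ∫ t in Ioi x, |zeroExt q t| := by
  have h0 : (0 : ℂ) ∈ closedUpperHP := by simp [closedUpperHP_def]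
  have a1 := norm_modJostDeriv_le hq x hk
  have a2 := norm_modJostDeriv_le hq x h0
  have a3 := norm_modJost_le hq (by linarith : -1 ≤ x) hk
  have a4 := norm_modJost_le hq (by linarith : -1 ≤ x) h0
  have hR0 : 0 ≤ ∫ t in Ioi x, |zeroExt q t| := integral_nonneg fun _ => abs_nonneg _
  refine (norm_add_le _ _).trans ?_
  rw [norm_mul, norm_mul]
  refine (add_le_add (mul_le_mul a1 a4 (norm_nonneg _) (by positivity))
    (mul_le_mul a3 a2 (norm_nonneg _) (by positivity))).trans_eq ?_
  ring

theorem continuousOn_modJostDeriv_left {k : ℂ} (hk : k ∈ closedUpperHP) :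
    ContinuousOn (fun x => modJostDeriv q x k) (Ici 0) := by
  have h := (isSolution_jostSol hq hk).continuousOn_deriv hq
  have hm := (continuousOn_modJost_left hq hk).mono (Ici_subset_Ici.2 (by norm_num : (-1 : ℝ) ≤ 0))
  refine ((Continuous.continuousOn (by fun_prop :
    Continuous fun x : ℝ => Complex.exp (-(Complex.I * k * x)))).mul h |>.sub
      (hm.const_mul (Complex.I * k))).congr fun x hx => ?_
  simp only [Pi.sub_apply, Pi.mul_apply]
  rw [derivWithin_jostSol hq hk hx, jostSolDeriv, ← mul_assoc, ← Complex.exp_add, neg_add_cancel,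
    Complex.exp_zero]
  ring

/-- If `f(0) = 0`, then `f(k) f'(0, 0) = -ik (1 + o(1))`, with an explicit remainder. -/
theorem jostFn_mul_jostDeriv_zero (h0 : jostFn q 0 = 0) {k : ℂ} (hk : k ∈ closedUpperHP) :
    jostFn q k * jostDeriv q 0 = -(Complex.I * k) *
      ∫ x in Ioi (0 : ℝ), Complex.exp (Complex.I * k * x) *
        (modJostDeriv q x k * modJost q x 0 + modJost q x k * modJostDeriv q x 0) ∧
    (∫ x in Ioi (0 : ℝ), (modJostDeriv q x 0 * modJost q x 0 + modJost q x 0 * modJostDeriv q x 0))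
      = 1 := by
  have hz : (0 : ℂ) ∈ closedUpperHP := by simp [closedUpperHP_def]
  have hR := (integrableOn_tail_abs hq).const_mul (2 * Real.exp (∫ t, weight q t) ^ 2)
  have hcP : ∀ k ∈ closedUpperHP, ContinuousOn (fun x : ℝ => Complex.exp (Complex.I * k * x) *
      (modJostDeriv q x k * modJost q x 0 + modJost q x k * modJostDeriv q x 0)) (Ici 0) := by
    intro k hk
    have hm : ∀ k ∈ closedUpperHP, ContinuousOn (fun x => modJost q x k) (Ici 0) := fun k hk =>
      (continuousOn_modJost_left hq hk).mono (Ici_subset_Ici.2 (by norm_num))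
    exact (Continuous.continuousOn (by fun_prop)).mul
      (((continuousOn_modJostDeriv_left hq hk).mul (hm 0 hz)).add
        ((hm k hk).mul (continuousOn_modJostDeriv_left hq hz)))
  have hint : ∀ k ∈ closedUpperHP, IntegrableOn (fun x : ℝ => Complex.exp (Complex.I * k * x) *
      (modJostDeriv q x k * modJost q x 0 + modJost q x k * modJostDeriv q x 0)) (Ioi 0) := by
    intro k hk
    refine hR.mono' (((hcP k hk).mono Ioi_subset_Ici_self).aestronglyMeasurable measurableSet_Ioi)
      ((ae_restrict_iff' measurableSet_Ioi).2 (ae_of_all _ fun x hx => ?_))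
    rw [norm_mul, Complex.norm_exp]
    refine (mul_le_of_le_one_left (norm_nonneg _) ?_).trans
      (integrableOn_modJost_prod_deriv hq hk hx)
    rw [Real.exp_le_one_iff]
    have := mul_nonneg ((closedUpperHP_def k).1 hk) (le_of_lt (show (0 : ℝ) < x from hx))
    simp
    linarith
  have hM0 : modJost q 0 0 = 0 := by rw [← jostFn_eq hq hz, h0]
  -- Integration by parts with no boundary term at 0, because m(0,0) = f(0) = 0.
  have hparts : ∀ k ∈ closedUpperHP, ∀ x : ℝ, 0 ≤ x →
      Complex.exp (Complex.I * k * x) * (modJost q x k * modJost q x 0) =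
      (Complex.I * k * ∫ t in (0 : ℝ)..x, jostSol q k t * jostSol q 0 t) +
        ∫ t in (0 : ℝ)..x, Complex.exp (Complex.I * k * t) *
      (modJostDeriv q t k * modJost q t 0 + modJost q t k * modJostDeriv q t 0) := by
    intro k hk x hx
    have hge : ∀ t ∈ uIcc 0 x, 0 ≤ t := fun t ht => by rw [uIcc_of_le hx] at ht; exact ht.1
    have i1 : IntervalIntegrable (fun t => Complex.I * k * (jostSol q k t * jostSol q 0 t))
        volume 0 x :=
      (continuousOn_const.mul (((isSolution_jostSol hq hk).continuousOn.mono hge).mul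
        ((isSolution_jostSol hq hz).continuousOn.mono hge))).intervalIntegrable
    have i2 := ((hcP k hk).mono hge).intervalIntegrable (μ := volume)
    rw [← intervalIntegral.integral_const_mul, ← intervalIntegral.integral_add i1 i2,
      intervalIntegral.integral_eq_sub_of_hasDerivAt (f := fun x : ℝ =>
        Complex.exp (Complex.I * k * x) * (modJost q x k * modJost q x 0)) (fun t ht => ?_)
        (i1.add i2)]
    · simp [hM0]
    · have ht0 : -1 < t := by linarith [hge t ht]
      refine ((hasDerivAt_exp_mul (Complex.I * k) t).mul
        ((hasDerivAt_modJost hq ht0 hk).mul (hasDerivAt_modJost hq ht0 hz))).congr_deriv ?_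
      simp only [jostSol, mul_zero, zero_mul, Complex.exp_zero, Pi.mul_apply]
      ring
  refine ⟨?_, ?_⟩
  · have hlim : ∀ x : ℝ, 0 ≤ x → jostFn q k * jostDeriv q 0 = Complex.exp (Complex.I * k * x) *
        (modJost q x k * modJostDeriv q x 0 - modJostDeriv q x k * modJost q x 0) -
        Complex.I * k * ∫ t in (0 : ℝ)..x, Complex.exp (Complex.I * k * t) *
        (modJostDeriv q t k * modJost q t 0 + modJost q t k * modJostDeriv q t 0) := by
      intro x hx
      have h1 := wronskian_sub hq (isSolution_jostSol hq hk) (isSolution_jostSol hq hz) le_rfl hx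
      rw [wronskian_jostSol hq hk hz hx, wronskian_jostSol_zero hq hk hz, h0] at h1
      have h2 := hparts k hk x hx
      simp only [add_zero] at h1
      linear_combination -h1 - Complex.I * k * h2 -
        k ^ 2 * (∫ t in (0 : ℝ)..x, jostSol q k t * jostSol q 0 t) * Complex.I_sq
    have hb : Tendsto (fun x : ℝ => Complex.exp (Complex.I * k * x) *
        (modJost q x k * modJostDeriv q x 0 - modJostDeriv q x k * modJost q x 0)) atTop (𝓝 0) := by
      have h3 := ((tendsto_modJost hq hk).mul (tendsto_modJostDeriv hq hz)).sub
        ((tendsto_modJostDeriv hq hk).mul (tendsto_modJost hq hz))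
      simp only [mul_zero, zero_mul, sub_zero] at h3
      refine squeeze_zero_norm' ?_ (tendsto_zero_iff_norm_tendsto_zero.1 h3)
      filter_upwards [eventually_ge_atTop 0] with x hx
      rw [norm_mul, Complex.norm_exp]
      refine mul_le_of_le_one_left (norm_nonneg _) ?_
      rw [Real.exp_le_one_iff]
      have := mul_nonneg ((closedUpperHP_def k).1 hk) hx
      simp
      linarith
    have h4 := hb.sub ((intervalIntegral_tendsto_integral_Ioi 0 (hint k hk)
      tendsto_id).const_mul (Complex.I * k))
    rw [zero_sub] at h4
    have h5 : Tendsto (fun _ : ℝ => jostFn q k * jostDeriv q 0) atTop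
        (𝓝 (jostFn q k * jostDeriv q 0)) := tendsto_const_nhds
    rw [neg_mul]
    refine tendsto_nhds_unique (h5.congr' ?_) h4
    filter_upwards [eventually_ge_atTop 0] with x hx using hlim x hx
  -- At k = 0 the integrand is the derivative of m(x,0)^2, which goes from 0 at x = 0 to 1 at
  -- infinity.
  · have h1 := intervalIntegral_tendsto_integral_Ioi 0 (hint 0 hz) tendsto_id
    simp only [mul_zero, zero_mul, Complex.exp_zero, one_mul, id] at h1
    have h2 := (tendsto_modJost hq hz).mul (tendsto_modJost hq hz)
    rw [one_mul] at h2
    refine tendsto_nhds_unique h1 (h2.congr' ?_)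
    filter_upwards [eventually_ge_atTop 0] with x hx
    have := hparts 0 hz x hx
    simpa using this

/-- The remainder integral P is continuous on the closed half-plane by domination with the tail of
|q|, and P(0) = 1. Therefore f(k)/k = -i P(k)/f'(0,0) has a limit. -/
theorem hasDerivWithinAt_jostFn_zero (h0 : jostFn q 0 = 0) :
    HasDerivWithinAt (jostFn q) (-Complex.I / jostDeriv q 0) closedUpperHP 0 := by
  have hz : (0 : ℂ) ∈ closedUpperHP := by simp [closedUpperHP_def]
  have hd0 := jostDeriv_ne_zero hq hz h0
  set P : ℂ → ℂ := fun k => ∫ x in Ioi (0 : ℝ), Complex.exp (Complex.I * k * x) *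
    (modJostDeriv q x k * modJost q x 0 + modJost q x k * modJostDeriv q x 0) with hP
  have hPc : ContinuousOn P closedUpperHP := by
    have hm : ∀ k ∈ closedUpperHP, ContinuousOn (fun x => modJost q x k) (Ici 0) := fun k hk =>
      (continuousOn_modJost_left hq hk).mono (Ici_subset_Ici.2 (by norm_num))
    refine continuousOn_of_dominated (bound := fun x => 2 * Real.exp (∫ t, weight q t) ^ 2 *
      ∫ t in Ioi x, |zeroExt q t|) (fun k hk => ?_) (fun k hk => ?_)
      ((integrableOn_tail_abs hq).const_mul _) ?_
    · refine ContinuousOn.aestronglyMeasurable (ContinuousOn.mono (s := Ici 0) ?_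
        Ioi_subset_Ici_self) measurableSet_Ioi
      exact (Continuous.continuousOn (by fun_prop)).mul
        (((continuousOn_modJostDeriv_left hq hk).mul (hm 0 hz)).add
          ((hm k hk).mul (continuousOn_modJostDeriv_left hq hz)))
    · refine (ae_restrict_iff' measurableSet_Ioi).2 (ae_of_all _ fun x hx => ?_)
      rw [norm_mul, Complex.norm_exp]
      refine (mul_le_of_le_one_left (norm_nonneg _) ?_).trans
        (integrableOn_modJost_prod_deriv hq hk hx)
      rw [Real.exp_le_one_iff]
      have := mul_nonneg ((closedUpperHP_def k).1 hk) (le_of_lt (show (0 : ℝ) < x from hx))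
      simp
      linarith
    · refine (ae_restrict_iff' measurableSet_Ioi).2 (ae_of_all _ fun x hx => ?_)
      have hx0 : 0 < x := hx
      exact (Continuous.continuousOn (by fun_prop)).mul
        (((continuousOn_modJostDeriv hq x).mul continuousOn_const).add
          ((continuousOn_modJost_right hq (by linarith)).mul continuousOn_const))
  have hP0 : P 0 = 1 := by
    simp only [hP, mul_zero, zero_mul, Complex.exp_zero, one_mul]
    exact (jostFn_mul_jostDeriv_zero hq h0 hz).2
  rw [hasDerivWithinAt_iff_tendsto_slope]
  have h1 : Tendsto (fun k => -Complex.I * P k / jostDeriv q 0) (𝓝[closedUpperHP \ {0}] 0)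
      (𝓝 (-Complex.I / jostDeriv q 0)) := by
    have := (((hPc 0 hz).mono (sdiff_subset (t := {0}))).tendsto.const_mul (-Complex.I)).div_const
      (jostDeriv q 0)
    rwa [hP0, mul_one] at this
  refine h1.congr' ?_
  filter_upwards [self_mem_nhdsWithin] with k hk
  have hk0 : k ≠ 0 := hk.2
  rw [slope_def_field, h0, sub_zero, sub_zero, div_eq_div_iff hd0 hk0,
    (jostFn_mul_jostDeriv_zero hq h0 hk.1).1]
  ring

omit hq in
theorem uniqueDiffWithinAt_closedUpperHP : UniqueDiffWithinAt ℂ closedUpperHP 0 := by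
  have : UniqueDiffWithinAt ℝ closedUpperHP (0 : ℂ) := by
    refine uniqueDiffOn_convex (convex_halfSpace_im_ge 0) ?_ 0 (by simp)
    exact ⟨Complex.I, mem_interior_iff_mem_nhds.2 (mem_of_superset
      (isOpen_openUpperHP.mem_nhds (by simp [openUpperHP])) openUpperHP_subset)⟩
  exact this.mono_field

theorem jostDot_zero (h0 : jostFn q 0 = 0) : jostDot q 0 = -Complex.I / jostDeriv q 0 :=
  (hasDerivWithinAt_jostFn_zero hq h0).derivWithin uniqueDiffWithinAt_closedUpperHP

theorem eventually_jostFn_ne_zero : ∀ᶠ k in 𝓝[closedUpperHP \ {0}] (0 : ℂ), jostFn q k ≠ 0 := by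
  have hz : (0 : ℂ) ∈ closedUpperHP := by simp [closedUpperHP_def]
  by_cases h0 : jostFn q 0 = 0
  · have h1 := hasDerivWithinAt_iff_tendsto_slope.1 (hasDerivWithinAt_jostFn_zero hq h0)
    have h2 := h1.eventually_ne (div_ne_zero (neg_ne_zero.2 Complex.I_ne_zero)
      (jostDeriv_ne_zero hq hz h0))
    filter_upwards [h2] with k hk hf
    refine hk ?_
    rw [slope_def_field, hf, h0, sub_zero, zero_div]
  · exact (((continuousOn_jostFn hq) 0 hz).mono sdiff_subset).eventually_ne h0

/-- The zeros stay away from 0 by the behaviour of f there, and stay bounded because |k||f(k) - 1|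
is bounded. An accumulation point on the compact interval left over would itself be a zero, and it
would be simple, hence isolated. -/
theorem finite_boundStates : (boundStates q).Finite := by
  have hlow : ∃ r > 0, ∀ κ ∈ boundStates q, r ≤ κ := by
    have h1 := eventually_jostFn_ne_zero hq
    rw [eventually_nhdsWithin_iff, Metric.eventually_nhds_iff] at h1
    obtain ⟨r, hr, h⟩ := h1
    refine ⟨r, hr, fun κ hκ => not_lt.1 fun hlt => ?_⟩
    have hm := I_mul_mem_openUpperHP hκ.1
    refine h (y := Complex.I * κ) ?_ ⟨openUpperHP_subset hm, ?_⟩ ((mem_boundStates_iff hq hκ.1).1 hκ)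
    · rw [dist_zero_right, norm_mul, Complex.norm_I, one_mul, Complex.norm_real,
        Real.norm_of_nonneg hκ.1.le]
      exact hlt
    · intro h0
      have : (κ : ℂ) ≠ 0 := by exact_mod_cast hκ.1.ne'
      simp [this] at h0
  have hup : ∃ R, ∀ κ ∈ boundStates q, κ ≤ R := by
    obtain ⟨C, hC⟩ := exists_norm_mul_norm_jostFn_sub_one_le hq
    refine ⟨C, fun κ hκ => ?_⟩
    have := hC _ (openUpperHP_subset (I_mul_mem_openUpperHP hκ.1))
    rw [(mem_boundStates_iff hq hκ.1).1 hκ, norm_mul, Complex.norm_I, one_mul, Complex.norm_real,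
        Real.norm_of_nonneg hκ.1.le] at this
    simpa using this
  obtain ⟨r, hr, hlow⟩ := hlow
  obtain ⟨R, hup⟩ := hup
  by_contra hinf
  obtain ⟨κ₀, hκ₀, hacc⟩ := Set.Infinite.exists_accPt_of_subset_isCompact (s := boundStates q)
    hinf (isCompact_Icc (a := r) (b := R)) fun κ hκ => ⟨hlow κ hκ, hup κ hκ⟩
  have hpos : 0 < κ₀ := hr.trans_le hκ₀.1
  have hm := I_mul_mem_openUpperHP hpos
  have hcont : ContinuousAt (jostFn q) (Complex.I * κ₀) :=
    ((differentiableOn_jostFn hq).differentiableAt (isOpen_openUpperHP.mem_nhds hm)).continuousAt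
  have hmap : Tendsto (fun κ : ℝ => Complex.I * (κ : ℂ)) (𝓝[≠] κ₀) (𝓝[≠] (Complex.I * κ₀)) := by
    refine tendsto_nhdsWithin_iff.2 ⟨tendsto_nhdsWithin_of_tendsto_nhds
      (Continuous.tendsto (by fun_prop) κ₀), ?_⟩
    filter_upwards [self_mem_nhdsWithin] with κ hκ h
    refine hκ ?_
    have := mul_left_cancel₀ Complex.I_ne_zero h
    exact_mod_cast this
  rw [accPt_iff_frequently_nhdsNE] at hacc
  have hfreq : ∃ᶠ z in 𝓝[≠] (Complex.I * κ₀), jostFn q z = 0 :=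
    hmap.frequently (hacc.mono fun κ hκ => (mem_boundStates_iff hq hκ.1).1 hκ)
  have h0 : jostFn q (Complex.I * κ₀) = 0 := by
    by_contra hne
    exact hfreq ((hcont.eventually_ne hne).filter_mono nhdsWithin_le_nhds)
  have hmem := (mem_boundStates_iff hq hpos).2 h0
  have hd := ((differentiableOn_jostFn hq).differentiableAt
    (isOpen_openUpperHP.mem_nhds hm)).hasDerivAt
  have hne : deriv (jostFn q) (Complex.I * κ₀) ≠ 0 := by
    rw [← jostDot_eq_deriv hm]; exact jostDot_ne_zero hq hmem
  exact hfreq ((hd.eventually_ne hne).mono fun z hz => hz)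

theorem isJostClass_jostFn : IsJostClass (boundStates q) (jostFn q) where
  continuousOn := continuousOn_jostFn hq
  differentiableOn := differentiableOn_jostFn hq
  tendsto_one := tendsto_jostFn hq
  zero_iff _ hz hz0 := jostFn_eq_zero_iff hq hz hz0
  simple κ hκ := by
    rw [← jostDot_eq_deriv (I_mul_mem_openUpperHP hκ.1)]; exact jostDot_ne_zero hq hκ
  simple_at_zero h0 := ⟨_, div_ne_zero (neg_ne_zero.2 Complex.I_ne_zero)
    (jostDeriv_ne_zero hq (by simp [closedUpperHP_def]) h0), hasDerivWithinAt_jostFn_zero hq h0⟩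

/-! ### The function I: boundary values, poles and residues -/

theorem iFun_neg (k : ℝ) : iFun q (-(k : ℂ)) = starRingEnd ℂ (iFun q k) := by
  rw [iFun, iFun, jostDeriv_neg_ofReal hq, jostFn_neg_ofReal hq, map_div₀]

/-- Over the common denominator f(k)f(-k) = |f(k)|^2 the numerator is a Wronskian, equal to 2ik. -/
theorem iFun_sub_iFun_neg {k : ℝ} (hk : k ≠ 0) :
    iFun q k - iFun q (-(k : ℂ)) = 2 * Complex.I * k / (‖jostFn q k‖ : ℂ) ^ 2 := by
  have h0 := jostFn_ofReal_ne_zero hq hk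
  have h1 : jostFn q (-(k : ℂ)) ≠ 0 := by
    rw [jostFn_neg_ofReal hq]; exact (map_ne_zero _).2 h0
  rw [← Complex.mul_conj', ← jostFn_neg_ofReal hq, iFun, iFun, div_sub_div _ _ h0 h1]
  congr 1
  linear_combination -(jost_wronskian_real hq k)

theorem iFun_im {k : ℝ} (hk : k ≠ 0) : (iFun q k).im = k / ‖jostFn q k‖ ^ 2 := by
  have h := iFun_sub_iFun_neg hq hk
  rw [iFun_neg hq, Complex.sub_conj] at h
  have h2 : ((2 * (iFun q k).im : ℝ) : ℂ) = ((2 * (k / ‖jostFn q k‖ ^ 2) : ℝ) : ℂ) := by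
    refine mul_right_cancel₀ Complex.I_ne_zero ?_
    rw [h]; push_cast; ring
  have h3 := Complex.ofReal_injective h2
  linarith

theorem gFun_eq {k : ℝ} (hk : k ≠ 0) : gFun q k = ‖jostFn q k‖ ^ 2 := by
  have h0 : ‖jostFn q k‖ ≠ 0 := norm_ne_zero_iff.2 (jostFn_ofReal_ne_zero hq hk)
  rw [gFun, iFun_im hq hk]
  field_simp

theorem gFun_pos {k : ℝ} (hk : k ≠ 0) : 0 < gFun q k := by
  rw [gFun_eq hq hk]
  have h0 : ‖jostFn q k‖ ≠ 0 := norm_ne_zero_iff.2 (jostFn_ofReal_ne_zero hq hk)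
  positivity

theorem jostFn_mul_jostFn_neg {k : ℝ} (hk : k ≠ 0) :
    jostFn q k * jostFn q (-(k : ℂ)) = gFun q k := by
  rw [jostFn_neg_ofReal hq, Complex.mul_conj', gFun_eq hq hk]
  push_cast; rfl

theorem continuousWithinAt_iFun {k : ℝ} (hk : k ≠ 0) :
    ContinuousWithinAt (iFun q) closedUpperHP k :=
  (continuousOn_jostDeriv hq k (ofReal_mem_closedUpperHP k)).div
    (continuousOn_jostFn hq k (ofReal_mem_closedUpperHP k)) (jostFn_ofReal_ne_zero hq hk)

theorem analyticAt_jostFn {z : ℂ} (hz : z ∈ openUpperHP) : AnalyticAt ℂ (jostFn q) z :=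
  (differentiableOn_jostFn hq).analyticAt (isOpen_openUpperHP.mem_nhds hz)

theorem analyticAt_jostDeriv {z : ℂ} (hz : z ∈ openUpperHP) : AnalyticAt ℂ (jostDeriv q) z :=
  (differentiableOn_jostDeriv hq).analyticAt (isOpen_openUpperHP.mem_nhds hz)

theorem meromorphicOn_iFun : MeromorphicOn (iFun q) openUpperHP := fun _ hz =>
  (analyticAt_jostDeriv hq hz).meromorphicAt.div (analyticAt_jostFn hq hz).meromorphicAt

omit hq in
theorem ne_zero_of_mem_openUpperHP {z : ℂ} (hz : z ∈ openUpperHP) : z ≠ 0 := by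
  rintro rfl
  simp [openUpperHP] at hz

theorem analyticAt_iFun {z : ℂ} (hz : z ∈ openUpperHP)
    (h : ¬ ∃ κ ∈ boundStates q, z = Complex.I * κ) : AnalyticAt ℂ (iFun q) z :=
  (analyticAt_jostDeriv hq hz).div (analyticAt_jostFn hq hz) fun h0 =>
    h ((jostFn_eq_zero_iff hq (openUpperHP_subset hz) (ne_zero_of_mem_openUpperHP hz)).1 h0)

/-- The denominator has a simple zero, and the numerator is nonzero because a nontrivial solution
cannot vanish together with its derivative. -/
theorem meromorphicOrderAt_iFun {κ : ℝ} (hκ : κ ∈ boundStates q) :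
    meromorphicOrderAt (iFun q) (Complex.I * κ) = ((-1 : ℤ) : WithTop ℤ) := by
  have hm := I_mul_mem_openUpperHP hκ.1
  have h0 := (mem_boundStates_iff hq hκ.1).1 hκ
  have h1 : meromorphicOrderAt (jostDeriv q) (Complex.I * κ) = 0 := by
    rw [(analyticAt_jostDeriv hq hm).meromorphicOrderAt_eq,
      (analyticAt_jostDeriv hq hm).analyticOrderAt_eq_zero.2
        (jostDeriv_ne_zero hq (openUpperHP_subset hm) h0)]
    rfl
  have h2 : meromorphicOrderAt (jostFn q) (Complex.I * κ) = ((1 : ℤ) : WithTop ℤ) := by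
    have h3 := (analyticAt_jostFn hq hm).analyticOrderAt_sub_eq_one_of_deriv_ne_zero (by
      rw [← jostDot_eq_deriv hm]; exact jostDot_ne_zero hq hκ)
    simp only [h0, sub_zero] at h3
    rw [(analyticAt_jostFn hq hm).meromorphicOrderAt_eq, h3]
    rfl
  unfold iFun
  rw [show (fun k => jostDeriv q k / jostFn q k) = jostDeriv q * (jostFn q)⁻¹ from
      funext fun k => div_eq_mul_inv _ _, meromorphicOrderAt_mul
        (analyticAt_jostDeriv hq hm).meromorphicAt (analyticAt_jostFn hq hm).meromorphicAt.inv,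
    meromorphicOrderAt_inv, h1, h2, zero_add]
  rfl

theorem tendsto_residue_iFun {κ : ℝ} (hκ : κ ∈ boundStates q) :
    Tendsto (fun z => (z - Complex.I * κ) * iFun q z) (𝓝[≠] (Complex.I * κ))
      (𝓝 (iRes q κ)) := by
  have hm := I_mul_mem_openUpperHP hκ.1
  have h0 := (mem_boundStates_iff hq hκ.1).1 hκ
  have hd := ((differentiableOn_jostFn hq).differentiableAt
    (isOpen_openUpperHP.mem_nhds hm)).hasDerivAt.tendsto_slope
  rw [← jostDot_eq_deriv hm] at hd
  have h1 : Tendsto (jostDeriv q) (𝓝[≠] (Complex.I * κ)) (𝓝 (jostDeriv q (Complex.I * κ))) :=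
    tendsto_nhdsWithin_of_tendsto_nhds (analyticAt_jostDeriv hq hm).continuousAt
  refine (h1.div hd (jostDot_ne_zero hq hκ)).congr' ?_
  filter_upwards [self_mem_nhdsWithin] with z hz
  have hz' : z - Complex.I * κ ≠ 0 := sub_ne_zero.2 hz
  simp only [Pi.div_apply]
  rw [slope_def_field, h0, sub_zero, iFun, div_div_eq_mul_div]
  ring

/-- Since the residue is f'/ḟ, the product ḟ f' from Green's identity equals ḟ^2 times the residue.
-/
theorem normingConst_formula {κ : ℝ} (hκ : κ ∈ boundStates q) : (normingConst q κ : ℂ) =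
    -(2 * Complex.I * κ) / (jostDot q (Complex.I * κ) ^ 2 * iRes q κ) := by
  have h1 := jostDot_mul_jostDeriv hq hκ
  have h2 : (normingConst q κ : ℂ) ≠ 0 := by exact_mod_cast (normingConst_pos hq hκ).ne'
  have h3 := jostDot_ne_zero hq hκ
  have h4 := jostDeriv_ne_zero hq (openUpperHP_subset (I_mul_mem_openUpperHP hκ.1))
    ((mem_boundStates_iff hq hκ.1).1 hκ)
  rw [iRes]
  rw [eq_div_iff h2] at h1
  rw [eq_div_iff (by positivity), ← h1]
  field_simp

theorem iRes_formula {κ : ℝ} (hκ : κ ∈ boundStates q) : iRes q κ =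
    -(2 * Complex.I * κ) / (jostDot q (Complex.I * κ) ^ 2 * normingConst q κ) := by
  have h1 := jostDot_mul_jostDeriv hq hκ
  have h2 : (normingConst q κ : ℂ) ≠ 0 := by exact_mod_cast (normingConst_pos hq hκ).ne'
  have h3 := jostDot_ne_zero hq hκ
  rw [iRes]
  rw [eq_div_iff h2] at h1
  rw [div_eq_div_iff h3 (by positivity), ← h1]
  ring

end

/-! ### Cauchy's theorem in the upper half-plane -/

theorem exp_mem_closedUpperHP {x y : ℝ} (h0 : 0 ≤ y) (hπ : y ≤ Real.pi) :
    Complex.exp (x + y * Complex.I) ∈ closedUpperHP \ {0} := by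
  refine ⟨?_, Complex.exp_ne_zero _⟩
  rw [closedUpperHP_def, Complex.exp_im]
  simp only [Complex.add_re, Complex.ofReal_re, Complex.mul_re, Complex.I_re, mul_zero,
    Complex.ofReal_im, Complex.I_im, mul_one, sub_self, add_zero, Complex.add_im, Complex.mul_im,
    zero_add]
  exact mul_nonneg (Real.exp_pos _).le (Real.sin_nonneg_of_nonneg_of_le_pi h0 hπ)

theorem exp_mem_openUpperHP {z : ℂ} (h0 : 0 < z.im) (hπ : z.im < Real.pi) :
    Complex.exp z ∈ openUpperHP := by
  show 0 < (Complex.exp z).im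
  rw [Complex.exp_im]
  exact mul_pos (Real.exp_pos _) (Real.sin_pos_of_pos_of_lt_pi h0 hπ)

/-- The point `r e^{iθ}`. -/
def polar (r θ : ℝ) : ℂ := r * Complex.exp (θ * Complex.I)

theorem polar_eq_exp {r : ℝ} (hr : 0 < r) (θ : ℝ) :
    polar r θ = Complex.exp ((Real.log r : ℝ) + θ * Complex.I) := by
  rw [Complex.exp_add, ← Complex.ofReal_exp, Real.exp_log hr, polar]

theorem polar_mem {r θ : ℝ} (hr : 0 < r) (h0 : 0 ≤ θ) (hπ : θ ≤ Real.pi) :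
    polar r θ ∈ closedUpperHP \ {0} := by
  rw [polar_eq_exp hr]; exact exp_mem_closedUpperHP h0 hπ

theorem norm_polar {r : ℝ} (hr : 0 < r) (θ : ℝ) : ‖polar r θ‖ = r := by
  rw [polar, norm_mul, Complex.norm_exp_ofReal_mul_I, mul_one, Complex.norm_real,
    Real.norm_of_nonneg hr.le]

@[fun_prop]
theorem continuous_polar (r : ℝ) : Continuous (polar r) := by unfold polar; fun_prop

theorem ofReal_mem_punctured {t : ℝ} (ht : t ≠ 0) : (t : ℂ) ∈ closedUpperHP \ {0} :=
  ⟨ofReal_mem_closedUpperHP t, by simpa using ht⟩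

theorem neg_ofReal_mem_punctured {t : ℝ} (ht : t ≠ 0) : -(t : ℂ) ∈ closedUpperHP \ {0} :=
  ⟨neg_ofReal_mem_closedUpperHP t, by simpa using ht⟩

/-- Cauchy's theorem for a half-annulus. -/
theorem integral_half_annulus {K : ℂ → ℂ} (hK : ContinuousOn K (closedUpperHP \ {0}))
    (hd : DifferentiableOn ℂ K openUpperHP) {ε N : ℝ} (hε : 0 < ε) (hN : ε ≤ N) :
    ∫ t in ε..N, (K t + K (-(t : ℂ))) = Complex.I *
      ((∫ θ in (0 : ℝ)..Real.pi, K (polar ε θ) * polar ε θ) -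
        ∫ θ in (0 : ℝ)..Real.pi, K (polar N θ) * polar N θ) := by
  have hN0 : 0 < N := hε.trans_le hN
  have hlog : Real.log ε ≤ Real.log N := Real.log_le_log hε hN
  have hπ := Real.pi_pos.le
  have hmaps : MapsTo Complex.exp (uIcc (Real.log ε) (Real.log N) ×ℂ uIcc 0 Real.pi)
      (closedUpperHP \ {0}) := by
    intro z hz
    have h2 : z.im ∈ Icc 0 Real.pi := by
      have := hz.2
      rwa [mem_preimage, uIcc_of_le hπ] at this
    have := exp_mem_closedUpperHP (x := z.re) h2.1 h2.2
    rwa [Complex.re_add_im] at this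
  -- The exponential maps the rectangle [log ε, log N] × [0, π] onto the half-annulus. The lower
  -- side becomes the positive axis, the upper side the negative axis, and the vertical sides the
  -- two arcs.
  have key := Complex.integral_boundary_rect_eq_zero_of_continuousOn_of_differentiableOn
    (fun ζ => K (Complex.exp ζ) * Complex.exp ζ) (⟨Real.log ε, 0⟩ : ℂ) ⟨Real.log N, Real.pi⟩
    ((hK.comp Complex.continuous_exp.continuousOn hmaps).mul
      Complex.continuous_exp.continuousOn)
    (by
      refine DifferentiableOn.mul (hd.comp Complex.differentiable_exp.differentiableOn ?_)
        Complex.differentiable_exp.differentiableOn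
      intro z hz
      have h2 := hz.2
      simp only [min_eq_left hπ, max_eq_right hπ, mem_preimage] at h2
      exact exp_mem_openUpperHP h2.1 h2.2)
  simp only [Complex.ofReal_zero, zero_mul, add_zero, smul_eq_mul] at key
  have hsub : ∀ g : ℝ → ℂ, ContinuousOn g (Ioi 0) →
      ∫ x in Real.log ε..Real.log N, g (Real.exp x) * (Real.exp x : ℂ) = ∫ t in ε..N, g t := by
    intro g hg
    have h1 := intervalIntegral.integral_deriv_smul_comp' (a := Real.log ε) (b := Real.log N)
      (f := Real.exp) (f' := Real.exp) (g := g) (fun x _ => Real.hasDerivAt_exp x)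
      Real.continuous_exp.continuousOn (hg.mono (by
        rintro _ ⟨x, -, rfl⟩; exact Real.exp_pos x))
    rw [Real.exp_log hε, Real.exp_log hN0] at h1
    rw [← h1]
    refine intervalIntegral.integral_congr fun x _ => ?_
    simp [mul_comm]
  have c1 : ContinuousOn (fun t : ℝ => K t) (Ioi 0) := hK.comp (by fun_prop)
    fun t (ht : 0 < t) => ofReal_mem_punctured ht.ne'
  have c2 : ContinuousOn (fun t : ℝ => K (-(t : ℂ))) (Ioi 0) := hK.comp (by fun_prop)
    fun t (ht : 0 < t) => neg_ofReal_mem_punctured ht.ne'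
  have b1 : ∫ x : ℝ in Real.log ε..Real.log N, K (Complex.exp x) * Complex.exp x =
      ∫ t in ε..N, K t := by
    rw [← hsub _ c1]
    refine intervalIntegral.integral_congr fun x _ => ?_
    simp only [Complex.ofReal_exp]
  have b2 : ∫ x : ℝ in Real.log ε..Real.log N, K (Complex.exp (x + Real.pi * Complex.I)) *
      Complex.exp (x + Real.pi * Complex.I) = -∫ t in ε..N, K (-(t : ℂ)) := by
    rw [← hsub _ c2, ← intervalIntegral.integral_neg]
    refine intervalIntegral.integral_congr fun x _ => ?_
    simp only [Complex.ofReal_exp, Complex.exp_add, Complex.exp_pi_mul_I, mul_neg, mul_one]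
  have b3 : ∀ r : ℝ, 0 < r → ∫ y : ℝ in (0 : ℝ)..Real.pi,
      K (Complex.exp ((Real.log r : ℝ) + y * Complex.I)) *
      Complex.exp ((Real.log r : ℝ) + y * Complex.I) =
      ∫ θ in (0 : ℝ)..Real.pi, K (polar r θ) * polar r θ := by
    intro r hr
    refine intervalIntegral.integral_congr fun x _ => ?_
    simp only [polar_eq_exp hr]
  rw [b1, b2, b3 N hN0, b3 ε hε] at key
  rw [intervalIntegral.integral_add]
  · linear_combination key
  · exact (c1.mono fun t ht => by
      rw [uIcc_of_le hN] at ht; exact hε.trans_le ht.1).intervalIntegrable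
  · exact (c2.mono fun t ht => by
      rw [uIcc_of_le hN] at ht; exact hε.trans_le ht.1).intervalIntegrable

/-- The contribution of a half-circle in the limit. -/
theorem tendsto_integral_arc {K : ℂ → ℂ} (hK : ContinuousOn K (closedUpperHP \ {0}))
    {a : ℂ} {l : Filter ℝ} {m : Filter ℂ} (hl : ∀ᶠ r in l, 0 < r)
    (hm : Tendsto (fun w => w * K w) m (𝓝 a))
    (hlm : ∀ s ∈ m, ∀ᶠ r in l, ∀ θ ∈ Icc 0 Real.pi, polar r θ ∈ s) :
    Tendsto (fun r => ∫ θ in (0 : ℝ)..Real.pi, K (polar r θ) * polar r θ) l (𝓝 (Real.pi * a)) := by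
  rw [Metric.tendsto_nhds]
  intro δ hδ
  have hδ' : 0 < δ / (2 * Real.pi) := by positivity
  filter_upwards [hlm _ (hm (Metric.ball_mem_nhds a hδ')), hl] with r hr hr0
  have hc : ContinuousOn (fun θ => K (polar r θ) * polar r θ) (uIcc 0 Real.pi) := by
    refine ContinuousOn.mul (hK.comp (by fun_prop) fun θ hθ => ?_) (by fun_prop)
    rw [uIcc_of_le Real.pi_pos.le] at hθ
    exact polar_mem hr0 hθ.1 hθ.2
  have h1 : (∫ θ in (0 : ℝ)..Real.pi, K (polar r θ) * polar r θ) - Real.pi * a =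
      ∫ θ in (0 : ℝ)..Real.pi, (K (polar r θ) * polar r θ - a) := by
    rw [intervalIntegral.integral_sub hc.intervalIntegrable intervalIntegrable_const]
    simp
  rw [dist_eq_norm, h1]
  have h2 := intervalIntegral.norm_integral_le_of_norm_le_const (a := 0) (b := Real.pi)
    (f := fun θ => K (polar r θ) * polar r θ - a) (C := δ / (2 * Real.pi)) (fun θ hθ => by
      rw [uIoc_of_le Real.pi_pos.le] at hθ
      have := hr θ ⟨hθ.1.le, hθ.2⟩
      rw [mem_preimage, Metric.mem_ball, dist_eq_norm, mul_comm] at this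
      exact this.le)
  refine h2.trans_lt ?_
  rw [sub_zero, abs_of_pos Real.pi_pos]
  have := Real.pi_pos
  field_simp
  norm_num

theorem eventually_polar_mem_nhds_zero {s : Set ℂ} (hs : s ∈ 𝓝[closedUpperHP \ {0}] (0 : ℂ)) :
    ∀ᶠ r in 𝓝[>] (0 : ℝ), ∀ θ ∈ Icc 0 Real.pi, polar r θ ∈ s := by
  rw [Metric.mem_nhdsWithin_iff] at hs
  obtain ⟨δ, hδ, hs⟩ := hs
  filter_upwards [Ioo_mem_nhdsGT hδ] with r hr θ hθ
  refine hs ⟨?_, polar_mem hr.1 hθ.1 hθ.2⟩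
  rw [mem_ball_zero_iff, norm_polar hr.1]
  exact hr.2

theorem eventually_polar_mem_cobounded {s : Set ℂ}
    (hs : s ∈ Bornology.cobounded ℂ ⊓ 𝓟 closedUpperHP) :
    ∀ᶠ r in (atTop : Filter ℝ), ∀ θ ∈ Icc 0 Real.pi, polar r θ ∈ s := by
  rw [mem_inf_principal, ← comap_norm_atTop, mem_comap] at hs
  obtain ⟨t, ht, hs⟩ := hs
  filter_upwards [ht, eventually_gt_atTop 0] with r hr hr0 θ hθ
  refine hs ?_ (polar_mem hr0 hθ.1 hθ.2).1
  rw [mem_preimage, norm_polar hr0]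
  exact hr

theorem eventually_annulus :
    ∀ᶠ e : ℝ × ℝ in 𝓝[>] 0 ×ˢ atTop, e.1 ∈ Ioo (0 : ℝ) 1 ∧ 1 < e.2 := by
  have h : ∀ᶠ x in 𝓝[>] (0 : ℝ), x ∈ Ioo (0 : ℝ) 1 := Ioo_mem_nhdsGT one_pos
  exact Eventually.prod_mk h (eventually_gt_atTop 1)

/-- The symmetric integral over the real line of a function analytic in the upper half-plane. -/
theorem tendsto_integral_symm {K : ℂ → ℂ} (hK : ContinuousOn K (closedUpperHP \ {0}))
    (hd : DifferentiableOn ℂ K openUpperHP) {a b : ℂ}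
    (ha : Tendsto (fun w => w * K w) (𝓝[closedUpperHP \ {0}] 0) (𝓝 a))
    (hb : Tendsto (fun w => w * K w) (Bornology.cobounded ℂ ⊓ 𝓟 closedUpperHP) (𝓝 b)) :
    Tendsto (fun e : ℝ × ℝ => ∫ t in e.1..e.2, (K t + K (-(t : ℂ)))) (𝓝[>] 0 ×ˢ atTop)
      (𝓝 (Complex.I * Real.pi * (a - b))) := by
  have h1 := tendsto_integral_arc hK self_mem_nhdsWithin ha
    fun s hs => eventually_polar_mem_nhds_zero hs
  have h2 := tendsto_integral_arc hK (eventually_gt_atTop 0) hb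
    fun s hs => eventually_polar_mem_cobounded hs
  have h3 := ((h1.comp tendsto_fst).sub (h2.comp tendsto_snd) :
    Tendsto _ (𝓝[>] (0 : ℝ) ×ˢ (atTop : Filter ℝ)) _).const_mul Complex.I
  have e : Complex.I * Real.pi * (a - b) = Complex.I * (Real.pi * a - Real.pi * b) := by ring
  rw [e]
  refine h3.congr' ?_
  filter_upwards [eventually_annulus] with e he
  exact (integral_half_annulus hK hd he.1.1 (he.1.2.le.trans he.2.le)).symm

theorem annulus_eq {ε N : ℝ} (hε : 0 < ε) :
    {t : ℝ | ε < |t| ∧ |t| < N} = Ioo (-N) (-ε) ∪ Ioo ε N := by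
  ext t
  simp only [mem_ofPred_eq, mem_union, mem_Ioo, lt_abs, abs_lt]
  constructor
  · rintro ⟨h1 | h1, h2, h3⟩
    · exact Or.inr ⟨h1, h3⟩
    · exact Or.inl ⟨h2, by linarith⟩
  · rintro (⟨h1, h2⟩ | ⟨h1, h2⟩)
    · exact ⟨Or.inr (by linarith), h1, by linarith⟩
    · exact ⟨Or.inl h1, by linarith, h2⟩

theorem setIntegral_annulus {F : ℝ → ℂ} (hF : ContinuousOn F {0}ᶜ) {ε N : ℝ} (hε : 0 < ε)
    (hN : ε ≤ N) :
    ∫ t in {t : ℝ | ε < |t| ∧ |t| < N}, F t = ∫ t in ε..N, (F t + F (-t)) := by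
  have i1 : IntegrableOn F (Icc ε N) := (hF.mono fun t ht => by
    have : 0 < t := hε.trans_le ht.1
    simpa using this.ne').integrableOn_Icc
  have i2 : IntegrableOn F (Icc (-N) (-ε)) := (hF.mono fun t ht => by
    have : t < 0 := by linarith [ht.2]
    simpa using this.ne).integrableOn_Icc
  have i1' : IntervalIntegrable F volume ε N :=
    (intervalIntegrable_iff_integrableOn_Icc_of_le hN).2 i1
  have i2' : IntervalIntegrable F volume (-N) (-ε) :=
    (intervalIntegrable_iff_integrableOn_Icc_of_le (by linarith)).2 i2
  rw [annulus_eq hε, setIntegral_union _ measurableSet_Ioo (i2.mono_set Ioo_subset_Icc_self)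
    (i1.mono_set Ioo_subset_Icc_self), intervalIntegral.integral_add i1' (by
      have := ((IntervalIntegrable.iff_comp_neg).1 i2').symm
      simpa using this),
    intervalIntegral.integral_comp_neg, intervalIntegral.integral_of_le hN,
    intervalIntegral.integral_of_le (by linarith : -N ≤ -ε), integral_Ioc_eq_integral_Ioo,
    integral_Ioc_eq_integral_Ioo, add_comm]
  rw [Set.disjoint_left]
  intro t ht ht'
  linarith [ht.2, ht'.1]

theorem add_ne_zero_of_mem {w z : ℂ} (hw : w ∈ closedUpperHP) (hz : z ∈ openUpperHP) :
    w + z ≠ 0 := by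
  intro h
  have h1 := congrArg Complex.im h
  have h2 : 0 ≤ w.im := hw
  have h3 : 0 < z.im := hz
  simp at h1
  linarith

theorem ofReal_sub_ne_zero {z : ℂ} (hz : z ∈ openUpperHP) (t : ℝ) : (t : ℂ) - z ≠ 0 := by
  intro h
  have h1 := congrArg Complex.im h
  have h3 : 0 < z.im := hz
  simp at h1
  linarith

theorem tendsto_div_add_cobounded (z : ℂ) :
    Tendsto (fun w => w / (w + z)) (Bornology.cobounded ℂ) (𝓝 1) := by
  have h1 : Tendsto (fun w : ℂ => (1 + z * w⁻¹)⁻¹) (Bornology.cobounded ℂ) (𝓝 (1 + z * 0)⁻¹) :=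
    ((tendsto_inv₀_cobounded.const_mul z).const_add 1).inv₀ (by simp)
  rw [mul_zero, add_zero, inv_one] at h1
  refine h1.congr' ?_
  have h2 : ∀ᶠ w : ℂ in Bornology.cobounded ℂ, 0 < ‖w‖ :=
    tendsto_norm_cobounded_atTop.eventually_gt_atTop 0
  filter_upwards [h2] with w hw
  have hw0 : w ≠ 0 := norm_pos_iff.1 hw
  rw [← div_eq_mul_inv, one_add_div hw0, inv_div]

/-- A function analytic in the upper half-plane, small at infinity and not too large at `0`, is
recovered from the even or odd part of its boundary values. -/
theorem tendsto_cauchy {G : ℂ → ℂ} (hG : ContinuousOn G (closedUpperHP \ {0}))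
    (hd : DifferentiableOn ℂ G openUpperHP)
    (h0 : Tendsto (fun w => w * G w) (𝓝[closedUpperHP \ {0}] 0) (𝓝 0))
    (hinf : Tendsto G (Bornology.cobounded ℂ ⊓ 𝓟 closedUpperHP) (𝓝 0)) (σ : ℂ)
    {z : ℂ} (hz : z ∈ openUpperHP) :
    Tendsto (fun e : ℝ × ℝ => ∫ t in {t : ℝ | e.1 < |t| ∧ |t| < e.2},
      (G t + σ * G (-(t : ℂ))) / (t - z)) (𝓝[>] 0 ×ˢ atTop)
      (𝓝 (2 * Real.pi * Complex.I * G z)) := by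
  have hz0 : z ≠ 0 := ne_zero_of_mem_openUpperHP hz
  have hopen : openUpperHP ⊆ closedUpperHP \ {0} := fun w hw =>
    ⟨openUpperHP_subset hw, ne_zero_of_mem_openUpperHP hw⟩
  have hnhds : closedUpperHP \ {0} ∈ 𝓝 z :=
    mem_of_superset (isOpen_openUpperHP.mem_nhds hz) hopen
  have hdz : DifferentiableAt ℂ G z := hd.differentiableAt (isOpen_openUpperHP.mem_nhds hz)
  have hid0 : Tendsto (fun w : ℂ => w) (𝓝[closedUpperHP \ {0}] 0) (𝓝 0) :=
    tendsto_nhdsWithin_of_tendsto_nhds tendsto_id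
  -- the difference quotient
  have t1 := tendsto_integral_symm (K := dslope G z) ((continuousOn_dslope hnhds).2 ⟨hG, hdz⟩)
    ((Complex.differentiableOn_dslope (isOpen_openUpperHP.mem_nhds hz)).2 hd)
    (a := 0) (b := -G z) (by
      have h1 : Tendsto (fun w => (w * G w - w * G z) / (w - z)) (𝓝[closedUpperHP \ {0}] 0)
          (𝓝 ((0 - 0 * G z) / (0 - z))) :=
        (h0.sub (hid0.mul_const (G z))).div (hid0.sub_const z) (by simpa using hz0)
      simp only [zero_mul, sub_zero, zero_div] at h1
      refine h1.congr' ?_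
      have : ∀ᶠ w in 𝓝[closedUpperHP \ {0}] (0 : ℂ), w ≠ z :=
        hid0.eventually_ne hz0.symm
      filter_upwards [this] with w hw
      rw [dslope_of_ne _ hw, slope_def_field]
      ring) (by
      have h1 := (hinf.sub_const (G z)).mul
        ((tendsto_div_add_cobounded (-z)).mono_left inf_le_left)
      rw [zero_sub, mul_one] at h1
      refine h1.congr' ?_
      have : ∀ᶠ w : ℂ in Bornology.cobounded ℂ ⊓ 𝓟 closedUpperHP, w ≠ z := by
        have h2 : ∀ᶠ w : ℂ in Bornology.cobounded ℂ ⊓ 𝓟 closedUpperHP, ‖z‖ < ‖w‖ :=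
          (tendsto_norm_cobounded_atTop.mono_left inf_le_left).eventually_gt_atTop _
        filter_upwards [h2] with w hw h
        rw [h] at hw; exact lt_irrefl _ hw
      filter_upwards [this] with w hw
      rw [dslope_of_ne _ hw, slope_def_field, ← sub_eq_add_neg]
      ring)
  have haddc : ContinuousOn (fun w : ℂ => w + z) (closedUpperHP \ {0}) := by fun_prop
  -- the kernel with the pole in the lower half-plane
  have t2 := tendsto_integral_symm (K := fun w => G w / (w + z))
    (hG.div haddc fun w hw => add_ne_zero_of_mem hw.1 hz)
    (hd.div (by fun_prop) fun w hw => add_ne_zero_of_mem (openUpperHP_subset hw) hz)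
    (a := 0) (b := 0) (by
      have h1 : Tendsto (fun w => w * G w / (w + z)) (𝓝[closedUpperHP \ {0}] 0)
          (𝓝 (0 / (0 + z))) := h0.div (hid0.add_const z) (by simpa using hz0)
      rw [zero_div] at h1
      exact h1.congr fun w => mul_div_assoc _ _ _) (by
      have h1 := hinf.mul ((tendsto_div_add_cobounded z).mono_left inf_le_left)
      rw [mul_one] at h1
      refine h1.congr fun w => ?_
      ring)
  -- This term compensates for the constant G(z) subtracted in the difference quotient. Its limit
  -- comes from the large arc, where w/(w+z) tends to 1.
  have t3 := tendsto_integral_symm (K := fun w => 1 / (w + z))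
    (continuousOn_const.div haddc fun w hw => add_ne_zero_of_mem hw.1 hz)
    ((differentiableOn_const 1).div (by fun_prop)
      fun w hw => add_ne_zero_of_mem (openUpperHP_subset hw) hz)
    (a := 0) (b := 1) (by
      have h1 : Tendsto (fun w => w / (w + z)) (𝓝[closedUpperHP \ {0}] 0)
          (𝓝 (0 / (0 + z))) := hid0.div (hid0.add_const z) (by simpa using hz0)
      rw [zero_div] at h1
      exact h1.congr fun w => by ring) (by
      refine ((tendsto_div_add_cobounded z).mono_left inf_le_left).congr fun w => ?_
      ring)
  -- The sum of the original integrand over t and -t splits as the difference quotient minus σ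
  -- G(w)/(w+z) minus G(z)/(w+z). The σ-term has limit 0, and the other two contribute iπ G(z) each.
  have hsum := (t1.sub (t2.const_mul σ)).sub (t3.const_mul (G z))
  have elim : Complex.I * Real.pi * (0 - -G z) - σ * (Complex.I * Real.pi * (0 - 0)) -
      G z * (Complex.I * Real.pi * (0 - 1)) = 2 * Real.pi * Complex.I * G z := by ring
  rw [elim] at hsum
  refine hsum.congr' ?_
  filter_upwards [eventually_annulus] with e he
  have hle : e.1 ≤ e.2 := he.1.2.le.trans he.2.le
  have hpos : ∀ t ∈ uIcc e.1 e.2, t ≠ 0 := fun t ht => by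
    rw [uIcc_of_le hle] at ht; exact (he.1.1.trans_le ht.1).ne'
  have r1 : ∀ {K : ℂ → ℂ}, ContinuousOn K (closedUpperHP \ {0}) →
      IntervalIntegrable (fun t : ℝ => K t + K (-(t : ℂ))) volume e.1 e.2 := fun {K} hK =>
    ((hK.comp (f := fun t : ℝ => (t : ℂ)) (by fun_prop) fun t ht =>
      ofReal_mem_punctured (hpos t ht)).add
    (hK.comp (f := fun t : ℝ => -(t : ℂ)) (by fun_prop) fun t ht =>
      neg_ofReal_mem_punctured (hpos t ht))).intervalIntegrable
  have hGr : ContinuousOn (fun t : ℝ => (G t + σ * G (-(t : ℂ))) / (t - z)) {0}ᶜ := by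
    refine ContinuousOn.div (ContinuousOn.add ?_ (continuousOn_const.mul ?_)) (by fun_prop)
      fun t _ => ofReal_sub_ne_zero hz t
    · exact hG.comp (f := fun t : ℝ => (t : ℂ)) (by fun_prop) fun t ht => ofReal_mem_punctured ht
    · exact hG.comp (f := fun t : ℝ => -(t : ℂ)) (by fun_prop)
        fun t ht => neg_ofReal_mem_punctured ht
  have i1 := r1 ((continuousOn_dslope hnhds).2 ⟨hG, hdz⟩)
  have i2 := (r1 (K := fun w => G w / (w + z))
    (hG.div haddc fun w hw => add_ne_zero_of_mem hw.1 hz)).const_mul σ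
  have i3 := (r1 (K := fun w => 1 / (w + z))
    (continuousOn_const.div haddc fun w hw => add_ne_zero_of_mem hw.1 hz)).const_mul (G z)
  rw [setIntegral_annulus hGr he.1.1 hle, ← intervalIntegral.integral_const_mul,
    ← intervalIntegral.integral_const_mul, ← intervalIntegral.integral_sub i1 i2,
    ← intervalIntegral.integral_sub (i1.sub i2) i3]
  refine intervalIntegral.integral_congr fun t ht => ?_
  have n1 := ofReal_sub_ne_zero hz t
  have n2 : (t : ℂ) + z ≠ 0 := add_ne_zero_of_mem (ofReal_mem_closedUpperHP t) hz
  have n3 : -(t : ℂ) + z ≠ 0 := add_ne_zero_of_mem (neg_ofReal_mem_closedUpperHP t) hz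
  have n4 : -(t : ℂ) - z ≠ 0 := by
    intro h; exact n2 (by linear_combination -h)
  simp only [Complex.ofReal_neg, neg_neg]
  rw [dslope_of_ne _ (sub_ne_zero.1 n1), dslope_of_ne _ (sub_ne_zero.1 n4), slope_def_field,
    slope_def_field]
  have e1 : -(t : ℂ) - z = -(t + z) := by ring
  have e2 : -(t : ℂ) + z = -(t - z) := by ring
  rw [e1, e2]
  field_simp
  ring

/-! ### Absolutely convergent Cauchy integrals and principal values -/

/-- The integrable majorant `|t|^{-1/2} / (1 + |t|)`. -/
def rootDecay (t : ℝ) : ℝ := (√|t|)⁻¹ * (1 + |t|)⁻¹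

theorem rootDecay_nonneg (t : ℝ) : 0 ≤ rootDecay t := by unfold rootDecay; positivity

theorem measurable_rootDecay : Measurable rootDecay := by unfold rootDecay; fun_prop

theorem integrable_rootDecay : Integrable rootDecay := by
  have hpos : IntegrableOn rootDecay (Ioi 0) := by
    rw [← Ioc_union_Ioi_eq_Ioi zero_le_one]
    refine IntegrableOn.union ?_ ?_
    · have h1 := (intervalIntegral.intervalIntegrable_rpow' (a := 0) (b := 1)
        (r := -(1 / 2)) (by norm_num)).1
      refine h1.mono' measurable_rootDecay.aestronglyMeasurable
        ((ae_restrict_iff' measurableSet_Ioc).2 (ae_of_all _ fun t ht => ?_))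
      rw [Real.norm_of_nonneg (rootDecay_nonneg t), rootDecay, abs_of_pos ht.1,
        Real.rpow_neg ht.1.le, ← Real.sqrt_eq_rpow]
      refine mul_le_of_le_one_right (by positivity) (inv_le_one_of_one_le₀ ?_)
      linarith [ht.1]
    · have h1 := integrableOn_Ioi_rpow_of_lt (a := -(3 / 2)) (by norm_num) one_pos
      refine h1.mono' measurable_rootDecay.aestronglyMeasurable
        ((ae_restrict_iff' measurableSet_Ioi).2 (ae_of_all _ fun t ht => ?_))
      have ht0 : 0 < t := zero_lt_one.trans ht
      rw [Real.norm_of_nonneg (rootDecay_nonneg t), rootDecay, abs_of_pos ht0,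
        show (-(3 / 2) : ℝ) = -(1 / 2) + -1 by norm_num, Real.rpow_add ht0,
        Real.rpow_neg ht0.le, ← Real.sqrt_eq_rpow, Real.rpow_neg_one]
      gcongr
      linarith
  have hneg : IntegrableOn rootDecay (Iio 0) := by
    have h2 := (Measure.measurePreserving_neg (volume : Measure ℝ)).integrableOn_comp_preimage
      (MeasurableEquiv.neg ℝ).measurableEmbedding (f := rootDecay) (s := Ioi 0)
    have h3 := h2.2 hpos
    have e1 : (Neg.neg ⁻¹' Ioi (0 : ℝ)) = Iio 0 := by ext t; simp
    have e2 : rootDecay ∘ Neg.neg = rootDecay := by funext t; simp [rootDecay]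
    rwa [e1, e2] at h3
  have : Integrable rootDecay (volume.restrict (Iic 0 ∪ Ioi 0)) :=
    ((integrableOn_Iic_iff_integrableOn_Iio (by simp)).2 hneg).union hpos
  rwa [Iic_union_Ioi, Measure.restrict_univ] at this

theorem one_add_abs_le {z : ℂ} {ε t : ℝ} (hε : 0 < ε) (h : ε ≤ ‖(t : ℂ) - z‖) :
    1 + |t| ≤ (1 + (1 + ‖z‖) / ε) * ‖(t : ℂ) - z‖ := by
  have h1 : |t| ≤ ‖(t : ℂ) - z‖ + ‖z‖ := by
    have := norm_sub_norm_le (t : ℂ) z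
    rw [Complex.norm_real, Real.norm_eq_abs] at this
    linarith
  have h2 : 1 + ‖z‖ ≤ (1 + ‖z‖) / ε * ‖(t : ℂ) - z‖ := by
    rw [div_mul_eq_mul_div, le_div_iff₀ hε]
    gcongr
  linarith

/-- Only a lower bound on |t - z| enters. The estimate thus serves both z in the open half-plane,
with ε = Im z, and real z = k with |t - k| > ε. -/
theorem norm_div_le_rootDecay {z a : ℂ} {B ε t : ℝ} (hε : 0 < ε)
    (h : ε ≤ ‖(t : ℂ) - z‖) (ha : ‖a‖ ≤ B * (√|t|)⁻¹) :
    ‖a / (t - z)‖ ≤ B * (1 + (1 + ‖z‖) / ε) * rootDecay t := by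
  have h1 := one_add_abs_le hε h
  have h2 : 0 < ‖(t : ℂ) - z‖ := hε.trans_le h
  have h3 : ‖(t : ℂ) - z‖⁻¹ ≤ (1 + (1 + ‖z‖) / ε) * (1 + |t|)⁻¹ := by
    rw [← div_eq_mul_inv, le_div_iff₀ (by positivity), inv_mul_le_iff₀ h2, mul_comm]
    exact h1
  rw [norm_div, div_eq_mul_inv, rootDecay]
  calc ‖a‖ * ‖(t : ℂ) - z‖⁻¹ ≤ (B * (√|t|)⁻¹) * ((1 + (1 + ‖z‖) / ε) * (1 + |t|)⁻¹) :=
        mul_le_mul ha h3 (by positivity) ((norm_nonneg a).trans ha)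
    _ = _ := by ring

theorem im_le_norm_ofReal_sub {z : ℂ} (t : ℝ) : z.im ≤ ‖(t : ℂ) - z‖ := by
  have := Complex.abs_im_le_norm ((t : ℂ) - z)
  simp at this
  exact (le_abs_self _).trans this

theorem measurableSet_annulus (a b : ℝ) : MeasurableSet {t : ℝ | a < |t| ∧ |t| < b} :=
  ((isOpen_lt continuous_const continuous_abs).inter
    (isOpen_lt continuous_abs continuous_const)).measurableSet

theorem tendsto_setIntegral_annulus {F : ℝ → ℂ} (hF : Integrable F) :
    Tendsto (fun e : ℝ × ℝ => ∫ t in {t : ℝ | e.1 < |t| ∧ |t| < e.2}, F t) (𝓝[>] 0 ×ˢ atTop)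
      (𝓝 (∫ t, F t)) := by
  have hm : ∀ e : ℝ × ℝ, MeasurableSet {t : ℝ | e.1 < |t| ∧ |t| < e.2} := fun e =>
    measurableSet_annulus _ _
  simp only [← integral_indicator (hm _)]
  refine tendsto_integral_filter_of_dominated_convergence (fun t => ‖F t‖)
    (Eventually.of_forall fun e => hF.aestronglyMeasurable.indicator (hm e))
    (Eventually.of_forall fun e => ae_of_all _ fun t => norm_indicator_le_norm_self _ _) hF.norm ?_
  have hne : ∀ᵐ t : ℝ, t ≠ 0 := by simp [ae_iff, measure_singleton]
  filter_upwards [hne] with t ht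
  refine tendsto_const_nhds.congr' ?_
  have h1 : ∀ᶠ x in 𝓝[>] (0 : ℝ), x < |t| := nhdsWithin_le_nhds (Iio_mem_nhds (abs_pos.2 ht))
  filter_upwards [h1.prod_mk (eventually_gt_atTop |t|)] with e he
  rw [indicator_of_mem (show t ∈ {t : ℝ | e.1 < |t| ∧ |t| < e.2} from he)]

section
variable {G : ℂ → ℂ} (hG : ContinuousOn G (closedUpperHP \ {0}))
  (hd : DifferentiableOn ℂ G openUpperHP) {B : ℝ}
  (hB : ∀ w ∈ closedUpperHP \ {0}, ‖G w‖ ≤ B * (√‖w‖)⁻¹)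
include hB

/-- The bound by |w|^{-1/2} is a single hypothesis that allows a logarithmic singularity at 0 and is
implied by O(1/|w|) at infinity; divided by t - z it is integrable. -/
theorem tendsto_mul_zero_of_le_root :
    Tendsto (fun w => w * G w) (𝓝[closedUpperHP \ {0}] 0) (𝓝 0) := by
  have h1 : Tendsto (fun w : ℂ => B * √‖w‖) (𝓝[closedUpperHP \ {0}] 0) (𝓝 0) := by
    have : Continuous fun w : ℂ => B * √‖w‖ := by fun_prop
    have h2 := this.tendsto 0
    simp only [norm_zero, Real.sqrt_zero, mul_zero] at h2
    exact tendsto_nhdsWithin_of_tendsto_nhds h2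
  refine squeeze_zero_norm' ?_ h1
  filter_upwards [self_mem_nhdsWithin] with w hw
  have hw0 : 0 < ‖w‖ := norm_pos_iff.2 hw.2
  rw [norm_mul]
  calc ‖w‖ * ‖G w‖ ≤ ‖w‖ * (B * (√‖w‖)⁻¹) := by gcongr; exact hB w hw
    _ = B * (√‖w‖ * √‖w‖ * (√‖w‖)⁻¹) := by rw [Real.mul_self_sqrt hw0.le]; ring
    _ = B * √‖w‖ := by
      have : √‖w‖ ≠ 0 := (Real.sqrt_pos.2 hw0).ne'
      field_simp

theorem tendsto_zero_of_le_root :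
    Tendsto G (Bornology.cobounded ℂ ⊓ 𝓟 closedUpperHP) (𝓝 0) := by
  have h1 : Tendsto (fun w : ℂ => B * (√‖w‖)⁻¹) (Bornology.cobounded ℂ ⊓ 𝓟 closedUpperHP)
      (𝓝 (B * 0)) := by
    refine Tendsto.const_mul B (Tendsto.mono_left ?_ inf_le_left)
    exact tendsto_inv_atTop_zero.comp (Real.tendsto_sqrt_atTop.comp tendsto_norm_cobounded_atTop)
  rw [mul_zero] at h1
  refine squeeze_zero_norm' ?_ h1
  have h2 : ∀ᶠ k : ℂ in Bornology.cobounded ℂ ⊓ 𝓟 closedUpperHP, 0 < ‖k‖ :=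
    (tendsto_norm_cobounded_atTop.mono_left inf_le_left).eventually_gt_atTop 0
  filter_upwards [h2, (mem_inf_of_right (mem_principal_self _) :
    closedUpperHP ∈ Bornology.cobounded ℂ ⊓ 𝓟 closedUpperHP)] with w hw hw'
  exact hB w ⟨hw', norm_pos_iff.1 hw⟩

theorem norm_add_mul_le {t : ℝ} (ht : t ≠ 0) (σ : ℂ) :
    ‖G t + σ * G (-(t : ℂ))‖ ≤ (B + ‖σ‖ * B) * (√|t|)⁻¹ := by
  have h1 := hB t (ofReal_mem_punctured ht)
  have h2 := hB _ (neg_ofReal_mem_punctured ht)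
  rw [norm_neg] at h2
  rw [Complex.norm_real, Real.norm_eq_abs] at h1 h2
  refine (norm_add_le _ _).trans ?_
  rw [norm_mul]
  nlinarith [norm_nonneg σ, mul_le_mul_of_nonneg_left h2 (norm_nonneg σ)]

include hG

omit hB in
theorem aestronglyMeasurable_boundary (σ z : ℂ) :
    AEStronglyMeasurable (fun t : ℝ => (G t + σ * G (-(t : ℂ))) / (t - z)) := by
  have h1 : ContinuousOn (fun t : ℝ => G t + σ * G (-(t : ℂ))) {0}ᶜ := by
    refine ContinuousOn.add ?_ (continuousOn_const.mul ?_)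
    · exact hG.comp (f := fun t : ℝ => (t : ℂ)) (by fun_prop) fun t ht => ofReal_mem_punctured ht
    · exact hG.comp (f := fun t : ℝ => -(t : ℂ)) (by fun_prop)
        fun t ht => neg_ofReal_mem_punctured ht
  have h2 : AEStronglyMeasurable (fun t : ℝ => G t + σ * G (-(t : ℂ))) := by
    have := h1.aestronglyMeasurable (μ := volume) (measurableSet_singleton (0 : ℝ)).compl
    rwa [Measure.restrict_eq_self_of_ae_mem] at this
    simp [ae_iff, measure_singleton]
  exact h2.div₀ (Continuous.aestronglyMeasurable (by fun_prop))

theorem integrable_boundary (σ : ℂ) {z : ℂ} (hz : z ∈ openUpperHP) :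
    Integrable fun t : ℝ => (G t + σ * G (-(t : ℂ))) / (t - z) := by
  refine (integrable_rootDecay.const_mul ((B + ‖σ‖ * B) * (1 + (1 + ‖z‖) / z.im))).mono'
    (aestronglyMeasurable_boundary hG σ z) ?_
  have hne : ∀ᵐ t : ℝ, t ≠ 0 := by simp [ae_iff, measure_singleton]
  filter_upwards [hne] with t ht
  exact norm_div_le_rootDecay hz (im_le_norm_ofReal_sub t) (norm_add_mul_le hB ht σ)

include hd

/-- The Cauchy-type formula with an absolutely convergent integral. -/
theorem integral_boundary (σ : ℂ) {z : ℂ} (hz : z ∈ openUpperHP) :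
    ∫ t : ℝ, (G t + σ * G (-(t : ℂ))) / (t - z) = 2 * Real.pi * Complex.I * G z :=
  tendsto_nhds_unique (tendsto_setIntegral_annulus (integrable_boundary hG hB σ hz))
    (tendsto_cauchy hG hd (tendsto_mul_zero_of_le_root hB) (tendsto_zero_of_le_root hB) σ hz)

/-- This is Cauchy's theorem on a half-annulus centred at k, whose outer arc goes to infinity. After
translation by k the singular point of G would lie on the boundary, at -k, so G is first shifted
upward by i/(n+1), with outer radius n, and both limits are taken along n. The condition ε < |k|
keeps the small arc away from the singularity. -/
theorem integral_principal_part {k ε : ℝ} (hε : 0 < ε) (hk : ε < |k|) :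
    ∫ t in {t : ℝ | ε < |t - k|}, G t / (t - k) =
      Complex.I * ∫ θ in (0 : ℝ)..Real.pi, G (k + polar ε θ) := by
  have hB0 : 0 ≤ B := by
    have h := hB 1 ⟨by simp [closedUpperHP_def], by simp⟩
    simp at h
    exact (norm_nonneg _).trans h
  -- the shifted function
  set s : ℕ → ℂ := fun n => k + ((1 / ((n : ℝ) + 1) : ℝ) : ℂ) * Complex.I with hs
  have hsim : ∀ n, (s n).im = 1 / ((n : ℝ) + 1) := fun n => by
    simp only [hs, Complex.add_im, Complex.ofReal_im, Complex.mul_im, Complex.ofReal_re,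
      Complex.I_im, Complex.I_re, mul_one, mul_zero, zero_add, add_zero]
  have hspos : ∀ n, 0 < (s n).im := fun n => by rw [hsim]; positivity
  have hslim : Tendsto s atTop (𝓝 k) := by
    have h1 := (Complex.continuous_ofReal.tendsto 0).comp
      (tendsto_one_div_add_atTop_nhds_zero_nat (𝕜 := ℝ))
    have h2 := (h1.mul_const Complex.I).const_add (k : ℂ)
    rwa [Complex.ofReal_zero, zero_mul, add_zero] at h2
  have hmem : ∀ n, ∀ w ∈ closedUpperHP, w + s n ∈ openUpperHP := fun n w hw => by
    show 0 < (w + s n).im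
    rw [Complex.add_im]
    have : 0 ≤ w.im := hw
    linarith [hspos n]
  have hopen : openUpperHP ⊆ closedUpperHP \ {0} := fun w hw =>
    ⟨openUpperHP_subset hw, ne_zero_of_mem_openUpperHP hw⟩
  have hnorm : ∀ n (w : ℂ), w ∈ closedUpperHP → ∀ r, 0 < r → r ≤ ‖w + s n‖ →
      ‖G (w + s n)‖ ≤ B * (√r)⁻¹ := by
    intro n w hw r hr hle
    refine (hB _ (hopen (hmem n w hw))).trans ?_
    gcongr
  have hKc : ∀ n, ContinuousOn (fun w => G (w + s n) / w) (closedUpperHP \ {0}) := fun n =>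
    ContinuousOn.div (hG.comp (by fun_prop) fun w hw => hopen (hmem n w hw.1)) continuousOn_id
      fun w hw => hw.2
  have hKd : ∀ n, DifferentiableOn ℂ (fun w => G (w + s n) / w) openUpperHP := fun n =>
    DifferentiableOn.div (hd.comp (by fun_prop) fun w hw => hmem n w (openUpperHP_subset hw))
      differentiableOn_id fun w hw => ne_zero_of_mem_openUpperHP hw
  -- Cauchy's theorem for the shifted function
  have hid : ∀ n : ℕ, ε ≤ n → ∫ t in {t : ℝ | ε < |t| ∧ |t| < n}, G (t + s n) / (t : ℂ) =
      Complex.I * ((∫ θ in (0 : ℝ)..Real.pi, G (polar ε θ + s n)) -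
        ∫ θ in (0 : ℝ)..Real.pi, G (polar n θ + s n)) := by
    intro n hn
    have h1 := integral_half_annulus (hKc n) (hKd n) hε hn
    have h2 : ∀ r : ℝ, 0 < r → ∫ θ in (0 : ℝ)..Real.pi,
        G (polar r θ + s n) / polar r θ * polar r θ =
        ∫ θ in (0 : ℝ)..Real.pi, G (polar r θ + s n) := by
      intro r hr
      refine intervalIntegral.integral_congr fun θ hθ => ?_
      rw [uIcc_of_le Real.pi_pos.le] at hθ
      exact div_mul_cancel₀ _ (polar_mem hr hθ.1 hθ.2).2
    rw [h2 ε hε, h2 n (hε.trans_le hn)] at h1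
    rw [← h1, setIntegral_annulus _ hε hn]
    · refine intervalIntegral.integral_congr fun t _ => ?_
      simp
    · exact (hKc n).comp (f := fun t : ℝ => (t : ℂ)) (by fun_prop)
        fun t ht => ofReal_mem_punctured ht
  -- the limit of the left-hand side
  have hre : ∀ n (t : ℝ), |t + k| ≤ ‖(t : ℂ) + s n‖ := fun n t => by
    have := Complex.abs_re_le_norm ((t : ℂ) + s n)
    simpa [hs] using this
  have hmeas : ∀ n : ℕ, MeasurableSet {t : ℝ | ε < |t| ∧ |t| < n} := fun n =>
    measurableSet_annulus _ _
  have hmeas' : MeasurableSet {t : ℝ | ε < |t|} := measurableSet_lt measurable_const (by fun_prop)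
  have hL : Tendsto (fun n : ℕ => ∫ t in {t : ℝ | ε < |t| ∧ |t| < n}, G (t + s n) / (t : ℂ)) atTop
      (𝓝 (∫ t in {t : ℝ | ε < |t|}, G (t + k) / (t : ℂ))) := by
    simp only [← integral_indicator (hmeas _), ← integral_indicator hmeas']
    refine tendsto_integral_of_dominated_convergence
      (fun t => B * (1 + (1 + ‖(k : ℂ)‖) / ε) * rootDecay (t + k)) (fun n => ?_)
      ((integrable_rootDecay.comp_add_right k).const_mul _) (fun n => ?_) ?_
    · refine AEStronglyMeasurable.indicator (AEStronglyMeasurable.div₀ ?_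
        (Continuous.aestronglyMeasurable (by fun_prop))) (hmeas n)
      refine Continuous.aestronglyMeasurable (continuousOn_univ.1 (hG.comp (by fun_prop)
        fun t _ => hopen (hmem n t (ofReal_mem_closedUpperHP t))))
    · have hne : ∀ᵐ t : ℝ, t ≠ -k := by simp [ae_iff, measure_singleton]
      filter_upwards [hne] with t ht
      have htk : 0 < |t + k| := abs_pos.2 fun h => ht (by linarith)
      by_cases hmt : t ∈ {t : ℝ | ε < |t| ∧ |t| < n}
      · rw [indicator_of_mem hmt]
        have h1 := hnorm n t (ofReal_mem_closedUpperHP t) _ htk (hre n t)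
        have h2 := norm_div_le_rootDecay (z := k) (t := t + k) (a := G (t + s n)) hε
          (by rw [← Complex.ofReal_sub, add_sub_cancel_right, Complex.norm_real]
              exact hmt.1.le) h1
        rwa [← Complex.ofReal_sub, add_sub_cancel_right] at h2
      · rw [indicator_of_notMem hmt, norm_zero]
        have := rootDecay_nonneg (t + k)
        positivity
    · have hne : ∀ᵐ t : ℝ, t ≠ -k := by simp [ae_iff, measure_singleton]
      filter_upwards [hne] with t ht
      have htk : t + k ≠ 0 := fun h => ht (by linarith)
      by_cases hmt : t ∈ {t : ℝ | ε < |t|}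
      · rw [indicator_of_mem hmt]
        have h1 : Tendsto (fun n => G (t + s n)) atTop (𝓝 (G (t + k))) := by
          have hc := hG ((t + k : ℝ) : ℂ) (ofReal_mem_punctured htk)
          rw [Complex.ofReal_add] at hc
          refine hc.tendsto.comp (tendsto_nhdsWithin_iff.2 ⟨hslim.const_add _,
            Eventually.of_forall fun n => hopen (hmem n t (ofReal_mem_closedUpperHP t))⟩)
        refine (h1.div_const (t : ℂ)).congr' ?_
        filter_upwards [tendsto_natCast_atTop_atTop.eventually_gt_atTop |t|] with n hn
        rw [indicator_of_mem (show t ∈ {t : ℝ | ε < |t| ∧ |t| < n} from ⟨hmt, hn⟩)]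
      · rw [indicator_of_notMem hmt]
        refine tendsto_const_nhds.congr fun n => ?_
        rw [indicator_of_notMem (show t ∉ {t : ℝ | ε < |t| ∧ |t| < n} from fun h => hmt h.1)]
  -- the limits of the arcs
  have hpol : ∀ θ ∈ uIoc 0 Real.pi, polar ε θ ∈ closedUpperHP := fun θ hθ => by
    rw [uIoc_of_le Real.pi_pos.le] at hθ
    exact (polar_mem hε hθ.1.le hθ.2).1
  -- The small arc is at distance at least |k| - ε > 0 from the singular point, which gives a
  -- constant majorant.
  have hfar : ∀ n θ, |k| - ε ≤ ‖polar ε θ + s n‖ := fun n θ => by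
    have h1 : |k| ≤ ‖s n‖ := by
      have := Complex.abs_re_le_norm (s n)
      simpa [hs] using this
    have h2 := norm_sub_norm_le (s n) (-polar ε θ)
    rw [norm_neg, norm_polar hε, sub_neg_eq_add, add_comm (s n)] at h2
    linarith
  have hA : Tendsto (fun n : ℕ => ∫ θ in (0 : ℝ)..Real.pi, G (polar ε θ + s n)) atTop
      (𝓝 (∫ θ in (0 : ℝ)..Real.pi, G (k + polar ε θ))) := by
    refine intervalIntegral.tendsto_integral_filter_of_dominated_convergence
      (fun _ => B * (√(|k| - ε))⁻¹) (Eventually.of_forall fun n => ?_)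
      (Eventually.of_forall fun n => ae_of_all _ fun θ hθ => ?_) intervalIntegrable_const
      (ae_of_all _ fun θ hθ => ?_)
    · exact (hG.comp (by fun_prop) fun θ hθ => hopen (hmem n _ (hpol θ hθ))).aestronglyMeasurable
        measurableSet_uIoc
    · exact hnorm n _ (hpol θ hθ) _ (by linarith) (hfar n θ)
    · have h0 : (k : ℂ) + polar ε θ ≠ 0 := fun h => by
        have h1 : ‖(k : ℂ)‖ = ‖polar ε θ‖ := by
          rw [← norm_neg (polar ε θ), eq_neg_of_add_eq_zero_left h]
        rw [Complex.norm_real, Real.norm_eq_abs, norm_polar hε] at h1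
        linarith
      have hcl : (k : ℂ) + polar ε θ ∈ closedUpperHP := by
        rw [closedUpperHP_def, Complex.add_im, Complex.ofReal_im, zero_add]
        exact hpol θ hθ
      refine (hG _ ⟨hcl, h0⟩).tendsto.comp (tendsto_nhdsWithin_iff.2 ⟨?_,
        Eventually.of_forall fun n => hopen (hmem n _ (hpol θ hθ))⟩)
      rw [add_comm (k : ℂ)]
      exact hslim.const_add _
  have hN : Tendsto (fun n : ℕ => ∫ θ in (0 : ℝ)..Real.pi, G (polar n θ + s n)) atTop (𝓝 0) := by
    have h1 : Tendsto (fun n : ℕ => B * (√((n : ℝ) - (|k| + 1)))⁻¹ * |Real.pi - 0|) atTop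
        (𝓝 (B * 0 * |Real.pi - 0|)) :=
      ((tendsto_inv_atTop_zero.comp (Real.tendsto_sqrt_atTop.comp
        (tendsto_atTop_add_const_right _ (-(|k| + 1)) tendsto_natCast_atTop_atTop))).const_mul
          B).mul_const _
    rw [mul_zero, zero_mul] at h1
    refine squeeze_zero_norm' ?_ h1
    filter_upwards [tendsto_natCast_atTop_atTop.eventually_gt_atTop (|k| + 1)] with n hn
    have hn0 : (0 : ℝ) < n := by have := abs_nonneg k; linarith
    refine intervalIntegral.norm_integral_le_of_norm_le_const fun θ hθ => ?_
    rw [uIoc_of_le Real.pi_pos.le] at hθ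
    refine hnorm n _ (polar_mem hn0 hθ.1.le hθ.2).1 _ (by linarith) ?_
    have h2 := norm_sub_norm_le (polar n θ) (-s n)
    rw [norm_neg, norm_polar hn0, sub_neg_eq_add] at h2
    have h3 : ‖s n‖ ≤ |k| + 1 := by
      refine (norm_add_le _ _).trans ?_
      rw [Complex.norm_real, Real.norm_eq_abs, norm_mul, Complex.norm_I, mul_one,
        Complex.norm_real, Real.norm_of_nonneg (by positivity)]
      gcongr
      rw [div_le_one (by positivity)]
      linarith
    linarith
  have hfin := tendsto_nhds_unique (hL.congr' (by
    filter_upwards [tendsto_natCast_atTop_atTop.eventually_ge_atTop ε] with n hn using hid n hn))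
    ((hA.sub hN).const_mul Complex.I)
  rw [sub_zero] at hfin
  rw [← hfin]
  have hshift := (measurePreserving_sub_right (volume : Measure ℝ) k).setIntegral_preimage_emb
    (measurableEmbedding_subRight k) (fun t : ℝ => G (t + k) / (t : ℂ)) {t : ℝ | ε < |t|}
  rw [← hshift]
  have hset : (fun x => x - k) ⁻¹' {t : ℝ | ε < |t|} = {t : ℝ | ε < |t - k|} := rfl
  rw [hset]
  refine integral_congr_ae (ae_of_all _ fun t => ?_)
  simp

omit hd in
theorem tendsto_small_arc {k : ℝ} (hk : k ≠ 0) :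
    Tendsto (fun ε : ℝ => ∫ θ in (0 : ℝ)..Real.pi, G (k + polar ε θ)) (𝓝[>] 0)
      (𝓝 (Real.pi * G k)) := by
  have hk0 : 0 < |k| := abs_pos.2 hk
  have hev : ∀ᶠ ε in 𝓝[>] (0 : ℝ), ε ∈ Ioo 0 (|k| / 2) := Ioo_mem_nhdsGT (by positivity)
  have hB0 : 0 ≤ B := by
    have h := hB 1 ⟨by simp [closedUpperHP_def], by simp⟩
    simp at h
    exact (norm_nonneg _).trans h
  have hmem : ∀ ε ∈ Ioo 0 (|k| / 2), ∀ θ ∈ uIoc 0 Real.pi, (k : ℂ) + polar ε θ ∈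
      closedUpperHP \ {0} ∧ |k| / 2 ≤ ‖(k : ℂ) + polar ε θ‖ := by
    intro ε hε θ hθ
    rw [uIoc_of_le Real.pi_pos.le] at hθ
    have h1 := norm_sub_norm_le (k : ℂ) (-polar ε θ)
    rw [norm_neg, norm_polar hε.1, sub_neg_eq_add, Complex.norm_real, Real.norm_eq_abs] at h1
    have h2 : |k| / 2 ≤ ‖(k : ℂ) + polar ε θ‖ := by linarith [hε.2]
    refine ⟨⟨?_, norm_pos_iff.1 (by linarith)⟩, h2⟩
    rw [closedUpperHP_def, Complex.add_im, Complex.ofReal_im, zero_add]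
    exact (polar_mem hε.1 hθ.1.le hθ.2).1
  have hlim : (Real.pi : ℂ) * G k = ∫ _θ in (0 : ℝ)..Real.pi, G k := by simp
  rw [hlim]
  refine intervalIntegral.tendsto_integral_filter_of_dominated_convergence
    (fun _ => B * (√(|k| / 2))⁻¹) ?_ ?_ intervalIntegrable_const (ae_of_all _ fun θ hθ => ?_)
  · filter_upwards [hev] with ε hε
    exact (hG.comp (by fun_prop) fun θ hθ => (hmem ε hε θ hθ).1).aestronglyMeasurable
        measurableSet_uIoc
  · filter_upwards [hev] with ε hε
    refine ae_of_all _ fun θ hθ => (hB _ (hmem ε hε θ hθ).1).trans ?_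
    have := (hmem ε hε θ hθ).2
    gcongr
  · refine (hG k (ofReal_mem_punctured hk)).tendsto.comp (tendsto_nhdsWithin_iff.2 ⟨?_, ?_⟩)
    · have : Continuous fun ε : ℝ => (k : ℂ) + polar ε θ := by unfold polar; fun_prop
      have h := this.tendsto 0
      simp only [polar, Complex.ofReal_zero, zero_mul, add_zero] at h
      exact tendsto_nhdsWithin_of_tendsto_nhds h
    · filter_upwards [hev] with ε hε using (hmem ε hε θ hθ).1

/-- The boundary version of the Cauchy-type formula. -/
theorem tendsto_principal_value {k : ℝ} (hk : k ≠ 0) :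
    Tendsto (fun ε : ℝ => ∫ t in {t : ℝ | ε < |t - k|}, (G t + G (-(t : ℂ))) / (t - k)) (𝓝[>] 0)
      (𝓝 (Complex.I * Real.pi * (G k - G (-(k : ℂ))))) := by
  have hk0 : 0 < |k| := abs_pos.2 hk
  have h1 := (tendsto_small_arc hG hB hk).const_mul Complex.I
  have h2 := (tendsto_small_arc hG hB (neg_ne_zero.2 hk)).const_mul Complex.I
  have h3 := h1.sub h2
  have e : Complex.I * (Real.pi * G k) - Complex.I * (Real.pi * G ((-k : ℝ) : ℂ)) =
      Complex.I * Real.pi * (G k - G (-(k : ℂ))) := by push_cast; ring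
  rw [e] at h3
  refine h3.congr' ?_
  have hev : ∀ᶠ ε in 𝓝[>] (0 : ℝ), ε ∈ Ioo 0 |k| := Ioo_mem_nhdsGT hk0
  filter_upwards [hev] with ε hε
  have hms : ∀ c : ℝ, MeasurableSet {t : ℝ | ε < |t - c|} := fun c =>
    measurableSet_lt measurable_const (by fun_prop)
  have hint : ∀ σ : ℂ, IntegrableOn (fun t : ℝ => (G t + σ * G (-(t : ℂ))) / (t - (k : ℂ)))
      {t : ℝ | ε < |t - k|} := by
    intro σ
    refine ((integrable_rootDecay.const_mul ((B + ‖σ‖ * B) *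
      (1 + (1 + ‖(k : ℂ)‖) / ε))).integrableOn).mono'
      (aestronglyMeasurable_boundary hG σ k).restrict ?_
    have hne : ∀ᵐ t : ℝ, t ≠ 0 := by simp [ae_iff, measure_singleton]
    refine (ae_restrict_iff' (hms k)).2 ?_
    filter_upwards [hne] with t ht htk
    refine norm_div_le_rootDecay hε.1 ?_ (norm_add_mul_le hB ht σ)
    rw [← Complex.ofReal_sub, Complex.norm_real]
    exact le_of_lt htk
  have i0 := hint 0
  simp only [zero_mul, add_zero] at i0
  have i1 := hint 1
  simp only [one_mul] at i1
  have i2 : IntegrableOn (fun t : ℝ => G (-(t : ℂ)) / (t - (k : ℂ))) {t : ℝ | ε < |t - k|} := by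
    refine (i1.sub i0).congr (ae_of_all _ fun t => ?_)
    simp only [Pi.sub_apply]
    ring
  -- The substitution t ↦ -t turns the term with G(-t) into the truncated integral at -k with
  -- opposite sign, whence the difference G(k) - G(-k) in the limit.
  have hneg := (Measure.measurePreserving_neg (volume : Measure ℝ)).setIntegral_preimage_emb
    (MeasurableEquiv.neg ℝ).measurableEmbedding (fun t : ℝ => G t / (t - ((-k : ℝ) : ℂ)))
    {t : ℝ | ε < |t - -k|}
  have hset : (Neg.neg ⁻¹' {t : ℝ | ε < |t - -k|}) = {t : ℝ | ε < |t - k|} := by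
    ext t
    simp only [mem_preimage, mem_ofPred_eq]
    rw [← abs_neg (-t - -k), show -(-t - -k) = t - k by ring]
  rw [hset] at hneg
  rw [← integral_principal_part hG hd hB hε.1 hε.2,
    ← integral_principal_part hG hd hB hε.1 (k := -k) (by rw [abs_neg]; exact hε.2), ← hneg,
    ← integral_sub i0 ?_]
  · refine integral_congr_ae (ae_of_all _ fun t => ?_)
    simp only [Complex.ofReal_neg]
    rw [show -(t : ℂ) - -(k : ℂ) = -(t - k) by ring, div_neg, sub_neg_eq_add, add_div]
  · refine i2.neg.congr (ae_of_all _ fun t => ?_)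
    simp only [Pi.neg_apply, Complex.ofReal_neg]
    rw [show -(t : ℂ) - -(k : ℂ) = -(t - k) by ring, div_neg]

end

/-! ### Logarithms on the closed half-plane -/

/-- The filter of neighbourhoods of infinity in the closed upper half-plane. -/
abbrev atInf : Filter ℂ := Bornology.cobounded ℂ ⊓ 𝓟 closedUpperHP

theorem eventually_atInf_mem : ∀ᶠ z in atInf, z ∈ closedUpperHP :=
  mem_inf_of_right (mem_principal_self _)

theorem tendsto_norm_atInf : Tendsto (fun z : ℂ => ‖z‖) atInf atTop :=
  tendsto_norm_cobounded_atTop.mono_left inf_le_left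

theorem tendsto_ofReal_atInf_atTop : Tendsto (fun t : ℝ => (t : ℂ)) atTop atInf := by
  refine tendsto_inf.2 ⟨?_, tendsto_principal.2 (Eventually.of_forall ofReal_mem_closedUpperHP)⟩
  rw [← tendsto_norm_atTop_iff_cobounded]
  simpa using tendsto_abs_atTop_atTop

theorem tendsto_ofReal_atInf_atBot : Tendsto (fun t : ℝ => (t : ℂ)) atBot atInf := by
  refine tendsto_inf.2 ⟨?_, tendsto_principal.2 (Eventually.of_forall ofReal_mem_closedUpperHP)⟩
  rw [← tendsto_norm_atTop_iff_cobounded]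
  simpa using tendsto_abs_atBot_atTop

theorem tendsto_neg_ofReal_atInf_atTop : Tendsto (fun t : ℝ => -(t : ℂ)) atTop atInf := by
  have h := tendsto_ofReal_atInf_atBot.comp (tendsto_neg_atTop_atBot (G := ℝ))
  simpa [Function.comp_def] using h

theorem tendsto_neg_ofReal_atInf_atBot : Tendsto (fun t : ℝ => -(t : ℂ)) atBot atInf := by
  have h := tendsto_ofReal_atInf_atTop.comp (tendsto_neg_atBot_atTop (G := ℝ))
  simpa [Function.comp_def] using h

section exp
variable {X : Type*} {a b : X → ℂ}

theorem eventuallyEq_of_exp_eq {l : Filter X} (ha : Tendsto a l (𝓝 0)) (hb : Tendsto b l (𝓝 0))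
    (h : ∀ᶠ x in l, Complex.exp (a x) = Complex.exp (b x)) : a =ᶠ[l] b := by
  have hlog : ∀ c : X → ℂ, Tendsto c l (𝓝 0) → ∀ᶠ x in l, Complex.log (Complex.exp (c x)) = c x := by
    intro c hc
    have h1 : ∀ᶠ x in l, ‖c x‖ < Real.pi := by
      have := hc.norm
      rw [norm_zero] at this
      exact this.eventually_lt_const Real.pi_pos
    filter_upwards [h1] with x hx
    have h2 := abs_lt.1 ((Complex.abs_im_le_norm (c x)).trans_lt hx)
    exact Complex.log_exp h2.1 h2.2.le
  filter_upwards [h, hlog a ha, hlog b hb] with x hx h1 h2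
  rw [← h1, hx, h2]

/-- Two lifts through the covering map exp that agree at one point of a connected set agree on it.
-/
theorem eqOn_of_exp_eq [TopologicalSpace X] {s : Set X} (hs : IsPreconnected s)
    (ha : ContinuousOn a s) (hb : ContinuousOn b s)
    (h : ∀ x ∈ s, Complex.exp (a x) = Complex.exp (b x)) {x : X} (hx : x ∈ s) (hab : a x = b x) :
    EqOn a b s :=
  Complex.isCoveringMap_exp.eqOn_of_comp_eqOn hs ha hb (fun y hy => Subtype.ext (h y hy)) hx hab

end exp

/-- The region is the image under exp of a convex half-strip. -/
theorem isPreconnected_outside (R : ℝ) (hR : 0 < R) :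
    IsPreconnected {z : ℂ | z ∈ closedUpperHP ∧ R < ‖z‖} := by
  have hc : Convex ℝ {u : ℂ | Real.log R < u.re ∧ 0 ≤ u.im ∧ u.im ≤ Real.pi} := by
    have h1 := convex_halfSpace_re_gt (Real.log R)
    have h2 := convex_halfSpace_im_ge 0
    have h3 := convex_halfSpace_im_le Real.pi
    exact h1.inter (h2.inter h3)
  have him : Complex.exp '' {u : ℂ | Real.log R < u.re ∧ 0 ≤ u.im ∧ u.im ≤ Real.pi} =
      {z : ℂ | z ∈ closedUpperHP ∧ R < ‖z‖} := by
    ext z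
    constructor
    · rintro ⟨u, ⟨h1, h2, h3⟩, rfl⟩
      refine ⟨?_, ?_⟩
      · have := (exp_mem_closedUpperHP (x := u.re) h2 h3).1
        rwa [Complex.re_add_im] at this
      · rw [Complex.norm_exp, ← Real.log_lt_iff_lt_exp hR]
        exact h1
    · rintro ⟨h1, h2⟩
      have hz : z ≠ 0 := norm_pos_iff.1 (hR.trans h2)
      refine ⟨Complex.log z, ⟨?_, ?_, ?_⟩, Complex.exp_log hz⟩
      · rw [Complex.log_re]
        exact Real.log_lt_log hR h2
      · rw [Complex.log_im]
        exact Complex.arg_nonneg_iff.2 h1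
      · rw [Complex.log_im]
        exact Complex.arg_le_pi z
  rw [← him]
  exact hc.isPreconnected.image _ Complex.continuous_exp.continuousOn

/-- A nonvanishing function that is analytic in the upper half-plane, continuous up to the boundary
and equal to `1` at infinity has a logarithm with the same properties that vanishes at infinity. -/
theorem exists_log {Φ : ℂ → ℂ} (hc : ContinuousOn Φ closedUpperHP)
    (hd : DifferentiableOn ℂ Φ openUpperHP) (h0 : ∀ z ∈ closedUpperHP, Φ z ≠ 0)
    (h1 : Tendsto Φ atInf (𝓝 1)) :
    ∃ l : ℂ → ℂ, ContinuousOn l closedUpperHP ∧ DifferentiableOn ℂ l openUpperHP ∧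
      (∀ z ∈ closedUpperHP, Complex.exp (l z) = Φ z) ∧
      l =ᶠ[atInf] fun z => Complex.log (Φ z) := by
  -- Reflecting the lower half-plane onto the upper one extends Φ to a continuous nonvanishing
  -- function on the simply connected plane. It lifts through exp without any lifting theorem for
  -- the half-plane itself.
  set fold : ℂ → ℂ := fun z => z.re + |z.im| * Complex.I with hfold
  have hfc : Continuous fold := by fun_prop
  have hfm : ∀ z, fold z ∈ closedUpperHP := fun z => by simp [hfold, closedUpperHP_def]
  have hfe : ∀ z ∈ closedUpperHP, fold z = z := fun z hz => by
    rw [hfold]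
    simp only
    rw [abs_of_nonneg (show 0 ≤ z.im from hz), Complex.re_add_im]
  have hcont : Continuous fun z => Φ (fold z) := hc.comp_continuous hfc hfm
  obtain ⟨F, ⟨-, hF⟩, -⟩ := Complex.isCoveringMapOn_exp.existsUnique_continuousMap_lifts
    (⟨fun z => Φ (fold z), hcont⟩ : C(ℂ, ℂ)) (a₀ := 0) (Complex.exp_log (h0 _ (hfm 0)))
    (fun z => h0 _ (hfm z))
  have hexp : ∀ z ∈ closedUpperHP, Complex.exp (F z) = Φ z := fun z hz => by
    have := congr_fun hF z
    simp only [Function.comp_apply, ContinuousMap.coe_mk] at this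
    rw [this, hfe z hz]
  -- analyticity
  have hFd : DifferentiableOn ℂ F openUpperHP := by
    intro z hz
    have hzc := openUpperHP_subset hz
    have hΦd : DifferentiableAt ℂ Φ z := (hd z hz).differentiableAt (isOpen_openUpperHP.mem_nhds hz)
    -- Near z the lift coincides with F(z) + log(Φ(w)/Φ(z)), since both are continuous there with
    -- equal exponentials and equal value at z.
    have hq : DifferentiableAt ℂ (fun w => F z + Complex.log (Φ w / Φ z)) z := by
      refine (DifferentiableAt.clog (hΦd.div_const _) ?_).const_add _
      rw [div_self (h0 z hzc)]
      exact Complex.one_mem_slitPlane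
    refine (hq.congr_of_eventuallyEq ?_).differentiableWithinAt
    have ha : Tendsto (fun w => F w - F z) (𝓝 z) (𝓝 0) := by
      have := (F.continuous.tendsto z).sub_const (F z)
      rwa [sub_self] at this
    have hb : Tendsto (fun w => Complex.log (Φ w / Φ z)) (𝓝 z) (𝓝 0) := by
      have := hq.continuousAt.tendsto.sub_const (F z)
      simpa [div_self (h0 z hzc)] using this
    have hev : ∀ᶠ w in 𝓝 z, w ∈ openUpperHP := isOpen_openUpperHP.mem_nhds hz
    have := eventuallyEq_of_exp_eq ha hb (by
      filter_upwards [hev] with w hw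
      have hwc := openUpperHP_subset hw
      rw [Complex.exp_log (div_ne_zero (h0 w hwc) (h0 z hzc)), Complex.exp_sub, hexp w hwc,
        hexp z hzc])
    filter_upwards [this] with w hw
    rw [← hw]
    ring
  -- behaviour at infinity
  have hev : ∀ᶠ z in atInf, ‖Φ z - 1‖ < 1 := by
    have := (tendsto_iff_norm_sub_tendsto_zero.1 h1).eventually_lt_const zero_lt_one
    exact this
  obtain ⟨R, hR, hRs⟩ : ∃ R : ℝ, 0 < R ∧ ∀ z ∈ closedUpperHP, R < ‖z‖ → ‖Φ z - 1‖ < 1 := by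
    rw [eventually_inf_principal, ← comap_norm_atTop, eventually_comap] at hev
    obtain ⟨R, hR⟩ := eventually_atTop.1 hev
    exact ⟨max R 1, by positivity, fun z hz h =>
      hR ‖z‖ ((le_max_left _ _).trans h.le) z rfl hz⟩
  set S := {z : ℂ | z ∈ closedUpperHP ∧ R < ‖z‖} with hS
  have hslit : ∀ z ∈ S, Φ z ∈ Complex.slitPlane := fun z hz =>
    Complex.mem_slitPlane_of_norm_lt_one (z := Φ z - 1) (hRs z hz.1 hz.2) |> fun h => by
      simpa using h
  have hSx : ((R + 1 : ℝ) : ℂ) ∈ S := ⟨ofReal_mem_closedUpperHP _, by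
    rw [Complex.norm_real, Real.norm_of_nonneg (by positivity)]; linarith⟩
  set x : ℂ := ((R + 1 : ℝ) : ℂ)
  -- Outside a large half-disc Φ avoids the cut of the principal logarithm. The lift differs from
  -- log Φ there by one constant with exponential 1, and subtracting it makes the logarithm vanish
  -- at infinity.
  set c : ℂ := F x - Complex.log (Φ x) with hcdef
  have hcexp : Complex.exp c = 1 := by
    rw [hcdef, Complex.exp_sub, hexp x hSx.1, Complex.exp_log (h0 x hSx.1), div_self (h0 x hSx.1)]
  have heq : EqOn (fun z => F z - c) (fun z => Complex.log (Φ z)) S := by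
    refine eqOn_of_exp_eq (isPreconnected_outside R hR) (F.continuous.sub
      continuous_const).continuousOn ((hc.mono fun z hz => hz.1).clog hslit) (fun z hz => ?_) hSx ?_
    · rw [Complex.exp_sub, hcexp, div_one, hexp z hz.1, Complex.exp_log (h0 z hz.1)]
    · simp [hcdef]
  refine ⟨fun z => F z - c, (F.continuous.sub continuous_const).continuousOn,
    hFd.sub_const c, fun z hz => ?_, ?_⟩
  · rw [Complex.exp_sub, hcexp, div_one, hexp z hz]
  · filter_upwards [eventually_atInf_mem, tendsto_norm_atInf.eventually_gt_atTop R] with z hz hz'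
    exact heq ⟨hz, hz'⟩

theorem isBigO_log {X : Type*} {l : Filter X} {u : X → ℂ} {v : X → ℂ} (h1 : Tendsto u l (𝓝 1))
    (h : (fun x => u x - 1) =O[l] v) : (fun x => Complex.log (u x)) =O[l] v := by
  have hd := (Complex.hasDerivAt_log Complex.one_mem_slitPlane).isBigO_sub
  have := hd.comp_tendsto h1
  simp only [Function.comp_def, Complex.log_one, sub_zero] at this
  exact this.trans h

theorem tendsto_log_atInf {u : ℂ → ℂ} (h1 : Tendsto u atInf (𝓝 1)) :
    Tendsto (fun x => Complex.log (u x)) atInf (𝓝 0) := by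
  have := h1.clog Complex.one_mem_slitPlane
  rwa [Complex.log_one] at this

theorem closedUpperHP_mem_nhds {z : ℂ} (hz : z ∈ openUpperHP) : closedUpperHP ∈ 𝓝 z :=
  mem_of_superset (isOpen_openUpperHP.mem_nhds hz) openUpperHP_subset

theorem add_I_mul_ne_zero {z : ℂ} (hz : z ∈ closedUpperHP) {κ : ℝ} (hκ : 0 < κ) :
    z + Complex.I * κ ≠ 0 := add_ne_zero_of_mem hz (I_mul_mem_openUpperHP hκ)

theorem tendsto_ne_atInf (a : ℂ) : ∀ᶠ z in atInf, z ≠ a := by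
  filter_upwards [tendsto_norm_atInf.eventually_gt_atTop ‖a‖] with z hz h
  rw [h] at hz
  exact lt_irrefl _ hz

/-- `u - 1 = O(1/z)` for a quotient of linear polynomials. -/
theorem isBigO_div_sub_one (a b : ℂ) :
    (fun z : ℂ => (z + a) / (z + b) - 1) =O[atInf] fun z => z⁻¹ := by
  refine Asymptotics.IsBigO.of_bound (2 * ‖a - b‖) ?_
  filter_upwards [tendsto_norm_atInf.eventually_gt_atTop (2 * ‖b‖),
    tendsto_norm_atInf.eventually_gt_atTop 0] with z hz hz0
  have h1 : ‖z‖ / 2 ≤ ‖z + b‖ := by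
    have := norm_sub_norm_le z (-b)
    rw [sub_neg_eq_add, norm_neg] at this
    linarith
  have h2 : z + b ≠ 0 := norm_pos_iff.1 (by linarith)
  rw [div_sub_one h2, add_sub_add_left_eq_sub, norm_div, norm_inv]
  rw [div_le_iff₀ (norm_pos_iff.2 h2)]
  calc ‖a - b‖ = 2 * ‖a - b‖ * ‖z‖⁻¹ * (‖z‖ / 2) := by field_simp
    _ ≤ _ := by gcongr

theorem tendsto_inv_atInf : Tendsto (fun z : ℂ => z⁻¹) atInf (𝓝 0) :=
  (tendsto_inv₀_cobounded (α := ℂ)).mono_left inf_le_left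

theorem tendsto_one_of_isBigO {u : ℂ → ℂ} (h : (fun z => u z - 1) =O[atInf] fun z => z⁻¹) :
    Tendsto u atInf (𝓝 1) :=
  tendsto_sub_nhds_zero_iff.1 (h.trans_tendsto tendsto_inv_atInf)

theorem isBigO_mul_sub_one {u v : ℂ → ℂ} (hu : (fun z => u z - 1) =O[atInf] fun z => z⁻¹)
    (hv : (fun z => v z - 1) =O[atInf] fun z => z⁻¹) :
    (fun z => u z * v z - 1) =O[atInf] fun z => z⁻¹ := by
  have h1 := hu.mul ((tendsto_one_of_isBigO hv).isBigO_one ℂ)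
  refine ((h1.congr_right fun z => mul_one _).add hv).congr_left fun z => ?_
  ring

/-! ### Factorization of functions in the Jost class -/

theorem blaschke_insert {K : Set ℝ} (hK : K.Finite) {κ : ℝ} (h : κ ∉ K) (z : ℂ) :
    blaschke (insert κ K) z = (z - Complex.I * κ) / (z + Complex.I * κ) * blaschke K z :=
  finprod_mem_insert _ h hK

/-- Dividing out one simple zero. -/
theorem IsJostClass.exists_div {K : Set ℝ} {F : ℂ → ℂ} {κ : ℝ} (hκ : 0 < κ) (hκK : κ ∉ K)
    (hpos : ∀ μ ∈ K, 0 < μ) (hF : IsJostClass (insert κ K) F) :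
    ∃ H : ℂ → ℂ, IsJostClass K H ∧ (H 0 = 0 ↔ F 0 = 0) ∧
      (∀ z ∈ closedUpperHP, F z = (z - Complex.I * κ) / (z + Complex.I * κ) * H z) ∧
      H =ᶠ[atInf] fun z => F z * ((z + Complex.I * κ) / (z + -(Complex.I * κ))) := by
  have hm : Complex.I * κ ∈ openUpperHP := I_mul_mem_openUpperHP hκ
  have hm0 : Complex.I * κ ≠ 0 := ne_zero_of_mem_openUpperHP hm
  have hFκ : F (Complex.I * κ) = 0 :=
    (hF.zero_iff _ (openUpperHP_subset hm) hm0).2 ⟨κ, mem_insert _ _, rfl⟩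
  have hda : DifferentiableAt ℂ F (Complex.I * κ) :=
    (hF.differentiableOn _ hm).differentiableAt (isOpen_openUpperHP.mem_nhds hm)
  -- The difference quotient removes the zero at iκ; the factor z + iκ restores the value 1 at
  -- infinity and has no zero in the closed half-plane.
  set H : ℂ → ℂ := fun z => (z + Complex.I * κ) * dslope F (Complex.I * κ) z with hH
  have hne : ∀ z, z ≠ Complex.I * κ →
      H z = F z * ((z + Complex.I * κ) / (z + -(Complex.I * κ))) := fun z hz => by
    have h1 : z - Complex.I * κ ≠ 0 := sub_ne_zero.2 hz
    simp only [hH, dslope_of_ne F hz, slope_def_field, hFκ, sub_zero]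
    rw [← sub_eq_add_neg]
    ring
  have hfac : ∀ z ∈ closedUpperHP, F z = (z - Complex.I * κ) / (z + Complex.I * κ) * H z := by
    intro z hz
    have h1 := sub_smul_dslope F (Complex.I * κ) z
    rw [hFκ, sub_zero, smul_eq_mul] at h1
    have h2 := add_I_mul_ne_zero hz hκ
    simp only [hH]
    rw [← h1]
    field_simp
  have hiff : ∀ z ∈ closedUpperHP, z ≠ Complex.I * κ → (H z = 0 ↔ F z = 0) := by
    intro z hz hz'
    exact ⟨fun h => by rw [hfac z hz, h, mul_zero], fun h =>
      (mul_eq_zero.1 ((hfac z hz).symm.trans h)).resolve_left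
        (div_ne_zero (sub_ne_zero.2 hz') (add_I_mul_ne_zero hz hκ))⟩
  have h0c : (0 : ℂ) ∈ closedUpperHP := by simp [closedUpperHP_def]
  have hev : H =ᶠ[atInf] fun z => F z * ((z + Complex.I * κ) / (z + -(Complex.I * κ))) := by
    filter_upwards [tendsto_ne_atInf (Complex.I * κ)] with z hz using hne z hz
  have hinj : ∀ μ : ℝ, Complex.I * μ = Complex.I * κ → μ = κ := fun μ h =>
    Complex.ofReal_injective (mul_left_cancel₀ Complex.I_ne_zero h)
  refine ⟨H, ⟨?_, ?_, ?_, ?_, ?_, ?_⟩, hiff 0 h0c hm0.symm, hfac, hev⟩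
  · exact ContinuousOn.mul (by fun_prop)
      ((continuousOn_dslope (closedUpperHP_mem_nhds hm)).2 ⟨hF.continuousOn, hda⟩)
  · exact DifferentiableOn.mul (by fun_prop) ((Complex.differentiableOn_dslope
      (isOpen_openUpperHP.mem_nhds hm)).2 hF.differentiableOn)
  · have := hF.tendsto_one.mul (tendsto_one_of_isBigO
      (isBigO_div_sub_one (Complex.I * κ) (-(Complex.I * κ))))
    rw [mul_one] at this
    exact this.congr' hev.symm
  · intro z hz hz0
    by_cases hzκ : z = Complex.I * κ
    · subst hzκ
      refine iff_of_false ?_ ?_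
      · simp only [hH, dslope_same]
        exact mul_ne_zero (add_I_mul_ne_zero hz hκ) (hF.simple κ (mem_insert _ _))
      · rintro ⟨μ, hμ, h⟩
        exact hκK (hinj μ h.symm ▸ hμ)
    · rw [hiff z hz hzκ, hF.zero_iff z hz hz0]
      constructor
      · rintro ⟨μ, hμ, rfl⟩
        rcases hμ with rfl | hμ
        · exact absurd rfl hzκ
        · exact ⟨μ, hμ, rfl⟩
      · rintro ⟨μ, hμ, rfl⟩
        exact ⟨μ, mem_insert_of_mem _ hμ, rfl⟩
  · intro μ hμ hd0
    have hμm : Complex.I * μ ∈ openUpperHP := I_mul_mem_openUpperHP (hpos μ hμ)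
    have hμc := openUpperHP_subset hμm
    refine hF.simple μ (mem_insert_of_mem _ hμ) ?_
    have hHμ : H (Complex.I * μ) = 0 := by
      rw [hiff _ hμc fun h => hκK (hinj μ h ▸ hμ)]
      exact (hF.zero_iff _ hμc (ne_zero_of_mem_openUpperHP hμm)).2 ⟨μ, mem_insert_of_mem _ hμ, rfl⟩
    have hHd : DifferentiableAt ℂ H (Complex.I * μ) := by
      refine DifferentiableAt.mul (by fun_prop) ?_
      exact ((Complex.differentiableOn_dslope (isOpen_openUpperHP.mem_nhds hm)).2
        hF.differentiableOn _ hμm).differentiableAt (isOpen_openUpperHP.mem_nhds hμm)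
    have hbd : DifferentiableAt ℂ (fun z : ℂ => (z - Complex.I * κ) / (z + Complex.I * κ))
        (Complex.I * μ) :=
      DifferentiableAt.div (by fun_prop) (by fun_prop) (add_I_mul_ne_zero hμc hκ)
    have hee : F =ᶠ[𝓝 (Complex.I * μ)]
        fun z => (z - Complex.I * κ) / (z + Complex.I * κ) * H z := by
      filter_upwards [closedUpperHP_mem_nhds hμm] with z hz using hfac z hz
    rw [hee.deriv_eq]
    refine (hbd.hasDerivAt.mul hHd.hasDerivAt).deriv.trans ?_
    rw [hHμ, hd0, mul_zero, mul_zero, add_zero]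
  · intro hH0
    obtain ⟨c, hc, hcd⟩ := hF.simple_at_zero ((hiff 0 h0c hm0.symm).1 hH0)
    have hbd : HasDerivWithinAt (fun z : ℂ => (z + Complex.I * κ) / (z + -(Complex.I * κ)))
        (derivWithin (fun z : ℂ => (z + Complex.I * κ) / (z + -(Complex.I * κ))) closedUpperHP 0)
        closedUpperHP 0 := by
      refine DifferentiableWithinAt.hasDerivWithinAt ?_
      refine DifferentiableWithinAt.div (by fun_prop) (by fun_prop) ?_
      rw [zero_add]
      exact neg_ne_zero.2 hm0
    have hprod := hcd.mul hbd
    rw [(hiff 0 h0c hm0.symm).1 hH0, zero_mul, add_zero] at hprod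
    refine ⟨_, ?_, hprod.congr_of_eventuallyEq ?_ (by simpa using hne 0 hm0.symm)⟩
    · rw [zero_add, zero_add]
      exact mul_ne_zero hc (div_ne_zero hm0 (neg_ne_zero.2 hm0))
    · have : ∀ᶠ z in 𝓝[closedUpperHP] (0 : ℂ), z ≠ Complex.I * κ :=
        nhdsWithin_le_nhds (isOpen_ne.mem_nhds hm0.symm)
      filter_upwards [this] with z hz using hne z hz

/-- A function without zeros in the upper half-plane, after removing a possible zero at `0`. -/
theorem IsJostClass.exists_div_zero {F : ℂ → ℂ} (hF : IsJostClass ∅ F) (h0 : F 0 = 0) :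
    ∃ Φ : ℂ → ℂ, ContinuousOn Φ closedUpperHP ∧ DifferentiableOn ℂ Φ openUpperHP ∧
      (∀ z ∈ closedUpperHP, Φ z ≠ 0) ∧
      (∀ z ∈ closedUpperHP, F z = z / (z + Complex.I) * Φ z) ∧
      Φ =ᶠ[atInf] fun z => F z * ((z + Complex.I) / (z + 0)) := by
  obtain ⟨c, hc, hcd⟩ := hF.simple_at_zero h0
  have hI : ∀ z ∈ closedUpperHP, z + Complex.I ≠ 0 := fun z hz => by
    have := add_I_mul_ne_zero hz one_pos
    simpa using this
  -- The value c·i at 0 is the limit of (F(z)/z)(z + i). The denominator is written z + 0 to match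
  -- the pattern (z + a)/(z + b).
  set Φ : ℂ → ℂ := Function.update (fun z => F z * ((z + Complex.I) / (z + 0))) 0 (c * Complex.I)
    with hΦ
  have hne : ∀ z, z ≠ 0 → Φ z = F z * ((z + Complex.I) / (z + 0)) := fun z hz => by
    rw [hΦ, Function.update_of_ne hz]
  have hz : Φ 0 = c * Complex.I := by rw [hΦ, Function.update_self]
  refine ⟨Φ, ?_, ?_, ?_, ?_, ?_⟩
  · intro z hzc
    by_cases hz0 : z = 0
    · subst hz0
      rw [hΦ, continuousWithinAt_update_same]
      have h1 := hasDerivWithinAt_iff_tendsto_slope.1 hcd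
      have h2 : Tendsto (fun z : ℂ => z + Complex.I) (𝓝[closedUpperHP \ {0}] 0) (𝓝 Complex.I) := by
        have : Continuous fun z : ℂ => z + Complex.I := by fun_prop
        have h := this.tendsto 0
        rw [zero_add] at h
        exact tendsto_nhdsWithin_of_tendsto_nhds h
      refine (h1.mul h2).congr fun z => ?_
      rw [slope_def_field, h0]
      ring
    · have h1 : ContinuousWithinAt (fun z => F z * ((z + Complex.I) / (z + 0))) closedUpperHP z := by
        refine (hF.continuousOn z hzc).mul (ContinuousWithinAt.div (by fun_prop) (by fun_prop) ?_)
        rwa [add_zero]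
      refine h1.congr_of_eventuallyEq ?_ (hne z hz0)
      have : ∀ᶠ w in 𝓝[closedUpperHP] z, w ≠ 0 := nhdsWithin_le_nhds (isOpen_ne.mem_nhds hz0)
      filter_upwards [this] with w hw using hne w hw
  · have h1 : DifferentiableOn ℂ (fun z => F z * ((z + Complex.I) / (z + 0))) openUpperHP := by
      refine hF.differentiableOn.mul (DifferentiableOn.div (by fun_prop) (by fun_prop) ?_)
      intro z hz
      rw [add_zero]
      exact ne_zero_of_mem_openUpperHP hz
    exact h1.congr fun z hz => hne z (ne_zero_of_mem_openUpperHP hz)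
  · intro z hzc
    by_cases hz0 : z = 0
    · rw [hz0, hz]
      exact mul_ne_zero hc Complex.I_ne_zero
    · rw [hne z hz0]
      refine mul_ne_zero (fun h => ?_) (div_ne_zero (hI z hzc) (by rwa [add_zero]))
      obtain ⟨κ, hκ, -⟩ := (hF.zero_iff z hzc hz0).1 h
      exact hκ
  · intro z hzc
    by_cases hz0 : z = 0
    · rw [hz0, h0]
      simp
    · rw [hne z hz0, add_zero]
      have := hI z hzc
      field_simp
  · filter_upwards [tendsto_ne_atInf 0] with z hz using hne z hz

/-- The two factorizations `F = w Φ` and `F = w₁ Φ` with a nonvanishing `Φ`. -/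
theorem IsJostClass.exists_factor {K : Set ℝ} (hK : K.Finite) (hpos : ∀ κ ∈ K, 0 < κ) :
    ∀ {F : ℂ → ℂ}, IsJostClass K F →
    ∃ Φ : ℂ → ℂ, ContinuousOn Φ closedUpperHP ∧ DifferentiableOn ℂ Φ openUpperHP ∧
      (∀ z ∈ closedUpperHP, Φ z ≠ 0) ∧ Tendsto Φ atInf (𝓝 1) ∧
      (((fun z => F z - 1) =O[atInf] fun z => z⁻¹) →
        (fun z => Φ z - 1) =O[atInf] fun z => z⁻¹) ∧
      (F 0 ≠ 0 → ∀ z ∈ closedUpperHP, F z = blaschke K z * Φ z) ∧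
      (F 0 = 0 → ∀ z ∈ closedUpperHP, F z = blaschke₁ K z * Φ z) := by
  induction K, hK using Set.Finite.induction_on with
  | empty =>
    intro F hF
    by_cases h0 : F 0 = 0
    · obtain ⟨Φ, h1, h2, h3, h4, h5⟩ := hF.exists_div_zero h0
      have hb := isBigO_div_sub_one Complex.I 0
      refine ⟨Φ, h1, h2, h3, ?_, fun h => ?_, fun h => absurd h0 h, fun _ z hz => ?_⟩
      · have := hF.tendsto_one.mul (tendsto_one_of_isBigO hb)
        rw [mul_one] at this
        exact this.congr' h5.symm
      · refine (isBigO_mul_sub_one h hb).congr' ?_ EventuallyEq.rfl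
        filter_upwards [h5] with z hz
        rw [hz]
      · rw [h4 z hz, blaschke₁, blaschke, finprod_mem_empty, mul_one]
    · refine ⟨F, hF.continuousOn, hF.differentiableOn, fun z hz h => ?_, hF.tendsto_one, id,
        fun _ z _ => ?_, fun h => absurd h h0⟩
      · by_cases hz0 : z = 0
        · exact h0 (hz0 ▸ h)
        · obtain ⟨κ, hκ, -⟩ := (hF.zero_iff z hz hz0).1 h
          exact hκ
      · rw [blaschke, finprod_mem_empty, one_mul]
  | @insert κ K hκ hK ih =>
    intro F hF
    have hκ0 := hpos κ (mem_insert _ _)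
    have hpos' : ∀ μ ∈ K, 0 < μ := fun μ hμ => hpos μ (mem_insert_of_mem _ hμ)
    obtain ⟨H, hH, hH0, hfac, hev⟩ := hF.exists_div hκ0 hκ hpos'
    obtain ⟨Φ, h1, h2, h3, h4, h5, h6, h7⟩ := ih hpos' hH
    refine ⟨Φ, h1, h2, h3, h4, fun h => h5 ?_, fun h z hz => ?_, fun h z hz => ?_⟩
    · refine (isBigO_mul_sub_one h (isBigO_div_sub_one (Complex.I * κ)
        (-(Complex.I * κ)))).congr' ?_ EventuallyEq.rfl
      filter_upwards [hev] with z hz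
      rw [hz]
    · rw [hfac z hz, h6 (mt hH0.1 h) z hz, blaschke_insert hK hκ]
      ring
    · rw [hfac z hz, h7 (hH0.2 h) z hz, blaschke₁, blaschke₁, blaschke_insert hK hκ]
      ring

theorem blaschke_neg {K : Set ℝ} (hK : K.Finite) (z : ℂ) : blaschke K (-z) = (blaschke K z)⁻¹ := by
  rw [blaschke, blaschke, ← finprod_mem_inv_distrib _ hK]
  refine finprod_mem_congr rfl fun κ _ => ?_
  rw [inv_div, ← neg_div_neg_eq]
  congr 1 <;> ring

theorem blaschke_ofReal_ne_zero {K : Set ℝ} (hpos : ∀ κ ∈ K, 0 < κ) (t : ℝ) :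
    blaschke K t ≠ 0 := by
  refine finprod_mem_induction (p := fun z : ℂ => z ≠ 0) one_ne_zero (fun _ _ => mul_ne_zero)
    fun κ hκ => div_ne_zero (fun h => ?_)
      (add_I_mul_ne_zero (ofReal_mem_closedUpperHP t) (hpos κ hκ))
  have h2 := congrArg Complex.im h
  have := hpos κ hκ
  simp at h2
  linarith

theorem blaschke₁_ofReal_ne_zero {K : Set ℝ} (hpos : ∀ κ ∈ K, 0 < κ) {t : ℝ} (ht : t ≠ 0) :
    blaschke₁ K t ≠ 0 := by
  refine mul_ne_zero (div_ne_zero (by exact_mod_cast ht) ?_) (blaschke_ofReal_ne_zero hpos t)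
  simpa using add_I_mul_ne_zero (ofReal_mem_closedUpperHP t) one_pos

/-- The numerator of the real part is |z|^2 + Im z > 0, so the principal logarithm is analytic on
the open half-plane and continuous up to the real axis away from 0. -/
theorem div_add_I_mem_slitPlane {z : ℂ} (hz : z ∈ closedUpperHP \ {0}) :
    z / (z + Complex.I) ∈ Complex.slitPlane := by
  have hI : z + Complex.I ≠ 0 := by simpa using add_I_mul_ne_zero hz.1 one_pos
  refine Or.inl ?_
  rw [Complex.div_re, ← add_div]
  refine div_pos ?_ (Complex.normSq_pos.2 hI)
  have h1 : 0 < Complex.normSq z := Complex.normSq_pos.2 hz.2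
  rw [Complex.normSq_apply] at h1
  have h2 : 0 ≤ z.im := hz.1
  simp only [Complex.add_re, Complex.I_re, Complex.add_im, Complex.I_im]
  nlinarith

theorem eventually_norm_lt_one : ∀ᶠ z : ℂ in 𝓝[closedUpperHP \ {0}] 0, ‖z‖ < 1 := by
  refine nhdsWithin_le_nhds ?_
  have : Tendsto (fun z : ℂ => ‖z‖) (𝓝 0) (𝓝 0) := by simpa using continuous_norm.tendsto (0 : ℂ)
  exact this.eventually_lt_const one_pos

theorem isBigO_one_root :
    (fun _ : ℂ => (1 : ℝ)) =O[𝓝[closedUpperHP \ {0}] 0] fun w => (√‖w‖)⁻¹ := by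
  refine Asymptotics.IsBigO.of_bound 1 ?_
  filter_upwards [eventually_norm_lt_one, self_mem_nhdsWithin] with z hz hz'
  rw [norm_one, one_mul, Real.norm_of_nonneg (by positivity)]
  refine (one_le_inv₀ (Real.sqrt_pos.2 (norm_pos_iff.2 hz'.2))).2 ?_
  exact Real.sqrt_le_one.2 hz.le

/-- The imaginary part of the logarithm is at most π, and the real part grows like log|z|, more
slowly than any negative power. -/
theorem isBigO_log_div_add_I :
    (fun z : ℂ => Complex.log (z / (z + Complex.I))) =O[𝓝[closedUpperHP \ {0}] 0]
      fun w => (√‖w‖)⁻¹ := by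
  have hlim : Tendsto (fun z : ℂ => ‖z / (z + Complex.I)‖) (𝓝[closedUpperHP \ {0}] 0)
      (𝓝[>] 0) := by
    refine tendsto_nhdsWithin_iff.2 ⟨?_, ?_⟩
    · have : ContinuousAt (fun z : ℂ => ‖z / (z + Complex.I)‖) 0 :=
        (ContinuousAt.div (by fun_prop) (by fun_prop) (by simp)).norm
      have h := this.tendsto
      simp only [zero_div, norm_zero] at h
      exact tendsto_nhdsWithin_of_tendsto_nhds h
    · filter_upwards [self_mem_nhdsWithin] with z hz
      exact norm_pos_iff.2 (Complex.slitPlane_ne_zero (div_add_I_mem_slitPlane hz))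
  have h1 := ((isLittleO_log_rpow_nhdsGT_zero (r := -(1 / 2)) (by norm_num)).isBigO).comp_tendsto
    hlim
  have h2 : (fun z : ℂ => ‖z / (z + Complex.I)‖ ^ (-(1 / 2) : ℝ)) =O[𝓝[closedUpperHP \ {0}] 0]
      fun w => (√‖w‖)⁻¹ := by
    refine Asymptotics.IsBigO.of_bound (√2) ?_
    filter_upwards [eventually_norm_lt_one, self_mem_nhdsWithin] with z hz hz'
    have hzI : ‖z + Complex.I‖ ≤ 2 := by
      refine (norm_add_le _ _).trans ?_
      rw [Complex.norm_I]
      linarith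
    rw [Real.rpow_neg (norm_nonneg _), ← Real.sqrt_eq_rpow, norm_div, Real.sqrt_div (norm_nonneg _),
      inv_div, Real.norm_of_nonneg (by positivity), Real.norm_of_nonneg (by positivity),
      div_eq_mul_inv]
    gcongr
  have h4 : (fun z : ℂ => Complex.log (z / (z + Complex.I))) =O[𝓝[closedUpperHP \ {0}] 0]
      fun z => |Real.log ‖z / (z + Complex.I)‖| + Real.pi * 1 := by
    refine Asymptotics.IsBigO.of_bound 1 (Eventually.of_forall fun z => ?_)
    rw [one_mul, mul_one, Real.norm_of_nonneg (by positivity)]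
    refine (Complex.norm_le_abs_re_add_abs_im _).trans ?_
    rw [Complex.log_re, Complex.log_im]
    gcongr
    exact Complex.abs_arg_le_pi _
  exact h4.trans (((h1.trans h2).abs_left).add (isBigO_one_root.const_mul_left _))

/-- `l` is a logarithm of `F / W` on the closed upper half-plane without `0`, with a controlled
singularity at `0` and equal to `0` at infinity. -/
structure IsLogQuotient (W F l : ℂ → ℂ) : Prop where
  continuousOn : ContinuousOn l (closedUpperHP \ {0})
  differentiableOn : DifferentiableOn ℂ l openUpperHP
  eq : ∀ z ∈ closedUpperHP \ {0}, F z = W z * Complex.exp (l z)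
  tendsto_zero : Tendsto l atInf (𝓝 0)
  isBigO_zero : l =O[𝓝[closedUpperHP \ {0}] 0] fun w => (√‖w‖)⁻¹

theorem isBigO_root_of_continuousOn {l : ℂ → ℂ} (h : ContinuousOn l closedUpperHP) :
    l =O[𝓝[closedUpperHP \ {0}] 0] fun w => (√‖w‖)⁻¹ := by
  have h0 := (h 0 (by simp [closedUpperHP_def])).mono (sdiff_subset (t := {0}))
  exact (h0.isBigO_one ℝ).trans isBigO_one_root

section exists_log
variable {K : Set ℝ} (hK : K.Finite) (hpos : ∀ κ ∈ K, 0 < κ) {F : ℂ → ℂ} (hF : IsJostClass K F)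
include hK hpos hF

theorem IsJostClass.exists_logQuotient_of_ne_zero (h0 : F 0 ≠ 0) :
    ∃ l, IsLogQuotient (blaschke K) F l ∧ ContinuousOn l closedUpperHP ∧
      (((fun z => F z - 1) =O[atInf] fun z => z⁻¹) → l =O[atInf] fun z => z⁻¹) := by
  obtain ⟨Φ, h1, h2, h3, h4, h5, h6, -⟩ := hF.exists_factor hK hpos
  obtain ⟨l, hl1, hl2, hl3, hl4⟩ := exists_log h1 h2 h3 h4
  refine ⟨l, ⟨hl1.mono sdiff_subset, hl2, fun z hz => ?_, ?_, isBigO_root_of_continuousOn hl1⟩, hl1,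
    fun h => (isBigO_log h4 (h5 h)).congr' hl4.symm EventuallyEq.rfl⟩
  · rw [hl3 z hz.1, h6 h0 z hz.1]
  · exact (tendsto_log_atInf h4).congr' hl4.symm

theorem IsJostClass.exists_logQuotient_of_eq_zero (h0 : F 0 = 0) :
    ∃ l, IsLogQuotient (blaschke₁ K) F l ∧ ContinuousOn l closedUpperHP ∧
      (((fun z => F z - 1) =O[atInf] fun z => z⁻¹) → l =O[atInf] fun z => z⁻¹) := by
  obtain ⟨Φ, h1, h2, h3, h4, h5, -, h6⟩ := hF.exists_factor hK hpos
  obtain ⟨l, hl1, hl2, hl3, hl4⟩ := exists_log h1 h2 h3 h4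
  refine ⟨l, ⟨hl1.mono sdiff_subset, hl2, fun z hz => ?_, ?_, isBigO_root_of_continuousOn hl1⟩, hl1,
    fun h => (isBigO_log h4 (h5 h)).congr' hl4.symm EventuallyEq.rfl⟩
  · rw [hl3 z hz.1, h6 h0 z hz.1]
  · exact (tendsto_log_atInf h4).congr' hl4.symm

/-- One factor w covers both cases: when F(0) = 0 the logarithm of z/(z+i) is added, at the price of
an integrable singularity at 0. This is why the formulas with w remain valid when f(0) = 0. -/
theorem IsJostClass.exists_logQuotient :
    ∃ l, IsLogQuotient (blaschke K) F l ∧ (F 0 ≠ 0 → ContinuousOn l closedUpperHP) ∧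
      (((fun z => F z - 1) =O[atInf] fun z => z⁻¹) → l =O[atInf] fun z => z⁻¹) := by
  by_cases h0 : F 0 = 0
  · obtain ⟨l, h1, -, h3⟩ := hF.exists_logQuotient_of_eq_zero hK hpos h0
    have hb : (fun z : ℂ => z / (z + Complex.I) - 1) =O[atInf] fun z => z⁻¹ := by
      simpa using isBigO_div_sub_one 0 Complex.I
    have hb1 := tendsto_one_of_isBigO hb
    refine ⟨fun z => Complex.log (z / (z + Complex.I)) + l z, ⟨?_, ?_, fun z hz => ?_, ?_,
      isBigO_log_div_add_I.add h1.isBigO_zero⟩, fun h => absurd h0 h, fun h =>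
        (isBigO_log hb1 hb).add (h3 h)⟩
    · refine ContinuousOn.add (ContinuousOn.clog (ContinuousOn.div (by fun_prop) (by fun_prop)
        fun z hz => ?_) fun z hz => div_add_I_mem_slitPlane hz) h1.continuousOn
      simpa using add_I_mul_ne_zero hz.1 one_pos
    · refine DifferentiableOn.add (DifferentiableOn.clog (DifferentiableOn.div (by fun_prop)
        (by fun_prop) fun z hz => ?_) fun z hz => div_add_I_mem_slitPlane
          ⟨openUpperHP_subset hz, ne_zero_of_mem_openUpperHP hz⟩) h1.differentiableOn
      simpa using add_I_mul_ne_zero (openUpperHP_subset hz) one_pos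
    · rw [Complex.exp_add, Complex.exp_log (Complex.slitPlane_ne_zero (div_add_I_mem_slitPlane hz)),
        h1.eq z hz, blaschke₁]
      ring
    · simpa using (tendsto_log_atInf hb1).add h1.tendsto_zero
  · obtain ⟨l, h1, h2, h3⟩ := hF.exists_logQuotient_of_ne_zero hK hpos h0
    exact ⟨l, h1, fun _ => h2, h3⟩

end exists_log

/-! ### Multiplicative Riemann problems -/

/-- The two half-lines are disconnected from each other, so each is normalized at its own infinite
end, where both branches are small and exp is injective. -/
theorem IsLogBranch.eqOn {h L L' : ℝ → ℂ} (hL : IsLogBranch h L) (hL' : IsLogBranch h L') :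
    EqOn L L' {0}ᶜ := by
  have hexp : ∀ t, t ≠ 0 → Complex.exp (L t) = Complex.exp (L' t) := fun t ht => by
    rw [hL.exp_eq t ht, hL'.exp_eq t ht]
  intro t ht
  rcases lt_or_gt_of_ne (show t ≠ 0 from ht) with h0 | h0
  · have h1 := eventuallyEq_of_exp_eq hL.tendsto_atBot hL'.tendsto_atBot (by
      filter_upwards [eventually_lt_atBot 0] with s hs using hexp s hs.ne)
    obtain ⟨s, hs, hs0⟩ := (h1.and (eventually_lt_atBot 0)).exists
    have hsub : Iio (0 : ℝ) ⊆ {0}ᶜ := fun x hx => ne_of_lt hx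
    exact eqOn_of_exp_eq isPreconnected_Iio (hL.continuousOn.mono hsub)
      (hL'.continuousOn.mono hsub) (fun x hx => hexp x (hsub hx)) hs0 hs h0
  · have h1 := eventuallyEq_of_exp_eq hL.tendsto_atTop hL'.tendsto_atTop (by
      filter_upwards [eventually_gt_atTop 0] with s hs using hexp s hs.ne')
    obtain ⟨s, hs, hs0⟩ := (h1.and (eventually_gt_atTop 0)).exists
    have hsub : Ioi (0 : ℝ) ⊆ {0}ᶜ := fun x hx => ne_of_gt hx
    exact eqOn_of_exp_eq isPreconnected_Ioi (hL.continuousOn.mono hsub)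
      (hL'.continuousOn.mono hsub) (fun x hx => hexp x (hsub hx)) hs0 hs h0

theorem IsLogBranch.congr {h h' L : ℝ → ℂ} (hL : IsLogBranch h L) (hh : ∀ t, t ≠ 0 → h t = h' t) :
    IsLogBranch h' L :=
  ⟨hL.continuousOn, fun t ht => (hL.exp_eq t ht).trans (hh t ht), hL.tendsto_atTop,
    hL.tendsto_atBot⟩

/-- The hypotheses cover neighbourhoods of 0 and of infinity; the part of the closed half-plane in
between is compact. -/
theorem exists_le_root {l : ℂ → ℂ} (hc : ContinuousOn l (closedUpperHP \ {0}))
    (h0 : l =O[𝓝[closedUpperHP \ {0}] 0] fun w => (√‖w‖)⁻¹) (hinf : l =O[atInf] fun z => z⁻¹) :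
    ∃ B : ℝ, ∀ w ∈ closedUpperHP \ {0}, ‖l w‖ ≤ B * (√‖w‖)⁻¹ := by
  obtain ⟨B₀, hB₀⟩ := h0.bound
  obtain ⟨B₁, hB₁, hB₁'⟩ := hinf.exists_pos
  rw [Asymptotics.isBigOWith_iff] at hB₁'
  obtain ⟨r, hr, hr'⟩ := Metric.mem_nhdsWithin_iff.1 hB₀
  obtain ⟨R, hR, hR'⟩ : ∃ R : ℝ, 1 ≤ R ∧ ∀ z ∈ closedUpperHP, R < ‖z‖ →
      ‖l z‖ ≤ B₁ * ‖z⁻¹‖ := by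
    rw [eventually_inf_principal, ← comap_norm_atTop, eventually_comap] at hB₁'
    obtain ⟨R, hR⟩ := eventually_atTop.1 hB₁'
    exact ⟨max R 1, le_max_right _ _, fun z hz h => hR ‖z‖ ((le_max_left _ _).trans h.le) z rfl hz⟩
  set A : Set ℂ := {z | z ∈ closedUpperHP ∧ r ≤ ‖z‖ ∧ ‖z‖ ≤ R} with hA
  have hAc : IsCompact A := by
    refine Metric.isCompact_of_isClosed_isBounded ?_ ?_
    · have h1 : IsClosed {z : ℂ | 0 ≤ z.im} := isClosed_le continuous_const Complex.continuous_im
      have h2 : IsClosed {z : ℂ | r ≤ ‖z‖} := isClosed_le continuous_const continuous_norm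
      have h3 : IsClosed {z : ℂ | ‖z‖ ≤ R} := isClosed_le continuous_norm continuous_const
      exact h1.inter (h2.inter h3)
    · refine (Metric.isBounded_closedBall (x := (0 : ℂ)) (r := R)).subset fun z hz => ?_
      rw [mem_closedBall_zero_iff]
      exact hz.2.2
  have hAs : A ⊆ closedUpperHP \ {0} := fun z hz => ⟨hz.1, norm_pos_iff.1 (hr.trans_le hz.2.1)⟩
  obtain ⟨M, hM⟩ := hAc.exists_bound_of_continuousOn (hc.mono hAs)
  refine ⟨max B₀ (max B₁ (M * √R)), fun w hw => ?_⟩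
  have hw0 : 0 < ‖w‖ := norm_pos_iff.2 hw.2
  have hs : 0 < √‖w‖ := Real.sqrt_pos.2 hw0
  by_cases h1 : ‖w‖ < r
  · have : ‖l w‖ ≤ B₀ * ‖(√‖w‖)⁻¹‖ := hr' ⟨mem_ball_zero_iff.2 h1, hw⟩
    rw [Real.norm_of_nonneg (by positivity)] at this
    exact this.trans (by gcongr; exact le_max_left _ _)
  · by_cases h2 : R < ‖w‖
    · refine (hR' w hw.1 h2).trans ?_
      rw [norm_inv]
      have h3 : √‖w‖ ≤ ‖w‖ := by
        rw [Real.sqrt_le_left hw0.le]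
        nlinarith
      exact mul_le_mul ((le_max_left _ _).trans (le_max_right _ _)) (by gcongr) (by positivity)
        (hB₁.le.trans ((le_max_left _ _).trans (le_max_right _ _)))
    · have h3 : ‖l w‖ ≤ M := hM w ⟨hw.1, not_lt.1 h1, not_lt.1 h2⟩
      have hM0 : 0 ≤ M := (norm_nonneg _).trans h3
      have h4 : M ≤ M * √R * (√‖w‖)⁻¹ := by
        rw [mul_assoc, ← div_eq_mul_inv]
        refine le_mul_of_one_le_right hM0 ((one_le_div hs).2 ?_)
        exact Real.sqrt_le_sqrt (not_lt.1 h2)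
      refine (h3.trans h4).trans ?_
      gcongr
      exact (le_max_right _ _).trans (le_max_right _ _)

namespace IsLogQuotient
variable {W F l : ℂ → ℂ} (hl : IsLogQuotient W F l)
include hl

theorem tendsto_mul_zero : Tendsto (fun w => w * l w) (𝓝[closedUpperHP \ {0}] 0) (𝓝 0) := by
  have h1 := (Asymptotics.isBigO_refl (fun w : ℂ => w) (𝓝[closedUpperHP \ {0}] 0)).norm_right.mul
    hl.isBigO_zero
  refine h1.trans_tendsto ?_
  have h2 : Tendsto (fun w : ℂ => √‖w‖) (𝓝[closedUpperHP \ {0}] 0) (𝓝 0) := by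
    have : Continuous fun w : ℂ => √‖w‖ := by fun_prop
    have h := this.tendsto 0
    simp only [norm_zero, Real.sqrt_zero] at h
    exact tendsto_nhdsWithin_of_tendsto_nhds h
  refine h2.congr fun w => ?_
  rw [← div_eq_mul_inv, Real.div_sqrt]

/-- The boundary values `l(t) ± l(-t)` as branches of logarithms. -/
theorem isLogBranch (hW : ∀ t : ℝ, t ≠ 0 → W t ≠ 0) (σ : ℤ) :
    IsLogBranch (fun t => F t / W t * (F (-(t : ℂ)) / W (-(t : ℂ))) ^ σ)
      fun t => l t + σ * l (-(t : ℂ)) := by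
  have hq : ∀ t : ℝ, t ≠ 0 → F t / W t = Complex.exp (l t) := fun t ht => by
    rw [hl.eq t (ofReal_mem_punctured ht), mul_div_cancel_left₀ _ (hW t ht)]
  refine ⟨?_, fun t ht => ?_, ?_, ?_⟩
  · refine ContinuousOn.add ?_ (continuousOn_const.mul ?_)
    · exact hl.continuousOn.comp (f := fun t : ℝ => (t : ℂ)) (by fun_prop)
        fun t ht => ofReal_mem_punctured ht
    · exact hl.continuousOn.comp (f := fun t : ℝ => -(t : ℂ)) (by fun_prop)
        fun t ht => neg_ofReal_mem_punctured ht
  · have h2 := hq (-t) (neg_ne_zero.2 ht)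
    rw [Complex.ofReal_neg] at h2
    rw [hq t ht, h2, Complex.exp_add, Complex.exp_int_mul]
  · simpa using (hl.tendsto_zero.comp tendsto_ofReal_atInf_atTop).add
      ((hl.tendsto_zero.comp tendsto_neg_ofReal_atInf_atTop).const_mul (σ : ℂ))
  · simpa using (hl.tendsto_zero.comp tendsto_ofReal_atInf_atBot).add
      ((hl.tendsto_zero.comp tendsto_neg_ofReal_atInf_atBot).const_mul (σ : ℂ))

/-- The solution formula for a Riemann problem. -/
theorem representation (hW : ∀ t : ℝ, t ≠ 0 → W t ≠ 0) (hinf : l =O[atInf] fun z => z⁻¹) {σ : ℤ}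
    {L : ℝ → ℂ} (hL : IsLogBranch (fun t => F t / W t * (F (-(t : ℂ)) / W (-(t : ℂ))) ^ σ) L)
    {z : ℂ} (hz : z ∈ openUpperHP) :
    Integrable (fun t : ℝ => L t / (t - z)) ∧
      F z = Complex.exp (1 / (2 * Real.pi * Complex.I) * ∫ t : ℝ, L t / (t - z)) * W z := by
  obtain ⟨B, hB⟩ := exists_le_root hl.continuousOn hl.isBigO_zero hinf
  have hne : ∀ᵐ t : ℝ, t ≠ 0 := by simp [ae_iff, measure_singleton]
  have hae : (fun t : ℝ => (l t + σ * l (-(t : ℂ))) / (t - z)) =ᵐ[volume]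
      fun t : ℝ => L t / (t - z) := by
    filter_upwards [hne] with t ht
    rw [hL.eqOn (hl.isLogBranch hW σ) ht]
  refine ⟨(integrable_boundary hl.continuousOn hB σ hz).congr hae, ?_⟩
  rw [← integral_congr_ae hae, integral_boundary hl.continuousOn hl.differentiableOn hB σ hz,
    hl.eq z ⟨openUpperHP_subset hz, ne_zero_of_mem_openUpperHP hz⟩, mul_comm]
  congr 2
  have := Real.pi_ne_zero
  field_simp

/-- Uniqueness in a Riemann problem. -/
theorem eqOn {F' l' : ℂ → ℂ} (hl' : IsLogQuotient W F' l') (hW : ∀ t : ℝ, t ≠ 0 → W t ≠ 0) (σ : ℤ)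
    (h : ∀ t : ℝ, t ≠ 0 → F t * F (-(t : ℂ)) ^ σ = F' t * F' (-(t : ℂ)) ^ σ) :
    EqOn F F' openUpperHP := by
  intro z hz
  have hz' : z ∈ closedUpperHP \ {0} := ⟨openUpperHP_subset hz, ne_zero_of_mem_openUpperHP hz⟩
  have hbr : EqOn (fun t : ℝ => l t + σ * l (-(t : ℂ))) (fun t : ℝ => l' t + σ * l' (-(t : ℂ)))
      {0}ᶜ := by
    refine (hl.isLogBranch hW σ).eqOn ((hl'.isLogBranch hW σ).congr fun t ht => ?_)
    rw [div_zpow, div_zpow, div_mul_div_comm, div_mul_div_comm, h t ht]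
  -- A general member of the class merely tends to 1 at infinity, with no rate. The two logarithms
  -- are therefore compared through symmetric limits rather than absolutely convergent integrals.
  have h1 := tendsto_cauchy hl.continuousOn hl.differentiableOn hl.tendsto_mul_zero
    hl.tendsto_zero (σ : ℂ) hz
  have h2 := tendsto_cauchy hl'.continuousOn hl'.differentiableOn hl'.tendsto_mul_zero
    hl'.tendsto_zero (σ : ℂ) hz
  have h3 : 2 * Real.pi * Complex.I * l z = 2 * Real.pi * Complex.I * l' z := by
    refine tendsto_nhds_unique (h1.congr fun e => ?_) h2
    refine integral_congr_ae (ae_restrict_of_ae ?_)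
    have hne : ∀ᵐ t : ℝ, t ≠ 0 := by simp [ae_iff, measure_singleton]
    filter_upwards [hne] with t ht
    have := hbr ht
    simp only at this
    rw [this]
  rw [hl.eq z hz', hl'.eq z hz', mul_left_cancel₀ Complex.two_pi_I_ne_zero h3]

end IsLogQuotient

/-- Uniqueness in a Riemann problem in the class of Jost functions. -/
theorem IsJostClass.eqOn {K : Set ℝ} (hK : K.Finite) (hpos : ∀ κ ∈ K, 0 < κ) {F F' : ℂ → ℂ}
    (hF : IsJostClass K F) (hF' : IsJostClass K F') (σ : ℤ)
    (h : ∀ t : ℝ, t ≠ 0 → F t * F (-(t : ℂ)) ^ σ = F' t * F' (-(t : ℂ)) ^ σ) :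
    EqOn F F' closedUpperHP := by
  obtain ⟨l, hl, -⟩ := hF.exists_logQuotient hK hpos
  obtain ⟨l', hl', -⟩ := hF'.exists_logQuotient hK hpos
  have h1 := hl.eqOn hl' (fun t _ => blaschke_ofReal_ne_zero hpos t) σ h
  exact h1.of_subset_closure hF.continuousOn hF'.continuousOn openUpperHP_subset
    closure_openUpperHP.ge

theorem IsJostClass.ofReal_ne_zero {K : Set ℝ} (hpos : ∀ κ ∈ K, 0 < κ) {F : ℂ → ℂ}
    (hF : IsJostClass K F) {t : ℝ} (ht : t ≠ 0) : F t ≠ 0 := fun h => by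
  obtain ⟨κ, hκ, h1⟩ := (hF.zero_iff t (ofReal_mem_closedUpperHP t) (by exact_mod_cast ht)).1 h
  have h2 := congrArg Complex.im h1
  have := hpos κ hκ
  simp at h2
  linarith

theorem isLogBranch_ofReal_log {g : ℝ → ℝ} (hc : ContinuousOn g {0}ᶜ) (hpos : ∀ t, t ≠ 0 → 0 < g t)
    (hT : Tendsto g atTop (𝓝 1)) (hB : Tendsto g atBot (𝓝 1)) :
    IsLogBranch (fun t => (g t : ℂ)) fun t => (Real.log (g t) : ℂ) := by
  have hlim : ∀ l : Filter ℝ, Tendsto g l (𝓝 1) →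
      Tendsto (fun t => (Real.log (g t) : ℂ)) l (𝓝 0) := fun l hl => by
    have := (Complex.continuous_ofReal.tendsto _).comp (hl.log one_ne_zero)
    rwa [Real.log_one, Complex.ofReal_zero] at this
  refine ⟨Complex.continuous_ofReal.comp_continuousOn (hc.log fun t ht => (hpos t ht).ne'),
    fun t ht => ?_, hlim _ hT, hlim _ hB⟩
  rw [← Complex.ofReal_exp, Real.exp_log (hpos t ht)]

theorem pos_of_mem_boundStates {q : ℝ → ℝ} : ∀ κ ∈ boundStates q, 0 < κ := fun _ h => h.1

/-! ### The Riemann problems with data g and S -/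

section
variable {q : ℝ → ℝ} (hq : MemL11 q)
include hq

theorem isBigO_jostFn_sub_one : (fun z => jostFn q z - 1) =O[atInf] fun z => z⁻¹ := by
  obtain ⟨C, hC⟩ := exists_norm_mul_norm_jostFn_sub_one_le hq
  refine Asymptotics.IsBigO.of_bound C ?_
  filter_upwards [eventually_atInf_mem, tendsto_ne_atInf 0] with z hz hz0
  rw [norm_inv, ← div_eq_mul_inv, le_div_iff₀ (norm_pos_iff.2 hz0), mul_comm]
  exact hC z hz

theorem continuous_norm_sq_jostFn : Continuous fun t : ℝ => ‖jostFn q t‖ ^ 2 :=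
  ((continuousOn_jostFn hq).comp_continuous (by fun_prop) ofReal_mem_closedUpperHP).norm.pow 2

theorem tendsto_norm_sq_jostFn {l : Filter ℝ} (hl : Tendsto (fun t : ℝ => (t : ℂ)) l atInf) :
    Tendsto (fun t : ℝ => ‖jostFn q t‖ ^ 2) l (𝓝 1) := by
  have := (((tendsto_jostFn hq).comp hl).norm).pow 2
  simpa using! this

theorem isLogBranch_log_gFun : IsLogBranch (fun t : ℝ => jostFn q t / blaschke (boundStates q) t *
    (jostFn q (-(t : ℂ)) / blaschke (boundStates q) (-(t : ℂ))) ^ (1 : ℤ))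
    fun t => (Real.log (gFun q t) : ℂ) := by
  have heq : EqOn (gFun q) (fun t : ℝ => ‖jostFn q t‖ ^ 2) {0}ᶜ := fun t ht => gFun_eq hq ht
  have h0 := isLogBranch_ofReal_log ((continuous_norm_sq_jostFn hq).continuousOn.congr heq)
    (fun t ht => gFun_pos hq ht)
    ((tendsto_norm_sq_jostFn hq tendsto_ofReal_atInf_atTop).congr' (by
      filter_upwards [eventually_gt_atTop 0] with t ht using (heq ht.ne').symm))
    ((tendsto_norm_sq_jostFn hq tendsto_ofReal_atInf_atBot).congr' (by
      filter_upwards [eventually_lt_atBot 0] with t ht using (heq ht.ne).symm))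
  refine h0.congr fun t ht => ?_
  have hw := blaschke_ofReal_ne_zero (pos_of_mem_boundStates (q := q)) t
  rw [zpow_one, blaschke_neg (finite_boundStates hq), ← jostFn_mul_jostFn_neg hq ht]
  field_simp

/-- The modified datum equals (1 + s^{-2})|f(s)|^2, that is |f|^2 divided by |s/(s+i)|^2; the
Blaschke product drops out because w(s)w(-s) = 1. -/
theorem isLogBranch_log_gFun_one : IsLogBranch (fun t : ℝ => jostFn q t /
    blaschke₁ (boundStates q) t *
    (jostFn q (-(t : ℂ)) / blaschke₁ (boundStates q) (-(t : ℂ))) ^ (1 : ℤ))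
    fun t => (Real.log ((t ^ 2 + 1) / (t * (iFun q t).im)) : ℂ) := by
  set g : ℝ → ℝ := fun t => (t ^ 2 + 1) / (t * (iFun q t).im)
  have heq : EqOn g (fun t : ℝ => (1 + (t⁻¹) ^ 2) * ‖jostFn q t‖ ^ 2) {0}ᶜ := fun t ht => by
    have ht' : t ≠ 0 := ht
    have hf : ‖jostFn q t‖ ≠ 0 := norm_ne_zero_iff.2 (jostFn_ofReal_ne_zero hq ht)
    simp only [g]
    rw [iFun_im hq ht]
    field_simp
  have hlim : ∀ l : Filter ℝ, Tendsto (fun t : ℝ => t⁻¹) l (𝓝 0) →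
      Tendsto (fun t : ℝ => (t : ℂ)) l atInf →
      Tendsto (fun t : ℝ => (1 + (t⁻¹) ^ 2) * ‖jostFn q t‖ ^ 2) l (𝓝 1) := fun l h1 h2 => by
    simpa using ((h1.pow 2).const_add 1).mul (tendsto_norm_sq_jostFn hq h2)
  have h0 := isLogBranch_ofReal_log (g := g) (ContinuousOn.congr (ContinuousOn.mul
      (continuousOn_const.add ((continuousOn_id.inv₀ fun t ht => ht).pow 2))
      (continuous_norm_sq_jostFn hq).continuousOn) heq)
    (fun t ht => by
      have hf : ‖jostFn q t‖ ≠ 0 := norm_ne_zero_iff.2 (jostFn_ofReal_ne_zero hq ht)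
      rw [heq ht]
      positivity)
    ((hlim _ tendsto_inv_atTop_zero tendsto_ofReal_atInf_atTop).congr' (by
      filter_upwards [eventually_gt_atTop 0] with t ht using (heq ht.ne').symm))
    ((hlim _ tendsto_inv_atBot_zero tendsto_ofReal_atInf_atBot).congr' (by
      filter_upwards [eventually_lt_atBot 0] with t ht using (heq ht.ne).symm))
  refine h0.congr fun t ht => ?_
  have hw := blaschke_ofReal_ne_zero (pos_of_mem_boundStates (q := q)) t
  have ht' : (t : ℂ) ≠ 0 := by exact_mod_cast ht
  have h1 : (t : ℂ) + Complex.I ≠ 0 := by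
    simpa using add_I_mul_ne_zero (ofReal_mem_closedUpperHP t) one_pos
  have h2 : -(t : ℂ) + Complex.I ≠ 0 := by
    simpa using add_I_mul_ne_zero (neg_ofReal_mem_closedUpperHP t) one_pos
  rw [heq ht, zpow_one, blaschke₁, blaschke₁, blaschke_neg (finite_boundStates hq)]
  push_cast
  rw [← Complex.ofReal_pow ‖jostFn q t‖, ← gFun_eq hq ht, ← jostFn_mul_jostFn_neg hq ht]
  have h3 : ((t : ℂ) + Complex.I) * (-(t : ℂ) + Complex.I) = -(t ^ 2 + 1) := by
    linear_combination (Complex.I_sq)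
  field_simp
  linear_combination (jostFn q t * jostFn q (-(t : ℂ))) * h3

omit hq in
theorem scatS_neg {t : ℝ} : scatS q (-t) = jostFn q t / jostFn q (-(t : ℂ)) := by
  rw [scatS]
  simp

/-- Because w(-t) = 1/w(t), dividing S(-t) by w(t)^2 divides f by w at both t and -t. This is the
case σ = -1 of the common scheme. -/
theorem scatS_div_eq (t : ℝ) : scatS q (-t) / blaschke (boundStates q) t ^ 2 =
    jostFn q t / blaschke (boundStates q) t *
      (jostFn q (-(t : ℂ)) / blaschke (boundStates q) (-(t : ℂ))) ^ (-1 : ℤ) := by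
  have hw := blaschke_ofReal_ne_zero (pos_of_mem_boundStates (q := q)) t
  rw [zpow_neg_one, blaschke_neg (finite_boundStates hq), scatS_neg, inv_div]
  field_simp

/-- The extra factor comes from (t+i)/t times (-t)/(-t+i), which equals (-t-i)/(-t+i). -/
theorem scatS_div_eq_one {t : ℝ} (ht : t ≠ 0) : scatS q (-t) *
    ((-(t : ℂ) - Complex.I) / (-(t : ℂ) + Complex.I)) / blaschke (boundStates q) t ^ 2 =
    jostFn q t / blaschke₁ (boundStates q) t *
      (jostFn q (-(t : ℂ)) / blaschke₁ (boundStates q) (-(t : ℂ))) ^ (-1 : ℤ) := by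
  have hw := blaschke_ofReal_ne_zero (pos_of_mem_boundStates (q := q)) t
  have ht' : (t : ℂ) ≠ 0 := by exact_mod_cast ht
  have h1 : (t : ℂ) + Complex.I ≠ 0 := by
    simpa using add_I_mul_ne_zero (ofReal_mem_closedUpperHP t) one_pos
  have h2 : -(t : ℂ) + Complex.I ≠ 0 := by
    simpa using add_I_mul_ne_zero (neg_ofReal_mem_closedUpperHP t) one_pos
  have h3 : jostFn q (-(t : ℂ)) ≠ 0 := by
    simpa using jostFn_ofReal_ne_zero hq (neg_ne_zero.2 ht)
  rw [zpow_neg_one, scatS_neg, blaschke₁, blaschke₁, blaschke_neg (finite_boundStates hq),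
    inv_div]
  field_simp
  ring

/-- The Riemann problem with datum `g`: uniqueness. -/
theorem eqOn_jostFn_of_gFun {F : ℂ → ℂ} (hF : IsJostClass (boundStates q) F)
    (h : ∀ k : ℝ, k ≠ 0 → F k = gFun q k / F (-(k : ℂ))) : EqOn F (jostFn q) closedUpperHP := by
  refine hF.eqOn (finite_boundStates hq) pos_of_mem_boundStates (isJostClass_jostFn hq) 1
    fun t ht => ?_
  have h1 : F (-(t : ℂ)) ≠ 0 := by
    simpa using hF.ofReal_ne_zero pos_of_mem_boundStates (neg_ne_zero.2 ht)
  rw [zpow_one, zpow_one, jostFn_mul_jostFn_neg hq ht, h t ht, div_mul_cancel₀ _ h1]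

/-- The Riemann problem with datum `S`: uniqueness. -/
theorem eqOn_jostFn_of_scatS {F : ℂ → ℂ} (hF : IsJostClass (boundStates q) F)
    (h : ∀ k : ℝ, k ≠ 0 → F k = scatS q (-k) * F (-(k : ℂ))) :
    EqOn F (jostFn q) closedUpperHP := by
  refine hF.eqOn (finite_boundStates hq) pos_of_mem_boundStates (isJostClass_jostFn hq) (-1)
    fun t ht => ?_
  have h1 : F (-(t : ℂ)) ≠ 0 := by
    simpa using hF.ofReal_ne_zero pos_of_mem_boundStates (neg_ne_zero.2 ht)
  rw [zpow_neg_one, zpow_neg_one, h t ht, scatS_neg, mul_inv_cancel_right₀ h1, div_eq_mul_inv]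

theorem exists_logQuotient_jostFn : ∃ l, IsLogQuotient (blaschke (boundStates q)) (jostFn q) l ∧
    (jostFn q 0 ≠ 0 → ContinuousOn l closedUpperHP) ∧ l =O[atInf] fun z => z⁻¹ := by
  obtain ⟨l, h1, h2, h3⟩ := (isJostClass_jostFn hq).exists_logQuotient (finite_boundStates hq)
    pos_of_mem_boundStates
  exact ⟨l, h1, h2, h3 (isBigO_jostFn_sub_one hq)⟩

theorem exists_logQuotient_jostFn_one (h0 : jostFn q 0 = 0) :
    ∃ l, IsLogQuotient (blaschke₁ (boundStates q)) (jostFn q) l ∧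
      ContinuousOn l closedUpperHP ∧ l =O[atInf] fun z => z⁻¹ := by
  obtain ⟨l, h1, h2, h3⟩ := (isJostClass_jostFn hq).exists_logQuotient_of_eq_zero
    (finite_boundStates hq) pos_of_mem_boundStates h0
  exact ⟨l, h1, h2, h3 (isBigO_jostFn_sub_one hq)⟩

theorem jostFn_eq_exp_log_gFun {z : ℂ} (hz : z ∈ openUpperHP) :
    Integrable (fun s : ℝ => (Real.log (gFun q s) : ℂ) / (s - z)) ∧
      jostFn q z = Complex.exp (1 / (2 * Real.pi * Complex.I) *
        ∫ s : ℝ, (Real.log (gFun q s) : ℂ) / (s - z)) * blaschke (boundStates q) z := by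
  obtain ⟨l, h1, -, h3⟩ := exists_logQuotient_jostFn hq
  exact h1.representation (fun t _ => blaschke_ofReal_ne_zero pos_of_mem_boundStates t) h3
    (isLogBranch_log_gFun hq) hz

theorem jostFn_eq_exp_log_gFun_one (h0 : jostFn q 0 = 0) {z : ℂ} (hz : z ∈ openUpperHP) :
    Integrable (fun s : ℝ => (Real.log ((s ^ 2 + 1) / (s * (iFun q s).im)) : ℂ) / (s - z)) ∧
      jostFn q z = Complex.exp (1 / (2 * Real.pi * Complex.I) *
        ∫ s : ℝ, (Real.log ((s ^ 2 + 1) / (s * (iFun q s).im)) : ℂ) / (s - z)) *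
          blaschke₁ (boundStates q) z := by
  obtain ⟨l, h1, -, h3⟩ := exists_logQuotient_jostFn_one hq h0
  exact h1.representation (fun t ht => blaschke₁_ofReal_ne_zero pos_of_mem_boundStates ht) h3
    (isLogBranch_log_gFun_one hq) hz

theorem gFun_neg (s : ℝ) : gFun q (-s) = gFun q s := by
  rw [gFun, gFun, Complex.ofReal_neg, iFun_neg hq, Complex.conj_im, neg_div_neg_eq]

/-- The function g is even, and 1/(s-z) + 1/(-s-z) = 2z/(s^2 - z^2). -/
theorem jostFn_eq_exp_half_line {z : ℂ} (hz : z ∈ openUpperHP) :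
    IntegrableOn (fun s : ℝ => z * (Real.log (gFun q s) : ℂ) / ((s : ℂ) ^ 2 - z ^ 2)) (Ioi 0) ∧
      jostFn q z = Complex.exp (1 / (Complex.I * Real.pi) *
        ∫ s in Ioi (0 : ℝ), z * (Real.log (gFun q s) : ℂ) / ((s : ℂ) ^ 2 - z ^ 2)) *
          blaschke (boundStates q) z := by
  obtain ⟨hi, he⟩ := jostFn_eq_exp_log_gFun hq hz
  set φ : ℝ → ℂ := fun s => (Real.log (gFun q s) : ℂ) / (s - z) with hφ
  have hsum : ∀ s : ℝ, z * (Real.log (gFun q s) : ℂ) / ((s : ℂ) ^ 2 - z ^ 2) =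
      1 / 2 * (φ s + φ (-s)) := fun s => by
    have h1 := ofReal_sub_ne_zero hz s
    have h2 := add_ne_zero_of_mem (ofReal_mem_closedUpperHP s) hz
    simp only [hφ]
    rw [gFun_neg hq, Complex.ofReal_neg, sq_sub_sq,
      show -(s : ℂ) - z = -(s + z) by ring, div_neg]
    field_simp
    ring
  have hi2 : Integrable fun s => φ (-s) := hi.comp_neg
  have hint := ((hi.add hi2).const_mul (1 / 2)).integrableOn (s := Ioi 0)
  simp only [hsum]
  refine ⟨hint, ?_⟩
  have hsplit : ∫ s, φ s = ∫ s in Ioi (0 : ℝ), (φ s + φ (-s)) := by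
    rw [integral_add hi.integrableOn hi2.integrableOn, integral_comp_neg_Ioi, neg_zero, add_comm,
      intervalIntegral.integral_Iic_add_Ioi hi.integrableOn hi.integrableOn]
  rw [he, integral_const_mul, ← hsplit]
  congr 2
  have := Real.pi_ne_zero
  field_simp

/-- The sum l(k) + l(-k) is ln g(k), and the principal value equals iπ(l(k) - l(-k)); half the sum
plus half the difference is l(k). -/
theorem jostFn_eq_exp_principal_value {k : ℝ} (hk : 0 < k) : ∃ P : ℂ,
    Tendsto (fun ε : ℝ => ∫ s in {s : ℝ | ε < |s - k|},
      (Real.log (gFun q s) : ℂ) / (s - k)) (𝓝[>] 0) (𝓝 P) ∧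
      jostFn q k = Complex.exp (1 / (2 * Real.pi * Complex.I) * P +
        1 / 2 * (Real.log (gFun q k) : ℂ)) * blaschke (boundStates q) k := by
  obtain ⟨l, h1, -, h3⟩ := exists_logQuotient_jostFn hq
  obtain ⟨B, hB⟩ := exists_le_root h1.continuousOn h1.isBigO_zero h3
  have hbr := (h1.isLogBranch (fun t _ => blaschke_ofReal_ne_zero pos_of_mem_boundStates t) 1).eqOn
    (isLogBranch_log_gFun hq)
  have hbr' : ∀ t : ℝ, t ≠ 0 → l t + l (-(t : ℂ)) = Real.log (gFun q t) := fun t ht => by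
    simpa using hbr ht
  refine ⟨Complex.I * Real.pi * (l k - l (-(k : ℂ))),
    (tendsto_principal_value h1.continuousOn h1.differentiableOn hB hk.ne').congr fun ε => ?_, ?_⟩
  · refine integral_congr_ae (ae_restrict_of_ae ?_)
    have hne : ∀ᵐ t : ℝ, t ≠ 0 := by simp [ae_iff, measure_singleton]
    filter_upwards [hne] with t ht
    rw [hbr' t ht]
  · rw [h1.eq k (ofReal_mem_punctured hk.ne'), ← hbr' k hk.ne', mul_comm]
    congr 2
    have := Real.pi_ne_zero
    field_simp
    ring

theorem exists_isLogBranch_scatS : ∃ L : ℝ → ℂ,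
    IsLogBranch (fun t => scatS q (-t) / blaschke (boundStates q) t ^ 2) L ∧
      (jostFn q 0 ≠ 0 → Continuous L) := by
  obtain ⟨l, h1, h2, -⟩ := exists_logQuotient_jostFn hq
  refine ⟨_, (h1.isLogBranch (fun t _ => blaschke_ofReal_ne_zero pos_of_mem_boundStates t)
    (-1)).congr fun t _ => (scatS_div_eq hq t).symm, fun h => ?_⟩
  exact ((h2 h).comp_continuous (by fun_prop) ofReal_mem_closedUpperHP).add
    (continuous_const.mul ((h2 h).comp_continuous (by fun_prop) neg_ofReal_mem_closedUpperHP))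

theorem jostFn_eq_exp_log_scatS {L : ℝ → ℂ}
    (hL : IsLogBranch (fun t => scatS q (-t) / blaschke (boundStates q) t ^ 2) L) {z : ℂ}
    (hz : z ∈ openUpperHP) : Integrable (fun t : ℝ => L t / (t - z)) ∧
      jostFn q z = Complex.exp (1 / (2 * Real.pi * Complex.I) * ∫ t : ℝ, L t / (t - z)) *
        blaschke (boundStates q) z := by
  obtain ⟨l, h1, -, h3⟩ := exists_logQuotient_jostFn hq
  exact h1.representation (fun t _ => blaschke_ofReal_ne_zero pos_of_mem_boundStates t) h3
    (hL.congr fun t _ => scatS_div_eq hq t) hz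

theorem exists_isLogBranch_scatS_one (h0 : jostFn q 0 = 0) : ∃ L : ℝ → ℂ,
    IsLogBranch (fun t => scatS q (-t) * ((-(t : ℂ) - Complex.I) / (-(t : ℂ) + Complex.I)) /
      blaschke (boundStates q) t ^ 2) L ∧ Continuous L := by
  obtain ⟨l, h1, h2, -⟩ := exists_logQuotient_jostFn_one hq h0
  refine ⟨_, (h1.isLogBranch (fun t ht => blaschke₁_ofReal_ne_zero pos_of_mem_boundStates ht)
    (-1)).congr fun t ht => (scatS_div_eq_one hq ht).symm, ?_⟩
  exact (h2.comp_continuous (by fun_prop) ofReal_mem_closedUpperHP).add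
    (continuous_const.mul (h2.comp_continuous (by fun_prop) neg_ofReal_mem_closedUpperHP))

theorem jostFn_eq_exp_log_scatS_one (h0 : jostFn q 0 = 0) {L : ℝ → ℂ}
    (hL : IsLogBranch (fun t => scatS q (-t) * ((-(t : ℂ) - Complex.I) / (-(t : ℂ) + Complex.I)) /
      blaschke (boundStates q) t ^ 2) L) {z : ℂ} (hz : z ∈ openUpperHP) :
    Integrable (fun t : ℝ => L t / (t - z)) ∧
      jostFn q z = Complex.exp (1 / (2 * Real.pi * Complex.I) * ∫ t : ℝ, L t / (t - z)) *
        blaschke₁ (boundStates q) z := by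
  obtain ⟨l, h1, -, h3⟩ := exists_logQuotient_jostFn_one hq h0
  exact h1.representation (fun t ht => blaschke₁_ofReal_ne_zero pos_of_mem_boundStates ht) h3
    (hL.congr fun t ht => scatS_div_eq_one hq ht) hz

end

/-! ### Boundary uniqueness for meromorphic functions -/

/-- A function analytic near a boundary interval with zero boundary values there vanishes at the
centre of a square standing on that interval: the product of its four rotations about the centre
vanishes on the boundary of the square. -/
theorem eq_zero_of_tendsto_zero {D : ℂ → ℂ} {k r s : ℝ}
    (hD : DifferentiableOn ℂ D (Metric.ball (k : ℂ) r ∩ openUpperHP))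
    (h0 : ∀ t : ℝ, |t - k| < r → Tendsto D (𝓝[openUpperHP] (t : ℂ)) (𝓝 0)) (hs : 0 < s)
    (hsr : 4 * s < r) : D (k + s * Complex.I) = 0 := by
  set E : ℂ → ℂ := openUpperHP.indicator D with hE
  set z₀ : ℂ := k + s * Complex.I with hz₀
  set U : Set ℂ := {w | |w.re| < s ∧ |w.im| < s} with hU
  set V : Set ℂ := {w | |w.re| ≤ s ∧ |w.im| ≤ s} with hV
  have hz₀re : z₀.re = k := by simp [hz₀]
  have hz₀im : z₀.im = s := by simp [hz₀]
  have hUo : IsOpen U :=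
    (isOpen_lt (by fun_prop : Continuous fun w : ℂ => |w.re|) continuous_const).inter
      (isOpen_lt (by fun_prop : Continuous fun w : ℂ => |w.im|) continuous_const)
  have hVc : IsClosed V :=
    (isClosed_le (by fun_prop : Continuous fun w : ℂ => |w.re|) continuous_const).inter
      (isClosed_le (by fun_prop : Continuous fun w : ℂ => |w.im|) continuous_const)
  have hUV : U ⊆ V := fun w hw => ⟨hw.1.le, hw.2.le⟩
  have hball : ∀ w ∈ V, z₀ + w ∈ Metric.ball (k : ℂ) r := by
    intro w hw
    rw [mem_ball_iff_norm]
    -- Every point of the closed square lies within 3s of k, hence inside the ball because 4s < r.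
    have h1 : ‖z₀ + w - k‖ ≤ s + (s + s) := by
      rw [show z₀ + w - k = s * Complex.I + w by rw [hz₀]; ring]
      refine (norm_add_le _ _).trans (add_le_add ?_ ?_)
      · simp [abs_of_pos hs]
      · exact (Complex.norm_le_abs_re_add_abs_im w).trans (add_le_add hw.1 hw.2)
    linarith
  have hcl : ∀ w ∈ V, z₀ + w ∈ closedUpperHP := by
    intro w hw
    rw [closedUpperHP_def, Complex.add_im, hz₀im]
    linarith [(abs_le.1 hw.2).1]
  -- the zero extension is continuous on the closed square
  have hEc : ContinuousOn (fun w => E (z₀ + w)) V := by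
    intro w hw
    have hcomp : ContinuousWithinAt E (Metric.ball (k : ℂ) r ∩ closedUpperHP) (z₀ + w) := by
      by_cases hm : z₀ + w ∈ openUpperHP
      · have h1 : ContinuousAt D (z₀ + w) := (hD.differentiableAt
          ((Metric.isOpen_ball.inter isOpen_openUpperHP).mem_nhds
            ⟨hball w hw, hm⟩)).continuousAt
        refine (h1.congr ?_).continuousWithinAt
        filter_upwards [isOpen_openUpperHP.mem_nhds hm] with z hz
        rw [hE, indicator_of_mem hz]
      · have him : (z₀ + w).im = 0 := le_antisymm (not_lt.1 hm) (hcl w hw)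
        have hre : (((z₀ + w).re : ℝ) : ℂ) = z₀ + w := Complex.ext (by simp) (by simp [him])
        have hlt : |(z₀ + w).re - k| < r := by
          have h1 := Complex.abs_re_le_norm (z₀ + w - k)
          have h2 := mem_ball_iff_norm.1 (hball w hw)
          rw [Complex.sub_re, Complex.ofReal_re] at h1
          exact h1.trans_lt h2
        have h1 := h0 _ hlt
        rw [hre] at h1
        have hval : E (z₀ + w) = 0 := by rw [hE, indicator_of_notMem hm]
        refine ContinuousAt.continuousWithinAt ?_
        rw [ContinuousAt, hval, hE]
        rw [Metric.tendsto_nhds]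
        intro ε hε
        have h2 := (Metric.tendsto_nhds.1 h1) ε hε
        rw [eventually_nhdsWithin_iff] at h2
        filter_upwards [h2] with z hz
        by_cases hzm : z ∈ openUpperHP
        · rw [indicator_of_mem hzm]
          exact hz hzm
        · rw [indicator_of_notMem hzm, dist_self]
          exact hε
    exact ContinuousWithinAt.comp (t := Metric.ball (k : ℂ) r ∩ closedUpperHP)
      (f := fun w => z₀ + w) hcomp (by fun_prop) fun x hx => ⟨hball x hx, hcl x hx⟩
  have hEd : DifferentiableOn ℂ (fun w => E (z₀ + w)) U := by
    intro w hw
    have hm : z₀ + w ∈ openUpperHP := by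
      show 0 < (z₀ + w).im
      rw [Complex.add_im, hz₀im]
      linarith [(abs_lt.1 hw.2).1]
    have h1 : DifferentiableAt ℂ E (z₀ + w) := by
      refine (hD.differentiableAt ((Metric.isOpen_ball.inter isOpen_openUpperHP).mem_nhds
            ⟨hball w (hUV hw), hm⟩)).congr_of_eventuallyEq ?_
      filter_upwards [isOpen_openUpperHP.mem_nhds hm] with z hz
      rw [hE, indicator_of_mem hz]
    exact (h1.comp w (by fun_prop : DifferentiableAt ℂ (fun w => z₀ + w) w)).differentiableWithinAt
  have hrotV : ∀ w ∈ V, Complex.I * w ∈ V := fun w hw => by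
    refine ⟨?_, ?_⟩ <;> simp [hw.1, hw.2]
  have hrotU : ∀ w ∈ U, Complex.I * w ∈ U := fun w hw => by
    refine ⟨?_, ?_⟩ <;> simp [hw.1, hw.2]
  have hnegV : ∀ w ∈ V, -w ∈ V := fun w hw => by
    refine ⟨?_, ?_⟩ <;> simp [hw.1, hw.2]
  have hnegU : ∀ w ∈ U, -w ∈ U := fun w hw => by
    refine ⟨?_, ?_⟩ <;> simp [hw.1, hw.2]
  set e : ℂ → ℂ := fun w => E (z₀ + w) with he
  set P : ℂ → ℂ := fun w => e w * e (-w) * (e (Complex.I * w) * e (-(Complex.I * w))) with hP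
  have hPc : ContinuousOn P V :=
    (hEc.mul (hEc.comp (by fun_prop) hnegV)).mul ((hEc.comp (by fun_prop) hrotV).mul
      (hEc.comp (by fun_prop) fun w hw => hnegV _ (hrotV w hw)))
  have hPd : DifferentiableOn ℂ P U :=
    (hEd.mul (hEd.comp (by fun_prop) hnegU)).mul ((hEd.comp (by fun_prop) hrotU).mul
      (hEd.comp (by fun_prop) fun w hw => hnegU _ (hrotU w hw)))
  have hclos : closure U ⊆ V := closure_minimal hUV hVc
  have hedge : ∀ w : ℂ, w.im = -s → e w = 0 := fun w hw => by
    simp only [he, hE]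
    refine indicator_of_notMem (fun h => ?_) _
    have h1 : 0 < (z₀ + w).im := h
    rw [Complex.add_im, hz₀im, hw, add_neg_cancel] at h1
    exact lt_irrefl _ h1
  have hfr : ∀ w ∈ frontier U, ‖P w‖ ≤ 0 := by
    intro w hw
    have hwV : w ∈ V := hclos (frontier_subset_closure hw)
    have hwU : w ∉ U := fun h => (hUo.frontier_eq ▸ hw).2 h
    have hcase : |w.re| = s ∨ |w.im| = s := by
      by_contra hne
      push Not at hne
      exact hwU ⟨lt_of_le_of_ne hwV.1 hne.1, lt_of_le_of_ne hwV.2 hne.2⟩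
    rw [norm_le_zero_iff, hP]
    simp only [mul_eq_zero]
    -- For each of the four sides, one of the rotations by 1, -1, i, -i carries it to the bottom
    -- side, which lies on the real axis, where the extension is zero.
    rcases hcase with h | h <;> rcases (abs_eq hs.le).1 h with h | h
    · exact Or.inr (Or.inr (hedge _ (by simp [h])))
    · exact Or.inr (Or.inl (hedge _ (by simp [h])))
    · exact Or.inl (Or.inr (hedge _ (by simp [h])))
    · exact Or.inl (Or.inl (hedge _ h))
  have hbd : Bornology.IsBounded U := by
    refine (Metric.isBounded_closedBall (x := (0 : ℂ)) (r := s + s)).subset fun w hw => ?_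
    rw [mem_closedBall_zero_iff]
    exact (Complex.norm_le_abs_re_add_abs_im w).trans (add_le_add hw.1.le hw.2.le)
  have h0U : (0 : ℂ) ∈ U := by simp [hU, hs]
  have hfin := Complex.norm_le_of_forall_mem_frontier_norm_le hbd
    ⟨hPd, hPc.mono hclos⟩ hfr (subset_closure h0U)
  rw [norm_le_zero_iff, hP] at hfin
  have hez : e 0 = 0 := by simpa using hfin
  have hzm : z₀ ∈ openUpperHP := by
    show 0 < z₀.im
    rw [hz₀im]
    exact hs
  simpa [he, hE, indicator_of_mem hzm] using hez

theorem isPreconnected_openUpperHP : IsPreconnected openUpperHP :=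
  (convex_halfSpace_im_gt 0).isPreconnected

/-- A meromorphic function in the upper half-plane whose boundary values on a half-line vanish is
zero. -/
theorem eventuallyEq_zero_of_tendsto_zero {D : ℂ → ℂ} (hD : MeromorphicOn D openUpperHP)
    (h0 : ∀ t : ℝ, 0 < t → Tendsto D (𝓝[openUpperHP] (t : ℂ)) (𝓝 0)) {z : ℂ}
    (hz : z ∈ openUpperHP) : D =ᶠ[𝓝[≠] z] 0 := by
  -- Values at isolated points are irrelevant to a meromorphic function, so D is replaced by its
  -- normal form, which is analytic wherever its order is nonnegative.
  set D' := toMeromorphicNFOn D openUpperHP with hD'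
  have hnf : MeromorphicNFOn D' openUpperHP := meromorphicNFOn_toMeromorphicNFOn _ _
  have heq : ∀ w ∈ openUpperHP, D =ᶠ[𝓝[≠] w] D' := fun w hw =>
    (hD.toMeromorphicNFOn_eq_self_on_nhdsNE hw).symm
  have hana : ∀ w ∈ openUpperHP, ∀ C : ℝ, (∀ᶠ u in 𝓝 w, ‖D u‖ ≤ C) →
      AnalyticAt ℂ D' w ∧ ‖D' w‖ ≤ C := by
    intro w hw C hC
    have hC' : ∀ᶠ u in 𝓝[≠] w, ‖D' u‖ ≤ C := by
      filter_upwards [heq w hw, nhdsWithin_le_nhds hC] with u hu hu'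
      rwa [← hu]
    have ha : AnalyticAt ℂ D' w := by
      -- At a pole the norm tends to infinity, contradicting the local bound.
      rw [← (hnf hw).meromorphicOrderAt_nonneg_iff_analyticAt]
      by_contra hneg
      have h1 := tendsto_norm_atTop_iff_cobounded.2
        (tendsto_cobounded_of_meromorphicOrderAt_neg (not_le.1 hneg))
      obtain ⟨u, hu, hu'⟩ := (hC'.and (h1.eventually_gt_atTop C)).exists
      exact absurd hu (not_le.2 hu')
    refine ⟨ha, le_of_tendsto (ha.continuousAt.tendsto.norm.mono_left nhdsWithin_le_nhds) hC'⟩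
  have hbd : ∀ t : ℝ, 0 < t → ∀ ε : ℝ, 0 < ε → ∃ r : ℝ, 0 < r ∧
      ∀ w ∈ Metric.ball (t : ℂ) r ∩ openUpperHP, ∀ᶠ u in 𝓝 w, ‖D u‖ ≤ ε := by
    intro t ht ε hε
    have h1 := Metric.tendsto_nhds.1 (h0 t ht) ε hε
    obtain ⟨r, hr, hr'⟩ := Metric.mem_nhdsWithin_iff.1 h1
    refine ⟨r, hr, fun w hw => ?_⟩
    filter_upwards [(Metric.isOpen_ball.inter isOpen_openUpperHP).mem_nhds hw] with u hu
    have : dist (D u) 0 < ε := hr' hu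
    rw [dist_zero_right] at this
    exact this.le
  obtain ⟨r₀, hr₀, hr₀'⟩ := hbd 1 one_pos 1 one_pos
  -- The bound r₀ keeps D bounded, hence its normal form analytic; the bound 1 keeps |t - 1| < r
  -- inside the positive half-line, where the boundary values vanish.
  set r := min r₀ 1 with hr
  have hrpos : 0 < r := lt_min hr₀ one_pos
  have hdiff : DifferentiableOn ℂ D' (Metric.ball ((1 : ℝ) : ℂ) r ∩ openUpperHP) := fun w hw =>
    (hana w hw.2 1 (hr₀' w ⟨Metric.ball_subset_ball (min_le_left _ _) hw.1,
      hw.2⟩)).1.differentiableAt.differentiableWithinAt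
  have hlim : ∀ t : ℝ, |t - 1| < r → Tendsto D' (𝓝[openUpperHP] (t : ℂ)) (𝓝 0) := by
    intro t ht
    have ht0 : 0 < t := by linarith [(abs_lt.1 ht).1, min_le_right r₀ 1]
    rw [Metric.tendsto_nhds]
    intro ε hε
    obtain ⟨ρ, hρ, hρ'⟩ := hbd t ht0 (ε / 2) (by positivity)
    refine Metric.mem_nhdsWithin_iff.2 ⟨ρ, hρ, fun w hw => ?_⟩
    show dist (D' w) 0 < ε
    rw [dist_zero_right]
    have := (hana w hw.2 _ (hρ' w hw)).2
    linarith
  have hzero : ∀ s : ℝ, 0 < s → 4 * s < r → D' ((1 : ℝ) + s * Complex.I) = 0 := fun s hs hsr =>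
    eq_zero_of_tendsto_zero hdiff hlim hs hsr
  -- the zeros accumulate inside the half-plane
  set z₁ : ℂ := (1 : ℝ) + ((r / 8 : ℝ) : ℂ) * Complex.I with hz₁
  have hz₁m : z₁ ∈ openUpperHP := by
    show 0 < z₁.im
    simp only [hz₁, Complex.add_im, Complex.ofReal_im, Complex.mul_im, Complex.ofReal_re,
      Complex.I_im, Complex.I_re, mul_one, mul_zero, zero_add, add_zero]
    positivity
  have hz₁b : z₁ ∈ Metric.ball ((1 : ℝ) : ℂ) r₀ := by
    rw [mem_ball_iff_norm, hz₁, add_sub_cancel_left, norm_mul, Complex.norm_I, mul_one,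
      Complex.norm_real, Real.norm_of_nonneg (by positivity)]
    linarith [min_le_left r₀ 1]
  have ha₁ := (hana z₁ hz₁m 1 (hr₀' z₁ ⟨hz₁b, hz₁m⟩)).1
  have hfreq : ∃ᶠ w in 𝓝[≠] z₁, D' w = 0 := by
    have hpath : Tendsto (fun s : ℝ => ((1 : ℝ) : ℂ) + s * Complex.I) (𝓝[≠] (r / 8)) (𝓝[≠] z₁) := by
      refine tendsto_nhdsWithin_iff.2 ⟨?_, ?_⟩
      · have : Continuous fun s : ℝ => ((1 : ℝ) : ℂ) + s * Complex.I := by fun_prop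
        exact tendsto_nhdsWithin_of_tendsto_nhds (this.tendsto (r / 8))
      · filter_upwards [self_mem_nhdsWithin] with s hs h
        refine hs ?_
        have h1 : ((1 : ℝ) : ℂ) + s * Complex.I = z₁ := h
        rw [hz₁] at h1
        exact Complex.ofReal_injective (mul_right_cancel₀ Complex.I_ne_zero (add_left_cancel h1))
    refine hpath.frequently (Eventually.frequently ?_)
    have : Ioo 0 (r / 4) ∈ 𝓝 (r / 8) := Ioo_mem_nhds (by linarith) (by linarith)
    filter_upwards [nhdsWithin_le_nhds this] with s hs
    exact hzero s hs.1 (by linarith [hs.2])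
  have hev := ha₁.frequently_zero_iff_eventually_zero.1 hfreq
  have htop : meromorphicOrderAt D z₁ = ⊤ := by
    rw [meromorphicOrderAt_eq_top_iff]
    filter_upwards [heq z₁ hz₁m, nhdsWithin_le_nhds hev] with w h1 h2
    rw [h1, h2]
  have htop' : meromorphicOrderAt D z = ⊤ := by
    by_contra hne
    exact hD.meromorphicOrderAt_ne_top_of_isPreconnected isPreconnected_openUpperHP hz hz₁m hne htop
  exact meromorphicOrderAt_eq_top_iff.1 htop'

theorem eventuallyEq_iFun {q : ℝ → ℝ} (hq : MemL11 q) {M : ℂ → ℂ} (hM : MeromorphicOn M openUpperHP)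
    (h : ∀ k : ℝ, 0 < k → Tendsto M (𝓝[openUpperHP] (k : ℂ)) (𝓝 (iFun q k))) {z : ℂ}
    (hz : z ∈ openUpperHP) : M =ᶠ[𝓝[≠] z] iFun q := by
  have h1 := eventuallyEq_zero_of_tendsto_zero (hM.sub (meromorphicOn_iFun hq)) (fun k hk => by
    have h2 := (continuousWithinAt_iFun hq hk.ne').tendsto.mono_left
      (nhdsWithin_mono _ openUpperHP_subset)
    have h3 := (h k hk).sub h2
    rwa [sub_self] at h3) hz
  filter_upwards [h1] with w hw
  exact sub_eq_zero.1 hw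

/-! ### The behaviour of I at infinity -/

/-- One integration by parts suffices. The boundary term at 0 survives, because the integral starts
there and g(0) need not vanish. -/
theorem exists_norm_integral_exp_mul_le {g : ℝ → ℂ} (hg : HasCompactSupport g)
    (hg1 : ContDiff ℝ 1 g) : ∃ A : ℝ, ∀ z ∈ closedUpperHP,
      ‖z‖ * ‖∫ t in Ioi (0 : ℝ), Complex.exp (2 * Complex.I * z * t) * g t‖ ≤ A := by
  obtain ⟨R, hR, hRs⟩ := hg.isCompact.isBounded.subset_closedBall_lt 0 0
  have hzero : ∀ t, R < t → g t = 0 := fun t ht => by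
    refine image_eq_zero_of_notMem_tsupport fun h => ?_
    have := hRs h
    rw [mem_closedBall_zero_iff, Real.norm_eq_abs] at this
    linarith [le_abs_self t]
  have hgd : ∀ t, HasDerivAt g (deriv g t) t := fun t =>
    (hg1.differentiable one_ne_zero t).hasDerivAt
  have hgc : Continuous (deriv g) := hg1.continuous_deriv_one
  set b : ℝ := R + 1 with hb
  have hb0 : 0 ≤ b := by linarith
  refine ⟨‖g 0‖ + ∫ t in (0 : ℝ)..b, ‖deriv g t‖, fun z hz => ?_⟩
  have hI : ∫ t in Ioi (0 : ℝ), Complex.exp (2 * Complex.I * z * t) * g t =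
      ∫ t in (0 : ℝ)..b, g t * Complex.exp (2 * Complex.I * z * t) := by
    rw [intervalIntegral.integral_of_le hb0]
    rw [setIntegral_eq_of_subset_of_forall_sdiff_eq_zero measurableSet_Ioi
      (Ioc_subset_Ioi_self : Ioc 0 b ⊆ Ioi 0)]
    · exact setIntegral_congr_fun measurableSet_Ioc fun t _ => mul_comm _ _
    · intro t ht
      have : b < t := by
        by_contra h
        exact ht.2 ⟨ht.1, not_lt.1 h⟩
      rw [hzero t (by linarith), mul_zero]
  have hparts := intervalIntegral.integral_mul_deriv_eq_deriv_mul (a := 0) (b := b) (u := g)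
    (u' := deriv g) (v := fun t : ℝ => Complex.exp (2 * Complex.I * z * t))
    (v' := fun t : ℝ => 2 * Complex.I * z * Complex.exp (2 * Complex.I * z * t))
    (fun t _ => hgd t) (fun t _ => hasDerivAt_exp_mul _ t) (hgc.intervalIntegrable _ _)
    (Continuous.intervalIntegrable (by fun_prop) _ _)
  simp only [hzero b (by linarith), zero_mul, Complex.ofReal_zero, mul_zero, Complex.exp_zero,
    mul_one, zero_sub] at hparts
  have hmul : 2 * Complex.I * z * ∫ t in (0 : ℝ)..b, g t * Complex.exp (2 * Complex.I * z * t) =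
      -g 0 - ∫ t in (0 : ℝ)..b, deriv g t * Complex.exp (2 * Complex.I * z * t) := by
    rw [← hparts, ← intervalIntegral.integral_const_mul]
    refine intervalIntegral.integral_congr fun t _ => ?_
    ring
  have hle : ‖∫ t in (0 : ℝ)..b, deriv g t * Complex.exp (2 * Complex.I * z * t)‖ ≤
      ∫ t in (0 : ℝ)..b, ‖deriv g t‖ := by
    refine intervalIntegral.norm_integral_le_of_norm_le hb0 (ae_of_all _ fun t ht => ?_)
      (hgc.norm.intervalIntegrable _ _)
    rw [norm_mul]
    exact mul_le_of_le_one_right (norm_nonneg _) (norm_exp_two_mul_le hz ht.1.le)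
  have hn := congrArg norm hmul
  rw [norm_mul, norm_mul, norm_mul, Complex.norm_I, mul_one, Complex.norm_ofNat] at hn
  have h2 : ‖-g 0 - ∫ t in (0 : ℝ)..b, deriv g t * Complex.exp (2 * Complex.I * z * t)‖ ≤
      ‖g 0‖ + ∫ t in (0 : ℝ)..b, ‖deriv g t‖ := by
    refine (norm_sub_le _ _).trans ?_
    rw [norm_neg]
    gcongr
  rw [hI]
  nlinarith [mul_nonneg (norm_nonneg z)
    (norm_nonneg (∫ t in (0 : ℝ)..b, g t * Complex.exp (2 * Complex.I * z * t)))]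

theorem integrableOn_exp_mul {φ : ℝ → ℂ} (hφ : Integrable φ) {z : ℂ} (hz : z ∈ closedUpperHP) :
    IntegrableOn (fun t : ℝ => Complex.exp (2 * Complex.I * z * t) * φ t) (Ioi 0) := by
  refine Integrable.mono hφ.integrableOn (AEStronglyMeasurable.mul (Continuous.aestronglyMeasurable
    (by fun_prop)) hφ.aestronglyMeasurable.restrict)
    ((ae_restrict_iff' measurableSet_Ioi).2 (ae_of_all _ fun t ht => ?_))
  rw [norm_mul]
  exact mul_le_of_le_one_left (norm_nonneg _) (norm_exp_two_mul_le hz (le_of_lt ht))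

/-- The Riemann–Lebesgue lemma in the closed upper half-plane. -/
theorem tendsto_integral_exp_mul {φ : ℝ → ℂ} (hφ : Integrable φ) :
    Tendsto (fun z : ℂ => ∫ t in Ioi (0 : ℝ), Complex.exp (2 * Complex.I * z * t) * φ t) atInf
      (𝓝 0) := by
  rw [Metric.tendsto_nhds]
  intro ε hε
  -- A smooth compactly supported function approximates φ in L¹, and the error is uniform in z
  -- because the exponential has modulus at most 1 for Im z ≥ 0.
  obtain ⟨g, hg1, hg2, hg3⟩ := (memLp_one_iff_integrable.2 hφ).exist_eLpNorm_sub_le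
    ENNReal.one_ne_top le_rfl (half_pos hε)
  have hgi : Integrable g := hg2.continuous.integrable_of_hasCompactSupport hg1
  obtain ⟨A, hA⟩ := exists_norm_integral_exp_mul_le hg1 (hg2.of_le (by exact_mod_cast le_top))
  have hdist : ∫ t, ‖φ t - g t‖ ≤ ε / 2 := by
    have h1 := ENNReal.toReal_mono ENNReal.ofReal_ne_top hg3
    rw [ENNReal.toReal_ofReal (half_pos hε).le, eLpNorm_one_eq_lintegral_enorm,
      ← integral_norm_eq_lintegral_enorm (hφ.sub hgi).aestronglyMeasurable] at h1
    exact h1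
  have hev : ∀ᶠ z : ℂ in atInf, A / ‖z‖ < ε / 2 := by
    have : Tendsto (fun z : ℂ => A / ‖z‖) atInf (𝓝 0) := tendsto_norm_atInf.const_div_atTop A
    exact this.eventually_lt_const (half_pos hε)
  filter_upwards [hev, eventually_atInf_mem, tendsto_norm_atInf.eventually_gt_atTop 0]
    with z hz hzm hz0
  rw [dist_zero_right]
  have hsplit : ∫ t in Ioi (0 : ℝ), Complex.exp (2 * Complex.I * z * t) * φ t =
      (∫ t in Ioi (0 : ℝ), Complex.exp (2 * Complex.I * z * t) * (φ t - g t)) +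
        ∫ t in Ioi (0 : ℝ), Complex.exp (2 * Complex.I * z * t) * g t := by
    rw [← integral_add (f := fun t : ℝ => Complex.exp (2 * Complex.I * z * t) * (φ t - g t))
      (integrableOn_exp_mul (hφ.sub hgi) hzm) (integrableOn_exp_mul hgi hzm)]
    refine integral_congr_ae (ae_of_all _ fun t => ?_)
    ring
  have h1 : ‖∫ t in Ioi (0 : ℝ), Complex.exp (2 * Complex.I * z * t) * (φ t - g t)‖ ≤ ε / 2 := by
    refine (norm_integral_le_of_norm_le (hφ.sub hgi).norm.integrableOn
      ((ae_restrict_iff' measurableSet_Ioi).2 (ae_of_all _ fun t ht => ?_))).trans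
        ((setIntegral_le_integral (hφ.sub hgi).norm (ae_of_all _ fun t => norm_nonneg _)).trans
          hdist)
    rw [norm_mul]
    exact mul_le_of_le_one_left (norm_nonneg _) (norm_exp_two_mul_le hzm (le_of_lt ht))
  have h2 : ‖∫ t in Ioi (0 : ℝ), Complex.exp (2 * Complex.I * z * t) * g t‖ ≤ A / ‖z‖ := by
    rw [le_div_iff₀ hz0, mul_comm]
    exact hA z hzm
  rw [hsplit]
  calc _ ≤ ε / 2 + A / ‖z‖ := (norm_add_le _ _).trans (add_le_add h1 h2)
    _ < ε := by linarith

section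
variable {q : ℝ → ℝ} (hq : MemL11 q)
include hq

/-- Replacing m by 1 under the integral costs O(1/|z|), and what remains is a Fourier-type integral
of q alone, to which the Riemann–Lebesgue lemma applies. -/
theorem tendsto_modJostDeriv_atInf : Tendsto (modJostDeriv q 0) atInf (𝓝 0) := by
  have hqi : Integrable fun t => (zeroExt q t : ℂ) := hq.integrable_zeroExt.ofReal
  have h1 := tendsto_integral_exp_mul hqi
  set C := Real.exp (∫ t, weight q t) * ∫ t, |zeroExt q t| with hC
  have h2 : Tendsto (fun z : ℂ => C / ‖z‖ * ∫ t, |zeroExt q t|) atInf (𝓝 0) := by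
    have := (tendsto_norm_atInf.const_div_atTop C).mul_const (∫ t, |zeroExt q t|)
    rwa [zero_mul] at this
  have h3 : Tendsto (fun z => modJostDeriv q 0 z +
      ∫ t in Ioi (0 : ℝ), Complex.exp (2 * Complex.I * z * t) * (zeroExt q t : ℂ)) atInf (𝓝 0) := by
    refine squeeze_zero_norm' ?_ h2
    filter_upwards [eventually_atInf_mem, tendsto_norm_atInf.eventually_gt_atTop 0] with z hz hz0
    have e : modJostDeriv q 0 z + ∫ t in Ioi (0 : ℝ), Complex.exp (2 * Complex.I * z * t) *
        (zeroExt q t : ℂ) = ∫ t in Ioi (0 : ℝ), -(Complex.exp (2 * Complex.I * z * t) *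
          ((zeroExt q t : ℂ) * (modJost q t z - 1))) := by
      rw [modJostDeriv, neg_add_eq_sub]
      simp only [sub_zero]
      rw [← integral_sub (integrableOn_exp_mul hqi hz) (integrableOn_exp_mul_zeroExt_mul_modJost hq hz)]
      refine integral_congr_ae (ae_of_all _ fun t => ?_)
      ring
    rw [e, ← integral_const_mul]
    refine (norm_integral_le_of_norm_le
      (hq.integrable_zeroExt.abs.const_mul (C / ‖z‖)).integrableOn
      ((ae_restrict_iff' measurableSet_Ioi).2 (ae_of_all _ fun t ht => ?_))).trans
        (setIntegral_le_integral (hq.integrable_zeroExt.abs.const_mul _) (ae_of_all _ fun t => ?_))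
    · have ht0 : (0 : ℝ) < t := ht
      have hm : ‖modJost q t z - 1‖ ≤ C / ‖z‖ := by
        rw [le_div_iff₀ hz0, mul_comm]
        exact norm_mul_norm_modJost_sub_one_le hq (by linarith) hz
      rw [norm_neg, norm_mul, norm_mul, Complex.norm_real, Real.norm_eq_abs]
      calc _ ≤ 1 * (|zeroExt q t| * (C / ‖z‖)) := by
            gcongr
            exact norm_exp_two_mul_le hz ht0.le
        _ = _ := by ring
    · have : 0 ≤ C := by rw [hC]; positivity
      show 0 ≤ C / ‖z‖ * |zeroExt q t|
      positivity
  have h4 := h3.sub h1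
  simpa using h4

theorem iFun_sub_eq {z : ℂ} (hz : z ∈ closedUpperHP) (h : jostFn q z ≠ 0) :
    iFun q z - Complex.I * z = modJostDeriv q 0 z / jostFn q z := by
  rw [iFun, jostDeriv_eq hq hz, ← jostFn_eq hq hz]
  field_simp
  ring

theorem tendsto_iFun_sub : Tendsto (fun z => iFun q z - Complex.I * z) atInf (𝓝 0) := by
  have h1 := (tendsto_modJostDeriv_atInf hq).div (tendsto_jostFn hq) one_ne_zero
  rw [zero_div] at h1
  refine h1.congr' ?_
  filter_upwards [eventually_atInf_mem, (tendsto_jostFn hq).eventually_ne one_ne_zero] with z hz hz0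
  exact (iFun_sub_eq hq hz hz0).symm

end

/-! ### The additive jump problem for I -/

open Classical in
/-- `f` with the singularities in `A` replaced by limits. -/
def removeSing (A : Set ℂ) (f : ℂ → ℂ) (z : ℂ) : ℂ :=
  if z ∈ A then limUnder (𝓝[≠] z) f else f z

theorem removeSing_of_notMem {A : Set ℂ} {z : ℂ} (hz : z ∉ A) (f : ℂ → ℂ) :
    removeSing A f z = f z := if_neg hz

theorem removeSing_eventuallyEq {A : Set ℂ} (hA : A.Finite) {z : ℂ} (hz : z ∉ A) (f : ℂ → ℂ) :
    removeSing A f =ᶠ[𝓝 z] f := by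
  filter_upwards [hA.isClosed.isOpen_compl.mem_nhds hz] with w hw using removeSing_of_notMem hw f

/-- Riemann's criterion is applied at one point of A at a time, on a neighbourhood from which the
other points are deleted; finiteness keeps that neighbourhood open. -/
theorem differentiableOn_removeSing {A U : Set ℂ} (hA : A.Finite) (hU : IsOpen U) {f : ℂ → ℂ}
    (hf : DifferentiableOn ℂ f (U \ A))
    (h : ∀ a ∈ A, Tendsto (fun z => (z - a) * f z) (𝓝[≠] a) (𝓝 0)) :
    DifferentiableOn ℂ (removeSing A f) U := by
  intro z hz
  by_cases hzA : z ∈ A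
  · have hs : U \ (A \ {z}) ∈ 𝓝 z :=
      (hU.sdiff (hA.subset sdiff_subset).isClosed).mem_nhds ⟨hz, fun h => h.2 rfl⟩
    have hd : DifferentiableOn ℂ f ((U \ (A \ {z})) \ {z}) := hf.mono fun w hw =>
      ⟨hw.1.1, fun hwA => hw.1.2 ⟨hwA, hw.2⟩⟩
    have ho : (fun w => f w - f z) =o[𝓝[≠] z] fun w => (w - z)⁻¹ := by
      have h1 : Tendsto (fun w => (w - z) * (f w - f z)) (𝓝[≠] z) (𝓝 0) := by
        have h2 : Tendsto (fun w : ℂ => (w - z) * f z) (𝓝[≠] z) (𝓝 0) := by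
          have : Continuous fun w : ℂ => (w - z) * f z := by fun_prop
          have h3 := this.tendsto z
          rw [sub_self, zero_mul] at h3
          exact tendsto_nhdsWithin_of_tendsto_nhds h3
        have h3 := (h z hzA).sub h2
        rw [sub_zero] at h3
        exact h3.congr fun w => (mul_sub _ _ _).symm
      rw [Asymptotics.isLittleO_iff_tendsto']
      · exact h1.congr fun w => by rw [div_inv_eq_mul, mul_comm]
      · filter_upwards [self_mem_nhdsWithin] with w hw h0
        exact absurd (sub_eq_zero.1 (inv_eq_zero.1 h0)) hw
    have key := (Complex.differentiableOn_update_limUnder_of_isLittleO hs hd ho).differentiableAt hs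
    refine (key.congr_of_eventuallyEq ?_).differentiableWithinAt
    filter_upwards [hs] with w hw
    by_cases hwz : w = z
    · rw [hwz, Function.update_self, removeSing, if_pos hzA]
    · rw [Function.update_of_ne hwz, removeSing_of_notMem fun hwA => hw.2 ⟨hwA, hwz⟩]
  · have h1 : DifferentiableAt ℂ f z :=
      hf.differentiableAt ((hU.sdiff hA.isClosed).mem_nhds ⟨hz, hzA⟩)
    exact (h1.congr_of_eventuallyEq (removeSing_eventuallyEq hA hzA f)).differentiableWithinAt

/-- The Cauchy-type formula for the solution of a jump problem. -/
theorem IsJumpSolution.tendsto_integral {h : ℝ → ℂ} {G : ℂ → ℂ} (hG : IsJumpSolution h G) {z : ℂ}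
    (hz : z ∈ openUpperHP) :
    Tendsto (fun e : ℝ × ℝ => ∫ t in {t : ℝ | e.1 < |t| ∧ |t| < e.2}, h t / (t - z))
      (𝓝[>] 0 ×ˢ atTop) (𝓝 (2 * Real.pi * Complex.I * G z)) := by
  refine (tendsto_cauchy hG.continuousOn hG.differentiableOn hG.isLittleO_at_zero hG.tendsto_zero
    (-1) hz).congr fun e => ?_
  refine integral_congr_ae (ae_restrict_of_ae ?_)
  have hne : ∀ᵐ t : ℝ, t ≠ 0 := by simp [ae_iff, measure_singleton]
  filter_upwards [hne] with t ht
  rw [hG.jump t ht]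
  ring

/-- The datum is G(t) - G(-t), so the Cauchy formula with σ = -1 recovers G in the open half-plane
from it; the real axis follows by continuity. -/
theorem IsJumpSolution.eqOn {h : ℝ → ℂ} {G G' : ℂ → ℂ} (hG : IsJumpSolution h G)
    (hG' : IsJumpSolution h G') : EqOn G G' (closedUpperHP \ {0}) := by
  have h1 : EqOn G G' openUpperHP := fun z hz => mul_left_cancel₀ Complex.two_pi_I_ne_zero
    (tendsto_nhds_unique (hG.tendsto_integral hz) (hG'.tendsto_integral hz))
  refine h1.of_subset_closure hG.continuousOn hG'.continuousOn
    (fun z hz => ⟨openUpperHP_subset hz, ne_zero_of_mem_openUpperHP hz⟩) fun z hz => ?_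
  rw [closure_openUpperHP]
  exact hz.1

/-- `I(z) - iz - ∑ I_j / (z - i k_j)`. -/
def regularPart (q : ℝ → ℝ) (z : ℂ) : ℂ :=
  iFun q z - Complex.I * z - ∑ᶠ κ ∈ poleSet q, iRes q κ / (z - Complex.I * κ)

theorem mem_poleSet {q : ℝ → ℝ} {κ : ℝ} :
    κ ∈ poleSet q ↔ κ ∈ boundStates q ∨ κ = 0 ∧ jostFn q 0 = 0 := Iff.rfl

theorem zero_mem_poleSet {q : ℝ → ℝ} : (0 : ℝ) ∈ poleSet q ↔ jostFn q 0 = 0 := by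
  rw [mem_poleSet]
  exact ⟨fun h => h.elim (fun h => absurd h.1 (lt_irrefl _)) fun h => h.2, fun h => Or.inr ⟨rfl, h⟩⟩

theorem ofReal_sub_I_mul_ne_zero {t : ℝ} (ht : t ≠ 0) (κ : ℝ) : (t : ℂ) - Complex.I * κ ≠ 0 :=
  fun h => ht (by simpa using congrArg Complex.re h)

theorem ofReal_add_I_mul_ne_zero {t : ℝ} (ht : t ≠ 0) (κ : ℝ) : (t : ℂ) + Complex.I * κ ≠ 0 :=
  fun h => ht (by simpa using congrArg Complex.re h)

section
variable {q : ℝ → ℝ} (hq : MemL11 q)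
include hq

theorem finite_poleSet : (poleSet q).Finite :=
  (finite_boundStates hq).union ((finite_singleton (0 : ℝ)).subset fun _ h => h.1)

theorem regularPart_eq (z : ℂ) : regularPart q z = iFun q z - Complex.I * z -
    ∑ κ ∈ (finite_poleSet hq).toFinset, iRes q κ / (z - Complex.I * κ) := by
  rw [regularPart, finsum_mem_eq_finite_toFinset_sum _ (finite_poleSet hq)]

theorem tendsto_regularPart : Tendsto (regularPart q) atInf (𝓝 0) := by
  have h1 : Tendsto (fun z : ℂ => ∑ κ ∈ (finite_poleSet hq).toFinset,
      iRes q κ / (z - Complex.I * κ)) atInf (𝓝 (∑ _κ ∈ (finite_poleSet hq).toFinset, 0)) := by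
    refine tendsto_finsetSum _ fun κ _ => ?_
    have h2 : Tendsto (fun z : ℂ => (z - Complex.I * κ)⁻¹) atInf (𝓝 0) :=
      (tendsto_inv₀_cobounded (α := ℂ)).comp
        ((tendsto_sub_const_cobounded (Complex.I * (κ : ℂ))).mono_left inf_le_left)
    have h3 := h2.const_mul (iRes q κ)
    rwa [mul_zero] at h3
  rw [Finset.sum_const_zero] at h1
  have h2 := (tendsto_iFun_sub hq).sub h1
  rw [sub_zero] at h2
  exact h2.congr fun z => (regularPart_eq hq z).symm

/-- A simple zero of f at 0 gives I the singularity I_0/z. Subtracting it leaves o(1/|z|), which is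
the growth condition in the jump problem. -/
theorem tendsto_mul_iFun_zero : Tendsto (fun z => z * iFun q z) (𝓝[closedUpperHP \ {0}] 0)
    (𝓝 (if (0 : ℝ) ∈ (finite_poleSet hq).toFinset then iRes q 0 else 0)) := by
  have h0c : (0 : ℂ) ∈ closedUpperHP := by simp [closedUpperHP_def]
  have hD : Tendsto (jostDeriv q) (𝓝[closedUpperHP \ {0}] 0) (𝓝 (jostDeriv q 0)) :=
    ((continuousOn_jostDeriv hq) 0 h0c).tendsto.mono_left (nhdsWithin_mono _ sdiff_subset)
  have hF : Tendsto (jostFn q) (𝓝[closedUpperHP \ {0}] 0) (𝓝 (jostFn q 0)) :=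
    ((continuousOn_jostFn hq) 0 h0c).tendsto.mono_left (nhdsWithin_mono _ sdiff_subset)
  have hiff : (0 : ℝ) ∈ (finite_poleSet hq).toFinset ↔ jostFn q 0 = 0 := by
    rw [Finite.mem_toFinset, zero_mem_poleSet]
  by_cases h0 : jostFn q 0 = 0
  · rw [if_pos (hiff.2 h0)]
    have hs := hasDerivWithinAt_iff_tendsto_slope.1 (hasDerivWithinAt_jostFn_zero hq h0)
    rw [← jostDot_zero hq h0] at hs
    have hd0 : jostDot q 0 ≠ 0 := by
      rw [jostDot_zero hq h0]
      exact div_ne_zero (neg_ne_zero.2 Complex.I_ne_zero) (jostDeriv_ne_zero hq h0c h0)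
    have h1 := hD.div hs hd0
    have e : iRes q 0 = jostDeriv q 0 / jostDot q 0 := by simp [iRes]
    rw [e]
    refine h1.congr fun z => ?_
    rw [Pi.div_apply, slope_def_field, h0, sub_zero, sub_zero, iFun, div_div_eq_mul_div, mul_comm, mul_div_assoc]
  · rw [if_neg (mt hiff.1 h0)]
    have h1 : Tendsto (fun z : ℂ => z) (𝓝[closedUpperHP \ {0}] 0) (𝓝 0) :=
      tendsto_nhdsWithin_of_tendsto_nhds tendsto_id
    have h2 := h1.mul (hD.div hF h0)
    rwa [zero_mul] at h2

theorem tendsto_mul_regularPart :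
    Tendsto (fun z => z * regularPart q z) (𝓝[closedUpperHP \ {0}] 0) (𝓝 0) := by
  have hid : Tendsto (fun z : ℂ => z) (𝓝[closedUpperHP \ {0}] 0) (𝓝 0) :=
    tendsto_nhdsWithin_of_tendsto_nhds tendsto_id
  have h1 : Tendsto (fun z : ℂ => ∑ κ ∈ (finite_poleSet hq).toFinset,
      z * (iRes q κ / (z - Complex.I * κ))) (𝓝[closedUpperHP \ {0}] 0)
      (𝓝 (∑ κ ∈ (finite_poleSet hq).toFinset, if 0 = κ then iRes q κ else 0)) := by
    refine tendsto_finsetSum _ fun κ hκ => ?_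
    by_cases h : 0 = κ
    · subst h
      rw [if_pos rfl]
      refine tendsto_const_nhds.congr' ?_
      filter_upwards [self_mem_nhdsWithin] with z hz
      have hz0 : z ≠ 0 := hz.2
      rw [Complex.ofReal_zero, mul_zero, sub_zero]
      field_simp
    · rw [if_neg h]
      have h2 : ContinuousAt (fun z : ℂ => z * (iRes q κ / (z - Complex.I * κ))) 0 := by
        refine continuousAt_id.mul (continuousAt_const.div (by fun_prop) ?_)
        rw [zero_sub]
        exact neg_ne_zero.2 (mul_ne_zero Complex.I_ne_zero (by exact_mod_cast Ne.symm h))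
      have h3 := h2.tendsto
      rw [zero_mul] at h3
      exact tendsto_nhdsWithin_of_tendsto_nhds h3
  -- Of the principal parts only the one at 0, if present, survives multiplication by z, and it
  -- matches the limit of z I(z).
  rw [Finset.sum_ite_eq] at h1
  have h2 := ((tendsto_mul_iFun_zero hq).sub ((hid.const_mul Complex.I).mul hid)).sub h1
  rw [mul_zero, sub_zero, sub_self] at h2
  refine h2.congr fun z => ?_
  rw [regularPart_eq hq, mul_sub, mul_sub, Finset.mul_sum]
  ring

theorem tendsto_sub_mul_regularPart {κ : ℝ} (hκ : κ ∈ boundStates q) :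
    Tendsto (fun z => (z - Complex.I * κ) * regularPart q z) (𝓝[≠] (Complex.I * κ)) (𝓝 0) := by
  have hid : Tendsto (fun z : ℂ => z - Complex.I * κ) (𝓝[≠] (Complex.I * κ)) (𝓝 0) := by
    have : Continuous fun z : ℂ => z - Complex.I * κ := by fun_prop
    have h := this.tendsto (Complex.I * κ)
    rw [sub_self] at h
    exact tendsto_nhdsWithin_of_tendsto_nhds h
  have hmem : κ ∈ (finite_poleSet hq).toFinset := (finite_poleSet hq).mem_toFinset.2 (Or.inl hκ)
  have h1 : Tendsto (fun z : ℂ => ∑ μ ∈ (finite_poleSet hq).toFinset,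
      (z - Complex.I * κ) * (iRes q μ / (z - Complex.I * μ))) (𝓝[≠] (Complex.I * κ))
      (𝓝 (∑ μ ∈ (finite_poleSet hq).toFinset, if κ = μ then iRes q μ else 0)) := by
    refine tendsto_finsetSum _ fun μ hμ => ?_
    by_cases h : κ = μ
    · subst h
      rw [if_pos rfl]
      refine tendsto_const_nhds.congr' ?_
      filter_upwards [self_mem_nhdsWithin] with z hz
      rw [mul_div_cancel₀ _ (sub_ne_zero.2 hz)]
    · rw [if_neg h]
      have hne : Complex.I * (κ : ℂ) - Complex.I * μ ≠ 0 := sub_ne_zero.2 fun h' =>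
        h (Complex.ofReal_injective (mul_left_cancel₀ Complex.I_ne_zero h'))
      have h2 : ContinuousAt (fun z : ℂ => iRes q μ / (z - Complex.I * μ)) (Complex.I * κ) :=
        continuousAt_const.div (by fun_prop) hne
      have h3 := hid.mul (h2.tendsto.mono_left nhdsWithin_le_nhds)
      rwa [zero_mul] at h3
  rw [Finset.sum_ite_eq, if_pos hmem] at h1
  have h3 : Tendsto (fun z : ℂ => (z - Complex.I * κ) * (Complex.I * z)) (𝓝[≠] (Complex.I * κ))
      (𝓝 0) := by
    have : Continuous fun z : ℂ => (z - Complex.I * κ) * (Complex.I * z) := by fun_prop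
    have h := this.tendsto (Complex.I * κ)
    rw [sub_self, zero_mul] at h
    exact tendsto_nhdsWithin_of_tendsto_nhds h
  have h2 := ((tendsto_residue_iFun hq hκ).sub h3).sub h1
  rw [sub_zero, sub_self] at h2
  refine h2.congr fun z => ?_
  rw [regularPart_eq hq, mul_sub, mul_sub, Finset.mul_sum]

end

/-- The points `i k_j`. -/
def boundPoints (q : ℝ → ℝ) : Set ℂ := (fun κ : ℝ => Complex.I * κ) '' boundStates q

theorem mem_boundPoints {q : ℝ → ℝ} {z : ℂ} :
    z ∈ boundPoints q ↔ ∃ κ ∈ boundStates q, z = Complex.I * κ :=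
  ⟨fun ⟨κ, h, e⟩ => ⟨κ, h, e.symm⟩, fun ⟨κ, h, e⟩ => ⟨κ, h, e.symm⟩⟩

theorem ofReal_notMem_boundPoints {q : ℝ → ℝ} (t : ℝ) : (t : ℂ) ∉ boundPoints q := by
  rintro ⟨κ, hκ, h⟩
  have h1 := congrArg Complex.im h
  have := hκ.1
  simp at h1
  linarith

/-- The function `𝒥`. -/
def jumpFun (q : ℝ → ℝ) : ℂ → ℂ := removeSing (boundPoints q) (regularPart q)

section
variable {q : ℝ → ℝ} (hq : MemL11 q)
include hq

theorem finite_boundPoints : (boundPoints q).Finite := (finite_boundStates hq).image _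

theorem differentiableOn_jumpFun : DifferentiableOn ℂ (jumpFun q) openUpperHP := by
  refine differentiableOn_removeSing (finite_boundPoints hq) isOpen_openUpperHP (fun z hz => ?_) ?_
  · refine DifferentiableAt.differentiableWithinAt ?_
    have h1 : DifferentiableAt ℂ (iFun q) z :=
      (analyticAt_iFun hq hz.1 (mt mem_boundPoints.2 hz.2)).differentiableAt
    have h2 : DifferentiableAt ℂ (fun z : ℂ => ∑ κ ∈ (finite_poleSet hq).toFinset,
        iRes q κ / (z - Complex.I * κ)) z := by
      refine DifferentiableAt.fun_sum fun κ hκ => (differentiableAt_const _).div (by fun_prop) ?_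
      rw [sub_ne_zero]
      intro h
      rcases (finite_poleSet hq).mem_toFinset.1 hκ with hκ | hκ
      · exact hz.2 (mem_boundPoints.2 ⟨κ, hκ, h⟩)
      · rw [hκ.1, Complex.ofReal_zero, mul_zero] at h
        exact ne_zero_of_mem_openUpperHP hz.1 h
    have h3 := (h1.sub (by fun_prop : DifferentiableAt ℂ (fun z => Complex.I * z) z)).sub h2
    exact h3.congr_of_eventuallyEq (Eventually.of_forall fun z => regularPart_eq hq z)
  · rintro _ ⟨κ, hκ, rfl⟩
    exact tendsto_sub_mul_regularPart hq hκ

theorem continuousOn_jumpFun : ContinuousOn (jumpFun q) (closedUpperHP \ {0}) := by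
  intro z hz
  by_cases hm : z ∈ openUpperHP
  · exact ((differentiableOn_jumpFun hq).differentiableAt
      (isOpen_openUpperHP.mem_nhds hm)).continuousAt.continuousWithinAt
  · have him : z.im = 0 := le_antisymm (not_lt.1 hm) hz.1
    obtain ⟨t, rfl⟩ : ∃ t : ℝ, (t : ℂ) = z := ⟨z.re, Complex.ext (by simp) (by simp [him])⟩
    have ht : t ≠ 0 := fun h => hz.2 (by simp [h])
    have h1 : ContinuousWithinAt (iFun q) (closedUpperHP \ {0}) t :=
      (continuousWithinAt_iFun hq ht).mono sdiff_subset
    have h2 : ContinuousWithinAt (fun z : ℂ => ∑ κ ∈ (finite_poleSet hq).toFinset,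
        iRes q κ / (z - Complex.I * κ)) (closedUpperHP \ {0}) t := by
      refine ContinuousAt.continuousWithinAt ?_
      exact tendsto_finsetSum _ fun κ _ => ContinuousAt.tendsto (f := fun z : ℂ =>
        iRes q κ / (z - Complex.I * κ)) (continuousAt_const.div (by fun_prop)
          (ofReal_sub_I_mul_ne_zero ht κ))
    have h3 := (h1.sub (by fun_prop : ContinuousWithinAt (fun z => Complex.I * z)
      (closedUpperHP \ {0}) t)).sub h2
    refine h3.congr_of_eventuallyEq ?_ ?_
    · filter_upwards [nhdsWithin_le_nhds (removeSing_eventuallyEq (finite_boundPoints hq)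
        (ofReal_notMem_boundPoints t) (regularPart q))] with w hw
      exact hw.trans (regularPart_eq hq w)
    · exact (removeSing_of_notMem (ofReal_notMem_boundPoints t) _).trans (regularPart_eq hq t)

omit hq in
theorem jumpFun_ofReal (t : ℝ) : jumpFun q t = regularPart q t :=
  removeSing_of_notMem (ofReal_notMem_boundPoints t) _

omit hq in
theorem jumpFun_eq {z : ℂ} (h : ¬ ∃ κ ∈ boundStates q, z = Complex.I * κ) :
    jumpFun q z = regularPart q z := removeSing_of_notMem (mt mem_boundPoints.1 h) _

/-- The jump of I is 2ik/|f|^2 by the Wronskian, iz has jump 2ik, and each principal part changes by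
the sum of its two simple fractions. The limits at infinity and at 0 have been arranged by the
subtractions. -/
theorem isJumpSolution_jumpFun : IsJumpSolution (jumpRHS q) (jumpFun q) where
  differentiableOn := differentiableOn_jumpFun hq
  continuousOn := continuousOn_jumpFun hq
  tendsto_zero := by
    refine (tendsto_regularPart hq).congr' ?_
    have h : ∀ᶠ z in atInf, z ∉ boundPoints q := by
      have := (finite_boundPoints hq).isBounded
      exact mem_inf_of_left (Bornology.isBounded_def.1 this)
    filter_upwards [h] with z hz using (removeSing_of_notMem hz _).symm
  isLittleO_at_zero := by
    refine (tendsto_mul_regularPart hq).congr' ?_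
    have h0 : (0 : ℂ) ∉ boundPoints q := by simpa using ofReal_notMem_boundPoints (q := q) 0
    filter_upwards [nhdsWithin_le_nhds (removeSing_eventuallyEq (finite_boundPoints hq) h0
      (regularPart q))] with z hz
    exact congrArg (z * ·) hz.symm
  jump k hk := by
    have e := jumpFun_ofReal (q := q) (-k)
    rw [Complex.ofReal_neg] at e
    rw [jumpFun_ofReal, e, regularPart_eq hq, regularPart_eq hq, jumpRHS,
      ← iFun_sub_iFun_neg hq hk, finsum_mem_eq_finite_toFinset_sum _ (finite_poleSet hq)]
    have hsum : ∑ κ ∈ (finite_poleSet hq).toFinset, iRes q κ / ((k : ℂ) - Complex.I * κ) =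
        (∑ κ ∈ (finite_poleSet hq).toFinset, iRes q κ / (-(k : ℂ) - Complex.I * κ)) +
        ∑ κ ∈ (finite_poleSet hq).toFinset,
          iRes q κ * (1 / (k - Complex.I * κ) + 1 / (k + Complex.I * κ)) := by
      rw [← Finset.sum_add_distrib]
      refine Finset.sum_congr rfl fun κ _ => ?_
      rw [show -(k : ℂ) - Complex.I * κ = -(k + Complex.I * κ) by ring, div_neg]
      ring
    rw [hsum]
    ring

/-- The paired fractions combine over t^2 + κ^2. The factor 2i pulled out here turns 1/(2πi) into
1/π. -/
theorem jumpRHS_eq {t : ℝ} (ht : t ≠ 0) : jumpRHS q t = 2 * Complex.I * jumpDensity q t := by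
  have h1 : ∀ κ : ℝ, iRes q κ * (1 / ((t : ℂ) - Complex.I * κ) + 1 / (t + Complex.I * κ)) =
      2 * (iRes q κ * t / ((t : ℂ) ^ 2 + (κ : ℂ) ^ 2)) := fun κ => by
    have e1 := ofReal_sub_I_mul_ne_zero ht κ
    have e2 := ofReal_add_I_mul_ne_zero ht κ
    have e3 : (t : ℂ) ^ 2 + (κ : ℂ) ^ 2 = (t - Complex.I * κ) * (t + Complex.I * κ) := by
      linear_combination (κ : ℂ) ^ 2 * Complex.I_sq
    rw [e3]
    field_simp
    ring
  rw [jumpRHS, jumpDensity, finsum_mem_eq_finite_toFinset_sum _ (finite_poleSet hq),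
    finsum_mem_eq_finite_toFinset_sum _ (finite_poleSet hq)]
  simp only [h1]
  rw [← Finset.mul_sum]
  linear_combination (-2 * ∑ κ ∈ (finite_poleSet hq).toFinset,
    iRes q κ * t / ((t : ℂ) ^ 2 + (κ : ℂ) ^ 2)) * Complex.I_sq

theorem tendsto_jumpDensity {z : ℂ} (hz : z ∈ openUpperHP) :
    Tendsto (fun e : ℝ × ℝ => 1 / (Real.pi : ℂ) *
      ∫ t in {t : ℝ | e.1 < |t| ∧ |t| < e.2}, jumpDensity q t / (t - z))
      (𝓝[>] 0 ×ˢ atTop) (𝓝 (jumpFun q z)) := by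
  have h1 := ((isJumpSolution_jumpFun hq).tendsto_integral hz).const_mul
    (2 * Real.pi * Complex.I)⁻¹
  rw [inv_mul_cancel_left₀ Complex.two_pi_I_ne_zero] at h1
  refine h1.congr fun e => ?_
  have e1 : ∫ t in {t : ℝ | e.1 < |t| ∧ |t| < e.2}, jumpRHS q t / (t - z) =
      2 * Complex.I * ∫ t in {t : ℝ | e.1 < |t| ∧ |t| < e.2}, jumpDensity q t / (t - z) := by
    rw [← integral_const_mul]
    refine integral_congr_ae (ae_restrict_of_ae ?_)
    have hne : ∀ᵐ t : ℝ, t ≠ 0 := by simp [ae_iff, measure_singleton]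
    filter_upwards [hne] with t ht
    rw [jumpRHS_eq hq ht]
    ring
  rw [e1]
  have := Real.pi_ne_zero
  have := Complex.I_ne_zero
  field_simp

end

/-! ### The one-to-one correspondence -/

theorem jostFn_zero_relations {q : ℝ → ℝ} (hq : MemL11 q) (h0 : jostFn q 0 = 0) :
    DifferentiableWithinAt ℂ (jostFn q) closedUpperHP 0 ∧ jostDot q 0 ≠ 0 ∧
      jostDeriv q 0 = -Complex.I / jostDot q 0 ∧ iRes q 0 = -Complex.I / jostDot q 0 ^ 2 := by
  have hD : jostDeriv q 0 ≠ 0 := jostDeriv_ne_zero hq (by simp [closedUpperHP_def]) h0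
  have hdot := jostDot_zero hq h0
  have hne : jostDot q 0 ≠ 0 := by
    rw [hdot]
    exact div_ne_zero (neg_ne_zero.2 Complex.I_ne_zero) hD
  have hder : jostDeriv q 0 = -Complex.I / jostDot q 0 := by
    rw [eq_div_iff hne, hdot, mul_div_cancel₀ _ hD]
  refine ⟨(hasDerivWithinAt_jostFn_zero hq h0).differentiableWithinAt, hne, hder, ?_⟩
  rw [iRes, Complex.ofReal_zero, mul_zero, hder, div_div, sq]

theorem mem_boundStates_of_not_analyticAt {q : ℝ → ℝ} (hq : MemL11 q) {κ : ℝ} (hκ : 0 < κ)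
    (h : ¬ AnalyticAt ℂ (iFun q) (Complex.I * κ)) : κ ∈ boundStates q := by
  by_contra hn
  refine h (analyticAt_iFun hq (I_mul_mem_openUpperHP hκ) ?_)
  rintro ⟨μ, hμ, e⟩
  exact hn (Complex.ofReal_injective (mul_left_cancel₀ Complex.I_ne_zero e) ▸ hμ)

section
variable {p q : ℝ → ℝ} (hp : MemL11 p) (hq : MemL11 q)
include hp hq

/-- Bound states are read off as poles: the order at a point depends only on a punctured
neighbourhood, and order -1 is impossible where the other function is analytic. -/
theorem boundStates_subset_of_eventuallyEq
    (h : ∀ z ∈ openUpperHP, iFun p =ᶠ[𝓝[≠] z] iFun q) : boundStates p ⊆ boundStates q := by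
  intro κ hκ
  refine mem_boundStates_of_not_analyticAt hq hκ.1 fun ha => ?_
  have h1 := meromorphicOrderAt_iFun hp hκ
  rw [meromorphicOrderAt_congr (h _ (I_mul_mem_openUpperHP hκ.1))] at h1
  have h2 := ha.meromorphicOrderAt_nonneg
  rw [h1] at h2
  exact absurd h2 (by decide)

omit hp hq in
theorem jostDot_eq_of_eqOn (h : EqOn (jostFn p) (jostFn q) closedUpperHP) {z : ℂ}
    (hz : z ∈ closedUpperHP) : jostDot p z = jostDot q z := derivWithin_congr h (h hz)

/-- Equality on k > 0 extends to the negative axis by conjugation and to the half-plane by boundary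
uniqueness. Poles then give the k_j, the Riemann problem with datum g gives f and hence S, and
residues together with ḟ give the s_j. -/
theorem scatteringData_eq_of_iData_eq (h : iData p = iData q) :
    scatteringData p = scatteringData q := by
  have hpos : ∀ k : ℝ, 0 < k → iFun p k = iFun q k := fun k hk => congr_fun h ⟨k, hk⟩
  have hreal : ∀ k : ℝ, k ≠ 0 → iFun p k = iFun q k := by
    intro k hk
    rcases lt_or_gt_of_ne hk with h0 | h0
    · have h1 := hpos (-k) (by linarith)
      rw [Complex.ofReal_neg, iFun_neg hp, iFun_neg hq] at h1
      exact (starRingEnd ℂ).injective h1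
    · exact hpos k h0
  have hev : ∀ z ∈ openUpperHP, iFun p =ᶠ[𝓝[≠] z] iFun q := fun z hz =>
    eventuallyEq_iFun hq (meromorphicOn_iFun hp) (fun k hk => by
      rw [← hpos k hk]
      exact (continuousWithinAt_iFun hp hk.ne').tendsto.mono_left
        (nhdsWithin_mono _ openUpperHP_subset)) hz
  have hK : boundStates p = boundStates q :=
    (boundStates_subset_of_eventuallyEq hp hq hev).antisymm
      (boundStates_subset_of_eventuallyEq hq hp fun z hz => (hev z hz).symm)
  have hf : EqOn (jostFn p) (jostFn q) closedUpperHP := by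
    refine eqOn_jostFn_of_gFun hq (hK ▸ isJostClass_jostFn hp) fun k hk => ?_
    have h1 : jostFn p (-(k : ℂ)) ≠ 0 := by
      simpa using jostFn_ofReal_ne_zero hp (neg_ne_zero.2 hk)
    rw [eq_div_iff h1, jostFn_mul_jostFn_neg hp hk, gFun, gFun, hreal k hk]
  refine ScatteringData.ext (funext fun k => ?_) ?_
  · show scatS p k = scatS q k
    rw [scatS, scatS, hf (ofReal_mem_closedUpperHP _), hf (neg_ofReal_mem_closedUpperHP _)]
  · show (fun κ => (κ, normingConst p κ)) '' boundStates p =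
      (fun κ => (κ, normingConst q κ)) '' boundStates q
    rw [← hK]
    refine image_congr fun κ hκ => Prod.ext rfl ?_
    have hκq : κ ∈ boundStates q := hK ▸ hκ
    have hm := I_mul_mem_openUpperHP hκ.1
    have hres : iRes p κ = iRes q κ := by
      refine tendsto_nhds_unique (tendsto_residue_iFun hp hκ)
        ((tendsto_residue_iFun hq hκq).congr' ?_)
      filter_upwards [hev _ hm] with z hz
      rw [hz]
    have h1 := normingConst_formula hp hκ
    rw [hres, jostDot_eq_of_eqOn hf (openUpperHP_subset hm), ← normingConst_formula hq hκq] at h1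
    exact Complex.ofReal_injective h1

/-- The Riemann problem with datum S identifies f. The s_j and ḟ then identify the residues,
including the one at 0, where ḟ(0) alone suffices. The jump problems therefore have the same datum,
and their unique solutions coincide. -/
theorem iData_eq_of_scatteringData_eq (h : scatteringData p = scatteringData q) :
    iData p = iData q := by
  have hS : ∀ k : ℝ, k ≠ 0 → scatS p k = scatS q k := fun k hk =>
    congr_fun (congrArg ScatteringData.S h) ⟨k, hk⟩
  have hB : (fun κ => (κ, normingConst p κ)) '' boundStates p =
      (fun κ => (κ, normingConst q κ)) '' boundStates q := congrArg ScatteringData.bound h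
  have hK : boundStates p = boundStates q := by
    have h1 := congrArg (fun s => Prod.fst '' s) hB
    simpa only [image_image, image_id'] using h1
  have hN : ∀ κ ∈ boundStates p, normingConst p κ = normingConst q κ := by
    intro κ hκ
    have h1 : (κ, normingConst p κ) ∈ (fun κ => (κ, normingConst q κ)) '' boundStates q :=
      hB ▸ mem_image_of_mem (fun κ => (κ, normingConst p κ)) hκ
    obtain ⟨μ, -, e⟩ := h1
    have e1 : μ = κ := congrArg Prod.fst e
    have e2 : normingConst q μ = normingConst p κ := congrArg Prod.snd e
    rw [← e2, e1]
  have hf : EqOn (jostFn p) (jostFn q) closedUpperHP := by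
    refine eqOn_jostFn_of_scatS hq (hK ▸ isJostClass_jostFn hp) fun k hk => ?_
    have h1 : jostFn p (-(k : ℂ)) ≠ 0 := by
      simpa using jostFn_ofReal_ne_zero hp (neg_ne_zero.2 hk)
    rw [← hS (-k) (neg_ne_zero.2 hk), scatS_neg, div_mul_cancel₀ _ h1]
  have h0c : (0 : ℂ) ∈ closedUpperHP := by simp [closedUpperHP_def]
  have hP : poleSet p = poleSet q := by rw [poleSet, poleSet, hK, hf h0c]
  have hR : ∀ κ ∈ poleSet p, iRes p κ = iRes q κ := by
    intro κ hκ
    rcases hκ with hκ | ⟨rfl, h0⟩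
    · rw [iRes_formula hp hκ, iRes_formula hq (hK ▸ hκ), hN κ hκ,
        jostDot_eq_of_eqOn hf (openUpperHP_subset (I_mul_mem_openUpperHP hκ.1))]
    · rw [(jostFn_zero_relations hp h0).2.2.2,
        (jostFn_zero_relations hq (hf h0c ▸ h0)).2.2.2, jostDot_eq_of_eqOn hf h0c]
  -- The coefficient c is left arbitrary so that the same identity handles the sum in the jump datum
  -- and the sum of principal parts.
  have hsum : ∀ c : ℝ → ℂ, ∑ᶠ κ ∈ poleSet p, iRes p κ * c κ = ∑ᶠ κ ∈ poleSet q, iRes q κ * c κ :=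
    fun c => finsum_mem_congr hP fun κ hκ => by rw [hR κ (hP ▸ hκ)]
  have hJ : jumpRHS p = jumpRHS q := by
    funext k
    rw [jumpRHS, jumpRHS, hf (ofReal_mem_closedUpperHP k), hsum]
  have hG := isJumpSolution_jumpFun hp
  rw [hJ] at hG
  have hEq := hG.eqOn (isJumpSolution_jumpFun hq)
  funext k
  show iFun p (k : ℝ) = iFun q (k : ℝ)
  have h1 := hEq (ofReal_mem_punctured k.2.ne')
  rw [jumpFun_ofReal, jumpFun_ofReal, regularPart, regularPart] at h1
  have h2 := hsum fun κ => ((k : ℂ) - Complex.I * κ)⁻¹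
  simp only [← div_eq_mul_inv] at h2
  rw [h2] at h1
  linear_combination h1

end

end IFunction

end

/-! ### Assembly of the theorem -/

open IFunction in
theorem mainTheorem1 :
    -- one-to-one correspondence: `I(k)`, `k > 0`, determines the scattering triple and conversely
    (∀ p q : ℝ → ℝ, MemL11 p → MemL11 q →
      (iData p = iData q ↔ scatteringData p = scatteringData q)) ∧
    ∀ q : ℝ → ℝ, MemL11 q →
      -- the objects are well defined
      ((∀ k ∈ closedUpperHP, IsJost q k (jost q k) ∧
          ∀ u, IsJost q k u → EqOn u (jost q k) (Ici 0)) ∧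
        (boundStates q).Finite ∧
        (∀ κ ∈ boundStates q,
          MemLp (jost q (Complex.I * κ)) 2 (volume.restrict (Ioi 0)) ∧ 0 < normingConst q κ) ∧
        IsJostClass (boundStates q) (jostFn q) ∧
        (∀ k : ℝ, k ≠ 0 → ContinuousWithinAt (iFun q) closedUpperHP k) ∧
        (∀ k : ℝ, k ≠ 0 → iFun q (-(k : ℂ)) = (starRingEnd ℂ) (iFun q k))) ∧
      -- from `I` to the triple: `I` on `k > 0` determines `I` in the upper half-plane, whose poles
      -- there are exactly the `i k_j`, all simple, with residues `I_j`
      (MeromorphicOn (iFun q) openUpperHP ∧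
        (∀ M : ℂ → ℂ, MeromorphicOn M openUpperHP →
          (∀ k : ℝ, 0 < k → Tendsto M (𝓝[openUpperHP] (k : ℂ)) (𝓝 (iFun q k))) →
          ∀ z ∈ openUpperHP, M =ᶠ[𝓝[≠] z] iFun q) ∧
        (∀ z ∈ openUpperHP, (¬ ∃ κ ∈ boundStates q, z = Complex.I * κ) → AnalyticAt ℂ (iFun q) z) ∧
        (∀ κ ∈ boundStates q,
          meromorphicOrderAt (iFun q) (Complex.I * κ) = ((-1 : ℤ) : WithTop ℤ) ∧
          Tendsto (fun z => (z - Complex.I * κ) * iFun q z) (𝓝[≠] (Complex.I * κ))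
            (𝓝 (iRes q κ)))) ∧
      -- the Riemann problem `f(k) = g(k) / f(-k)`, `g(k) = k / Im I(k) > 0`, and its solution
      ((∀ k : ℝ, k ≠ 0 → 0 < gFun q k ∧ jostFn q k = gFun q k / jostFn q (-(k : ℂ))) ∧
        (∀ F : ℂ → ℂ, IsJostClass (boundStates q) F →
          (∀ k : ℝ, k ≠ 0 → F k = gFun q k / F (-(k : ℂ))) → EqOn F (jostFn q) closedUpperHP) ∧
        (∀ z ∈ openUpperHP,
          Integrable (fun s : ℝ => (Real.log (gFun q s) : ℂ) / (s - z)) ∧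
          jostFn q z = Complex.exp (1 / (2 * Real.pi * Complex.I) *
            ∫ s : ℝ, (Real.log (gFun q s) : ℂ) / (s - z)) * blaschke (boundStates q) z) ∧
        (∀ z ∈ openUpperHP,
          IntegrableOn (fun s : ℝ => z * (Real.log (gFun q s) : ℂ) / ((s : ℂ) ^ 2 - z ^ 2))
            (Ioi 0) ∧
          jostFn q z = Complex.exp (1 / (Complex.I * Real.pi) *
            ∫ s in Ioi (0 : ℝ), z * (Real.log (gFun q s) : ℂ) / ((s : ℂ) ^ 2 - z ^ 2)) *
              blaschke (boundStates q) z) ∧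
        (∀ k : ℝ, 0 < k → ∃ P : ℂ,
          Tendsto (fun ε : ℝ => ∫ s in {s : ℝ | ε < |s - k|},
            (Real.log (gFun q s) : ℂ) / (s - k)) (𝓝[>] 0) (𝓝 P) ∧
          jostFn q k = Complex.exp (1 / (2 * Real.pi * Complex.I) * P +
            1 / 2 * (Real.log (gFun q k) : ℂ)) * blaschke (boundStates q) k) ∧
        (jostFn q 0 = 0 → ∀ z ∈ openUpperHP,
          Integrable (fun s : ℝ => (Real.log ((s ^ 2 + 1) / (s * (iFun q s).im)) : ℂ) / (s - z)) ∧
          jostFn q z = Complex.exp (1 / (2 * Real.pi * Complex.I) *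
            ∫ s : ℝ, (Real.log ((s ^ 2 + 1) / (s * (iFun q s).im)) : ℂ) / (s - z)) *
              blaschke₁ (boundStates q) z)) ∧
      -- the norming constants from the residues of `I`
      (∀ κ ∈ boundStates q, (normingConst q κ : ℂ) =
        -(2 * Complex.I * κ) / (jostDot q (Complex.I * κ) ^ 2 * iRes q κ)) ∧
      -- from the triple to `f`: the Riemann problem `f(k) = S(-k) f(-k)` and its solution
      ((∀ k : ℝ, k ≠ 0 → jostFn q k = scatS q (-k) * jostFn q (-(k : ℂ))) ∧
        (∀ F : ℂ → ℂ, IsJostClass (boundStates q) F →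
          (∀ k : ℝ, k ≠ 0 → F k = scatS q (-k) * F (-(k : ℂ))) →
          EqOn F (jostFn q) closedUpperHP) ∧
        (∃ L : ℝ → ℂ,
          IsLogBranch (fun t => scatS q (-t) / blaschke (boundStates q) t ^ 2) L ∧
          (jostFn q 0 ≠ 0 → Continuous L)) ∧
        (∀ L : ℝ → ℂ, IsLogBranch (fun t => scatS q (-t) / blaschke (boundStates q) t ^ 2) L →
          ∀ z ∈ openUpperHP, Integrable (fun t : ℝ => L t / (t - z)) ∧
            jostFn q z = Complex.exp (1 / (2 * Real.pi * Complex.I) * ∫ t : ℝ, L t / (t - z)) *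
              blaschke (boundStates q) z) ∧
        (jostFn q 0 = 0 →
          (∃ L : ℝ → ℂ, IsLogBranch (fun t => scatS q (-t) *
              ((-(t : ℂ) - Complex.I) / (-(t : ℂ) + Complex.I)) /
                blaschke (boundStates q) t ^ 2) L ∧ Continuous L) ∧
          ∀ L : ℝ → ℂ, IsLogBranch (fun t => scatS q (-t) *
              ((-(t : ℂ) - Complex.I) / (-(t : ℂ) + Complex.I)) /
                blaschke (boundStates q) t ^ 2) L →
            ∀ z ∈ openUpperHP, Integrable (fun t : ℝ => L t / (t - z)) ∧
              jostFn q z = Complex.exp (1 / (2 * Real.pi * Complex.I) *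
                ∫ t : ℝ, L t / (t - z)) * blaschke₁ (boundStates q) z)) ∧
      -- from the triple and `f` to `I`: the numbers `I_j`, the jump problem for `I`, and `𝒥`
      ((∀ κ ∈ boundStates q, iRes q κ =
          -(2 * Complex.I * κ) / (jostDot q (Complex.I * κ) ^ 2 * normingConst q κ)) ∧
        (jostFn q 0 = 0 →
          DifferentiableWithinAt ℂ (jostFn q) closedUpperHP 0 ∧ jostDot q 0 ≠ 0 ∧
          jostDeriv q 0 = -Complex.I / jostDot q 0 ∧
          iRes q 0 = -Complex.I / jostDot q 0 ^ 2) ∧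
        (∀ k : ℝ, k ≠ 0 →
          iFun q k - iFun q (-(k : ℂ)) = 2 * Complex.I * k / (‖jostFn q k‖ : ℂ) ^ 2) ∧
        ∃ J : ℂ → ℂ,
          (∀ z ∈ closedUpperHP, z ≠ 0 → (¬ ∃ κ ∈ boundStates q, z = Complex.I * κ) →
            J z = iFun q z - Complex.I * z -
              ∑ᶠ κ ∈ poleSet q, iRes q κ / (z - Complex.I * κ)) ∧
          IsJumpSolution (jumpRHS q) J ∧
          (∀ G : ℂ → ℂ, IsJumpSolution (jumpRHS q) G → EqOn G J (closedUpperHP \ {0})) ∧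
          ∀ z ∈ openUpperHP,
            Tendsto (fun e : ℝ × ℝ => 1 / (Real.pi : ℂ) *
                ∫ t in {t : ℝ | e.1 < |t| ∧ |t| < e.2}, jumpDensity q t / (t - z))
              (𝓝[>] 0 ×ˢ atTop) (𝓝 (J z))) := by
  refine ⟨fun p q hp hq => ⟨scatteringData_eq_of_iData_eq hp hq,
    iData_eq_of_scatteringData_eq hp hq⟩, fun q hq => ⟨⟨fun k hk => ⟨isJost_jost hq hk,
      fun u hu => (hu.eqOn_jostSol hq hk).trans (eqOn_jost hq hk).symm⟩, finite_boundStates hq,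
      fun κ hκ => ⟨?_, normingConst_pos hq hκ⟩, isJostClass_jostFn hq,
      fun k hk => continuousWithinAt_iFun hq hk, fun k _ => iFun_neg hq k⟩,
    ⟨meromorphicOn_iFun hq, fun M hM h z hz => eventuallyEq_iFun hq hM h hz,
      fun z hz h => analyticAt_iFun hq hz h,
      fun κ hκ => ⟨meromorphicOrderAt_iFun hq hκ, tendsto_residue_iFun hq hκ⟩⟩,
    ⟨fun k hk => ⟨gFun_pos hq hk, ?_⟩, fun F hF h => eqOn_jostFn_of_gFun hq hF h,
      fun z hz => jostFn_eq_exp_log_gFun hq hz, fun z hz => jostFn_eq_exp_half_line hq hz,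
      fun k hk => jostFn_eq_exp_principal_value hq hk,
      fun h0 z hz => jostFn_eq_exp_log_gFun_one hq h0 hz⟩,
    fun κ hκ => normingConst_formula hq hκ,
    ⟨fun k hk => ?_, fun F hF h => eqOn_jostFn_of_scatS hq hF h, exists_isLogBranch_scatS hq,
      fun L hL z hz => jostFn_eq_exp_log_scatS hq hL hz,
      fun h0 => ⟨exists_isLogBranch_scatS_one hq h0,
        fun L hL z hz => jostFn_eq_exp_log_scatS_one hq h0 hL hz⟩⟩,
    ⟨fun κ hκ => iRes_formula hq hκ, fun h0 => jostFn_zero_relations hq h0,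
      fun k hk => iFun_sub_iFun_neg hq hk, jumpFun q, fun z _ _ h => jumpFun_eq h,
      isJumpSolution_jumpFun hq, fun G hG => hG.eqOn (isJumpSolution_jumpFun hq),
      fun z hz => tendsto_jumpDensity hq hz⟩⟩⟩
  · have hm := I_mul_mem_openUpperHP hκ.1
    refine (memLp_congr_ae ?_).2 (memLp_jostSol hq hm)
    exact (ae_restrict_iff' measurableSet_Ioi).2 (ae_of_all _ fun x hx =>
      eqOn_jost hq (openUpperHP_subset hm) (mem_Ici_of_Ioi hx))
  · have h1 : jostFn q (-(k : ℂ)) ≠ 0 := by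
      simpa using jostFn_ofReal_ne_zero hq (neg_ne_zero.2 hk)
    rw [eq_div_iff h1, jostFn_mul_jostFn_neg hq hk]
  · have h1 : jostFn q (-(k : ℂ)) ≠ 0 := by
      simpa using jostFn_ofReal_ne_zero hq (neg_ne_zero.2 hk)
    rw [scatS_neg, div_mul_cancel₀ _ h1]
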